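/- Let $\Gamma(1)=\mathrm{PSL}_2(\mathbb Z)$, with generators $S=\pm\begin{pmatrix}0&1\\-1&0\end{pmatrix}$, $T=\pm\begin{pmatrix}1&1\\0&1\end{pmatrix}$, let $\Gamma\subset\Gamma(1)$ be a torsion-free normal subgroup of finite index, $\Gamma_{\rm par}\subset\Gamma$ the subgroup generated by the parabolic elements of $\Gamma$, and $N\ge 1$ minimal with $T^N\in\Gamma$. Let $q\ge 0$ and let $(\eta,V)$ be a finite-dimensional complex representation of $\Gamma(1)$ that is trivial on $\Gamma_{\rm par}$ and whose restriction to $\Gamma$ is unipotent of length $q$, i.e. there is a $\Gamma$-stable filtration $0\subset V_0\subset\dots\subset V_q=V$ with $\Gamma$ acting trivially on $V_0$ and on every $V_{k+1}/V_k$. For $\nu\in\mathbb C$ let $\mathcal M_{\nu,q}$ be the space of twice continuously differentiable $u:\mathbb H\to\mathbb C$ with $-y^2(\partial_x^2+\partial_y^2)u=(\tfrac14-\nu^2)u$, locally square integrable (with respect to $dx\,dy/y^2$) on the Borel--Serre space $\mathbb H_\Gamma\supset\mathbb H$ (obtained by attaching a real line at each cusp), and annihilated by $J_{q+1}=I_\Gamma^{q+1}+\mathbb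 C[\Gamma]I_{\Gamma_{\rm par}}$, where $I$ denotes augmentation ideals. Let $\mathcal S_{\nu,q}\subset \mathcal M_{\nu,q}$ be the subspace of those $u$ whose zeroth Fourier coefficient vanishes at every cusp, and let $\mathcal S_{\nu,q,\eta}=(V\otimes\mathcal S_{\nu,q})^{\Gamma(1)}$: the functions $u:\mathbb H\to V$ with coordinates in $\mathcal S_{\nu,q}$ and $u(\gamma z)=\eta(\gamma)u(z)$ for all $\gamma\in\Gamma(1)$. Complex powers use the principal branch of the logarithm. Let $\mathcal F_{\nu,\eta}$ be the space of holomorphic $f:\mathbb C\smallsetminus\mathbb R\to V$ with $f(z+1)=\eta(T)f(z)$, $f(z)=O(1)$ as $|\mathrm{Im}\,z|\to\infty$, $f(i\infty)+f(-i\infty)=0$, such that $z\mapsto f(z)-z^{-2\nu-1}\eta(S)f(-1/z)$ extends holomorphically to $\mathbb C\smallsetminus(-\infty,0]$. Let $\Psi_{\nu,\eta}$ be the space of holomorphic $\psi:\mathbb C\smallsetminus(-\infty,0]\to V$ with $$\eta(T)\psi(z)=\psi(z+1)+(z+1)^{-2\nu-1}\eta(ST^{-1})\psi\Big(\frac z{z+1}\Big)$$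 and $$0=e^{\pi i\nu}\lim_{\mathrm{Im}\,z\to\infty}\Big(\psi(z)+z^{-2\nu-1}\eta(S)\psi\Big(\frac{-1}z\Big)\Big)+e^{-\pi i\nu}\lim_{\mathrm{Im}\,z\to-\infty}\Big(\psi(z)+z^{-2\nu-1}\eta(S)\psi\Big(\frac{-1}z\Big)\Big),$$ both limits being supposed to exist. For $\mathrm{Re}(\nu)>-\frac12$ let $\Psi^o_{\nu,\eta}$ be the space of all $\psi\in\Psi_{\nu,\eta}$ such that, for some $0<C<2\,\mathrm{Re}(\nu)+1$, one has $\psi(z)=O(\min\{1,|z|^{-C}\})$ on $\mathbb C\smallsetminus(-\infty,0]$, with implied constant uniform on each sector $|\arg z|\le\pi-\delta$, $\delta>0$. **Lemma.** Let $\mathrm{Re}(\nu)>-\frac12$. Every $u\in\mathcal S_{\nu,q,\eta}$ has an expansion $$u(x+iy)=\sum_{k\in\mathbb Z,\,k\ne0}e^{2\pi i\frac kNx}\sqrt y\,K_\nu\Big(2\pi\frac{|k|}Ny\Big)v_k$$ with uniquely determined $v_k\in V$, where $K_\nu$ is the $K$-Bessel function. Put $$f_u(z)=\begin{cases}\sum_{k>0}k^\nu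 e^{2\pi i\frac kNz}v_k,&\mathrm{Im}(z)>0,\\-\sum_{k<0}|k|^\nu e^{2\pi i\frac kNz}v_k,&\mathrm{Im}(z)<0,\end{cases}\qquad \psi_u(z)=f_u(z)-z^{-2\nu-1}\eta(S)f_u\Big(\frac{-1}z\Big).$$ The series converge, $\psi_u$ extends holomorphically to $\mathbb C\smallsetminus(-\infty,0]$, and $u\mapsto f_u$ and $u\mapsto\psi_u$ are well-defined linear maps $\mathcal S_{\nu,q,\eta}\to\mathcal F_{\nu,\eta}$ and $\mathcal S_{\nu,q,\eta}\to\Psi^o_{\nu,\eta}$, respectively. -/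

import Mathlib

open Filter Topology MeasureTheory UpperHalfPlane
open scoped MatrixGroups InnerProductSpace

namespace HigherOrderLewis

noncomputable section

/-! ### Invariants of higher order -/

section Algebra

variable {G : Type*} [Group G]

/-- The augmentation ideal `I_G` of the complex group algebra: the kernel of
`∑ c_g g ↦ ∑ c_g`. -/
def augIdeal (G : Type*) [Group G] : Ideal (MonoidAlgebra ℂ G) :=
  RingHom.ker (MonoidAlgebra.lift ℂ ℂ G (1 : G →* ℂ))

/-- `J_q = I_G ^ q + ℂ[G] I_P`. -/
def orderIdeal (P : Subgroup G) (q : ℕ) : Ideal (MonoidAlgebra ℂ G) :=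
  augIdeal G ^ q ⊔ (augIdeal P).map (MonoidAlgebra.mapDomainRingHom ℂ P.subtype)

/-- The invariants of type `P` and order `q`: all vectors `w` with `J_{q+1} w = 0`. -/
def higherInvariants {W : Type*} [AddCommGroup W] [Module ℂ W] (ρ : Representation ℂ G W)
    (P : Subgroup G) (q : ℕ) : Submodule ℂ W where
  carrier := {w | ∀ a ∈ orderIdeal P (q + 1), ρ.asAlgebraHom a w = 0}
  zero_mem' := fun a _ => map_zero _
  add_mem' := fun hv hw a ha => by rw [map_add, hv a ha, hw a ha, add_zero]
  smul_mem' := fun c v hv a ha => by rw [map_smul, hv a ha, smul_zero]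

/-- A representation of `G` is unipotent of length `q` if there is a stable filtration
`0 ⊆ F 0 ⊆ ⋯ ⊆ F q = V` such that `G` acts trivially on `F 0` and on each `F (k+1) / F k`. -/
def IsUnipotentOfLength {V : Type*} [AddCommGroup V] [Module ℂ V] (ρ : Representation ℂ G V)
    (q : ℕ) : Prop :=
  ∃ F : ℕ → Submodule ℂ V, Monotone F ∧ F q = ⊤ ∧
    (∀ k g, ∀ v ∈ F k, ρ g v ∈ F k) ∧
    (∀ g, ∀ v ∈ F 0, ρ g v = v) ∧
    ∀ k < q, ∀ g, ∀ v ∈ F (k + 1), ρ g v - v ∈ F k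

end Algebra

/-! ### The modular group acting on the upper half plane -/

/-- The image in `PSL(2, ℤ)` of a matrix in `SL(2, ℤ)`. -/
abbrev toPSL : SL(2, ℤ) →* PSL(2, ℤ) := QuotientGroup.mk' _

/-- The generator `S`, acting by `z ↦ -1/z`. -/
abbrev genS : PSL(2, ℤ) := toPSL ModularGroup.S

/-- The generator `T`, acting by `z ↦ z + 1`. -/
abbrev genT : PSL(2, ℤ) := toPSL ModularGroup.T

/-- The action of `PSL(2, ℤ)` on the upper half plane by linear fractional transformations. -/
def moebius : PSL(2, ℤ) →* Equiv.Perm ℍ :=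
  QuotientGroup.lift _ (MulAction.toPermHom SL(2, ℤ) ℍ) (by
    intro g hg
    obtain ⟨r, -, h⟩ := Matrix.SpecialLinearGroup.mem_center_iff.mp hg
    have h00 : g 0 0 = r := by rw [← h]; simp only [Matrix.scalar_apply, Matrix.diagonal_apply_eq]
    have h01 : g 0 1 = 0 := by
      rw [← h, Matrix.scalar_apply, Matrix.diagonal_apply_ne _ (by decide)]
    have h10 : g 1 0 = 0 := by
      rw [← h, Matrix.scalar_apply, Matrix.diagonal_apply_ne _ (by decide)]
    have h11 : g 1 1 = r := by rw [← h]; simp only [Matrix.scalar_apply, Matrix.diagonal_apply_eq]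
    have hdet := g.det_coe
    rw [Matrix.det_fin_two, h00, h01, h10, h11] at hdet
    have hr : (r : ℂ) ≠ 0 := by
      intro h0
      have : r = 0 := by exact_mod_cast h0
      simp [this] at hdet
    refine Equiv.ext fun z => UpperHalfPlane.ext ?_
    change ((g • z : ℍ) : ℂ) = z
    rw [UpperHalfPlane.coe_specialLinearGroup_apply]
    simp [h00, h01, h10, h11, hr])

lemma moebius_toPSL (g : SL(2, ℤ)) (z : ℍ) : moebius (toPSL g) z = g • z := rfl

/-- The left action `(γ f)(z) = f(γ⁻¹ z)` of a subgroup of `PSL(2, ℤ)` on functions on `ℍ`. -/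
def functionRep (Γ : Subgroup PSL(2, ℤ)) : Representation ℂ Γ (ℍ → ℂ) where
  toFun γ := LinearMap.funLeft ℂ ℂ (moebius (γ : PSL(2, ℤ))⁻¹)
  map_one' := by ext f z; simp [LinearMap.funLeft]
  map_mul' a b := by ext f z; simp [LinearMap.funLeft]

/-- The subgroup `Γ_par` of `Γ` generated by all parabolic elements of `Γ`. -/
def parabolicSubgroup (Γ : Subgroup PSL(2, ℤ)) : Subgroup Γ :=
  Subgroup.closure {γ : Γ | ∃ g : SL(2, ℤ), toPSL g = γ ∧
    (g : Matrix (Fin 2) (Fin 2) ℤ).IsParabolic}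

/-- The width of the cusp `∞` of `Γ`: the smallest `N > 0` with `T ^ N ∈ Γ`. As `Γ` is assumed to
be normal in `PSL(2, ℤ)`, it is the width of every cusp. -/
def cuspWidth (Γ : Subgroup PSL(2, ℤ)) : ℕ := sInf {n : ℕ | 0 < n ∧ genT ^ n ∈ Γ}

/-! ### The Borel-Serre space and locally square integrable functions -/

/-- The set `ℍ_Γ`: the upper half plane with a real line attached at each cusp `c ∈ ℙ¹(ℚ)`. The
line at `c` is `ℙ¹(ℝ) ∖ {c}`: a point `x` of it is the end at `c` of the geodesic from `x`
to `c`. -/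
inductive BorelSerre : Type
  | inner (z : ℍ) : BorelSerre
  | bdry (c : OnePoint ℚ) (x : OnePoint ℝ) (hx : x ≠ OnePoint.map (fun r : ℚ => (r : ℝ)) c) :
      BorelSerre

/-- The translate by `σ` of the half strip `{a < Re z < b, Im z > Y}`, together with the piece
`(a, b)` of the line at `∞`. -/
def stripNhd (σ : SL(2, ℤ)) (a b Y : ℝ) : Set BorelSerre :=
  {p | match p with
    | .inner z => a < (σ⁻¹ • z).re ∧ (σ⁻¹ • z).re < b ∧ Y < (σ⁻¹ • z).im
    | .bdry c x _ => c = Matrix.SpecialLinearGroup.mapGL ℚ σ • (OnePoint.infty : OnePoint ℚ) ∧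
        ∃ t : ℝ, a < t ∧ t < b ∧ x = Matrix.SpecialLinearGroup.mapGL ℝ σ • (t : OnePoint ℝ)}

/-- The topology of `ℍ_Γ`: `ℍ` is an open subspace, and the translated half strips are the basic
neighbourhoods of the boundary points. -/
instance : TopologicalSpace BorelSerre :=
  TopologicalSpace.generateFrom
    ({s | ∃ U : Set ℍ, IsOpen U ∧ s = BorelSerre.inner '' U} ∪
      {s | ∃ (σ : SL(2, ℤ)) (a b Y : ℝ), 0 < Y ∧ s = stripNhd σ a b Y})

/-- Membership in `L²_loc(ℍ_Γ)`: square integrability, for the hyperbolic measure, over every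
compact subset of `ℍ_Γ` (whose boundary is a null set). -/
def IsLocL2 (f : ℍ → ℂ) : Prop :=
  AEStronglyMeasurable f (volume : Measure ℍ) ∧
    ∀ K : Set BorelSerre, IsCompact K →
      MemLp f 2 ((volume : Measure ℍ).restrict (BorelSerre.inner ⁻¹' K))

/-! ### Maass forms of higher order -/

/-- `u` is twice continuously differentiable and `Δ u = (1/4 - ν²) u` for the hyperbolic Laplace
operator `Δ = -y² (∂²/∂x² + ∂²/∂y²)`. -/
def IsEigenfunction (ν : ℂ) (u : ℍ → ℂ) : Prop :=
  ContDiffOn ℝ 2 (u ∘ ofComplex) {z : ℂ | 0 < z.im} ∧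
    ∀ z : ℍ, -((z.im : ℂ) ^ 2) * (Laplacian.laplacian (u ∘ ofComplex) : ℂ → ℂ) (z : ℂ) =
      (1 / 4 - ν ^ 2) * u z

lemma isOpen_im_pos : IsOpen {z : ℂ | 0 < z.im} := isOpen_lt continuous_const Complex.continuous_im

lemma IsEigenfunction.continuous {ν : ℂ} {u : ℍ → ℂ} (h : IsEigenfunction ν u) :
    Continuous u := by
  have h1 : Continuous fun z : ℍ => (u ∘ ofComplex) (z : ℂ) :=
    h.1.continuousOn.comp_continuous UpperHalfPlane.continuous_coe fun z => z.im_pos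
  simpa [Function.comp_def, ofComplex_apply] using h1

/-- The space `M_{ν,q}` of Maass wave forms of order `q` for `Γ`. -/
def maassForms (Γ : Subgroup PSL(2, ℤ)) (ν : ℂ) (q : ℕ) : Submodule ℂ (ℍ → ℂ) where
  carrier := {u | IsEigenfunction ν u ∧ IsLocL2 u ∧
    u ∈ higherInvariants (functionRep Γ) (parabolicSubgroup Γ) q}
  zero_mem' := by
    refine ⟨⟨?_, fun z => ?_⟩, ⟨?_, fun K _ => ?_⟩, Submodule.zero_mem _⟩
    · exact contDiffOn_const
    · have : ((0 : ℍ → ℂ) ∘ ofComplex) = fun _ : ℂ => (0 : ℂ) := rfl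
      rw [this, InnerProductSpace.laplacian_const]
      simp
    · exact aestronglyMeasurable_zero
    · exact MemLp.zero
  add_mem' := by
    rintro u v ⟨⟨hu1, hu2⟩, ⟨hu3, hu4⟩, hu5⟩ ⟨⟨hv1, hv2⟩, ⟨hv3, hv4⟩, hv5⟩
    refine ⟨⟨?_, fun z => ?_⟩, ⟨hu3.add hv3, fun K hK => (hu4 K hK).add (hv4 K hK)⟩,
      Submodule.add_mem _ hu5 hv5⟩
    · exact hu1.add hv1
    · have hz : {z : ℂ | 0 < z.im} ∈ 𝓝 (z : ℂ) := isOpen_im_pos.mem_nhds z.im_pos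
      have : ((u + v) ∘ ofComplex) = (u ∘ ofComplex) + (v ∘ ofComplex) := rfl
      rw [this, (hu1.contDiffAt hz).laplacian_add (hv1.contDiffAt hz), mul_add, hu2, hv2,
        Pi.add_apply, mul_add]
  smul_mem' := by
    rintro c u ⟨⟨hu1, hu2⟩, ⟨hu3, hu4⟩, hu5⟩
    refine ⟨⟨?_, fun z => ?_⟩, ⟨hu3.const_smul c, fun K hK => (hu4 K hK).const_smul c⟩,
      Submodule.smul_mem _ c hu5⟩
    · exact hu1.const_smul c
    · have hz : {z : ℂ | 0 < z.im} ∈ 𝓝 (z : ℂ) := isOpen_im_pos.mem_nhds z.im_pos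
      have : ((c • u) ∘ ofComplex) = c • (u ∘ ofComplex) := rfl
      rw [this, InnerProductSpace.laplacian_smul c (hu1.contDiffAt hz), smul_eq_mul,
        Pi.smul_apply, smul_eq_mul, mul_left_comm, hu2, mul_left_comm]

lemma continuous_horocycle {u : ℍ → ℂ} (hu : Continuous u) (σ : SL(2, ℤ)) {y : ℝ} (hy : 0 < y) :
    Continuous fun x : ℝ => u (σ • ofComplex (x + y * Complex.I)) := by
  have h1 : (fun x : ℝ => ofComplex (x + y * Complex.I)) =
      fun x : ℝ => (⟨x + y * Complex.I, by simpa using hy⟩ : ℍ) := by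
    funext x
    exact ofComplex_apply_of_im_pos (by simpa using hy)
  have h2 : Continuous fun x : ℝ => ofComplex (x + y * Complex.I) := by
    rw [h1, UpperHalfPlane.isEmbedding_coe.continuous_iff]
    change Continuous fun x : ℝ => (x + y * Complex.I : ℂ)
    fun_prop
  have h3 : Continuous fun z : ℍ => σ • z := by
    exact continuous_const_smul (Matrix.SpecialLinearGroup.mapGL ℝ σ)
  exact hu.comp (h3.comp h2)

/-- The space `S_{ν,q}` of Maass cusp forms of order `q`: at every cusp `c = σ ∞` the zeroth
Fourier coefficient of `z ↦ u (σ z)`, which is periodic of period the cusp width, vanishes. -/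
def cuspForms (Γ : Subgroup PSL(2, ℤ)) (ν : ℂ) (q : ℕ) : Submodule ℂ (ℍ → ℂ) where
  carrier := {u | u ∈ maassForms Γ ν q ∧ ∀ (σ : SL(2, ℤ)) (y : ℝ), 0 < y →
    ∫ x in (0 : ℝ)..(cuspWidth Γ), u (σ • ofComplex (x + y * Complex.I)) = 0}
  zero_mem' := ⟨Submodule.zero_mem _, fun σ y _ => by simp⟩
  add_mem' := by
    rintro u v ⟨hu, hu0⟩ ⟨hv, hv0⟩
    refine ⟨Submodule.add_mem _ hu hv, fun σ y hy => ?_⟩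
    have h := intervalIntegral.integral_add (μ := volume) (a := 0) (b := (cuspWidth Γ : ℝ))
      ((continuous_horocycle hu.1.continuous σ hy).intervalIntegrable 0 (cuspWidth Γ))
      ((continuous_horocycle hv.1.continuous σ hy).intervalIntegrable 0 (cuspWidth Γ))
    rw [hu0 σ y hy, hv0 σ y hy, add_zero] at h
    exact h
  smul_mem' := by
    rintro c u ⟨hu, hu0⟩
    refine ⟨Submodule.smul_mem _ c hu, fun σ y hy => ?_⟩
    have h := intervalIntegral.integral_smul (μ := volume) (a := 0) (b := (cuspWidth Γ : ℝ)) c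
      (fun x : ℝ => u (σ • ofComplex (x + y * Complex.I)))
    rw [hu0 σ y hy, smul_zero] at h
    exact h

section Twisted

variable {V : Type*} [NormedAddCommGroup V] [NormedSpace ℂ V]

/-- The space `S_{ν,q,η} = (V ⊗ S_{ν,q})^{PSL(2,ℤ)}`, for finite dimensional `V`. An element of
`V ⊗ S_{ν,q}` is a function `u : ℍ → V` whose coordinates (its compositions with all linear
functionals) lie in `S_{ν,q}`, and invariance under the diagonal action
`u ↦ η(γ) u(γ⁻¹ z)` means `u(γ z) = η(γ) u(z)`. -/
def twistedCuspForms (Γ : Subgroup PSL(2, ℤ)) (ν : ℂ) (q : ℕ)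
    (η : Representation ℂ PSL(2, ℤ) V) : Submodule ℂ (ℍ → V) where
  carrier := {u | (∀ l : Module.Dual ℂ V, (fun z => l (u z)) ∈ cuspForms Γ ν q) ∧
    ∀ (γ : PSL(2, ℤ)) (z : ℍ), u (moebius γ z) = η γ (u z)}
  zero_mem' := by
    refine ⟨fun l => ?_, fun γ z => by simp⟩
    have : (fun z : ℍ => l ((0 : ℍ → V) z)) = 0 := by funext z; simp
    rw [this]
    exact Submodule.zero_mem _
  add_mem' := by
    rintro u v ⟨hu, hu'⟩ ⟨hv, hv'⟩
    refine ⟨fun l => ?_, fun γ z => by simp [hu', hv']⟩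
    have : (fun z : ℍ => l ((u + v) z)) = (fun z => l (u z)) + fun z => l (v z) := by
      funext z; simp
    rw [this]
    exact Submodule.add_mem _ (hu l) (hv l)
  smul_mem' := by
    rintro c u ⟨hu, hu'⟩
    refine ⟨fun l => ?_, fun γ z => by simp [hu']⟩
    have : (fun z : ℍ => l ((c • u) z)) = c • fun z => l (u z) := by
      funext z; simp
    rw [this]
    exact Submodule.smul_mem _ c (hu l)

/-! ### The Fourier-Bessel expansion -/

/-- The `K`-Bessel function `K_ν(t) = ∫_0^∞ exp(-t cosh s) cosh(ν s) ds`, for `t > 0`. -/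
def besselK (ν : ℂ) (t : ℝ) : ℂ :=
  ∫ s in Set.Ioi (0 : ℝ), (Real.exp (-t * Real.cosh s) : ℂ) * Complex.cosh (ν * s)

/-- The family `v` (indexed by the nonzero integers; `v 0` is set to `0`) is the family of
Fourier-Bessel coefficients of `u`:
`u(x + iy) = ∑_{k ≠ 0} e^{2πikx/N} √y K_ν(2π|k|y/N) v_k`. -/
def IsFourierBessel (ν : ℂ) (N : ℕ) (u : ℍ → V) (v : ℤ → V) : Prop :=
  v 0 = 0 ∧ ∀ z : ℍ, HasSum
    (fun k : {k : ℤ // k ≠ 0} =>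
      (Complex.exp (2 * Real.pi * Complex.I * ((k : ℤ) : ℂ) * (z.re : ℂ) / (N : ℂ)) *
        (Real.sqrt z.im : ℂ) * besselK ν (2 * Real.pi * |((k : ℤ) : ℝ)| * z.im / (N : ℝ))) •
          v k)
    (u z)

/-- `f` is the function with
`f(z) = ∑_{k>0} k^ν e^{2πikz/N} v_k` for `Im z > 0` and
`f(z) = -∑_{k<0} |k|^ν e^{2πikz/N} v_k` for `Im z < 0`. -/
def IsLewisSeries (ν : ℂ) (N : ℕ) (v : ℤ → V) (f : ℂ → V) : Prop :=
  (∀ z : ℂ, 0 < z.im → HasSum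
    (fun k : {k : ℤ // 0 < k} => (((k : ℤ) : ℂ) ^ ν *
      Complex.exp (2 * Real.pi * Complex.I * ((k : ℤ) : ℂ) * z / (N : ℂ))) • v k) (f z)) ∧
  ∀ z : ℂ, z.im < 0 → HasSum
    (fun k : {k : ℤ // k < 0} => -(((|((k : ℤ) : ℝ)| : ℝ) : ℂ) ^ ν *
      Complex.exp (2 * Real.pi * Complex.I * ((k : ℤ) : ℂ) * z / (N : ℂ))) • v k) (f z)

/-! ### The spaces of holomorphic functions

A function on an open subset of `ℂ` is represented by its extension by zero to `ℂ`. -/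

/-- The space `F_η` of holomorphic functions `f` on `ℂ ∖ ℝ` with `f(z+1) = η(T) f(z)` which are
bounded as `|Im z| → ∞` and satisfy `f(i∞) + f(-i∞) = 0`. -/
def spaceF (η : Representation ℂ PSL(2, ℤ) V) : Submodule ℂ (ℂ → V) where
  carrier := {f | DifferentiableOn ℂ f {z : ℂ | z.im ≠ 0} ∧ (∀ z : ℂ, z.im = 0 → f z = 0) ∧
    (∀ z : ℂ, z.im ≠ 0 → f (z + 1) = η genT (f z)) ∧
    (f =O[comap (fun z : ℂ => |z.im|) atTop] fun _ => (1 : ℝ)) ∧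
    ∃ w : V, Tendsto f (comap Complex.im atTop) (𝓝 w) ∧
      Tendsto f (comap Complex.im atBot) (𝓝 (-w))}
  zero_mem' := by
    refine ⟨differentiableOn_const 0, fun _ _ => rfl, fun z _ => by simp,
      Asymptotics.isBigO_zero _ _, 0, tendsto_const_nhds, ?_⟩
    rw [neg_zero]
    exact tendsto_const_nhds
  add_mem' := by
    rintro f g ⟨hf1, hf2, hf3, hf4, a, hf5, hf6⟩ ⟨hg1, hg2, hg3, hg4, b, hg5, hg6⟩
    refine ⟨hf1.add hg1, fun z hz => by simp [hf2 z hz, hg2 z hz],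
      fun z hz => by simp [hf3 z hz, hg3 z hz], hf4.add hg4, a + b, hf5.add hg5, ?_⟩
    rw [neg_add]
    exact hf6.add hg6
  smul_mem' := by
    rintro c f ⟨hf1, hf2, hf3, hf4, a, hf5, hf6⟩
    refine ⟨hf1.const_smul c, fun z hz => by simp [hf2 z hz],
      fun z hz => by simp [hf3 z hz], hf4.const_smul_left c, c • a, hf5.const_smul c, ?_⟩
    rw [← smul_neg]
    exact hf6.const_smul c

/-- The space `F_{ν,η}` of all `f ∈ F_η` for which `f(z) - z^{-2ν-1} η(S) f(-1/z)` extends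
holomorphically to `ℂ ∖ (-∞,0]`. The complex power is the one given by the principal branch of
the logarithm, and `Complex.slitPlane` is `ℂ ∖ (-∞,0]`. -/
def spaceFnu (ν : ℂ) (η : Representation ℂ PSL(2, ℤ) V) : Submodule ℂ (ℂ → V) where
  carrier := {f | f ∈ spaceF η ∧ ∃ g : ℂ → V, DifferentiableOn ℂ g Complex.slitPlane ∧
    ∀ z : ℂ, z.im ≠ 0 → g z = f z - z ^ (-2 * ν - 1) • η genS (f (-1 / z))}
  zero_mem' := ⟨Submodule.zero_mem _, 0, differentiableOn_const 0, fun z _ => by simp⟩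
  add_mem' := by
    rintro f₁ f₂ ⟨h₁, g₁, hg₁, e₁⟩ ⟨h₂, g₂, hg₂, e₂⟩
    refine ⟨Submodule.add_mem _ h₁ h₂, g₁ + g₂, hg₁.add hg₂, fun z hz => ?_⟩
    simp only [Pi.add_apply, e₁ z hz, e₂ z hz, map_add, smul_add]
    abel
  smul_mem' := by
    rintro c f ⟨h, g, hg, e⟩
    refine ⟨Submodule.smul_mem _ c h, c • g, hg.const_smul c, fun z hz => ?_⟩
    simp only [Pi.smul_apply, e z hz, map_smul, smul_sub]
    rw [smul_comm]

/-- The space `Ψ_{ν,η}` of holomorphic functions on `ℂ ∖ (-∞,0]` that satisfy the Lewis equation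
and the limit formula. -/
def spacePsi (ν : ℂ) (η : Representation ℂ PSL(2, ℤ) V) : Submodule ℂ (ℂ → V) where
  carrier := {ψ | DifferentiableOn ℂ ψ Complex.slitPlane ∧
    (∀ z, z ∉ Complex.slitPlane → ψ z = 0) ∧
    (∀ z ∈ Complex.slitPlane, η genT (ψ z) =
      ψ (z + 1) + (z + 1) ^ (-2 * ν - 1) • η (genS * genT⁻¹) (ψ (z / (z + 1)))) ∧
    ∃ a b : V,
      Tendsto (fun z : ℂ => ψ z + z ^ (-2 * ν - 1) • η genS (ψ (-1 / z)))
        (comap Complex.im atTop) (𝓝 a) ∧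
      Tendsto (fun z : ℂ => ψ z + z ^ (-2 * ν - 1) • η genS (ψ (-1 / z)))
        (comap Complex.im atBot) (𝓝 b) ∧
      Complex.exp (Real.pi * Complex.I * ν) • a + Complex.exp (-(Real.pi * Complex.I * ν)) • b = 0}
  zero_mem' := by
    refine ⟨differentiableOn_const 0, fun _ _ => rfl, fun z _ => by simp, 0, 0, ?_, ?_, by simp⟩
    · simpa using tendsto_const_nhds
    · simpa using tendsto_const_nhds
  add_mem' := by
    rintro f g ⟨hf1, hf2, hf3, a, b, ha, hb, hab⟩ ⟨hg1, hg2, hg3, c, d, hc, hd, hcd⟩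
    refine ⟨hf1.add hg1, fun z hz => by simp [hf2 z hz, hg2 z hz], fun z hz => ?_,
      a + c, b + d, ?_, ?_, ?_⟩
    · simp only [Pi.add_apply, map_add, hf3 z hz, hg3 z hz, smul_add]
      abel
    · refine (ha.add hc).congr fun z => ?_
      simp only [Pi.add_apply, map_add, smul_add]
      abel
    · refine (hb.add hd).congr fun z => ?_
      simp only [Pi.add_apply, map_add, smul_add]
      abel
    · rw [smul_add, smul_add, add_add_add_comm, hab, hcd, add_zero]
  smul_mem' := by
    rintro c f ⟨hf1, hf2, hf3, a, b, ha, hb, hab⟩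
    refine ⟨hf1.const_smul c, fun z hz => by simp [hf2 z hz], fun z hz => ?_,
      c • a, c • b, ?_, ?_, ?_⟩
    · simp only [Pi.smul_apply, map_smul, hf3 z hz, smul_add]
      rw [smul_comm]
    · refine (ha.const_smul c).congr fun z => ?_
      simp only [Pi.smul_apply, map_smul, smul_add]
      rw [smul_comm]
    · refine (hb.const_smul c).congr fun z => ?_
      simp only [Pi.smul_apply, map_smul, smul_add]
      rw [smul_comm]
    · rw [smul_comm _ c, smul_comm _ c, ← smul_add, hab, smul_zero]

lemma min_rpow_le {r C D : ℝ} (hr : 0 < r) (hC : 0 ≤ C) (h : C ≤ D) :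
    min 1 (r ^ (-D)) ≤ min 1 (r ^ (-C)) := by
  refine le_min (min_le_left _ _) ?_
  rcases le_total 1 r with h1 | h1
  · exact (min_le_right _ _).trans (Real.rpow_le_rpow_of_exponent_le h1 (by linarith))
  · exact (min_le_left _ _).trans
      (Real.one_le_rpow_of_pos_of_le_one_of_nonpos hr h1 (by linarith))

/-- The bound `ψ(z) = O(min{1, |z|^{-C}})` on the slit plane `ℂ ∖ (-∞,0]`, in the sense usual for
asymptotics on a slit plane: uniformly on every closed sector `|arg z| ≤ π - δ` with `δ > 0`. -/
def HasDecay (C : ℝ) (ψ : ℂ → V) : Prop :=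
  ∀ δ > 0, ∃ M : ℝ, ∀ z ∈ Complex.slitPlane, |z.arg| ≤ Real.pi - δ →
    ‖ψ z‖ ≤ M * min 1 (‖z‖ ^ (-C))

/-- The space `Ψ^o_{ν,η}` of period functions, for `Re ν > -1/2`: all `ψ ∈ Ψ_{ν,η}` with
`ψ(z) = O(min{1, |z|^{-C}})` for some `0 < C < 2 Re ν + 1`. -/
def periodFunctions (ν : ℂ) (hν : -(1 / 2 : ℝ) < ν.re) (η : Representation ℂ PSL(2, ℤ) V) :
    Submodule ℂ (ℂ → V) where
  carrier := {ψ | ψ ∈ spacePsi ν η ∧ ∃ C : ℝ, 0 < C ∧ C < 2 * ν.re + 1 ∧ HasDecay C ψ}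
  zero_mem' := by
    refine ⟨Submodule.zero_mem _, ν.re + 1 / 2, by linarith, by linarith, fun δ _ =>
      ⟨0, fun z _ _ => by simp⟩⟩
  add_mem' := by
    rintro f g ⟨hf, C, hC, hC', hfC⟩ ⟨hg, D, hD, hD', hgD⟩
    refine ⟨Submodule.add_mem _ hf hg, min C D, lt_min hC hD, (min_le_left _ _).trans_lt hC',
      fun δ hδ => ?_⟩
    obtain ⟨M, hM⟩ := hfC δ hδ
    obtain ⟨M', hM'⟩ := hgD δ hδ
    refine ⟨|M| + |M'|, fun z hz hz' => ?_⟩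
    have hz0 : 0 < ‖z‖ := norm_pos_iff.mpr (Complex.slitPlane_ne_zero hz)
    have h1 := min_rpow_le hz0 (lt_min hC hD).le (min_le_left C D)
    have h2 := min_rpow_le hz0 (lt_min hC hD).le (min_le_right C D)
    have p1 : 0 ≤ min 1 (‖z‖ ^ (-C)) := le_min zero_le_one (Real.rpow_nonneg hz0.le _)
    have p2 : 0 ≤ min 1 (‖z‖ ^ (-D)) := le_min zero_le_one (Real.rpow_nonneg hz0.le _)
    calc ‖f z + g z‖ ≤ ‖f z‖ + ‖g z‖ := norm_add_le _ _
      _ ≤ |M| * min 1 (‖z‖ ^ (-C)) + |M'| * min 1 (‖z‖ ^ (-D)) :=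
          add_le_add ((hM z hz hz').trans (mul_le_mul_of_nonneg_right (le_abs_self _) p1))
            ((hM' z hz hz').trans (mul_le_mul_of_nonneg_right (le_abs_self _) p2))
      _ ≤ |M| * min 1 (‖z‖ ^ (-min C D)) + |M'| * min 1 (‖z‖ ^ (-min C D)) :=
          add_le_add (mul_le_mul_of_nonneg_left h1 (abs_nonneg _))
            (mul_le_mul_of_nonneg_left h2 (abs_nonneg _))
      _ = (|M| + |M'|) * min 1 (‖z‖ ^ (-min C D)) := by ring
  smul_mem' := by
    rintro c f ⟨hf, C, hC, hC', hfC⟩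
    refine ⟨Submodule.smul_mem _ c hf, C, hC, hC', fun δ hδ => ?_⟩
    obtain ⟨M, hM⟩ := hfC δ hδ
    refine ⟨‖c‖ * M, fun z hz hz' => ?_⟩
    rw [Pi.smul_apply, norm_smul, mul_assoc]
    exact mul_le_mul_of_nonneg_left (hM z hz hz') (norm_nonneg _)

end Twisted

end

end HigherOrderLewis

namespace HigherOrderLewis

noncomputable section

/-! ### The K-Bessel function -/

/-! Put s = ν + 1/2, so that z^(-2ν-1) = z^(-2s). The idea is to write f_u as the integral of a
closed one-form and then to move the contour. Fix a coordinate of u, again called u. Off a vertical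
slit above ζ, the kernel (y / ((z-ζ)(z̄-ζ)))^s is an eigenfunction of the Laplacian for the same
eigenvalue as u (`kernelV_isEig`), so Green's form of the two is closed (`greenForm_closed`). Its
integral `lewisF` over a parabola that comes down from i∞ left of ζ, passes below ζ and returns to
i∞ on the right does not depend on the parabola and is holomorphic in ζ. For a single mode e^{iax}
√y K_ν(|a|y), translation in x forces this integral to be a multiple of e^{iaζ}, scaling produces
the factor |a|^ν, and the behaviour at ζ = iY for Y → ∞ shows that the multiple is zero for a < 0
and nonzero for a > 0 (`lewisF_mode_of_neg`, `lewisF_mode_of_pos`, `lewisConst_ne_zero`). Summing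
over the modes, `lewisF` is a nonzero constant times f_u on the upper half plane
(`IsExpansion.lewisF_eq`). Equivariance under S says that the coordinates along l and l ∘ η(S) are
exchanged by z ↦ -1/z (`IsSwapPair`). Hence the decay at i∞ reappears at 0 in every sector, and for
ζ = iY the parabola may be replaced by the two rays of arguments θ and π - θ
(`IsSwapPair.lewisF_eq_rayL`). The inversion exchanges these rays, and in f_u(z) - z^(-2s) η(S)
f_u(-1/z) one of the two ray integrals cancels (`IsSwapPair.lewisF_sub`). The remaining one is
holomorphic in ζ away from the rays of arguments θ and -θ and is O(min(1, |ζ|^(-2 Re s))). Letting θ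
approach π, this single formula gives both the continuation of ψ_u across the positive reals and its
decay (`IsSwapPair.lewisSeries_sub`, `IsSwapPair.exists_norm_rayF_le`). The lower half plane is
reduced to the upper one by z ↦ -z̄. The expansion itself comes from separation of variables. Local
square integrability up to the boundary line at ∞ makes u integrable against dx dy / y² on a strip.
The Fourier coefficients solve the Bessel equation, and a Wronskian argument leaves only multiples
of √y K_ν (`exists_eq_mul_modeG`). Periodicity holds because T^N lies in the parabolic subgroup, on
which η is trivial. The remaining conditions are formal. The Lewis equation follows from TS =
(ST⁻¹)² (`periodDiff_lewis`). Since f_u tends to 0 at both ends, the limits in the definitions of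
the two target spaces are all zero. Vector valued statements are tested on linear functionals, and
linearity of the two maps follows from uniqueness (`IsLewisTransform.unique`). -/

lemma integrable_exp_quadratic {b : ℝ} (hb : 0 < b) (c : ℝ) :
    Integrable fun s : ℝ => Real.exp (-b * s ^ 2 + c * s) := by
  have h := (integrable_cexp_quadratic' (b := ((-b : ℝ) : ℂ)) (by simpa using hb) (c : ℂ) 0).norm
  refine h.congr (ae_of_all _ fun s => ?_)
  simp only [Complex.norm_exp]
  norm_cast
  simp

/-- Follows from cosh s = 1 + 2 sinh²(s/2) and |x| ≤ sinh |x|. It turns every Bessel integrand into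
one with a Gaussian tail. -/
lemma one_add_half_sq_le_cosh (s : ℝ) : 1 + s ^ 2 / 2 ≤ Real.cosh s := by
  have h : Real.cosh s = 1 + 2 * Real.sinh (s / 2) ^ 2 := by
    have h1 := Real.cosh_two_mul (s / 2)
    have h2 := Real.cosh_sq (s / 2)
    rw [show 2 * (s / 2) = s by ring] at h1
    linarith
  have h3 : (s / 2) ^ 2 ≤ Real.sinh (s / 2) ^ 2 := by
    rw [sq_le_sq, Real.abs_sinh]
    exact Real.self_le_sinh_iff.mpr (abs_nonneg _)
  nlinarith

lemma norm_cosh_le (z : ℂ) : ‖Complex.cosh z‖ ≤ Real.exp |z.re| := by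
  rw [Complex.cosh, norm_div, Complex.norm_two, div_le_iff₀ two_pos]
  refine (norm_add_le _ _).trans ?_
  rw [Complex.norm_exp, Complex.norm_exp, Complex.neg_re]
  have h1 := Real.exp_le_exp.mpr (le_abs_self z.re)
  have h2 := Real.exp_le_exp.mpr (neg_le_abs z.re)
  linarith

/-- The integrand `exp (-t cosh s) cosh s ^ j cosh (ν s)`. -/
def besselIntegrand (ν : ℂ) (j : ℕ) (t s : ℝ) : ℂ :=
  (Real.exp (-t * Real.cosh s) : ℂ) * (Real.cosh s : ℂ) ^ j * Complex.cosh (ν * s)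

/-- The moment `∫_0^∞ exp (-t cosh s) cosh s ^ j cosh (ν s) ds`. -/
def besselMoment (ν : ℂ) (j : ℕ) (t : ℝ) : ℂ :=
  ∫ s in Set.Ioi (0 : ℝ), besselIntegrand ν j t s

lemma besselK_eq (ν : ℂ) (t : ℝ) : besselK ν t = besselMoment ν 0 t := by
  simp [besselK, besselMoment, besselIntegrand]

lemma continuous_besselIntegrand (ν : ℂ) (j : ℕ) (t : ℝ) :
    Continuous (besselIntegrand ν j t) := by
  unfold besselIntegrand
  have h : Continuous fun s : ℝ => Complex.cosh (ν * s) :=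
    Complex.continuous_cosh.comp (by fun_prop)
  have h2 := Real.continuous_cosh
  fun_prop

/-- The factor e^{-t} is split off exactly, and the remaining decay is shared between t - t₀ and t₀.
For t ≥ t₀ the first share is at most 1 and the second gives a majorant independent of t. -/
lemma norm_besselIntegrand_le (ν : ℂ) (j : ℕ) {t₀ t s : ℝ} (hs : 0 ≤ s) :
    ‖besselIntegrand ν j t s‖ ≤
      Real.exp (-t) * Real.exp (-(t - t₀) * (Real.cosh s - 1)) *
        Real.exp (-(t₀ * (Real.cosh s - 1)) + (j + |ν.re|) * s) := by
  unfold besselIntegrand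
  rw [norm_mul, norm_mul, norm_pow, Complex.norm_real, Complex.norm_real, Real.norm_eq_abs,
    Real.norm_eq_abs, Real.abs_exp, abs_of_pos (Real.cosh_pos s)]
  have h1 : ‖Complex.cosh (ν * s)‖ ≤ Real.exp (|ν.re| * s) := by
    refine (norm_cosh_le _).trans (Real.exp_le_exp.mpr ?_)
    rw [Complex.re_mul_ofReal, abs_mul, abs_of_nonneg hs]
  have h2 : Real.cosh s ^ j ≤ Real.exp (j * s) := by
    rw [Real.exp_nat_mul]
    refine pow_le_pow_left₀ (Real.cosh_pos s).le ?_ j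
    have := Real.cosh_add_sinh s
    have := Real.sinh_nonneg_iff.mpr hs
    linarith
  calc _ ≤ Real.exp (-t * Real.cosh s) * Real.exp (j * s) * Real.exp (|ν.re| * s) := by
        gcongr
    _ = _ := by
        rw [← Real.exp_add, ← Real.exp_add, ← Real.exp_add, ← Real.exp_add]
        congr 1
        ring

lemma integrable_besselBound {t₀ : ℝ} (ht : 0 < t₀) (c : ℝ) :
    Integrable fun s : ℝ => Real.exp (-(t₀ * (Real.cosh s - 1)) + c * s) := by
  refine (integrable_exp_quadratic (b := t₀ / 2) (by linarith) c).mono'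
    (by have h2 := Real.continuous_cosh
        exact (by fun_prop : Continuous _).aestronglyMeasurable) (ae_of_all _ fun s => ?_)
  rw [Real.norm_eq_abs, Real.abs_exp]
  refine Real.exp_le_exp.mpr ?_
  have := one_add_half_sq_le_cosh s
  nlinarith

lemma norm_besselIntegrand_le' (ν : ℂ) (j : ℕ) {t₀ t s : ℝ} (ht : t₀ ≤ t) (hs : 0 ≤ s) :
    ‖besselIntegrand ν j t s‖ ≤
      Real.exp (-t) * Real.exp (-(t₀ * (Real.cosh s - 1)) + (j + |ν.re|) * s) := by
  refine (norm_besselIntegrand_le ν j (t₀ := t₀) hs).trans ?_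
  have h1 : Real.exp (-(t - t₀) * (Real.cosh s - 1)) ≤ 1 := by
    rw [Real.exp_le_one_iff]
    have := Real.one_le_cosh s
    nlinarith
  have h2 := Real.exp_pos (-t)
  gcongr
  nlinarith

lemma integrableOn_besselIntegrand (ν : ℂ) (j : ℕ) {t : ℝ} (ht : 0 < t) :
    IntegrableOn (besselIntegrand ν j t) (Set.Ioi 0) := by
  refine ((integrable_besselBound ht (j + |ν.re|)).const_mul (Real.exp (-t))).integrableOn.mono'
    (continuous_besselIntegrand ν j t).aestronglyMeasurable ?_
  refine (ae_restrict_iff' measurableSet_Ioi).mpr (ae_of_all _ fun s hs => ?_)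
  exact norm_besselIntegrand_le' ν j le_rfl (le_of_lt hs)

lemma exists_norm_besselMoment_le (ν : ℂ) (j : ℕ) {t₀ : ℝ} (h₀ : 0 < t₀) :
    ∃ C, 0 ≤ C ∧ ∀ t, t₀ ≤ t → ‖besselMoment ν j t‖ ≤ C * Real.exp (-t) := by
  refine ⟨∫ s in Set.Ioi (0 : ℝ), Real.exp (-(t₀ * (Real.cosh s - 1)) + (j + |ν.re|) * s),
    integral_nonneg fun _ => (Real.exp_pos _).le, fun t ht => ?_⟩
  rw [mul_comm, ← integral_const_mul]
  refine norm_integral_le_of_norm_le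
    ((integrable_besselBound h₀ _).const_mul _).integrableOn ?_
  refine (ae_restrict_iff' measurableSet_Ioi).mpr (ae_of_all _ fun s hs => ?_)
  exact norm_besselIntegrand_le' ν j ht (le_of_lt hs)

/-- Differentiating in t brings down -cosh s, which raises j by one. The moments exist so that all
derivatives of K_ν stay in one family. -/
lemma hasDerivAt_besselMoment (ν : ℂ) (j : ℕ) {t : ℝ} (ht : 0 < t) :
    HasDerivAt (besselMoment ν j) (-besselMoment ν (j + 1) t) t := by
  have h := hasDerivAt_integral_of_dominated_loc_of_deriv_le
    (μ := volume.restrict (Set.Ioi (0 : ℝ))) (F := fun t s => besselIntegrand ν j t s)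
    (F' := fun t s => -besselIntegrand ν (j + 1) t s) (x₀ := t) (s := Set.Ioi (t / 2))
    (bound := fun s => Real.exp (-((t / 2) * (Real.cosh s - 1)) + ((j + 1 : ℕ) + |ν.re|) * s))
    (Ioi_mem_nhds (by linarith))
    (Eventually.of_forall fun t => (continuous_besselIntegrand ν j t).aestronglyMeasurable)
    (integrableOn_besselIntegrand ν j ht)
    (continuous_besselIntegrand ν (j + 1) t).neg.aestronglyMeasurable ?_
    (integrable_besselBound (by linarith) _).integrableOn ?_
  · have h2 := h.2
    rw [integral_neg] at h2
    exact h2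
  · refine (ae_restrict_iff' measurableSet_Ioi).mpr (ae_of_all _ fun s hs x hx => ?_)
    rw [norm_neg]
    refine (norm_besselIntegrand_le' ν (j + 1) (le_of_lt hx) (le_of_lt hs)).trans ?_
    have hx' : t / 2 < x := hx
    refine mul_le_of_le_one_left (Real.exp_pos _).le (Real.exp_le_one_iff.mpr ?_)
    linarith
  · refine ae_of_all _ fun s x _ => ?_
    unfold besselIntegrand
    have h1 : HasDerivAt (fun x : ℝ => -x * Real.cosh s) (-1 * Real.cosh s) x :=
      (hasDerivAt_id x).neg.mul_const _
    have h2 := (h1.exp.ofReal_comp).mul_const ((Real.cosh s : ℂ) ^ j)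
    have h3 := h2.mul_const (Complex.cosh (ν * s))
    convert! h3 using 1
    push_cast
    ring

/-- The modified Bessel equation for K_ν, whose first two derivatives are minus moment 1 and moment
2. The combination of integrands is the s-derivative of e^{-t cosh s}(-t sinh s cosh νs - ν sinh
νs), which vanishes at 0 and at infinity. -/
lemma besselMoment_ode (ν : ℂ) {t : ℝ} (ht : 0 < t) :
    (t : ℂ) ^ 2 * besselMoment ν 2 t - t * besselMoment ν 1 t -
      ((t : ℂ) ^ 2 + ν ^ 2) * besselMoment ν 0 t = 0 := by
  set E : ℝ → ℂ := fun s => (Real.exp (-t * Real.cosh s) : ℂ) with hE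
  set Φ : ℝ → ℂ := fun s => E s * (-(t * (Real.sinh s : ℂ) * Complex.cosh (ν * s)) -
    ν * Complex.sinh (ν * s)) with hΦ
  have hd : ∀ s ∈ Set.Ici (0 : ℝ), HasDerivAt Φ ((t : ℂ) ^ 2 * besselIntegrand ν 2 t s -
      t * besselIntegrand ν 1 t s - ((t : ℂ) ^ 2 + ν ^ 2) * besselIntegrand ν 0 t s) s := by
    intro s _
    have h1 : HasDerivAt E (Real.exp (-t * Real.cosh s) * (-t * Real.sinh s) : ℝ) s :=
      ((Real.hasDerivAt_cosh s).const_mul (-t)).exp.ofReal_comp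
    have h0 : HasDerivAt (fun s : ℝ => ν * (s : ℂ)) (ν * 1) s :=
      (Complex.ofRealCLM.hasDerivAt (x := s)).const_mul ν
    have h2 : HasDerivAt (fun s : ℝ => Complex.cosh (ν * s))
        (Complex.sinh (ν * s) * (ν * 1)) s := HasDerivAt.comp (h₂ := Complex.cosh) (h := fun s : ℝ => ν * (s : ℂ)) s
        (Complex.hasDerivAt_cosh (ν * s)) h0
    have h3 : HasDerivAt (fun s : ℝ => Complex.sinh (ν * s))
        (Complex.cosh (ν * s) * (ν * 1)) s := HasDerivAt.comp (h₂ := Complex.sinh) (h := fun s : ℝ => ν * (s : ℂ)) s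
        (Complex.hasDerivAt_sinh (ν * s)) h0
    have h4 := (Real.hasDerivAt_sinh s).ofReal_comp
    have h5 := h1.mul ((((h4.const_mul (t : ℂ)).mul h2).neg).sub (h3.const_mul ν))
    convert! h5 using 1
    simp only [besselIntegrand, hE, Pi.neg_apply, Pi.sub_apply, Pi.mul_apply]
    have hcs : (Real.cosh s : ℂ) ^ 2 = (Real.sinh s : ℂ) ^ 2 + 1 := by
      exact_mod_cast Real.cosh_sq s
    push_cast at hcs ⊢
    rw [hcs]
    ring
  have hint : ∀ j, IntegrableOn (besselIntegrand ν j t) (Set.Ioi 0) := fun j =>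
    integrableOn_besselIntegrand ν j ht
  have hi : IntegrableOn (fun s => (t : ℂ) ^ 2 * besselIntegrand ν 2 t s -
      t * besselIntegrand ν 1 t s - ((t : ℂ) ^ 2 + ν ^ 2) * besselIntegrand ν 0 t s)
      (Set.Ioi 0) :=
    (((hint 2).const_mul _).sub ((hint 1).const_mul _)).sub ((hint 0).const_mul _)
  have hlim : Tendsto Φ atTop (𝓝 0) := by
    have hb : Tendsto (fun s : ℝ => (t + ‖ν‖) *
        Real.exp (-(t / 2) * s ^ 2 + (1 + |ν.re|) * s)) atTop (𝓝 ((t + ‖ν‖) * 0)) := by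
      refine Tendsto.const_mul _ (Real.tendsto_exp_atBot.comp ?_)
      have : Tendsto (fun s : ℝ => s * ((t / 2) * s - (1 + |ν.re|))) atTop atTop := by
        refine tendsto_id.atTop_mul_atTop₀ (tendsto_atTop_add_const_right _ _ ?_)
        exact tendsto_id.const_mul_atTop (by linarith)
      refine (tendsto_neg_atTop_atBot.comp this).congr fun s => ?_
      simp only [Function.comp_apply]
      ring
    rw [mul_zero] at hb
    refine squeeze_zero_norm' ?_ hb
    filter_upwards [eventually_ge_atTop 0] with s hs
    have hre : (ν * s).re = ν.re * s := by simp
    have hc := norm_cosh_le (ν * s)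
    have hsn : ‖Complex.sinh (ν * s)‖ ≤ Real.exp (|ν.re| * s) := by
      rw [Complex.sinh, norm_div, Complex.norm_two, div_le_iff₀ two_pos]
      refine (norm_sub_le _ _).trans ?_
      rw [Complex.norm_exp, Complex.norm_exp, Complex.neg_re, hre]
      have h1 : Real.exp (ν.re * s) ≤ Real.exp (|ν.re| * s) :=
        Real.exp_le_exp.mpr (by gcongr; exact le_abs_self _)
      have h2 : Real.exp (-(ν.re * s)) ≤ Real.exp (|ν.re| * s) :=
        Real.exp_le_exp.mpr (by rw [← neg_mul]; gcongr; exact neg_le_abs _)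
      linarith
    rw [hre, abs_mul, abs_of_nonneg hs] at hc
    have hsh : |Real.sinh s| ≤ Real.exp s := by
      rw [abs_of_nonneg (Real.sinh_nonneg_iff.mpr hs)]
      have := Real.cosh_add_sinh s
      have := Real.cosh_pos s
      linarith
    have he : Real.exp (-t * Real.cosh s) ≤ Real.exp (-(t / 2) * s ^ 2) := by
      refine Real.exp_le_exp.mpr ?_
      have := one_add_half_sq_le_cosh s
      nlinarith
    have h1s : 1 ≤ Real.exp s := Real.one_le_exp hs
    simp only [hΦ, hE, norm_mul, Complex.norm_real, Real.norm_eq_abs, Real.abs_exp]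
    calc _ ≤ Real.exp (-(t / 2) * s ^ 2) *
          (t * Real.exp s * Real.exp (|ν.re| * s) + ‖ν‖ * (Real.exp s * Real.exp (|ν.re| * s))) := by
          refine mul_le_mul he ?_ (norm_nonneg _) (Real.exp_pos _).le
          refine (norm_sub_le _ _).trans ?_
          rw [norm_neg, norm_mul, norm_mul, norm_mul, Complex.norm_real, Complex.norm_real,
            Real.norm_eq_abs, Real.norm_eq_abs, abs_of_pos ht]
          gcongr
          refine hsn.trans (le_mul_of_one_le_left (Real.exp_pos _).le h1s)
      _ = _ := by
          rw [Real.exp_add, show (1 + |ν.re|) * s = s + |ν.re| * s by ring, Real.exp_add]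
          ring
  have h := integral_Ioi_of_hasDerivAt_of_tendsto' hd hi hlim
  have hΦ0 : Φ 0 = 0 := by simp [hΦ]
  rw [hΦ0, sub_zero, integral_sub, integral_sub, integral_const_mul, integral_const_mul,
    integral_const_mul] at h
  · exact h
  · exact (hint 2).const_mul _
  · exact (hint 1).const_mul _
  · exact ((hint 2).const_mul _).sub ((hint 1).const_mul _)
  · exact (hint 0).const_mul _

lemma tendsto_mul_cosh_sub_one (x : ℝ) :
    Tendsto (fun r : ℝ => r ^ 2 * (Real.cosh (r⁻¹ * x) - 1)) atTop (𝓝 (x ^ 2 / 2)) := by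
  have h1 : Tendsto (fun r : ℝ => r * Real.sinh (r⁻¹ * (x / 2))) atTop (𝓝 (x / 2)) := by
    have hd : HasDerivAt (fun h : ℝ => Real.sinh (h * (x / 2))) (x / 2) 0 := by
      have := (Real.hasDerivAt_sinh (0 * (x / 2))).comp (0 : ℝ)
        ((hasDerivAt_id (0 : ℝ)).mul_const (x / 2))
      simpa [Function.comp_def] using! this
    have h2 := hasDerivAt_iff_tendsto_slope_zero.mp hd
    have h3 : Tendsto (fun r : ℝ => r⁻¹) atTop (𝓝[≠] 0) :=
      tendsto_inv_atTop_nhdsGT_zero.mono_right (nhdsWithin_mono _ fun y hy => ne_of_gt hy)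
    refine (h2.comp h3).congr fun r => ?_
    simp
  have h4 := (h1.pow 2).const_mul 2
  rw [show 2 * (x / 2) ^ 2 = x ^ 2 / 2 by ring] at h4
  refine h4.congr fun r => ?_
  have h1 := Real.cosh_two_mul (r⁻¹ * (x / 2))
  have h2 := Real.cosh_sq (r⁻¹ * (x / 2))
  rw [show 2 * (r⁻¹ * (x / 2)) = r⁻¹ * x by ring] at h1
  rw [h1, h2]
  ring

/-- Laplace's method. With t = r² and s = x/r, the exponent r²(cosh(x/r) - 1) tends to x²/2 while
the other factors tend to 1, so the limit is a half-line Gaussian integral whatever j is. -/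
lemma tendsto_besselMoment (ν : ℂ) (j : ℕ) :
    Tendsto (fun t : ℝ => (Real.sqrt t * Real.exp t : ℝ) * besselMoment ν j t) atTop
      (𝓝 (Real.sqrt (Real.pi / 2) : ℝ)) := by
  have key : Tendsto (fun r : ℝ => ∫ x in Set.Ioi (0 : ℝ),
      (Real.exp (r ^ 2) : ℂ) * besselIntegrand ν j (r ^ 2) (r⁻¹ * x)) atTop
      (𝓝 (∫ x in Set.Ioi (0 : ℝ), ((Real.exp (-(1 / 2) * x ^ 2) : ℝ) : ℂ))) := by
    refine tendsto_integral_filter_of_dominated_convergence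
      (fun x => Real.exp (-(1 / 2) * x ^ 2 + (j + |ν.re|) * x)) ?_ ?_
      (integrable_exp_quadratic (by norm_num) _).integrableOn ?_
    · refine Eventually.of_forall fun r => Continuous.aestronglyMeasurable ?_
      have := (continuous_besselIntegrand ν j (r ^ 2)).comp (continuous_const_mul r⁻¹)
      exact continuous_const.mul this
    · filter_upwards [eventually_ge_atTop 1] with r hr
      refine (ae_restrict_iff' measurableSet_Ioi).mpr (ae_of_all _ fun x hx => ?_)
      have hx' : (0 : ℝ) < x := hx
      have hr0 : 0 < r := by linarith
      rw [norm_mul, Complex.norm_real, Real.norm_eq_abs, Real.abs_exp]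
      have h1 := norm_besselIntegrand_le' ν j (le_refl (r ^ 2)) (s := r⁻¹ * x) (by positivity)
      refine (mul_le_mul_of_nonneg_left h1 (Real.exp_pos _).le).trans ?_
      rw [← Real.exp_add, ← Real.exp_add]
      refine Real.exp_le_exp.mpr ?_
      have h2 := one_add_half_sq_le_cosh (r⁻¹ * x)
      have h3 : r ^ 2 * (r⁻¹ * x) ^ 2 = x ^ 2 := by field_simp
      have h4 : r⁻¹ * x ≤ x := mul_le_of_le_one_left hx'.le (inv_le_one_of_one_le₀ hr)
      have h5 : (j + |ν.re|) * (r⁻¹ * x) ≤ (j + |ν.re|) * x := by gcongr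
      nlinarith [sq_nonneg r]
    · refine ae_of_all _ fun x => ?_
      have hinv : Tendsto (fun r : ℝ => r⁻¹ * x) atTop (𝓝 0) := by
        simpa using tendsto_inv_atTop_zero.mul_const x
      have h1 : Tendsto (fun r : ℝ => ((Real.cosh (r⁻¹ * x) : ℝ) : ℂ) ^ j) atTop (𝓝 1) := by
        have := (((Complex.continuous_ofReal.comp Real.continuous_cosh).pow j).tendsto 0).comp hinv
        simpa [Function.comp_def] using! this
      have h2 : Tendsto (fun r : ℝ => Complex.cosh (ν * ((r⁻¹ * x : ℝ) : ℂ))) atTop (𝓝 1) := by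
        have hc : Continuous fun s : ℝ => Complex.cosh (ν * s) :=
          Complex.continuous_cosh.comp (by fun_prop)
        have := (hc.tendsto 0).comp hinv
        simpa [Function.comp_def] using! this
      have h3 : Tendsto (fun r : ℝ => ((Real.exp (-(r ^ 2 * (Real.cosh (r⁻¹ * x) - 1))) : ℝ) : ℂ))
          atTop (𝓝 ((Real.exp (-(x ^ 2 / 2)) : ℝ) : ℂ)) :=
        (((Complex.continuous_ofReal.comp Real.continuous_exp).tendsto _).comp
          (tendsto_mul_cosh_sub_one x).neg)
      have h4 := (h3.mul h1).mul h2
      rw [mul_one, mul_one] at h4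
      have h5 : -(1 / 2) * x ^ 2 = -(x ^ 2 / 2) := by ring
      rw [h5]
      refine h4.congr fun r => ?_
      simp only [besselIntegrand]
      rw [← mul_assoc, ← mul_assoc, ← Complex.ofReal_mul, ← Real.exp_add]
      congr 4
      ring
  have hval : (∫ x in Set.Ioi (0 : ℝ), ((Real.exp (-(1 / 2) * x ^ 2) : ℝ) : ℂ)) =
      ((Real.sqrt (Real.pi / 2) : ℝ) : ℂ) := by
    rw [integral_complex_ofReal, integral_gaussian_Ioi]
    congr 1
    rw [show Real.pi / (1 / 2) = 2 ^ 2 * (Real.pi / 2) by ring, Real.sqrt_mul (by norm_num),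
      Real.sqrt_sq (by norm_num)]
    ring
  rw [hval] at key
  refine (key.comp Real.tendsto_sqrt_atTop).congr' ?_
  filter_upwards [eventually_gt_atTop 0] with t ht
  have hr : 0 < Real.sqrt t := Real.sqrt_pos.mpr ht
  simp only [Function.comp_apply]
  rw [integral_const_mul, Real.sq_sqrt ht.le,
    integral_comp_mul_left_Ioi (besselIntegrand ν j t) 0 (inv_pos.mpr hr), mul_zero, inv_inv,
    Complex.real_smul, besselMoment]
  push_cast
  ring

/-- The function `√t K_ν(t)`. -/
def besselW (ν : ℂ) (t : ℝ) : ℂ := Real.sqrt t * besselK ν t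

/-- The derivative of `√t K_ν(t)`. -/
def besselW' (ν : ℂ) (t : ℝ) : ℂ :=
  besselMoment ν 0 t / (2 * Real.sqrt t) - Real.sqrt t * besselMoment ν 1 t

lemma hasDerivAt_besselW (ν : ℂ) {t : ℝ} (ht : 0 < t) :
    HasDerivAt (besselW ν) (besselW' ν t) t := by
  have h1 := (Real.hasDerivAt_sqrt ht.ne').ofReal_comp
  have h2 := h1.mul (hasDerivAt_besselMoment ν 0 ht)
  have h3 : besselW ν = (fun t : ℝ => ((Real.sqrt t : ℝ) : ℂ)) * besselMoment ν 0 := by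
    funext t
    simp [besselW, besselK_eq]
  rw [h3]
  convert! h2 using 1
  simp only [besselW']
  push_cast
  ring

/-- The factor √t removes the first order term of the Bessel equation, which leaves the ordinary
differential equation satisfied by the vertical part of a separated eigenfunction. -/
lemma hasDerivAt_besselW' (ν : ℂ) {t : ℝ} (ht : 0 < t) :
    HasDerivAt (besselW' ν) ((1 + (ν ^ 2 - 1 / 4) / (t : ℂ) ^ 2) * besselW ν t) t := by
  have hr : 0 < Real.sqrt t := Real.sqrt_pos.mpr ht
  have hr' : ((Real.sqrt t : ℝ) : ℂ) ≠ 0 := by exact_mod_cast hr.ne'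
  have h1 := (Real.hasDerivAt_sqrt ht.ne').ofReal_comp
  have h2 := ((hasDerivAt_besselMoment ν 0 ht).div (h1.const_mul 2) (by simpa using hr')).sub
    (h1.mul (hasDerivAt_besselMoment ν 1 ht))
  convert! h2 using 1
  have hode := besselMoment_ode ν ht
  have hsq : (t : ℂ) = (Real.sqrt t : ℂ) ^ 2 := by exact_mod_cast (Real.sq_sqrt ht.le).symm
  simp only [besselW, besselK_eq]
  rw [hsq] at hode ⊢
  push_cast
  set r : ℂ := (Real.sqrt t : ℂ)
  field_simp
  linear_combination (-16) * hode

lemma exists_norm_besselW_le (ν : ℂ) {t₀ : ℝ} (h₀ : 0 < t₀) :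
    ∃ C, 0 ≤ C ∧ ∀ t, t₀ ≤ t → ‖besselW ν t‖ ≤ C * Real.sqrt t * Real.exp (-t) ∧
      ‖besselW' ν t‖ ≤ C * Real.sqrt t * Real.exp (-t) := by
  obtain ⟨C, hC, h⟩ := exists_norm_besselMoment_le ν 0 h₀
  obtain ⟨D, hD, h'⟩ := exists_norm_besselMoment_le ν 1 h₀
  refine ⟨C + C / t₀ + D, by positivity, fun t ht => ?_⟩
  have ht0 : 0 < t := h₀.trans_le ht
  have hr : 0 < Real.sqrt t := Real.sqrt_pos.mpr ht0
  have he := Real.exp_pos (-t)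
  constructor
  · rw [besselW, besselK_eq, norm_mul, Complex.norm_real, Real.norm_eq_abs, abs_of_pos hr]
    calc _ ≤ Real.sqrt t * (C * Real.exp (-t)) := by gcongr; exact h t ht
      _ = C * Real.sqrt t * Real.exp (-t) := by ring
      _ ≤ _ := by
        have : 0 ≤ C / t₀ := by positivity
        gcongr
        linarith
  · have h1 : ‖besselMoment ν 0 t / (2 * Real.sqrt t)‖ ≤ C / t₀ * Real.sqrt t * Real.exp (-t) := by
      rw [norm_div, norm_mul, Complex.norm_real, Real.norm_eq_abs, abs_of_pos hr,
        Complex.norm_two, div_le_iff₀ (by positivity)]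
      refine (h t ht).trans ?_
      have h2 : Real.sqrt t * Real.sqrt t = t := Real.mul_self_sqrt ht0.le
      have h3 : 1 ≤ t / t₀ := (one_le_div h₀).mpr ht
      calc C * Real.exp (-t) ≤ (C * Real.exp (-t)) * (2 * (t / t₀)) :=
            le_mul_of_one_le_right (by positivity) (by linarith)
        _ = C / t₀ * (Real.sqrt t * Real.sqrt t) * Real.exp (-t) * 2 := by rw [h2]; ring
        _ = _ := by ring
    have h2 : ‖(Real.sqrt t : ℂ) * besselMoment ν 1 t‖ ≤ D * Real.sqrt t * Real.exp (-t) := by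
      rw [norm_mul, Complex.norm_real, Real.norm_eq_abs, abs_of_pos hr]
      calc _ ≤ Real.sqrt t * (D * Real.exp (-t)) := by gcongr; exact h' t ht
        _ = _ := by ring
    rw [besselW']
    refine (norm_sub_le _ _).trans ((add_le_add h1 h2).trans ?_)
    have : 0 ≤ C * Real.sqrt t * Real.exp (-t) := by positivity
    nlinarith

lemma tendsto_besselW (ν : ℂ) :
    Tendsto (fun t : ℝ => (Real.exp t : ℂ) * besselW ν t) atTop
      (𝓝 (Real.sqrt (Real.pi / 2) : ℝ)) := by
  refine (tendsto_besselMoment ν 0).congr fun t => ?_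
  rw [besselW, besselK_eq]
  push_cast
  ring

lemma tendsto_besselW' (ν : ℂ) :
    Tendsto (fun t : ℝ => (Real.exp t : ℂ) * besselW' ν t) atTop
      (𝓝 (-(Real.sqrt (Real.pi / 2) : ℝ))) := by
  have h1 : Tendsto (fun t : ℝ => ((t⁻¹ : ℝ) : ℂ)) atTop (𝓝 0) := by
    have := (Complex.continuous_ofReal.tendsto 0).comp tendsto_inv_atTop_zero
    simpa [Function.comp_def] using! this
  have h2 := (((tendsto_besselMoment ν 0).mul h1).div_const 2).sub (tendsto_besselMoment ν 1)
  simp only [mul_zero, zero_div, zero_sub] at h2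
  refine h2.congr' ?_
  filter_upwards [eventually_gt_atTop 0] with t ht
  have hr : 0 < Real.sqrt t := Real.sqrt_pos.mpr ht
  have hr' : ((Real.sqrt t : ℝ) : ℂ) ≠ 0 := by exact_mod_cast hr.ne'
  have hsq : (t : ℂ) = (Real.sqrt t : ℂ) ^ 2 := by exact_mod_cast (Real.sq_sqrt ht.le).symm
  rw [besselW']
  push_cast
  rw [hsq]
  field_simp

/-- From some point on, `√t K_ν(t)` is at least a multiple of `e^{-t}`. -/
lemma exists_le_norm_besselW (ν : ℂ) :
    ∃ t₁ > 0, ∃ c > 0, ∀ t, t₁ ≤ t → c * Real.exp (-t) ≤ ‖besselW ν t‖ := by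
  have hp : 0 < Real.sqrt (Real.pi / 2) := Real.sqrt_pos.mpr (by positivity)
  have h := (tendsto_besselW ν).norm
  rw [Complex.norm_real, Real.norm_eq_abs, abs_of_pos hp] at h
  obtain ⟨t₁, ht₁⟩ := eventually_atTop.mp (h.eventually_const_lt (half_lt_self hp))
  refine ⟨max t₁ 1, by positivity, Real.sqrt (Real.pi / 2) / 2, by positivity, fun t ht => ?_⟩
  have h1 := ht₁ t ((le_max_left _ _).trans ht)
  rw [norm_mul, Complex.norm_real, Real.norm_eq_abs, Real.abs_exp] at h1
  rw [Real.exp_neg, ← div_eq_mul_inv, div_le_iff₀ (Real.exp_pos t)]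
  linarith

end

end HigherOrderLewis

namespace HigherOrderLewis

noncomputable section

/-! ### Closed one-forms on a slit half plane -/

/-- The upper half plane with the vertical half line above `ζ` removed. -/
def slitHalf (ζ : ℂ) : Set ℂ := {z | 0 < z.im ∧ (z.re = ζ.re → z.im < ζ.im)}

/-- Two primitives of one form differ by a constant on the connected intersection. Shifting the
second by the difference at `p` makes them match. -/
lemma exists_primitive_union {ω : ℂ → ℂ →L[ℝ] ℂ} {U V : Set ℂ} (hU : IsOpen U) (hV : IsOpen V)
    (hUV : Convex ℝ (U ∩ V)) {p : ℂ} (hp : p ∈ U ∩ V)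
    (h₁ : ∃ W : ℂ → ℂ, ∀ z ∈ U, HasFDerivAt W (ω z) z)
    (h₂ : ∃ W : ℂ → ℂ, ∀ z ∈ V, HasFDerivAt W (ω z) z) :
    ∃ W : ℂ → ℂ, ∀ z ∈ U ∪ V, HasFDerivAt W (ω z) z := by
  classical
  obtain ⟨A, hA⟩ := h₁
  obtain ⟨B, hB⟩ := h₂
  have hc : ∀ z ∈ U ∩ V, A z = B z + (A p - B p) := by
    intro z hz
    have hd : ∀ w ∈ U ∩ V, HasFDerivAt (fun w => A w - B w) (0 : ℂ →L[ℝ] ℂ) w := by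
      intro w hw
      have := (hA w hw.1).sub (hB w hw.2)
      rwa [sub_self] at this
    have := (hU.inter hV).is_const_of_fderiv_eq_zero hUV.isPreconnected
      (fun w hw => (hd w hw).differentiableAt.differentiableWithinAt)
      (fun w hw => (hd w hw).fderiv) hz hp
    linear_combination this
  refine ⟨fun z => if z ∈ U then A z else B z + (A p - B p), fun z hz => ?_⟩
  by_cases hzU : z ∈ U
  · refine (hA z hzU).congr_of_eventuallyEq ?_
    filter_upwards [hU.mem_nhds hzU] with w hw
    rw [if_pos hw]
  · have hzV : z ∈ V := hz.resolve_left hzU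
    refine ((hB z hzV).add_const (A p - B p)).congr_of_eventuallyEq ?_
    filter_upwards [hV.mem_nhds hzV] with w hw
    by_cases hwU : w ∈ U
    · rw [if_pos hwU, hc w ⟨hwU, hw⟩]
    · rw [if_neg hwU]

/-- The Poincaré lemma. By bilinearity, symmetry of the derivative need only be known on the basis
vectors 1 and i. -/
lemma exists_primitive_of_convex {ω : ℂ → ℂ →L[ℝ] ℂ} {D : Set ℂ} (hD : Convex ℝ D)
    (hDo : IsOpen D) (hω : ∀ z ∈ D, DifferentiableAt ℝ ω z)
    (hs : ∀ z ∈ D, fderiv ℝ ω z 1 Complex.I = fderiv ℝ ω z Complex.I 1) :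
    ∃ W : ℂ → ℂ, ∀ z ∈ D, HasFDerivAt W (ω z) z := by
  refine hD.exists_forall_hasFDerivAt_of_fderiv_symmetric hDo
    (fun z hz => (hω z hz).differentiableWithinAt) fun a ha x y => ?_
  have hx : x = x.re • (1 : ℂ) + x.im • Complex.I := by simp
  have hy : y = y.re • (1 : ℂ) + y.im • Complex.I := by simp
  rw [hx, hy]
  simp only [map_add, map_smul, add_apply, smul_apply,
    smul_add, hs a ha, smul_smul]
  rw [mul_comm x.re y.re, mul_comm x.re y.im, mul_comm x.im y.re, mul_comm x.im y.im]
  abel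

/-- The slit half plane is not convex, but it is the union of the strip below the height of ζ and
the two quarter planes beside the slit. The quarter planes are disjoint, so both gluings take place
over convex intersections. -/
lemma exists_primitive {ζ : ℂ} (hζ : 0 < ζ.im) {ω : ℂ → ℂ →L[ℝ] ℂ}
    (hω : ∀ z ∈ slitHalf ζ, DifferentiableAt ℝ ω z)
    (hs : ∀ z ∈ slitHalf ζ, fderiv ℝ ω z 1 Complex.I = fderiv ℝ ω z Complex.I 1) :
    ∃ W : ℂ → ℂ, ∀ z ∈ slitHalf ζ, HasFDerivAt W (ω z) z := by
  set P : Set ℂ := {z | 0 < z.im} with hP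
  set B : Set ℂ := P ∩ {z | z.im < ζ.im} with hB
  set L : Set ℂ := P ∩ {z | z.re < ζ.re} with hL
  set R : Set ℂ := P ∩ {z | ζ.re < z.re} with hR
  have cP : Convex ℝ P := convex_halfSpace_im_gt 0
  have oP : IsOpen P := isOpen_im_pos
  have cB : Convex ℝ B := cP.inter (convex_halfSpace_im_lt _)
  have cL : Convex ℝ L := cP.inter (convex_halfSpace_re_lt _)
  have cR : Convex ℝ R := cP.inter (convex_halfSpace_re_gt _)
  have oB : IsOpen B := oP.inter (isOpen_lt Complex.continuous_im continuous_const)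
  have oL : IsOpen L := oP.inter (isOpen_lt Complex.continuous_re continuous_const)
  have oR : IsOpen R := oP.inter (isOpen_lt continuous_const Complex.continuous_re)
  have sB : B ⊆ slitHalf ζ := fun z hz => ⟨hz.1, fun _ => hz.2⟩
  have sL : L ⊆ slitHalf ζ := fun z hz => ⟨hz.1, fun h => absurd h (ne_of_lt hz.2)⟩
  have sR : R ⊆ slitHalf ζ := fun z hz => ⟨hz.1, fun h => absurd h (ne_of_gt hz.2)⟩
  have pr : ∀ D : Set ℂ, Convex ℝ D → IsOpen D → D ⊆ slitHalf ζ →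
      ∃ W : ℂ → ℂ, ∀ z ∈ D, HasFDerivAt W (ω z) z := fun D c o h =>
    exists_primitive_of_convex c o (fun z hz => hω z (h hz)) fun z hz => hs z (h hz)
  have h1 := exists_primitive_union oB oL (cB.inter cL)
    (p := ⟨ζ.re - 1, ζ.im / 2⟩) ⟨⟨by simp [hP, hζ], by simp [hζ]⟩,
      ⟨by simp [hP, hζ], by simp⟩⟩ (pr B cB oB sB) (pr L cL oL sL)
  have hint : (B ∪ L) ∩ R = B ∩ R := by
    ext z
    constructor
    · rintro ⟨h | h, h'⟩
      · exact ⟨h, h'⟩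
      · exact absurd (lt_trans (Set.mem_ofPred.mp h.2) (Set.mem_ofPred.mp h'.2)) (lt_irrefl _)
    · rintro ⟨h, h'⟩
      exact ⟨Or.inl h, h'⟩
  obtain ⟨W, hW⟩ := exists_primitive_union (oB.union oL) oR (hint ▸ cB.inter cR)
    (p := ⟨ζ.re + 1, ζ.im / 2⟩) (by
      rw [hint]
      exact ⟨⟨by simp [hP, hζ], by simp [hζ]⟩, ⟨by simp [hP, hζ], by simp⟩⟩) h1 (pr R cR oR sR)
  refine ⟨W, fun z hz => hW z ?_⟩
  rcases lt_trichotomy z.re ζ.re with h | h | h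
  · exact Or.inl (Or.inr ⟨hz.1, h⟩)
  · exact Or.inl (Or.inl ⟨hz.1, hz.2 h⟩)
  · exact Or.inr ⟨hz.1, h⟩

/-- A primitive of an exponentially decreasing form has a limit at `i∞`. -/
lemma exists_limit_of_decay {ω : ℂ → ℂ →L[ℝ] ℂ} {W : ℂ → ℂ} {Q : Set ℂ} (hQ : Convex ℝ Q)
    (hW : ∀ z ∈ Q, HasFDerivAt W (ω z) z) {M ε Y x₀ : ℝ} (hε : 0 < ε)
    (hb : ∀ z ∈ Q, ‖ω z‖ ≤ M * Real.exp (-ε * z.im))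
    (hx₀ : ∀ y, Y ≤ y → (⟨x₀, y⟩ : ℂ) ∈ Q) :
    ∃ w, ∀ (l : Filter ℝ) (z : ℝ → ℂ), (∀ᶠ t in l, z t ∈ Q) →
      Tendsto (fun t => (z t).im) l atTop →
      Tendsto (fun t => |(z t).re| * Real.exp (-ε * (z t).im)) l (𝓝 0) →
      Tendsto (fun t => W (z t)) l (𝓝 w) := by
  set f : ℝ → ℂ := fun y => W ⟨x₀, y⟩ with hf
  have hd : ∀ y, Y ≤ y → HasDerivAt f (ω ⟨x₀, y⟩ Complex.I) y := by
    intro y hy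
    have h1 : HasDerivAt (fun y : ℝ => (⟨x₀, y⟩ : ℂ)) Complex.I y := by
      have h2 : HasDerivAt (fun y : ℝ => (x₀ : ℂ) + (y : ℂ) * Complex.I) Complex.I y := by
        simpa using ((Complex.ofRealCLM.hasDerivAt (x := y)).mul_const Complex.I).const_add (x₀ : ℂ)
      refine h2.congr_of_eventuallyEq (Eventually.of_forall fun y => ?_)
      apply Complex.ext <;> simp
    exact (hW _ (hx₀ y hy)).comp_hasDerivAt y h1
  have hexp : IntegrableOn (fun y : ℝ => M * Real.exp (-ε * y)) (Set.Ioi Y) :=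
    (integrableOn_exp_mul_Ioi (by linarith) Y).const_mul M
  have hint : IntegrableOn (fun y : ℝ => ω ⟨x₀, y⟩ Complex.I) (Set.Ioi Y) := by
    refine hexp.mono' ?_ ?_
    · have := aestronglyMeasurable_deriv f (volume.restrict (Set.Ioi Y))
      refine this.congr ((ae_restrict_iff' measurableSet_Ioi).mpr (ae_of_all _ fun y hy => ?_))
      exact (hd y (le_of_lt hy)).deriv
    · refine (ae_restrict_iff' measurableSet_Ioi).mpr (ae_of_all _ fun y hy => ?_)
      refine ((ω ⟨x₀, y⟩).le_opNorm _).trans ?_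
      rw [Complex.norm_I, mul_one]
      exact hb _ (hx₀ y (le_of_lt hy))
  have hlim := tendsto_limUnder_of_hasDerivAt_of_integrableOn_Ioi
    (fun y hy => hd y (le_of_lt hy)) hint
  refine ⟨limUnder atTop f, fun l z hzQ him hre => ?_⟩
  have h1 : Tendsto (fun t => f (z t).im) l (𝓝 (limUnder atTop f)) := hlim.comp him
  -- Compare with the vertical line at the same height. The horizontal segment between the two
  -- points lies in the convex set `Q`, and along it the form is at most M e^{-εy}, so the
  -- difference is at most this times |Re z| + |x₀|.
  have h2 : Tendsto (fun t => W (z t) - f (z t).im) l (𝓝 0) := by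
    have h3 : Tendsto (fun t => M * (|(z t).re| * Real.exp (-ε * (z t).im) +
        |x₀| * Real.exp (-ε * (z t).im))) l (𝓝 (M * (0 + |x₀| * 0))) := by
      refine (hre.add (Tendsto.const_mul _ (Real.tendsto_exp_atBot.comp ?_))).const_mul _
      exact him.const_mul_atTop_of_neg (by linarith)
    rw [mul_zero, add_zero, mul_zero] at h3
    refine squeeze_zero_norm' ?_ h3
    filter_upwards [hzQ, him.eventually_ge_atTop Y] with t ht hY
    have hc : Convex ℝ (Q ∩ {w | w.im = (z t).im}) :=
      hQ.inter (convex_hyperplane Complex.imLm.isLinear _)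
    have h4 := hc.norm_image_sub_le_of_norm_hasFDerivWithin_le (f := W) (f' := ω)
      (C := M * Real.exp (-ε * (z t).im)) (x := ⟨x₀, (z t).im⟩) (y := z t)
      (fun w hw => (hW w hw.1).hasFDerivWithinAt) (fun w hw => by
        have := hb w hw.1
        rwa [hw.2] at this) ⟨hx₀ _ hY, rfl⟩ ⟨ht, rfl⟩
    refine h4.trans ?_
    have h5 : ‖z t - ⟨x₀, (z t).im⟩‖ ≤ |(z t).re| + |x₀| := by
      have : z t - ⟨x₀, (z t).im⟩ = (((z t).re - x₀ : ℝ) : ℂ) := by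
        apply Complex.ext <;> simp
      rw [this, Complex.norm_real, Real.norm_eq_abs]
      exact abs_sub _ _
    have h6 : 0 ≤ M * Real.exp (-ε * (z t).im) := (norm_nonneg _).trans (hb _ ht)
    calc _ ≤ M * Real.exp (-ε * (z t).im) * (|(z t).re| + |x₀|) := by gcongr
      _ = _ := by ring
  have := h1.add h2
  simpa using this

/-! ### Parabolic contours. -/

/-- The parabola `p - i r (1 + it)²`. -/
def parabola (p : ℂ) (r t : ℝ) : ℂ := p - r * Complex.I * (1 + t * Complex.I) ^ 2

/-- The velocity of the parabola. -/
def parabola' (r t : ℝ) : ℂ := 2 * r * (1 + t * Complex.I)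

lemma parabola_re (p : ℂ) (r t : ℝ) : (parabola p r t).re = p.re + 2 * r * t := by
  simp [parabola, pow_two]
  ring

/-- The height is quadratic in t and the abscissa linear, so exponential decay at i∞ becomes
Gaussian decay along the contour. The lowest point is p - ir. -/
lemma parabola_im (p : ℂ) (r t : ℝ) : (parabola p r t).im = p.im + r * (t ^ 2 - 1) := by
  simp [parabola, pow_two]
  ring

lemma hasDerivAt_parabola (p : ℂ) (r t : ℝ) :
    HasDerivAt (parabola p r) (parabola' r t) t := by
  have h0 : HasDerivAt (fun t : ℝ => (1 : ℂ) + (t : ℂ) * Complex.I) Complex.I t := by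
    simpa using ((Complex.ofRealCLM.hasDerivAt (x := t)).mul_const Complex.I).const_add (1 : ℂ)
  have h1 := ((h0.pow 2).const_mul (r * Complex.I : ℂ)).const_sub p
  convert! h1 using 1
  simp only [parabola']
  push_cast
  linear_combination (2 * r * (1 + t * Complex.I)) * Complex.I_sq

lemma norm_one_add_mul_I_le (t : ℝ) : ‖(1 : ℂ) + t * Complex.I‖ ≤ 1 + |t| := by
  refine (norm_add_le _ _).trans ?_
  simp

lemma norm_parabola'_le {r : ℝ} (hr : 0 ≤ r) (t : ℝ) : ‖parabola' r t‖ ≤ 2 * r * (1 + |t|) := by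
  rw [parabola', norm_mul, norm_mul, Complex.norm_two, Complex.norm_real, Real.norm_eq_abs,
    abs_of_nonneg hr]
  have := norm_one_add_mul_I_le t
  gcongr

lemma continuous_parabola (p : ℂ) (r : ℝ) : Continuous (parabola p r) := by
  unfold parabola
  fun_prop

lemma continuous_parabola' (r : ℝ) : Continuous (parabola' r) := by
  unfold parabola'
  fun_prop

lemma tendsto_exp_neg_sq {b : ℝ} (hb : 0 < b) (c d : ℝ) :
    Tendsto (fun t : ℝ => |c + d * t| * Real.exp (-b * t ^ 2)) (cocompact ℝ) (𝓝 0) := by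
  have h := (tendsto_rpow_abs_mul_exp_neg_mul_sq_cocompact hb 1).const_mul |d|
  have h0 := (tendsto_rpow_abs_mul_exp_neg_mul_sq_cocompact hb 0).const_mul |c|
  have := h0.add h
  simp only [mul_zero, add_zero] at this
  refine squeeze_zero (fun t => by positivity) (fun t => ?_) this
  simp only [Real.rpow_zero, Real.rpow_one, one_mul]
  have h3 := abs_add_le c (d * t)
  rw [abs_mul d t] at h3
  nlinarith [Real.exp_pos (-b * t ^ 2)]

/-- A closed form on the slit half plane, exponentially decreasing at `i∞`, has a primitive with
limits at both sides of the slit. -/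
lemma exists_primitive_ends {ζ : ℂ} (hζ : 0 < ζ.im) {ω : ℂ → ℂ →L[ℝ] ℂ}
    (hω : ∀ z ∈ slitHalf ζ, DifferentiableAt ℝ ω z)
    (hs : ∀ z ∈ slitHalf ζ, fderiv ℝ ω z 1 Complex.I = fderiv ℝ ω z Complex.I 1)
    {M ε : ℝ} (hε : 0 < ε) (hb : ∀ z : ℂ, ζ.im + 1 ≤ z.im → 1 ≤ |z.re - ζ.re| →
      ‖ω z‖ ≤ M * Real.exp (-ε * z.im)) :
    ∃ (W : ℂ → ℂ) (wL wR : ℂ), (∀ z ∈ slitHalf ζ, HasFDerivAt W (ω z) z) ∧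
      (∀ (l : Filter ℝ) (z : ℝ → ℂ), (∀ᶠ t in l, (z t).re ≤ ζ.re - 1) →
        Tendsto (fun t => (z t).im) l atTop →
        Tendsto (fun t => |(z t).re| * Real.exp (-ε * (z t).im)) l (𝓝 0) →
        Tendsto (fun t => W (z t)) l (𝓝 wL)) ∧
      (∀ (l : Filter ℝ) (z : ℝ → ℂ), (∀ᶠ t in l, ζ.re + 1 ≤ (z t).re) →
        Tendsto (fun t => (z t).im) l atTop →
        Tendsto (fun t => |(z t).re| * Real.exp (-ε * (z t).im)) l (𝓝 0) →
        Tendsto (fun t => W (z t)) l (𝓝 wR)) := by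
  obtain ⟨W, hW⟩ := exists_primitive hζ hω hs
  have cI : Convex ℝ {z : ℂ | ζ.im + 1 ≤ z.im} := convex_halfSpace_im_ge _
  obtain ⟨wL, hL⟩ := exists_limit_of_decay (ω := ω) (W := W)
    (Q := {z : ℂ | ζ.im + 1 ≤ z.im} ∩ {z | z.re ≤ ζ.re - 1}) (x₀ := ζ.re - 1) (Y := ζ.im + 1)
    (M := M) (cI.inter (convex_halfSpace_re_le _)) (fun z hz => hW z ⟨by
      have := hz.1
      simp only [Set.mem_ofPred_eq] at this
      linarith, fun h => by
      have := hz.2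
      simp only [Set.mem_ofPred_eq] at this
      linarith⟩) hε (fun z hz => hb z hz.1 (by
      have := hz.2
      simp only [Set.mem_ofPred_eq] at this
      rw [le_abs]
      right
      linarith)) (fun y hy => ⟨hy, by simp⟩)
  obtain ⟨wR, hR⟩ := exists_limit_of_decay (ω := ω) (W := W)
    (Q := {z : ℂ | ζ.im + 1 ≤ z.im} ∩ {z | ζ.re + 1 ≤ z.re}) (x₀ := ζ.re + 1) (Y := ζ.im + 1)
    (M := M) (cI.inter (convex_halfSpace_re_ge _)) (fun z hz => hW z ⟨by
      have := hz.1
      simp only [Set.mem_ofPred_eq] at this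
      linarith, fun h => by
      have := hz.2
      simp only [Set.mem_ofPred_eq] at this
      linarith⟩) hε (fun z hz => hb z hz.1 (by
      have := hz.2
      simp only [Set.mem_ofPred_eq] at this
      rw [le_abs]
      left
      linarith)) (fun y hy => ⟨hy, by simp⟩)
  refine ⟨W, wL, wR, hW, fun l z h1 h2 h3 => hL l z ?_ h2 h3, fun l z h1 h2 h3 => hR l z ?_ h2 h3⟩
  · filter_upwards [h1, h2.eventually_ge_atTop (ζ.im + 1)] with t a b using ⟨b, a⟩
  · filter_upwards [h1, h2.eventually_ge_atTop (ζ.im + 1)] with t a b using ⟨b, a⟩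

lemma tendsto_parabola_im (p : ℂ) {r : ℝ} (hr : 0 < r) {l : Filter ℝ}
    (hl : Tendsto (fun t : ℝ => |t|) l atTop) :
    Tendsto (fun t => (parabola p r t).im) l atTop := by
  have h : Tendsto (fun t : ℝ => t ^ 2) l atTop := by
    refine ((tendsto_pow_atTop two_ne_zero).comp hl).congr fun t => ?_
    simp
  simp_rw [parabola_im]
  refine tendsto_atTop_add_const_left _ _ (Tendsto.const_mul_atTop hr ?_)
  exact tendsto_atTop_add_const_right _ _ h

lemma tendsto_parabola_re_mul (p : ℂ) {r ε : ℝ} (hr : 0 < r) (hε : 0 < ε) :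
    Tendsto (fun t => |(parabola p r t).re| * Real.exp (-ε * (parabola p r t).im))
      (cocompact ℝ) (𝓝 0) := by
  have h := (tendsto_exp_neg_sq (mul_pos hε hr) p.re (2 * r)).mul_const
    (Real.exp (-ε * (p.im - r)))
  rw [zero_mul] at h
  refine h.congr fun t => ?_
  rw [parabola_re, parabola_im, mul_assoc, ← Real.exp_add]
  congr 2
  ring

lemma integrable_abs_mul_exp_neg_sq {b : ℝ} (hb : 0 < b) :
    Integrable fun t : ℝ => (1 + |t|) * Real.exp (-b * t ^ 2) := by
  have h1 := integrable_exp_neg_mul_sq hb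
  have h2 := (integrable_mul_exp_neg_mul_sq hb).norm
  refine (h1.add h2).congr (ae_of_all _ fun t => ?_)
  simp only [Pi.add_apply, norm_mul, Real.norm_eq_abs, Real.abs_exp]
  ring

/-- The bound on ω is available only high up and away from the slit, that is for |t| large.
Continuity takes care of the remaining compact range of t. -/
lemma integrable_parabola {ζ p : ℂ} {r : ℝ} (hr : 0 < r) {ω : ℂ → ℂ →L[ℝ] ℂ}
    (hω : ContinuousOn ω (slitHalf ζ)) {M ε : ℝ} (hε : 0 < ε)
    (hb : ∀ z : ℂ, ζ.im + 1 ≤ z.im → 1 ≤ |z.re - ζ.re| → ‖ω z‖ ≤ M * Real.exp (-ε * z.im))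
    (hp : ∀ t, parabola p r t ∈ slitHalf ζ) :
    Integrable fun t => ω (parabola p r t) (parabola' r t) := by
  have hc : Continuous fun t => ω (parabola p r t) (parabola' r t) :=
    (hω.comp_continuous (continuous_parabola p r) hp).clm_apply (continuous_parabola' r)
  have hO : (fun t => ω (parabola p r t) (parabola' r t)) =O[cocompact ℝ]
      fun t : ℝ => (1 + |t|) * Real.exp (-(ε * r) * t ^ 2) := by
    refine Asymptotics.IsBigO.of_bound (|M| * Real.exp (-ε * (p.im - r)) * (2 * r)) ?_
    have habs : Tendsto (fun t : ℝ => |t|) (cocompact ℝ) atTop := tendsto_norm_cocompact_atTop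
    have h2 : ∀ᶠ t in cocompact ℝ, 1 ≤ |(parabola p r t).re - ζ.re| := by
      have : Tendsto (fun t : ℝ => 2 * r * |t| - |p.re - ζ.re|) (cocompact ℝ) atTop :=
        tendsto_atTop_add_const_right _ _ (habs.const_mul_atTop (by linarith))
      filter_upwards [this.eventually_ge_atTop 1] with t ht
      rw [parabola_re]
      have h3 := abs_add_le (p.re + 2 * r * t - ζ.re) (-(p.re - ζ.re))
      rw [abs_neg, show p.re + 2 * r * t - ζ.re + -(p.re - ζ.re) = 2 * r * t by ring, abs_mul,
        abs_of_pos (by linarith : (0:ℝ) < 2 * r)] at h3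
      linarith
    filter_upwards [(tendsto_parabola_im p hr habs).eventually_ge_atTop (ζ.im + 1), h2]
      with t h1 h2
    refine ((ω _).le_opNorm _).trans ?_
    rw [Real.norm_of_nonneg (by positivity)]
    calc _ ≤ (|M| * Real.exp (-ε * (parabola p r t).im)) * (2 * r * (1 + |t|)) := by
          refine mul_le_mul ((hb _ h1 h2).trans ?_) (norm_parabola'_le hr.le t) (norm_nonneg _)
            (by positivity)
          gcongr
          exact le_abs_self _
      _ = _ := by
        rw [parabola_im, show -ε * (p.im + r * (t ^ 2 - 1)) = -ε * (p.im - r) + -(ε * r) * t ^ 2 by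
          ring, Real.exp_add]
        ring
  have hI := integrable_abs_mul_exp_neg_sq (mul_pos hε hr)
  refine hc.locallyIntegrable.integrable_of_isBigO_cocompact hO ?_
  exact hI.integrableAtFilter _

/-- The fundamental theorem of calculus. The value involves only the two limits of the primitive,
which gives independence of the parabola. -/
lemma integral_parabola_eq {ζ p : ℂ} {r : ℝ} (hr : 0 < r) {ω : ℂ → ℂ →L[ℝ] ℂ}
    {M ε : ℝ} (hε : 0 < ε) (hω : ContinuousOn ω (slitHalf ζ))
    (hb : ∀ z : ℂ, ζ.im + 1 ≤ z.im → 1 ≤ |z.re - ζ.re| → ‖ω z‖ ≤ M * Real.exp (-ε * z.im))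
    (hp : ∀ t, parabola p r t ∈ slitHalf ζ) {W : ℂ → ℂ} {wL wR : ℂ}
    (hW : ∀ z ∈ slitHalf ζ, HasFDerivAt W (ω z) z)
    (hL : ∀ (l : Filter ℝ) (z : ℝ → ℂ), (∀ᶠ t in l, (z t).re ≤ ζ.re - 1) →
        Tendsto (fun t => (z t).im) l atTop →
        Tendsto (fun t => |(z t).re| * Real.exp (-ε * (z t).im)) l (𝓝 0) →
        Tendsto (fun t => W (z t)) l (𝓝 wL))
    (hR : ∀ (l : Filter ℝ) (z : ℝ → ℂ), (∀ᶠ t in l, ζ.re + 1 ≤ (z t).re) →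
        Tendsto (fun t => (z t).im) l atTop →
        Tendsto (fun t => |(z t).re| * Real.exp (-ε * (z t).im)) l (𝓝 0) →
        Tendsto (fun t => W (z t)) l (𝓝 wR)) :
    ∫ t, ω (parabola p r t) (parabola' r t) = wR - wL := by
  refine integral_of_hasDerivAt_of_tendsto (f := fun t => W (parabola p r t))
    (fun t => (hW _ (hp t)).comp_hasDerivAt t (hasDerivAt_parabola p r t))
    (integrable_parabola hr hω hε hb hp) ?_ ?_
  · refine hL atBot _ ?_ (tendsto_parabola_im p hr tendsto_abs_atBot_atTop)
      ((tendsto_parabola_re_mul p hr hε).mono_left atBot_le_cocompact)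
    have : Tendsto (fun t => (parabola p r t).re) atBot atBot := by
      simp_rw [parabola_re]
      exact tendsto_atBot_add_const_left _ _ (tendsto_id.const_mul_atBot (by linarith))
    exact this.eventually_le_atBot _
  · refine hR atTop _ ?_ (tendsto_parabola_im p hr tendsto_abs_atTop_atTop)
      ((tendsto_parabola_re_mul p hr hε).mono_left atTop_le_cocompact)
    have : Tendsto (fun t => (parabola p r t).re) atTop atTop := by
      simp_rw [parabola_re]
      exact tendsto_atTop_add_const_left _ _ (tendsto_id.const_mul_atTop (by linarith))
    exact this.eventually_ge_atTop _

end

end HigherOrderLewis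

namespace HigherOrderLewis

noncomputable section

/-! ### Holomorphic parameter integrals and a Gaussian integral -/

/-- Cauchy's estimate on small discs turns a majorant of F into a majorant of its ζ-derivative, so
no hypothesis on the derivative is needed. -/
lemma differentiableOn_integral_param {α : Type*} [MeasurableSpace α] {μ : Measure α}
    {F : ℂ → α → ℂ} {U : Set ℂ} (hU : IsOpen U)
    (hm : ∀ ζ ∈ U, AEStronglyMeasurable (F ζ) μ)
    (hd : ∀ᵐ t ∂μ, DifferentiableOn ℂ (fun ζ => F ζ t) U) {bound : α → ℝ}
    (hb : ∀ᵐ t ∂μ, ∀ ζ ∈ U, ‖F ζ t‖ ≤ bound t) (hbi : Integrable bound μ) :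
    DifferentiableOn ℂ (fun ζ => ∫ t, F ζ t ∂μ) U := by
  intro ζ₀ hζ₀
  obtain ⟨ε, hε, hball⟩ := Metric.isOpen_iff.mp hU ζ₀ hζ₀
  have hsub : ∀ ζ ∈ Metric.ball ζ₀ (ε / 2), Metric.closedBall ζ (ε / 3) ⊆ U := by
    intro ζ hζ w hw
    refine hball ?_
    have h1 := dist_triangle w ζ ζ₀
    have h2 := Metric.mem_ball.mp hζ
    have h3 := Metric.mem_closedBall.mp hw
    exact Metric.mem_ball.mpr (by linarith)
  -- The derivative is measurable as a limit of difference quotients along a sequence tending to ζ₀.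
  have hmd : AEStronglyMeasurable (fun t => deriv (fun ζ => F ζ t) ζ₀) μ := by
    have hseq : ∀ n : ℕ, ζ₀ + ((ε / 2 / (n + 1) : ℝ) : ℂ) ∈ U := by
      intro n
      refine hball (Metric.mem_ball.mpr ?_)
      rw [dist_eq_norm, add_sub_cancel_left, Complex.norm_real, Real.norm_eq_abs,
        abs_of_pos (by positivity)]
      calc ε / 2 / (n + 1) ≤ ε / 2 := div_le_self (by positivity) (by linarith [n.cast_nonneg (α := ℝ)])
        _ < ε := by linarith
    refine aestronglyMeasurable_of_tendsto_ae atTop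
      (f := fun (n : ℕ) t => ((ε / 2 / (n + 1) : ℝ) : ℂ)⁻¹ •
        (F (ζ₀ + ((ε / 2 / (n + 1) : ℝ) : ℂ)) t - F ζ₀ t)) (fun n => ?_) ?_
    · exact AEStronglyMeasurable.const_smul (𝕜 := ℂ) ((hm _ (hseq n)).sub (hm _ hζ₀)) _
    · filter_upwards [hd] with t ht
      have h1 := ((ht.differentiableAt (hU.mem_nhds hζ₀)).hasDerivAt).tendsto_slope_zero
      refine h1.comp ?_
      refine tendsto_nhdsWithin_iff.mpr ⟨?_, Eventually.of_forall fun n => ?_⟩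
      · have h2 : Tendsto (fun n : ℕ => ε / 2 / ((n : ℝ) + 1)) atTop (𝓝 0) :=
          tendsto_const_nhds.div_atTop
            (tendsto_atTop_add_const_right _ _ tendsto_natCast_atTop_atTop)
        have := (Complex.continuous_ofReal.tendsto 0).comp h2
        simpa [Function.comp_def] using! this
      · simp only [Set.mem_compl_iff, Set.mem_singleton_iff, Complex.ofReal_eq_zero]
        positivity
  have h := hasDerivAt_integral_of_dominated_loc_of_deriv_le (μ := μ) (F := F) (x₀ := ζ₀)
    (F' := fun ζ t => deriv (fun ζ => F ζ t) ζ) (bound := fun t => bound t / (ε / 3))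
    (s := Metric.ball ζ₀ (ε / 2)) (Metric.ball_mem_nhds _ (by positivity))
    (by filter_upwards [hU.mem_nhds hζ₀] with ζ hζ using hm ζ hζ)
    (hbi.mono' (hm _ hζ₀) (by filter_upwards [hb] with t ht using ht _ hζ₀)) hmd ?_
    (hbi.div_const _) ?_
  · exact h.2.differentiableAt.differentiableWithinAt
  · filter_upwards [hd, hb] with t ht htb ζ hζ
    refine Complex.norm_deriv_le_of_forall_mem_sphere_norm_le (by positivity) ?_ fun w hw =>
      htb w (hsub ζ hζ (Metric.sphere_subset_closedBall hw))
    refine (ht.mono (hsub ζ hζ)).diffContOnCl_ball ?_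
    exact subset_rfl
  · filter_upwards [hd] with t ht ζ hζ
    refine (ht.differentiableAt (hU.mem_nhds ?_)).hasDerivAt
    exact hsub ζ hζ (Metric.mem_closedBall_self (by positivity))

/-- The identity theorem for two functions that agree on a short segment. -/
lemma eqOn_of_eq_on_segment {f g : ℂ → ℂ} {U : Set ℂ} (hU : IsOpen U) (hc : IsPreconnected U)
    (hf : DifferentiableOn ℂ f U) (hg : DifferentiableOn ℂ g U) {z₀ d : ℂ} (hz₀ : z₀ ∈ U)
    (hd : d ≠ 0) (h : ∀ᶠ t : ℝ in 𝓝[>] 0, f (z₀ + t * d) = g (z₀ + t * d)) : Set.EqOn f g U := by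
  refine (hf.analyticOnNhd hU).eqOn_of_preconnected_of_frequently_eq (hg.analyticOnNhd hU) hc hz₀ ?_
  have ht : Tendsto (fun t : ℝ => z₀ + t * d) (𝓝[>] 0) (𝓝[≠] z₀) := by
    refine tendsto_nhdsWithin_iff.mpr ⟨?_, ?_⟩
    · have : Continuous fun t : ℝ => z₀ + t * d := by fun_prop
      have := (this.tendsto 0).mono_left (nhdsWithin_le_nhds (s := Set.Ioi 0))
      simpa using! this
    · filter_upwards [self_mem_nhdsWithin] with t ht
      have : (t : ℂ) ≠ 0 := by exact_mod_cast ne_of_gt (Set.mem_Ioi.mp ht)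
      simp only [Set.mem_compl_iff, Set.mem_singleton_iff, add_eq_left, mul_eq_zero, not_or]
      exact ⟨this, hd⟩
  exact ht.frequently h.frequently

lemma integrableOn_cpow_mul_exp {a : ℂ} (ha : 0 < a.re) {c : ℝ} (hc : 0 < c) :
    IntegrableOn (fun x : ℝ => x ^ (a.re - 1) * Real.exp (-(c * x))) (Set.Ioi 0) := by
  have h2 := integrableOn_rpow_mul_exp_neg_mul_rpow (p := 1) (s := a.re - 1) (b := c) (by linarith)
    one_pos hc
  simpa [neg_mul] using h2

/-- The formula is the Gamma integral for real p > 0. Both sides are holomorphic for Re p > 0, so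
the identity theorem applies. -/
lemma integral_cpow_mul_exp_neg {a p : ℂ} (ha : 0 < a.re) (hp : 0 < p.re) :
    ∫ x in Set.Ioi (0 : ℝ), (x : ℂ) ^ (a - 1) * Complex.exp (-(p * x)) =
      p ^ (-a) * Complex.Gamma a := by
  -- A uniform majorant exists only on the smaller half planes Re p > c.
  have key : ∀ c : ℝ, 0 < c → DifferentiableOn ℂ (fun p : ℂ => ∫ x in Set.Ioi (0 : ℝ),
      (x : ℂ) ^ (a - 1) * Complex.exp (-(p * x))) {p | c < p.re} := by
    intro c hc
    refine differentiableOn_integral_param (isOpen_lt continuous_const Complex.continuous_re)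
      (bound := fun x : ℝ => x ^ (a.re - 1) * Real.exp (-(c * x)))
      (fun p _ => ?_) ?_ ?_ (integrableOn_cpow_mul_exp ha hc)
    · refine ContinuousOn.aestronglyMeasurable (fun x hx => ?_) measurableSet_Ioi
      have h1 : ContinuousAt (fun x : ℝ => (x : ℂ) ^ (a - 1)) x :=
        Complex.continuousAt_ofReal_cpow_const _ _ (Or.inr (ne_of_gt hx))
      exact (h1.mul (by fun_prop)).continuousWithinAt
    · refine ae_of_all _ fun x => ?_
      fun_prop
    · refine (ae_restrict_iff' measurableSet_Ioi).mpr (ae_of_all _ fun x hx p hp => ?_)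
      have hx' : (0 : ℝ) < x := hx
      have hp' : c < p.re := hp
      rw [norm_mul, Complex.norm_cpow_eq_rpow_re_of_pos hx', Complex.norm_exp]
      simp only [Complex.sub_re, Complex.one_re, Complex.neg_re, Complex.re_mul_ofReal]
      gcongr
  set U : Set ℂ := {p | 0 < p.re} with hU
  have h1 : DifferentiableOn ℂ (fun p : ℂ => ∫ x in Set.Ioi (0 : ℝ),
      (x : ℂ) ^ (a - 1) * Complex.exp (-(p * x))) U := by
    intro p hp
    have hp' : 0 < p.re := hp
    refine ((key (p.re / 2) (by linarith)).differentiableAt ?_).differentiableWithinAt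
    exact (isOpen_lt continuous_const Complex.continuous_re).mem_nhds (by
      change p.re / 2 < p.re
      linarith)
  have h2 : DifferentiableOn ℂ (fun p : ℂ => p ^ (-a) * Complex.Gamma a) U := by
    intro p hp
    refine (DifferentiableAt.mul_const (DifferentiableAt.cpow_const differentiableAt_id ?_) _
      ).differentiableWithinAt
    exact Or.inl hp
  refine eqOn_of_eq_on_segment (isOpen_lt continuous_const Complex.continuous_re)
    (convex_halfSpace_re_gt 0).isPreconnected h1 h2 (z₀ := 1) (d := 1) (by simp) one_ne_zero
    ?_ hp
  filter_upwards [self_mem_nhdsWithin] with t ht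
  have ht' : (0 : ℝ) < t := ht
  have h3 := Complex.integral_cpow_mul_exp_neg_mul_Ioi ha (show (0:ℝ) < 1 + t by linarith)
  have h4 : (1 : ℂ) + t * 1 = ((1 + t : ℝ) : ℂ) := by push_cast; ring
  rw [h4, h3, one_div, Complex.inv_cpow, ← Complex.cpow_neg]
  rw [Complex.arg_ofReal_of_nonneg (by linarith)]
  exact Real.pi_pos.ne

lemma re_one_add_mul_I (t : ℝ) : ((1 : ℂ) + t * Complex.I).re = 1 := by simp

lemma one_add_mul_I_ne_zero (t : ℝ) : (1 : ℂ) + t * Complex.I ≠ 0 := fun h => by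
  have := re_one_add_mul_I t
  simp [h] at this

lemma norm_cexp_sq (t : ℝ) :
    ‖Complex.exp ((1 + t * Complex.I) ^ 2)‖ = Real.exp 1 * Real.exp (-1 * t ^ 2) := by
  rw [Complex.norm_exp, ← Real.exp_add]
  congr 1
  simp [pow_two]
  ring

/-- Write Γ(a)(1+it)^(-a) as a Gamma integral in x and exchange the integrals. The Gaussian integral
over t is √π e^{-x²/4}, and the Mellin transform of e^{-x²/4} at a is a nonzero multiple of Γ(a/2),
which does not vanish for Re a > 0. -/
lemma integral_gaussian_mul_cpow_ne_zero {a : ℂ} (ha : 0 < a.re) :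
    ∫ t : ℝ, Complex.exp ((1 + t * Complex.I) ^ 2) * (1 + t * Complex.I : ℂ) ^ (-a) ≠ 0 := by
  intro h0
  set f : ℝ → ℝ → ℂ := fun t x => Complex.exp ((1 + t * Complex.I) ^ 2) *
    ((x : ℂ) ^ (a - 1) * Complex.exp (-((1 + t * Complex.I) * x))) with hf
  have hswap : ∫ t : ℝ, ∫ x in Set.Ioi (0 : ℝ), f t x = ∫ x in Set.Ioi (0 : ℝ), ∫ t : ℝ, f t x := by
    refine integral_integral_swap ?_
    have hb : Integrable (fun z : ℝ × ℝ => (Real.exp 1 * Real.exp (-1 * z.1 ^ 2)) *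
        (z.2 ^ (a.re - 1) * Real.exp (-(1 * z.2)))) (volume.prod (volume.restrict (Set.Ioi 0))) :=
      ((integrable_exp_neg_mul_sq one_pos).const_mul _).mul_prod
        (integrableOn_cpow_mul_exp ha one_pos)
    refine hb.mono' ?_ ?_
    · refine AEStronglyMeasurable.mul ?_ (AEStronglyMeasurable.mul ?_ ?_)
      · exact (by fun_prop : Continuous fun z : ℝ × ℝ =>
          Complex.exp ((1 + z.1 * Complex.I) ^ 2)).aestronglyMeasurable
      · have : AEStronglyMeasurable (fun x : ℝ => (x : ℂ) ^ (a - 1))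
            (volume.restrict (Set.Ioi 0)) := by
          refine ContinuousOn.aestronglyMeasurable (fun x hx => ?_) measurableSet_Ioi
          exact (Complex.continuousAt_ofReal_cpow_const _ _
            (Or.inr (ne_of_gt hx))).continuousWithinAt
        exact this.comp_snd
      · exact (by fun_prop : Continuous fun z : ℝ × ℝ =>
          Complex.exp (-((1 + z.1 * Complex.I) * z.2))).aestronglyMeasurable
    · have h1 : ∀ᵐ z ∂((volume : Measure ℝ).prod (volume.restrict (Set.Ioi (0 : ℝ)))),
          (0 : ℝ) < z.2 :=
        Measure.quasiMeasurePreserving_snd.ae (ae_restrict_mem measurableSet_Ioi)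
      filter_upwards [h1] with z hz
      simp only [Function.uncurry, hf]
      rw [norm_mul, norm_cexp_sq, norm_mul, Complex.norm_cpow_eq_rpow_re_of_pos hz,
        Complex.norm_exp]
      simp
  have hL : ∫ t : ℝ, ∫ x in Set.Ioi (0 : ℝ), f t x = 0 := by
    have : ∀ t : ℝ, ∫ x in Set.Ioi (0 : ℝ), f t x =
        Complex.exp ((1 + t * Complex.I) ^ 2) * (1 + t * Complex.I : ℂ) ^ (-a) *
          Complex.Gamma a := by
      intro t
      rw [hf]
      simp only
      rw [integral_const_mul, integral_cpow_mul_exp_neg ha (by simp)]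
      ring
    simp_rw [this]
    rw [integral_mul_const, h0, zero_mul]
  have hinner : ∀ x : ℝ, ∫ t : ℝ, f t x =
      (Real.pi : ℂ) ^ (1 / 2 : ℂ) * ((x : ℂ) ^ (a - 1) * Complex.exp (-(x ^ 2 / 4))) := by
    intro x
    have h1 : ∀ t : ℝ, f t x = (x : ℂ) ^ (a - 1) *
        Complex.exp ((-1) * t ^ 2 + (Complex.I * (2 - x)) * t + (1 - x)) := by
      intro t
      rw [hf]
      simp only
      rw [mul_left_comm, ← Complex.exp_add]
      congr 2
      linear_combination (t : ℂ) ^ 2 * Complex.I_sq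
    simp_rw [h1]
    rw [integral_const_mul, integral_cexp_quadratic (by simp)]
    rw [mul_left_comm]
    congr 3
    · norm_num
    · linear_combination ((2 - x : ℂ) ^ 2 / 4) * Complex.I_sq
  rw [hL] at hswap
  simp_rw [hinner] at hswap
  rw [integral_const_mul] at hswap
  have hpi : (Real.pi : ℂ) ^ (1 / 2 : ℂ) ≠ 0 := by
    rw [Complex.cpow_ne_zero_iff]
    left
    exact_mod_cast Real.pi_pos.ne'
  have hz := (mul_eq_zero.mp hswap.symm).resolve_left hpi
  have hm : mellin (fun x : ℝ => Complex.exp (-((x : ℂ) / 4))) (a / 2) = (4 : ℂ) ^ (a / 2) *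
      Complex.Gamma (a / 2) := by
    have ha2 : 0 < (a / 2).re := by simpa using ha
    have := Complex.integral_cpow_mul_exp_neg_mul_Ioi ha2 (show (0 : ℝ) < 1 / 4 by norm_num)
    rw [mellin]
    simp only [smul_eq_mul]
    convert! this using 2
    · ext x
      congr 2
      push_cast
      ring
    · norm_num
  -- Substituting x² reduces the Mellin transform of e^{-x²/4} at a to that of e^{-x/4} at a/2.
  have hm2 := mellin_comp_rpow (fun x : ℝ => Complex.exp (-((x : ℂ) / 4))) a 2
  have h3 : mellin (fun t : ℝ => Complex.exp (-((t ^ (2 : ℝ) : ℝ) : ℂ) / 4)) a = 0 := by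
    rw [mellin, ← hz]
    refine setIntegral_congr_fun measurableSet_Ioi fun x hx => ?_
    simp only [smul_eq_mul]
    congr 2
    rw [Real.rpow_two]
    push_cast
    ring
  have h4 : (fun t : ℝ => Complex.exp (-((t ^ (2 : ℝ) : ℝ) : ℂ) / 4)) =
      fun t : ℝ => Complex.exp (-(((t ^ (2 : ℝ) : ℝ) : ℂ) / 4)) := by
    funext t
    rw [neg_div]
  rw [h4, hm2] at h3
  push_cast at h3
  rw [hm] at h3
  have h5 : Complex.Gamma (a / 2) ≠ 0 := Complex.Gamma_ne_zero_of_re_pos (by simpa using ha)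
  have h6 : (4 : ℂ) ^ (a / 2) ≠ 0 := by
    rw [Complex.cpow_ne_zero_iff]
    left
    norm_num
  simp [h5, h6] at h3

/-- The earlier bound carries a superfluous √t. This is harmless on a bounded range, and beyond it
the limits of e^t times the two functions give the bound without it. -/
lemma exists_norm_besselW_le_exp (ν : ℂ) {t₀ : ℝ} (h₀ : 0 < t₀) :
    ∃ C, 0 ≤ C ∧ ∀ t, t₀ ≤ t → ‖besselW ν t‖ ≤ C * Real.exp (-t) ∧
      ‖besselW' ν t‖ ≤ C * Real.exp (-t) := by
  obtain ⟨C, hC, h⟩ := exists_norm_besselW_le ν h₀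
  obtain ⟨T, hT⟩ := eventually_atTop.mp ((tendsto_besselW ν).norm.eventually_le_const
    (lt_add_one _))
  obtain ⟨T', hT'⟩ := eventually_atTop.mp ((tendsto_besselW' ν).norm.eventually_le_const
    (lt_add_one _))
  set c := ‖((Real.sqrt (Real.pi / 2) : ℝ) : ℂ)‖ + 1 with hc
  have hc0 : 0 ≤ c := by positivity
  have conv : ∀ {w : ℂ} {t : ℝ}, ‖(Real.exp t : ℂ) * w‖ ≤ c → ‖w‖ ≤ c * Real.exp (-t) := by
    intro w t hw
    rw [norm_mul, Complex.norm_real, Real.norm_eq_abs, Real.abs_exp] at hw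
    rw [Real.exp_neg, ← div_eq_mul_inv, le_div_iff₀ (Real.exp_pos t)]
    linarith
  refine ⟨max c (C * Real.sqrt (max T T')), le_max_of_le_left hc0, fun t ht => ?_⟩
  have he := Real.exp_pos (-t)
  rcases le_total (max T T') t with h1 | h1
  · have h2 := conv (hT t ((le_max_left _ _).trans h1))
    have h3 := hT' t ((le_max_right _ _).trans h1)
    rw [norm_neg] at h3
    have h3 := conv h3
    exact ⟨h2.trans (by gcongr; exact le_max_left _ _), h3.trans (by gcongr; exact le_max_left _ _)⟩
  · have h2 : C * Real.sqrt t ≤ max c (C * Real.sqrt (max T T')) :=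
      le_max_of_le_right (by gcongr)
    exact ⟨(h t ht).1.trans (by gcongr), (h t ht).2.trans (by gcongr)⟩

end

end HigherOrderLewis

namespace HigherOrderLewis

noncomputable section

/-! ### Green's form of two eigenfunctions -/

/-- `u` is an eigenfunction of the hyperbolic Laplacian on `D`, with derivative `u₁`. -/
def IsEig (ν : ℂ) (D : Set ℂ) (u : ℂ → ℂ) (u₁ : ℂ → ℂ →L[ℝ] ℂ) : Prop :=
  ∀ z ∈ D, HasFDerivAt u (u₁ z) z ∧ ∃ u₂ : ℂ →L[ℝ] ℂ →L[ℝ] ℂ, HasFDerivAt u₁ u₂ z ∧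
    u₂ 1 1 + u₂ Complex.I Complex.I = (ν ^ 2 - 1 / 4) / (z.im : ℂ) ^ 2 * u z

/-- Multiplication by `i` as a real linear map. -/
def mulI : ℂ →L[ℝ] ℂ := ContinuousLinearMap.mul ℝ ℂ Complex.I

@[simp] lemma mulI_apply (h : ℂ) : mulI h = Complex.I * h := rfl

/-- Green's form `v *du - u *dv`. -/
def greenForm (u : ℂ → ℂ) (u₁ : ℂ → ℂ →L[ℝ] ℂ) (v : ℂ → ℂ) (v₁ : ℂ → ℂ →L[ℝ] ℂ) (z : ℂ) :
    ℂ →L[ℝ] ℂ :=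
  v z • (u₁ z).comp mulI - u z • (v₁ z).comp mulI

lemma greenForm_apply (u : ℂ → ℂ) (u₁ : ℂ → ℂ →L[ℝ] ℂ) (v : ℂ → ℂ) (v₁ : ℂ → ℂ →L[ℝ] ℂ)
    (z h : ℂ) : greenForm u u₁ v v₁ z h =
      v z * u₁ z (Complex.I * h) - u z * v₁ z (Complex.I * h) := rfl

lemma norm_mulI_le : ‖mulI‖ ≤ 1 :=
  ContinuousLinearMap.opNorm_le_bound _ zero_le_one fun h => by simp

lemma norm_comp_mulI_le (L : ℂ →L[ℝ] ℂ) : ‖L.comp mulI‖ ≤ ‖L‖ :=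
  (L.opNorm_comp_le mulI).trans (mul_le_of_le_one_right (norm_nonneg _) norm_mulI_le)

lemma norm_greenForm_le (u : ℂ → ℂ) (u₁ : ℂ → ℂ →L[ℝ] ℂ) (v : ℂ → ℂ) (v₁ : ℂ → ℂ →L[ℝ] ℂ)
    (z : ℂ) : ‖greenForm u u₁ v v₁ z‖ ≤ (‖v z‖ + ‖v₁ z‖) * (‖u z‖ + ‖u₁ z‖) := by
  refine (norm_sub_le _ _).trans ?_
  rw [norm_smul, norm_smul]
  have h1 := norm_comp_mulI_le (u₁ z)
  have h2 := norm_comp_mulI_le (v₁ z)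
  have a := norm_nonneg (u z)
  have b := norm_nonneg (v z)
  have c := norm_nonneg (u₁ z)
  have d := norm_nonneg (v₁ z)
  nlinarith [mul_le_mul_of_nonneg_left h1 b, mul_le_mul_of_nonneg_left h2 a, mul_nonneg a b,
    mul_nonneg c d]

lemma IsEig.hasFDerivAt {ν : ℂ} {D : Set ℂ} {u : ℂ → ℂ} {u₁ : ℂ → ℂ →L[ℝ] ℂ}
    (h : IsEig ν D u u₁) {z : ℂ} (hz : z ∈ D) : HasFDerivAt u (u₁ z) z := (h z hz).1

lemma IsEig.continuousOn_deriv {ν : ℂ} {D : Set ℂ} {u : ℂ → ℂ} {u₁ : ℂ → ℂ →L[ℝ] ℂ}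
    (h : IsEig ν D u u₁) : ContinuousOn u₁ D := fun z hz => by
  obtain ⟨u₂, h2, -⟩ := (h z hz).2
  exact h2.continuousAt.continuousWithinAt

lemma IsEig.continuousOn {ν : ℂ} {D : Set ℂ} {u : ℂ → ℂ} {u₁ : ℂ → ℂ →L[ℝ] ℂ}
    (h : IsEig ν D u u₁) : ContinuousOn u D := fun _ hz =>
  (h.hasFDerivAt hz).continuousAt.continuousWithinAt

lemma IsEig.mono {ν : ℂ} {D D' : Set ℂ} {u : ℂ → ℂ} {u₁ : ℂ → ℂ →L[ℝ] ℂ}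
    (h : IsEig ν D u u₁) (hD : D' ⊆ D) : IsEig ν D' u u₁ := fun z hz => h z (hD hz)

lemma hasFDerivAt_smul_comp {v : ℂ → ℂ} {v' : ℂ →L[ℝ] ℂ} {L : ℂ → ℂ →L[ℝ] ℂ}
    {L' : ℂ →L[ℝ] ℂ →L[ℝ] ℂ} {z : ℂ} (hv : HasFDerivAt v v' z) (hL : HasFDerivAt L L' z) :
    ∃ A : ℂ →L[ℝ] ℂ →L[ℝ] ℂ, HasFDerivAt (fun z => v z • (L z).comp mulI) A z ∧
      ∀ h k, A h k = v z * L' h (Complex.I * k) + v' h * L z (Complex.I * k) := by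
  have h1 := (((ContinuousLinearMap.compL ℝ ℂ ℂ ℂ).flip mulI).hasFDerivAt (x := L z)).comp z hL
  refine ⟨_, hv.smul h1, fun h k => ?_⟩
  simp

/-- In d(v *du - u *dv) the first order terms are symmetric in u and v and cancel. What remains is
vΔu - uΔv, which is zero because the eigenvalues agree. -/
lemma greenForm_closed {ν : ℂ} {D : Set ℂ} {u v : ℂ → ℂ} {u₁ v₁ : ℂ → ℂ →L[ℝ] ℂ}
    (hu : IsEig ν D u u₁) (hv : IsEig ν D v v₁) {z : ℂ} (hz : z ∈ D) :
    DifferentiableAt ℝ (greenForm u u₁ v v₁) z ∧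
      fderiv ℝ (greenForm u u₁ v v₁) z 1 Complex.I =
        fderiv ℝ (greenForm u u₁ v v₁) z Complex.I 1 := by
  obtain ⟨hu0, u₂, hu2, hue⟩ := hu z hz
  obtain ⟨hv0, v₂, hv2, hve⟩ := hv z hz
  obtain ⟨A, hA, hA'⟩ := hasFDerivAt_smul_comp hv0 hu2
  obtain ⟨B, hB, hB'⟩ := hasFDerivAt_smul_comp hu0 hv2
  have h : HasFDerivAt (greenForm u u₁ v v₁) (A - B) z := hA.sub hB
  refine ⟨h.differentiableAt, ?_⟩
  rw [h.fderiv]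
  simp only [sub_apply, hA', hB', Complex.I_mul_I, mul_one, map_neg]
  linear_combination (u z) * hve - (v z) * hue

/-! ### The kernel -/

/-- A branch of `(y / ((z - ζ) (z̄ - ζ)))^s` on the slit half plane. -/
def kernelV (s ζ z : ℂ) : ℂ :=
  Complex.exp (s * (Real.log z.im - Complex.log (Complex.I * (z - ζ)) -
    Complex.log (Complex.I * ((starRingEnd ℂ) z - ζ))))

/-- The logarithmic derivative of `y / ((z - ζ) (z̄ - ζ))`. -/
def kernelD (ζ z : ℂ) : ℂ →L[ℝ] ℂ :=
  (z.im : ℂ)⁻¹ • Complex.ofRealCLM.comp Complex.imCLM - (z - ζ)⁻¹ • ContinuousLinearMap.id ℝ ℂ -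
    ((starRingEnd ℂ) z - ζ)⁻¹ • (Complex.conjCLE : ℂ →L[ℝ] ℂ)

lemma kernelD_apply (ζ z h : ℂ) : kernelD ζ z h =
    h.im / z.im - h / (z - ζ) - (starRingEnd ℂ) h / ((starRingEnd ℂ) z - ζ) := by
  simp [kernelD, div_eq_inv_mul]

/-- The derivative of the kernel. -/
def kernelV' (s ζ z : ℂ) : ℂ →L[ℝ] ℂ := (s * kernelV s ζ z) • kernelD ζ z

/-- The factor i rotates the cut of the principal logarithm onto the vertical half line above ζ,
which is exactly what `slitHalf` removes. -/
lemma mem_slitPlane_left {ζ z : ℂ} (hz : z ∈ slitHalf ζ) :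
    Complex.I * (z - ζ) ∈ Complex.slitPlane := by
  rw [Complex.mem_slitPlane_iff]
  by_cases h : z.re = ζ.re
  · left
    have := hz.2 h
    simp
    linarith
  · right
    simpa [sub_eq_zero] using h

/-- The second factor of the kernel has positive real part and never meets the cut. -/
lemma mem_slitPlane_right {ζ z : ℂ} (h : 0 < z.im + ζ.im) :
    Complex.I * ((starRingEnd ℂ) z - ζ) ∈ Complex.slitPlane := by
  rw [Complex.mem_slitPlane_iff]
  left
  simp
  linarith

lemma sub_ne_zero_of_mem_slitHalf {ζ z : ℂ} (hz : z ∈ slitHalf ζ) : z - ζ ≠ 0 := fun h => by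
  have := Complex.slitPlane_ne_zero (mem_slitPlane_left hz)
  simp [h] at this

lemma conj_sub_ne_zero {ζ z : ℂ} (h : 0 < z.im + ζ.im) : (starRingEnd ℂ) z - ζ ≠ 0 := fun h' => by
  have := Complex.slitPlane_ne_zero (mem_slitPlane_right h)
  simp [h'] at this

lemma hasFDerivAt_conj_sub (ζ z : ℂ) : HasFDerivAt (fun z : ℂ => (starRingEnd ℂ) z - ζ)
    (Complex.conjCLE : ℂ →L[ℝ] ℂ) z :=
  (Complex.conjCLE.hasFDerivAt (x := z)).sub_const ζ

lemma hasFDerivAt_im (z : ℂ) : HasFDerivAt (fun z : ℂ => (z.im : ℂ))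
    (Complex.ofRealCLM.comp Complex.imCLM) z :=
  (Complex.ofRealCLM.comp Complex.imCLM).hasFDerivAt

lemma hasFDerivAt_comp_holomorphic {g f : ℂ → ℂ} {g' z : ℂ} {f' : ℂ →L[ℝ] ℂ}
    (hf : HasFDerivAt f f' z) (hg : HasDerivAt g g' (f z)) :
    HasFDerivAt (fun z => g (f z)) (g' • f') z := by
  have h := (hg.hasFDerivAt.restrictScalars ℝ).comp z hf
  convert! h using 1
  ext h
  simp [mul_comm]

lemma hasFDerivAt_kernelV (s : ℂ) {ζ z : ℂ} (hζ : 0 < ζ.im) (hz : z ∈ slitHalf ζ) :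
    HasFDerivAt (kernelV s ζ) (kernelV' s ζ z) z := by
  have hy : 0 < z.im := hz.1
  have h1 : HasFDerivAt (fun z : ℂ => ((Real.log z.im : ℝ) : ℂ))
      ((z.im : ℂ)⁻¹ • Complex.ofRealCLM.comp Complex.imCLM) z := by
    have h := (Complex.ofRealCLM.hasFDerivAt (x := Real.log z.im)).comp z
      ((Real.hasDerivAt_log hy.ne').comp_hasFDerivAt z (Complex.imCLM.hasFDerivAt (x := z)))
    convert! h using 1
    ext h; simp
  have h2 : HasFDerivAt (fun z : ℂ => Complex.log (Complex.I * (z - ζ)))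
      ((z - ζ)⁻¹ • ContinuousLinearMap.id ℝ ℂ) z := by
    have h := hasFDerivAt_comp_holomorphic
      (((hasFDerivAt_id (𝕜 := ℝ) z).sub_const ζ).const_mul Complex.I)
      (Complex.hasDerivAt_log (mem_slitPlane_left hz))
    convert! h using 1
    rw [smul_smul, mul_inv, mul_assoc, mul_comm _ Complex.I, ← mul_assoc,
      inv_mul_cancel₀ Complex.I_ne_zero, one_mul]
    rfl
  have h3 : HasFDerivAt (fun z : ℂ => Complex.log (Complex.I * ((starRingEnd ℂ) z - ζ)))
      (((starRingEnd ℂ) z - ζ)⁻¹ • (Complex.conjCLE : ℂ →L[ℝ] ℂ)) z := by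
    have h := hasFDerivAt_comp_holomorphic
      ((hasFDerivAt_conj_sub ζ z).const_mul Complex.I)
      (Complex.hasDerivAt_log (mem_slitPlane_right (by linarith)))
    convert! h using 1
    rw [smul_smul, mul_inv, mul_assoc, mul_comm _ Complex.I, ← mul_assoc,
      inv_mul_cancel₀ Complex.I_ne_zero, one_mul]
  have h4 := hasFDerivAt_comp_holomorphic (((h1.sub h2).sub h3).const_mul s)
    (Complex.hasDerivAt_exp _)
  convert! h4 using 1
  rw [smul_smul, kernelV', mul_comm s]
  rfl

/-- The eigenvalue is s(1-s) = 1/4 - ν². The equation is checked by differentiating the kernel twice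
in logarithmic form. -/
lemma kernelV_isEig {ν s ζ : ℂ} (hs : s = ν + 1 / 2) (hζ : 0 < ζ.im) :
    IsEig ν (slitHalf ζ) (kernelV s ζ) (kernelV' s ζ) := by
  intro z hz
  have hy : (z.im : ℂ) ≠ 0 := by exact_mod_cast ne_of_gt hz.1
  have h0 := hasFDerivAt_kernelV s hζ hz
  have hzζ := sub_ne_zero_of_mem_slitHalf hz
  have hzζ' := conj_sub_ne_zero (ζ := ζ) (z := z) (by linarith [hz.1])
  refine ⟨h0, ?_⟩
  have i1 := (hasFDerivAt_comp_holomorphic (hasFDerivAt_im z) (hasDerivAt_inv hy)).smul_const (Complex.ofRealCLM.comp Complex.imCLM)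
  have i2 := (hasFDerivAt_comp_holomorphic
    ((hasFDerivAt_id (𝕜 := ℝ) z).sub_const ζ) (hasDerivAt_inv hzζ)).smul_const
    (ContinuousLinearMap.id ℝ ℂ)
  have i3 := (hasFDerivAt_comp_holomorphic
    (hasFDerivAt_conj_sub ζ z) (hasDerivAt_inv hzζ')).smul_const (Complex.conjCLE : ℂ →L[ℝ] ℂ)
  have hD := (i1.sub i2).sub i3
  have hV := (h0.const_mul s).smul hD
  refine ⟨_, hV, ?_⟩
  have hν : ν = s - 1 / 2 := by rw [hs]; ring
  -- Eliminating z̄ leaves a rational identity in s, z - ζ and y, in which the last two may be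
  -- treated as independent variables.
  have hrel : (starRingEnd ℂ) z - ζ = (z - ζ) - 2 * Complex.I * z.im := by
    apply Complex.ext <;> simp
    ring
  simp [kernelV', kernelD]
  rw [hν]
  generalize hK : kernelV s ζ z = K
  rw [hrel] at hzζ' ⊢
  generalize hw : z - ζ = w at *
  generalize hyy : (z.im : ℂ) = y at *
  have hI := Complex.I_sq
  have hI3 : Complex.I ^ 3 = -Complex.I := by rw [pow_succ, hI]; ring
  have hI4 : Complex.I ^ 4 = 1 := by rw [show 4 = 2 * 2 by norm_num, pow_mul, hI]; ring
  field_simp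
  ring_nf
  simp only [hI, hI3, hI4]
  ring

end

end HigherOrderLewis

namespace HigherOrderLewis

noncomputable section

/-! ### Integrals of Green's form along parabolas -/

/-- The two arguments are at most π in absolute value, so the imaginary part of s costs only a
constant. Everything else depends on the moduli alone. -/
lemma norm_cexp_mul_sub_log_le {s w₁ w₂ : ℂ} {a : ℝ} :
    ‖Complex.exp (s * (a - Complex.log w₁ - Complex.log w₂))‖ ≤
      Real.exp (2 * Real.pi * |s.im|) *
        Real.exp (s.re * (a - Real.log ‖w₁‖ - Real.log ‖w₂‖)) := by
  rw [Complex.norm_exp, ← Real.exp_add]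
  refine Real.exp_le_exp.mpr ?_
  rw [Complex.mul_re]
  simp only [Complex.sub_re, Complex.sub_im, Complex.ofReal_re, Complex.ofReal_im, Complex.log_re,
    Complex.log_im]
  have h1 := Complex.abs_arg_le_pi w₁
  have h2 := Complex.abs_arg_le_pi w₂
  have h3 : |s.im * (Complex.arg w₁ + Complex.arg w₂)| ≤ |s.im| * (2 * Real.pi) := by
    rw [abs_mul]
    gcongr
    exact (abs_add_le _ _).trans (by linarith)
  have h4 := le_abs_self (s.im * (Complex.arg w₁ + Complex.arg w₂))
  nlinarith

lemma im_le_norm_conj_sub {ζ z : ℂ} (hζ : 0 ≤ ζ.im) (hz : 0 < z.im) :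
    z.im ≤ ‖(starRingEnd ℂ) z - ζ‖ := by
  have h := Complex.abs_im_le_norm ((starRingEnd ℂ) z - ζ)
  simp only [Complex.sub_im, Complex.conj_im] at h
  rw [abs_of_nonpos (by linarith)] at h
  linarith

/-- Since y ≤ |z̄ - ζ|, the numerator is absorbed by the second factor and only |z - ζ|^(-Re s) is
left. -/
lemma norm_kernelV_le {s ζ z : ℂ} (hs : 0 ≤ s.re) (hζ : 0 ≤ ζ.im) (hz : 0 < z.im) {δ : ℝ}
    (hδ : 0 < δ) (hd : δ ≤ ‖z - ζ‖) :
    ‖kernelV s ζ z‖ ≤ Real.exp (2 * Real.pi * |s.im|) * δ ^ (-s.re) := by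
  refine norm_cexp_mul_sub_log_le.trans ?_
  rw [norm_mul, norm_mul, Complex.norm_I, one_mul, one_mul, Real.rpow_def_of_pos hδ]
  have h1 : Real.log δ ≤ Real.log ‖z - ζ‖ := Real.log_le_log hδ hd
  have h2 : Real.log z.im ≤ Real.log ‖(starRingEnd ℂ) z - ζ‖ :=
    Real.log_le_log hz (im_le_norm_conj_sub hζ hz)
  refine mul_le_mul_of_nonneg_left (Real.exp_le_exp.mpr ?_) (Real.exp_pos _).le
  nlinarith

lemma norm_kernelD_le {ζ z : ℂ} (hζ : 0 ≤ ζ.im) {y₀ δ : ℝ} (hy : 0 < y₀) (hz : y₀ ≤ z.im)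
    (hδ : 0 < δ) (hd : δ ≤ ‖z - ζ‖) : ‖kernelD ζ z‖ ≤ 2 / y₀ + 1 / δ := by
  have hz0 : 0 < z.im := hy.trans_le hz
  have h1 := im_le_norm_conj_sub hζ hz0
  refine ContinuousLinearMap.opNorm_le_bound _ (by positivity) fun h => ?_
  rw [kernelD_apply]
  have e1 : ‖(h.im : ℂ) / z.im‖ ≤ 1 / y₀ * ‖h‖ := by
    rw [norm_div, Complex.norm_real, Complex.norm_real, Real.norm_eq_abs, Real.norm_eq_abs,
      abs_of_pos hz0, div_mul_eq_mul_div, one_mul]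
    gcongr
    exact Complex.abs_im_le_norm h
  have e2 : ‖h / (z - ζ)‖ ≤ 1 / δ * ‖h‖ := by
    rw [norm_div, div_mul_eq_mul_div, one_mul]
    gcongr
  have e3 : ‖(starRingEnd ℂ) h / ((starRingEnd ℂ) z - ζ)‖ ≤ 1 / y₀ * ‖h‖ := by
    rw [norm_div, RCLike.norm_conj, div_mul_eq_mul_div, one_mul]
    gcongr
    linarith
  refine (norm_sub_le _ _).trans ((add_le_add (norm_sub_le _ _) le_rfl).trans ?_)
  calc _ ≤ 1 / y₀ * ‖h‖ + 1 / δ * ‖h‖ + 1 / y₀ * ‖h‖ := by gcongr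
    _ = _ := by ring

/-- The constant in the bound for the kernel and its derivative. -/
def kernelBound (s : ℂ) (y₀ δ : ℝ) : ℝ :=
  Real.exp (2 * Real.pi * |s.im|) * δ ^ (-s.re) * (1 + ‖s‖ * (2 / y₀ + 1 / δ))

lemma kernelBound_nonneg (s : ℂ) {y₀ δ : ℝ} (hy : 0 < y₀) (hδ : 0 < δ) :
    0 ≤ kernelBound s y₀ δ := by
  unfold kernelBound
  have := Real.rpow_nonneg hδ.le (-s.re)
  positivity

lemma norm_kernelV_add_le {s ζ z : ℂ} (hs : 0 ≤ s.re) (hζ : 0 ≤ ζ.im) {y₀ δ : ℝ} (hy : 0 < y₀)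
    (hz : y₀ ≤ z.im) (hδ : 0 < δ) (hd : δ ≤ ‖z - ζ‖) :
    ‖kernelV s ζ z‖ + ‖kernelV' s ζ z‖ ≤ kernelBound s y₀ δ := by
  have h1 := norm_kernelV_le hs hζ (hy.trans_le hz) hδ hd
  have h2 := norm_kernelD_le hζ hy hz hδ hd
  rw [kernelV', norm_smul, norm_mul]
  calc _ = ‖kernelV s ζ z‖ * (1 + ‖s‖ * ‖kernelD ζ z‖) := by ring
    _ ≤ _ := by
      unfold kernelBound
      gcongr

/-- Exponential decrease at `i∞`. -/
def RapidDecay (u : ℂ → ℂ) (u₁ : ℂ → ℂ →L[ℝ] ℂ) : Prop :=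
  ∀ y₀ > 0, ∃ M ε : ℝ, 0 < ε ∧ ∀ z : ℂ, y₀ ≤ z.im → ‖u z‖ + ‖u₁ z‖ ≤ M * Real.exp (-ε * z.im)

/-- The form attached to an eigenfunction and the kernel. -/
def lewisForm (s : ℂ) (u : ℂ → ℂ) (u₁ : ℂ → ℂ →L[ℝ] ℂ) (ζ : ℂ) : ℂ → ℂ →L[ℝ] ℂ :=
  greenForm u u₁ (kernelV s ζ) (kernelV' s ζ)

/-- The integral of Green's form along a parabola. -/
def contourF (s : ℂ) (u : ℂ → ℂ) (u₁ : ℂ → ℂ →L[ℝ] ℂ) (p : ℂ) (r : ℝ) (ζ : ℂ) : ℂ :=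
  ∫ t, lewisForm s u u₁ ζ (parabola p r t) (parabola' r t)

lemma norm_lewisForm_le {s ζ z : ℂ} (hs : 0 ≤ s.re) (hζ : 0 ≤ ζ.im) {u : ℂ → ℂ}
    {u₁ : ℂ → ℂ →L[ℝ] ℂ} {y₀ δ : ℝ} (hy : 0 < y₀) (hz : y₀ ≤ z.im) (hδ : 0 < δ)
    (hd : δ ≤ ‖z - ζ‖) :
    ‖lewisForm s u u₁ ζ z‖ ≤ kernelBound s y₀ δ * (‖u z‖ + ‖u₁ z‖) := by
  refine (norm_greenForm_le _ _ _ _ _).trans ?_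
  gcongr
  exact norm_kernelV_add_le hs hζ hy hz hδ hd

section

variable {ν s : ℂ} {u : ℂ → ℂ} {u₁ : ℂ → ℂ →L[ℝ] ℂ}

lemma slitHalf_subset (ζ : ℂ) : slitHalf ζ ⊆ {z : ℂ | 0 < z.im} := fun _ hz => hz.1

lemma exists_bound_lewisForm (hs : 0 ≤ s.re) (hd : RapidDecay u u₁) {ζ : ℂ} (hζ : 0 < ζ.im) :
    ∃ M ε : ℝ, 0 < ε ∧ ∀ z : ℂ, ζ.im + 1 ≤ z.im → 1 ≤ |z.re - ζ.re| →
      ‖lewisForm s u u₁ ζ z‖ ≤ M * Real.exp (-ε * z.im) := by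
  obtain ⟨M, ε, hε, h⟩ := hd 1 one_pos
  refine ⟨kernelBound s 1 1 * M, ε, hε, fun z hz hz' => ?_⟩
  have h1 : (1 : ℝ) ≤ z.im := by linarith
  refine (norm_lewisForm_le hs hζ.le one_pos h1 one_pos ?_).trans ?_
  · have := Complex.abs_re_le_norm (z - ζ)
    rw [Complex.sub_re] at this
    linarith
  · rw [mul_assoc]
    exact mul_le_mul_of_nonneg_left (h z h1) (kernelBound_nonneg s one_pos one_pos)

lemma lewisForm_closed (hνs : s = ν + 1 / 2) (hu : IsEig ν {z : ℂ | 0 < z.im} u u₁) {ζ z : ℂ}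
    (hζ : 0 < ζ.im) (hz : z ∈ slitHalf ζ) : DifferentiableAt ℝ (lewisForm s u u₁ ζ) z ∧
      fderiv ℝ (lewisForm s u u₁ ζ) z 1 Complex.I = fderiv ℝ (lewisForm s u u₁ ζ) z Complex.I 1 :=
  greenForm_closed (hu.mono (slitHalf_subset ζ)) (kernelV_isEig hνs hζ) hz

/-- The end limits of the primitive are kept in the statement because the later deformation to rays
uses the same primitive and the same two ends. -/
lemma exists_ends_lewisForm (hνs : s = ν + 1 / 2) (hs : 0 ≤ s.re)
    (hu : IsEig ν {z : ℂ | 0 < z.im} u u₁) (hd : RapidDecay u u₁) {ζ : ℂ} (hζ : 0 < ζ.im) :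
    ∃ (W : ℂ → ℂ) (wL wR : ℂ) (ε : ℝ), 0 < ε ∧
      (∀ z ∈ slitHalf ζ, HasFDerivAt W (lewisForm s u u₁ ζ z) z) ∧
      (∀ (l : Filter ℝ) (z : ℝ → ℂ), (∀ᶠ t in l, (z t).re ≤ ζ.re - 1) →
        Tendsto (fun t => (z t).im) l atTop →
        Tendsto (fun t => |(z t).re| * Real.exp (-ε * (z t).im)) l (𝓝 0) →
        Tendsto (fun t => W (z t)) l (𝓝 wL)) ∧
      (∀ (l : Filter ℝ) (z : ℝ → ℂ), (∀ᶠ t in l, ζ.re + 1 ≤ (z t).re) →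
        Tendsto (fun t => (z t).im) l atTop →
        Tendsto (fun t => |(z t).re| * Real.exp (-ε * (z t).im)) l (𝓝 0) →
        Tendsto (fun t => W (z t)) l (𝓝 wR)) ∧
      ∀ (p : ℂ) (r : ℝ), 0 < r → (∀ t, parabola p r t ∈ slitHalf ζ) →
        contourF s u u₁ p r ζ = wR - wL := by
  obtain ⟨M, ε, hε, hb⟩ := exists_bound_lewisForm hs hd hζ
  obtain ⟨W, wL, wR, hW, hL, hR⟩ := exists_primitive_ends hζ
    (fun z hz => (lewisForm_closed hνs hu hζ hz).1) (fun z hz => (lewisForm_closed hνs hu hζ hz).2)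
    hε hb
  refine ⟨W, wL, wR, ε, hε, hW, hL, hR, fun p r hr hp => ?_⟩
  exact integral_parabola_eq hr hε (fun z hz =>
    (lewisForm_closed hνs hu hζ hz).1.continuousAt.continuousWithinAt) hb hp hW hL hR

lemma contourF_eq (hνs : s = ν + 1 / 2) (hs : 0 ≤ s.re)
    (hu : IsEig ν {z : ℂ | 0 < z.im} u u₁) (hd : RapidDecay u u₁) {ζ : ℂ} (hζ : 0 < ζ.im)
    {p p' : ℂ} {r r' : ℝ} (hr : 0 < r) (hr' : 0 < r') (hp : ∀ t, parabola p r t ∈ slitHalf ζ)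
    (hp' : ∀ t, parabola p' r' t ∈ slitHalf ζ) :
    contourF s u u₁ p r ζ = contourF s u u₁ p' r' ζ := by
  obtain ⟨W, wL, wR, ε, -, -, -, -, h⟩ := exists_ends_lewisForm hνs hs hu hd hζ
  rw [h p r hr hp, h p' r' hr' hp']

lemma norm_parabola_sub (p : ℂ) {r : ℝ} (hr : 0 < r) (t : ℝ) : r ≤ ‖parabola p r t - p‖ := by
  have h : ‖parabola p r t - p‖ = r * ‖(1 : ℂ) + t * Complex.I‖ ^ 2 := by
    rw [parabola, sub_sub_cancel_left, norm_neg, norm_mul, norm_mul, norm_pow, Complex.norm_I,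
      Complex.norm_real, Real.norm_eq_abs, abs_of_pos hr, mul_one]
  have h1 : 1 ≤ ‖(1 : ℂ) + t * Complex.I‖ := by
    have := Complex.abs_re_le_norm ((1 : ℂ) + t * Complex.I)
    rwa [re_one_add_mul_I, abs_one] at this
  rw [h]
  exact le_mul_of_one_le_right hr.le (one_le_pow₀ h1)

lemma le_norm_parabola_sub {ζ p : ℂ} {r : ℝ} (hr : 0 < r) (h : ‖ζ - p‖ ≤ r / 2) (t : ℝ) :
    r / 2 ≤ ‖parabola p r t - ζ‖ := by
  have h1 := norm_parabola_sub p hr t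
  have h2 := norm_add_le (parabola p r t - ζ) (ζ - p)
  rw [sub_add_sub_cancel] at h2
  linarith

lemma le_parabola_im (p : ℂ) {r : ℝ} (hr : 0 < r) (t : ℝ) : p.im - r ≤ (parabola p r t).im := by
  rw [parabola_im]
  nlinarith [sq_nonneg t]

/-- If the parabola has the abscissa of ζ at t, then 2r|t| ≤ r/2, so |t| ≤ 1/4. Its height there is
at most Im p - 15r/16, whereas Im ζ is at least Im p - r/2. -/
lemma parabola_mem_slitHalf {ζ p : ℂ} {r : ℝ} (hr : 0 < r) (hrp : r < p.im)
    (h : ‖ζ - p‖ ≤ r / 2) (t : ℝ) : parabola p r t ∈ slitHalf ζ := by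
  refine ⟨by linarith [le_parabola_im p hr t], fun hre => ?_⟩
  rw [parabola_re] at hre
  have h1 := (Complex.abs_re_le_norm (ζ - p)).trans h
  have h2 := (Complex.abs_im_le_norm (ζ - p)).trans h
  rw [Complex.sub_re, ← hre, add_sub_cancel_left, abs_mul, abs_of_pos (by linarith : 0 < 2 * r)]
    at h1
  rw [Complex.sub_im] at h2
  have h3 : |t| ≤ 1 / 4 := by
    by_contra hc
    push Not at hc
    nlinarith
  have h4 : t ^ 2 ≤ (1 / 4) ^ 2 := sq_le_sq' (by linarith [neg_abs_le t]) (by linarith [le_abs_self t])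
  rw [parabola_im]
  have h5 := neg_abs_le (ζ.im - p.im)
  nlinarith

lemma im_pos_of_norm_sub_le {ζ p : ℂ} {r : ℝ} (hr : 0 < r) (hrp : r < p.im)
    (h : ‖ζ - p‖ ≤ r / 2) : 0 < ζ.im := by
  have h2 := (Complex.abs_im_le_norm (ζ - p)).trans h
  rw [Complex.sub_im] at h2
  have h5 := neg_abs_le (ζ.im - p.im)
  linarith

lemma continuous_lewisForm_parabola (hνs : s = ν + 1 / 2)
    (hu : IsEig ν {z : ℂ | 0 < z.im} u u₁) {ζ p : ℂ} {r : ℝ} (hζ : 0 < ζ.im)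
    (hp : ∀ t, parabola p r t ∈ slitHalf ζ) :
    Continuous fun t => lewisForm s u u₁ ζ (parabola p r t) (parabola' r t) := by
  have hω : ContinuousOn (lewisForm s u u₁ ζ) (slitHalf ζ) := fun z hz =>
    (lewisForm_closed hνs hu hζ hz).1.continuousAt.continuousWithinAt
  exact (hω.comp_continuous (continuous_parabola p r) hp).clm_apply (continuous_parabola' r)

lemma norm_lewisForm_parabola_le (hs : 0 ≤ s.re) {ζ p : ℂ} {r : ℝ} (hr : 0 < r) (hrp : r < p.im)
    (h : ‖ζ - p‖ ≤ r / 2) {M ε : ℝ}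
    (hb : ∀ z : ℂ, p.im - r ≤ z.im → ‖u z‖ + ‖u₁ z‖ ≤ M * Real.exp (-ε * z.im)) (t : ℝ) :
    ‖lewisForm s u u₁ ζ (parabola p r t) (parabola' r t)‖ ≤
      kernelBound s (p.im - r) (r / 2) * (M * Real.exp (-ε * (p.im - r))) * (2 * r) *
        ((1 + |t|) * Real.exp (-(ε * r) * t ^ 2)) := by
  have hy : 0 < p.im - r := by linarith
  refine (ContinuousLinearMap.le_opNorm _ _).trans ?_
  have h1 := norm_lewisForm_le (u := u) (u₁ := u₁) hs (im_pos_of_norm_sub_le hr hrp h).le hy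
    (le_parabola_im p hr t) (by linarith : 0 < r / 2) (le_norm_parabola_sub hr h t)
  have h2 := hb _ (le_parabola_im p hr t)
  have h3 := kernelBound_nonneg s hy (by linarith : 0 < r / 2)
  calc _ ≤ (kernelBound s (p.im - r) (r / 2) * (M * Real.exp (-ε * (parabola p r t).im))) *
        (2 * r * (1 + |t|)) := by
        refine mul_le_mul (h1.trans (by gcongr)) (norm_parabola'_le hr.le t) (norm_nonneg _) ?_
        exact mul_nonneg h3 ((by positivity : 0 ≤ ‖u (parabola p r t)‖ + _).trans h2)
    _ = _ := by
      rw [parabola_im, show -ε * (p.im + r * (t ^ 2 - 1)) = -ε * (p.im - r) + -(ε * r) * t ^ 2 by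
        ring, Real.exp_add]
      ring

/-- The kernel contains z and z̄ but only ζ, never its conjugate, and is therefore holomorphic in ζ.
-/
lemma differentiableAt_lewisForm_param (u : ℂ → ℂ) (u₁ : ℂ → ℂ →L[ℝ] ℂ) (s : ℂ) {ζ z : ℂ}
    (h : ℂ) (hζ : 0 < ζ.im) (hz : z ∈ slitHalf ζ) :
    DifferentiableAt ℂ (fun ζ => lewisForm s u u₁ ζ z h) ζ := by
  have h1 := mem_slitPlane_left hz
  have h2 := mem_slitPlane_right (ζ := ζ) (z := z) (by linarith [hz.1])
  have h3 := sub_ne_zero_of_mem_slitHalf hz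
  have h4 := conj_sub_ne_zero (ζ := ζ) (z := z) (by linarith [hz.1])
  have hK : DifferentiableAt ℂ (fun ζ => kernelV s ζ z) ζ := by
    unfold kernelV
    refine DifferentiableAt.cexp (DifferentiableAt.const_mul ?_ _)
    refine DifferentiableAt.sub (DifferentiableAt.sub (by fun_prop) ?_) ?_
    · exact DifferentiableAt.clog (by fun_prop) h1
    · exact DifferentiableAt.clog (by fun_prop) h2
  simp only [lewisForm, greenForm_apply, kernelV', smul_apply, smul_eq_mul, kernelD_apply]
  refine DifferentiableAt.sub (hK.mul_const _) (DifferentiableAt.const_mul ?_ _)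
  refine DifferentiableAt.mul (hK.const_mul s) ?_
  refine DifferentiableAt.sub (DifferentiableAt.sub (by fun_prop) ?_) ?_
  · exact DifferentiableAt.div (by fun_prop) (by fun_prop) h3
  · exact DifferentiableAt.div (by fun_prop) (by fun_prop) h4

lemma differentiableOn_contourF (hνs : s = ν + 1 / 2) (hs : 0 ≤ s.re)
    (hu : IsEig ν {z : ℂ | 0 < z.im} u u₁) (hd : RapidDecay u u₁) {p : ℂ} {r : ℝ} (hr : 0 < r)
    (hrp : r < p.im) : DifferentiableOn ℂ (contourF s u u₁ p r) (Metric.ball p (r / 2)) := by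
  obtain ⟨M, ε, hε, hb⟩ := hd (p.im - r) (by linarith)
  have hball : ∀ ζ ∈ Metric.ball p (r / 2), ‖ζ - p‖ ≤ r / 2 := fun ζ hζ => by
    rw [← dist_eq_norm]
    exact (Metric.mem_ball.mp hζ).le
  refine differentiableOn_integral_param Metric.isOpen_ball (fun ζ hζ => ?_)
    (ae_of_all _ fun t ζ hζ => ?_)
    (ae_of_all _ fun t ζ hζ => norm_lewisForm_parabola_le hs hr hrp (hball ζ hζ) hb t)
    ((integrable_abs_mul_exp_neg_sq (mul_pos hε hr)).const_mul _)
  · exact (continuous_lewisForm_parabola hνs hu (im_pos_of_norm_sub_le hr hrp (hball ζ hζ))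
      (parabola_mem_slitHalf hr hrp (hball ζ hζ))).aestronglyMeasurable
  · exact (differentiableAt_lewisForm_param u u₁ s _ (im_pos_of_norm_sub_le hr hrp (hball ζ hζ))
      (parabola_mem_slitHalf hr hrp (hball ζ hζ) t)).differentiableWithinAt

/-- The function `ζ ↦ ∫ Green's form` for a parabola around `ζ`. -/
def lewisF (s : ℂ) (u : ℂ → ℂ) (u₁ : ℂ → ℂ →L[ℝ] ℂ) (ζ : ℂ) : ℂ :=
  contourF s u u₁ ζ (ζ.im / 2) ζ

lemma lewisF_eq (hνs : s = ν + 1 / 2) (hs : 0 ≤ s.re)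
    (hu : IsEig ν {z : ℂ | 0 < z.im} u u₁) (hd : RapidDecay u u₁) {ζ p : ℂ} {r : ℝ} (hr : 0 < r)
    (hrp : r < p.im) (h : ‖ζ - p‖ ≤ r / 2) : lewisF s u u₁ ζ = contourF s u u₁ p r ζ := by
  have hζ := im_pos_of_norm_sub_le hr hrp h
  refine contourF_eq hνs hs hu hd hζ (by linarith) hr ?_ (parabola_mem_slitHalf hr hrp h)
  exact parabola_mem_slitHalf (by linarith) (by linarith) (by simp; linarith)

/-- The defining contour moves with ζ. Contour independence allows it to be frozen near a given
point, after which only the integrand depends on ζ. -/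
lemma differentiableAt_lewisF (hνs : s = ν + 1 / 2) (hs : 0 ≤ s.re)
    (hu : IsEig ν {z : ℂ | 0 < z.im} u u₁) (hd : RapidDecay u u₁) {ζ : ℂ} (hζ : 0 < ζ.im) :
    DifferentiableAt ℂ (lewisF s u u₁) ζ := by
  have hr : 0 < ζ.im / 2 := by linarith
  have h := (differentiableOn_contourF hνs hs hu hd hr (p := ζ) (by linarith)).differentiableAt
    (Metric.ball_mem_nhds ζ (by linarith : 0 < ζ.im / 2 / 2))
  refine h.congr_of_eventuallyEq ?_
  filter_upwards [Metric.ball_mem_nhds ζ (by linarith : 0 < ζ.im / 2 / 2)] with w hw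
  refine lewisF_eq hνs hs hu hd hr (by linarith) ?_
  rw [← dist_eq_norm]
  exact (Metric.mem_ball.mp hw).le

end

end

end HigherOrderLewis

namespace HigherOrderLewis

noncomputable section

/-! ### Separated eigenfunctions -/

/-- The real part, as a complex valued real linear map. -/
def reC : ℂ →L[ℝ] ℂ := Complex.ofRealCLM.comp Complex.reCLM

/-- The imaginary part, as a complex valued real linear map. -/
def imC : ℂ →L[ℝ] ℂ := Complex.ofRealCLM.comp Complex.imCLM

@[simp] lemma reC_apply (h : ℂ) : reC h = h.re := rfl

@[simp] lemma imC_apply (h : ℂ) : imC h = h.im := rfl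

lemma norm_reC_le : ‖reC‖ ≤ 1 :=
  ContinuousLinearMap.opNorm_le_bound _ zero_le_one fun h => by
    rw [reC_apply, Complex.norm_real, one_mul]
    exact Complex.abs_re_le_norm h

lemma norm_imC_le : ‖imC‖ ≤ 1 :=
  ContinuousLinearMap.opNorm_le_bound _ zero_le_one fun h => by
    rw [imC_apply, Complex.norm_real, one_mul]
    exact Complex.abs_im_le_norm h

/-- The character `x ↦ e^{iax}` as a function on the plane. -/
def charX (a : ℝ) (z : ℂ) : ℂ := Complex.exp (Complex.I * a * z.re)

lemma norm_charX (a : ℝ) (z : ℂ) : ‖charX a z‖ = 1 := by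
  rw [charX, Complex.norm_exp]
  simp

lemma hasFDerivAt_charX_mul (a : ℝ) {g : ℝ → ℂ} {g' : ℂ} {z : ℂ} (hg : HasDerivAt g g' z.im) :
    HasFDerivAt (fun z => charX a z * g z.im)
      ((charX a z * (Complex.I * a * g z.im)) • reC + (charX a z * g') • imC) z := by
  have h1 : HasFDerivAt (charX a) ((Complex.exp (Complex.I * a * z.re)) •
      ((Complex.I * a) • reC)) z :=
    hasFDerivAt_comp_holomorphic (g := Complex.exp) (f := fun z => Complex.I * a * (z.re : ℂ))
      (reC.hasFDerivAt.const_mul (Complex.I * a)) (Complex.hasDerivAt_exp _)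
  have h2 := hg.hasFDerivAt.comp z (Complex.imCLM.hasFDerivAt (x := z))
  refine (h1.mul h2).congr_fderiv ?_
  ext h
  simp [charX]
  ring

/-- The derivative of `e^{iax} g(y)`. -/
def sepDeriv (a : ℝ) (g g' : ℝ → ℂ) (z : ℂ) : ℂ →L[ℝ] ℂ :=
  (charX a z * (Complex.I * a * g z.im)) • reC + (charX a z * g' z.im) • imC

lemma norm_sepDeriv_le (a : ℝ) (g g' : ℝ → ℂ) (z : ℂ) :
    ‖sepDeriv a g g' z‖ ≤ |a| * ‖g z.im‖ + ‖g' z.im‖ := by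
  refine (norm_add_le _ _).trans ?_
  simp only [norm_smul, norm_mul, norm_charX, Complex.norm_I, Complex.norm_real, one_mul,
    Real.norm_eq_abs]
  have h1 := norm_reC_le
  have h2 := norm_imC_le
  refine add_le_add (mul_le_of_le_one_right (by positivity) h1)
    (mul_le_of_le_one_right (by positivity) h2)

lemma isEig_sep {ν : ℂ} (a : ℝ) {g g' : ℝ → ℂ} (hg : ∀ y : ℝ, 0 < y → HasDerivAt g (g' y) y)
    (hg' : ∀ y : ℝ, 0 < y → HasDerivAt g' (((a : ℂ) ^ 2 + (ν ^ 2 - 1 / 4) / (y : ℂ) ^ 2) * g y) y) :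
    IsEig ν {z : ℂ | 0 < z.im} (fun z => charX a z * g z.im) (sepDeriv a g g') := by
  intro z hz
  have hz' : 0 < z.im := hz
  refine ⟨hasFDerivAt_charX_mul a (hg _ hz'), ?_⟩
  have h1 := hasFDerivAt_charX_mul a ((hg _ hz').const_mul (Complex.I * a))
  have h2 := hasFDerivAt_charX_mul a (hg' _ hz')
  refine ⟨_, (h1.smul_const reC).add (h2.smul_const imC), ?_⟩
  simp
  linear_combination (charX a z * a ^ 2 * g z.im) * Complex.I_sq

/-- The vertical part `√y K_ν(|a| y)` of the separated solution. -/
def modeG (ν : ℂ) (a y : ℝ) : ℂ := ((Real.sqrt |a|)⁻¹ : ℝ) * besselW ν (|a| * y)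

/-- The derivative of `√y K_ν(|a| y)`. -/
def modeG' (ν : ℂ) (a y : ℝ) : ℂ := ((Real.sqrt |a|)⁻¹ : ℝ) * (((|a| : ℝ) : ℂ) * besselW' ν (|a| * y))

lemma modeG_eq (ν : ℂ) {a y : ℝ} (ha : a ≠ 0) :
    modeG ν a y = Real.sqrt y * besselK ν (|a| * y) := by
  have h : Real.sqrt |a| ≠ 0 := (Real.sqrt_pos.mpr (abs_pos.mpr ha)).ne'
  rw [modeG, besselW, Real.sqrt_mul (abs_nonneg a), ← mul_assoc, ← Complex.ofReal_mul, ← mul_assoc,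
    inv_mul_cancel₀ h, one_mul]

lemma hasDerivAt_modeG (ν : ℂ) {a y : ℝ} (ha : a ≠ 0) (hy : 0 < y) :
    HasDerivAt (modeG ν a) (modeG' ν a y) y := by
  have h := (hasDerivAt_besselW ν (mul_pos (abs_pos.mpr ha) hy)).scomp y
    ((hasDerivAt_id y).const_mul |a|)
  have h2 := h.const_mul (((Real.sqrt |a|)⁻¹ : ℝ) : ℂ)
  convert! h2 using 1
  simp [modeG']

lemma hasDerivAt_modeG' (ν : ℂ) {a y : ℝ} (ha : a ≠ 0) (hy : 0 < y) :
    HasDerivAt (modeG' ν a) (((a : ℂ) ^ 2 + (ν ^ 2 - 1 / 4) / (y : ℂ) ^ 2) * modeG ν a y) y := by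
  have ha' : 0 < |a| := abs_pos.mpr ha
  have h := (hasDerivAt_besselW' ν (mul_pos ha' hy)).scomp y ((hasDerivAt_id y).const_mul |a|)
  have h2 := (h.const_mul ((|a| : ℝ) : ℂ)).const_mul (((Real.sqrt |a|)⁻¹ : ℝ) : ℂ)
  convert! h2 using 1
  have h3 : (a : ℂ) ^ 2 = ((|a| : ℝ) : ℂ) ^ 2 := by
    rw [← Complex.ofReal_pow, ← Complex.ofReal_pow, sq_abs]
  have h4 : ((|a| : ℝ) : ℂ) ≠ 0 := by exact_mod_cast ha'.ne'
  have h5 : (y : ℂ) ≠ 0 := by exact_mod_cast hy.ne'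
  rw [h3, modeG]
  simp
  field_simp

/-- The separated solution `e^{iax} √y K_ν(|a| y)`. -/
def mode (ν : ℂ) (a : ℝ) (z : ℂ) : ℂ := charX a z * modeG ν a z.im

/-- The derivative of the separated solution. -/
def mode' (ν : ℂ) (a : ℝ) : ℂ → ℂ →L[ℝ] ℂ := sepDeriv a (modeG ν a) (modeG' ν a)

lemma isEig_mode (ν : ℂ) {a : ℝ} (ha : a ≠ 0) :
    IsEig ν {z : ℂ | 0 < z.im} (mode ν a) (mode' ν a) :=
  isEig_sep a (fun _ hy => hasDerivAt_modeG ν ha hy) fun _ hy => hasDerivAt_modeG' ν ha hy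

/-- The constant serves all frequencies |a| ≥ κ at once, because |a|y stays above κy₀. This
uniformity is what summation over the frequencies requires. -/
lemma exists_norm_mode_le (ν : ℂ) {κ y₀ : ℝ} (hκ : 0 < κ) (hy₀ : 0 < y₀) :
    ∃ C, 0 ≤ C ∧ ∀ a : ℝ, κ ≤ |a| → ∀ z : ℂ, y₀ ≤ z.im →
      ‖mode ν a z‖ + ‖mode' ν a z‖ ≤ C * (1 + |a|) * Real.exp (-(|a| * z.im)) := by
  obtain ⟨C, hC, h⟩ := exists_norm_besselW_le_exp ν (mul_pos hκ hy₀)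
  refine ⟨2 * ((Real.sqrt κ)⁻¹ * C), by positivity, fun a ha z hz => ?_⟩
  have ht : κ * y₀ ≤ |a| * z.im := by gcongr
  have hr : (Real.sqrt |a|)⁻¹ ≤ (Real.sqrt κ)⁻¹ :=
    inv_anti₀ (Real.sqrt_pos.mpr hκ) (Real.sqrt_le_sqrt ha)
  have hr0 : 0 ≤ (Real.sqrt |a|)⁻¹ := by positivity
  have h1 : ‖modeG ν a z.im‖ ≤ (Real.sqrt κ)⁻¹ * C * Real.exp (-(|a| * z.im)) := by
    rw [modeG, norm_mul, Complex.norm_real, Real.norm_of_nonneg hr0, mul_assoc]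
    gcongr
    exact (h _ ht).1
  have h2 : ‖modeG' ν a z.im‖ ≤ (Real.sqrt κ)⁻¹ * C * |a| * Real.exp (-(|a| * z.im)) := by
    rw [modeG', norm_mul, norm_mul, Complex.norm_real, Complex.norm_real, Real.norm_of_nonneg hr0,
      Real.norm_of_nonneg (abs_nonneg a)]
    calc _ ≤ (Real.sqrt κ)⁻¹ * (|a| * (C * Real.exp (-(|a| * z.im)))) := by
          gcongr
          exact (h _ ht).2
      _ = _ := by ring
  have h3 : ‖mode ν a z‖ = ‖modeG ν a z.im‖ := by rw [mode, norm_mul, norm_charX, one_mul]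
  rw [h3]
  have h4 := norm_sepDeriv_le a (modeG ν a) (modeG' ν a) z
  have h5 := mul_le_mul_of_nonneg_left h1 (abs_nonneg a)
  have h6 : 0 ≤ (Real.sqrt κ)⁻¹ * C * Real.exp (-(|a| * z.im)) := by positivity
  rw [mode']
  nlinarith [abs_nonneg a]

lemma rapidDecay_mode (ν : ℂ) {a : ℝ} (ha : a ≠ 0) : RapidDecay (mode ν a) (mode' ν a) := by
  intro y₀ hy₀
  obtain ⟨C, hC, h⟩ := exists_norm_mode_le ν (abs_pos.mpr ha) hy₀
  refine ⟨C * (1 + |a|), |a|, abs_pos.mpr ha, fun z hz => ?_⟩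
  rw [neg_mul]
  exact h a le_rfl z hz

/-! ### The transform of the separated solutions -/

section

variable {ν s : ℂ}

lemma charX_add (a x : ℝ) (z : ℂ) :
    charX a (z + x) = Complex.exp (Complex.I * a * x) * charX a z := by
  rw [charX, charX, ← Complex.exp_add, Complex.add_re, Complex.ofReal_re]
  congr 1
  push_cast
  ring

lemma mode_add (ν : ℂ) (a x : ℝ) (z : ℂ) :
    mode ν a (z + x) = Complex.exp (Complex.I * a * x) * mode ν a z := by
  rw [mode, mode, charX_add]
  simp
  ring

lemma mode'_add (ν : ℂ) (a x : ℝ) (z : ℂ) :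
    mode' ν a (z + x) = Complex.exp (Complex.I * a * x) • mode' ν a z := by
  ext h
  simp [mode', sepDeriv, charX_add]
  ring

lemma kernelV_add (s ζ z : ℂ) (x : ℝ) : kernelV s (ζ + x) (z + x) = kernelV s ζ z := by
  simp [kernelV]

lemma kernelD_add (ζ z : ℂ) (x : ℝ) : kernelD (ζ + x) (z + x) = kernelD ζ z := by
  simp [kernelD]

/-- The contour of ζ + x is the translate of that of ζ, the kernel is invariant under simultaneous
real translation, and the mode acquires the character value. -/
lemma lewisF_mode_add (ν s : ℂ) (a x : ℝ) (ζ : ℂ) :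
    lewisF s (mode ν a) (mode' ν a) (ζ + x) =
      Complex.exp (Complex.I * a * x) * lewisF s (mode ν a) (mode' ν a) ζ := by
  rw [lewisF, lewisF, contourF, contourF, ← integral_const_mul]
  congr 1
  funext t
  have h : parabola (ζ + x) ((ζ + x).im / 2) t = parabola ζ (ζ.im / 2) t + x := by
    simp [parabola]
    ring
  rw [h]
  simp only [lewisForm, greenForm_apply, kernelV', kernelV_add, kernelD_add, mode_add, mode'_add]
  simp
  ring

/-- After multiplication by e^{-iaζ} the transform is holomorphic and invariant under real
translations. Its derivative in the real direction vanishes, hence so does its complex derivative.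
-/
lemma exists_lewisF_mode_eq (hνs : s = ν + 1 / 2) (hs : 0 ≤ s.re) {a : ℝ} (ha : a ≠ 0) :
    ∃ c : ℂ, ∀ ζ : ℂ, 0 < ζ.im →
      lewisF s (mode ν a) (mode' ν a) ζ = c * Complex.exp (Complex.I * a * ζ) := by
  set G : ℂ → ℂ := fun ζ =>
    lewisF s (mode ν a) (mode' ν a) ζ * Complex.exp (-(Complex.I * a * ζ)) with hG
  have hd : ∀ ζ : ℂ, 0 < ζ.im → DifferentiableAt ℂ G ζ := fun ζ hζ =>
    (differentiableAt_lewisF hνs hs (isEig_mode ν ha) (rapidDecay_mode ν ha) hζ).mul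
      (by fun_prop)
  have hx : ∀ (x : ℝ) (ζ : ℂ), G (ζ + x) = G ζ := by
    intro x ζ
    simp only [hG, lewisF_mode_add]
    have : Complex.exp (Complex.I * a * x) * Complex.exp (-(Complex.I * a * (ζ + x))) =
        Complex.exp (-(Complex.I * a * ζ)) := by
      rw [← Complex.exp_add]
      congr 1
      ring
    rw [← this]
    ring
  have hz : ∀ ζ : ℂ, 0 < ζ.im → HasDerivAt G 0 ζ := by
    intro ζ hζ
    have h1 := (hd ζ hζ).hasDerivAt
    have h2 : HasDerivAt (fun x : ℝ => G (ζ + x)) (deriv G ζ) 0 := by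
      have h3 : HasDerivAt (fun x : ℝ => ζ + (x : ℂ)) 1 (0 : ℝ) :=
        (Complex.ofRealCLM.hasDerivAt (x := 0)).const_add ζ
      have h4 : HasDerivAt G (deriv G ζ) (ζ + ((0 : ℝ) : ℂ)) := by simpa using h1
      simpa using! h4.comp (0 : ℝ) h3
    have h5 : (fun x : ℝ => G (ζ + x)) = fun _ => G ζ := funext fun x => hx x ζ
    rw [h5] at h2
    have := h2.unique (hasDerivAt_const _ _)
    rwa [this] at h1
  refine ⟨G Complex.I, fun ζ hζ => ?_⟩
  have hconst : G ζ = G Complex.I := by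
    have hc : IsPreconnected {z : ℂ | 0 < z.im} := (convex_halfSpace_im_gt 0).isPreconnected
    refine isOpen_im_pos.is_const_of_deriv_eq_zero hc
      (fun w hw => (hd w hw).differentiableWithinAt) (fun w hw => (hz w hw).deriv) hζ (by simp)
  rw [← hconst, hG]
  simp only
  rw [mul_assoc, ← Complex.exp_add]
  simp

/-- Substitute z ↦ az. The kernel contributes a^s and the mode a^(-1/2), while the form is otherwise
scale invariant. The product a^(s-1/2) = a^ν is the origin of the weights k^ν in f_u. -/
lemma lewisF_mode_scale (hνs : s = ν + 1 / 2) {a e : ℝ} (ha : 0 < a) (he : |e| = 1) {ζ : ℂ}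
    (hζ : 0 < ζ.im) :
    lewisF s (mode ν (a * e)) (mode' ν (a * e)) ζ =
      (a : ℂ) ^ ν * lewisF s (mode ν e) (mode' ν e) (a * ζ) := by
  rw [lewisF, lewisF, contourF, contourF, ← integral_const_mul]
  congr 1
  funext t
  have haC : (a : ℂ) ≠ 0 := by exact_mod_cast ha.ne'
  have hp : parabola (a * ζ) ((a * ζ).im / 2) t = a * parabola ζ (ζ.im / 2) t := by
    simp [parabola]
    ring
  have hp' : parabola' ((a * ζ).im / 2) t = a * parabola' (ζ.im / 2) t := by
    simp [parabola']
    ring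
  have hmem : parabola ζ (ζ.im / 2) t ∈ slitHalf ζ :=
    parabola_mem_slitHalf (by linarith) (by linarith) (by simp; linarith) t
  rw [hp, hp']
  generalize parabola ζ (ζ.im / 2) t = z at *
  generalize parabola' (ζ.im / 2) t = h at *
  have hz : 0 < z.im := hmem.1
  have him : ((a : ℂ) * z).im = a * z.im := by simp
  have habs : |a * e| = a := by rw [abs_mul, he, mul_one, abs_of_pos ha]
  have hsub : (a : ℂ) * z - a * ζ = a * (z - ζ) := by ring
  have hsub' : (starRingEnd ℂ) ((a : ℂ) * z) - a * ζ = a * ((starRingEnd ℂ) z - ζ) := by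
    rw [map_mul, Complex.conj_ofReal]
    ring
  have hK : kernelV s ζ z = (a : ℂ) ^ s * kernelV s (a * ζ) (a * z) := by
    rw [kernelV, kernelV, Complex.cpow_def_of_ne_zero haC, ← Complex.exp_add, hsub, hsub', him,
      Real.log_mul ha.ne' hz.ne', mul_left_comm, Complex.log_ofReal_mul ha
        (Complex.slitPlane_ne_zero (mem_slitPlane_left hmem)), mul_left_comm Complex.I,
      Complex.log_ofReal_mul ha (Complex.slitPlane_ne_zero
        (mem_slitPlane_right (by linarith))), ← Complex.ofReal_log ha.le]
    congr 1
    push_cast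
    ring
  have hD : ∀ h, kernelD (a * ζ) (a * z) (a * h) = kernelD ζ z h := by
    intro h
    rw [kernelD_apply, kernelD_apply, hsub, hsub', him, mul_div_mul_left _ _ haC, map_mul,
      Complex.conj_ofReal, mul_div_mul_left _ _ haC]
    congr 2
    rw [Complex.im_ofReal_mul]
    push_cast
    rw [mul_div_mul_left _ _ haC]
  have hr : (Real.sqrt a : ℂ) ≠ 0 := by exact_mod_cast (Real.sqrt_pos.mpr ha).ne'
  have hmode : mode ν (a * e) z = (Real.sqrt a : ℂ)⁻¹ * mode ν e (a * z) := by
    simp only [mode, modeG, charX, habs, he, him, Real.sqrt_one, inv_one, one_mul,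
      Complex.re_ofReal_mul]
    push_cast
    ring_nf
  have hmode' : ∀ h, mode' ν (a * e) z h = (Real.sqrt a : ℂ)⁻¹ * mode' ν e (a * z) (a * h) := by
    intro h
    simp [mode', sepDeriv, modeG, modeG', charX, habs, he]
    ring_nf
  have hpow : (a : ℂ) ^ s * (Real.sqrt a : ℂ)⁻¹ = (a : ℂ) ^ ν := by
    have : (Real.sqrt a : ℂ) = (a : ℂ) ^ (1 / 2 : ℂ) := by
      rw [Real.sqrt_eq_rpow, Complex.ofReal_cpow ha.le]
      norm_num
    rw [this, ← Complex.cpow_neg, ← Complex.cpow_add _ _ haC, hνs]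
    congr 1
    ring
  simp only [lewisForm, greenForm_apply, kernelV', smul_apply, smul_eq_mul]
  rw [show Complex.I * ((a : ℂ) * h) = a * (Complex.I * h) by ring, hD, hmode', hmode, hK, ← hpow]
  ring

end

end

end HigherOrderLewis

namespace HigherOrderLewis

noncomputable section

/-! ### The constant in the transform of a separated solution -/

lemma norm_one_add_mul_I_cpow_le {b : ℂ} (hb : b.re ≤ 1) (t : ℝ) :
    ‖((1 : ℂ) + t * Complex.I) ^ b‖ ≤ Real.exp (Real.pi * |b.im|) * (1 + |t|) := by
  have h1 : 1 ≤ ‖(1 : ℂ) + t * Complex.I‖ := by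
    have := Complex.abs_re_le_norm ((1 : ℂ) + t * Complex.I)
    rwa [re_one_add_mul_I, abs_one] at this
  rw [Complex.norm_cpow_of_ne_zero (one_add_mul_I_ne_zero t), div_eq_inv_mul, ← Real.exp_neg]
  refine mul_le_mul (Real.exp_le_exp.mpr ?_) ?_ (by positivity) (by positivity)
  · rw [← neg_mul]
    refine (le_abs_self _).trans ?_
    rw [abs_mul, abs_neg]
    gcongr
    exact Complex.abs_arg_le_pi _
  · calc _ ≤ ‖(1 : ℂ) + t * Complex.I‖ ^ (1 : ℝ) := Real.rpow_le_rpow_of_exponent_le h1 hb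
      _ ≤ _ := by
        rw [Real.rpow_one]
        exact norm_one_add_mul_I_le t

lemma continuous_one_add_mul_I_cpow (b : ℂ) :
    Continuous fun t : ℝ => ((1 : ℂ) + t * Complex.I) ^ b := by
  refine Continuous.cpow (by fun_prop) continuous_const fun t => ?_
  left
  simp

lemma norm_gaussian_mul_cpow_le {b : ℂ} (hb : b.re ≤ 1) (t : ℝ) :
    ‖Complex.exp ((1 + t * Complex.I) ^ 2) * (1 + t * Complex.I : ℂ) ^ b‖ ≤
      Real.exp 1 * Real.exp (Real.pi * |b.im|) * ((1 + |t|) * Real.exp (-1 * t ^ 2)) := by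
  rw [norm_mul, norm_cexp_sq]
  have h := norm_one_add_mul_I_cpow_le hb t
  calc _ ≤ Real.exp 1 * Real.exp (-1 * t ^ 2) * (Real.exp (Real.pi * |b.im|) * (1 + |t|)) := by
        gcongr
    _ = _ := by ring

lemma integrable_gaussian_mul_cpow {b : ℂ} (hb : b.re ≤ 1) : Integrable fun t : ℝ =>
    Complex.exp ((1 + t * Complex.I) ^ 2) * (1 + t * Complex.I : ℂ) ^ b := by
  refine ((integrable_abs_mul_exp_neg_sq one_pos).const_mul _).mono' ?_
    (ae_of_all _ (norm_gaussian_mul_cpow_le hb))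
  exact ((by fun_prop : Continuous fun t : ℝ => Complex.exp ((1 + t * Complex.I) ^ 2)).mul
    (continuous_one_add_mul_I_cpow b)).aestronglyMeasurable

/-- Integrate the derivative of e^{(1+it)²}(1+it)^(-2s), which tends to 0 at both ends. This merges
the two integrals that make up the constant of the transform. -/
lemma integral_gaussian_by_parts {s : ℂ} (hs : 0 ≤ s.re) :
    ∫ t : ℝ, Complex.exp ((1 + t * Complex.I) ^ 2) * (1 + t * Complex.I : ℂ) ^ (1 - 2 * s) =
      s * ∫ t : ℝ, Complex.exp ((1 + t * Complex.I) ^ 2) *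
        (1 + t * Complex.I : ℂ) ^ (-(2 * s + 1)) := by
  have i1 := integrable_gaussian_mul_cpow (b := 1 - 2 * s) (by simp; linarith)
  have i2 := integrable_gaussian_mul_cpow (b := -(2 * s + 1)) (by simp; linarith)
  have hd : ∀ t : ℝ, HasDerivAt (fun t : ℝ => Complex.exp ((1 + t * Complex.I) ^ 2) *
      (1 + t * Complex.I : ℂ) ^ (-(2 * s)))
      (2 * Complex.I * (Complex.exp ((1 + t * Complex.I) ^ 2) *
        (1 + t * Complex.I : ℂ) ^ (1 - 2 * s) - s * (Complex.exp ((1 + t * Complex.I) ^ 2) *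
        (1 + t * Complex.I : ℂ) ^ (-(2 * s + 1))))) t := by
    intro t
    have h0 : HasDerivAt (fun t : ℝ => (1 : ℂ) + (t : ℂ) * Complex.I) Complex.I t := by
      simpa using ((Complex.ofRealCLM.hasDerivAt (x := t)).mul_const Complex.I).const_add (1 : ℂ)
    have h1 := (h0.pow 2).cexp
    have h2 : HasDerivAt (fun t : ℝ => (1 + t * Complex.I : ℂ) ^ (-(2 * s)))
        (-(2 * s) * (1 + t * Complex.I : ℂ) ^ (-(2 * s) - 1) * Complex.I) t :=
      by
        have h := (((hasDerivAt_id (1 + t * Complex.I : ℂ)).cpow_const (c := -(2 * s))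
          (by left; simp)).comp t h0)
        simpa [Function.comp_def] using! h
    refine (h1.mul h2).congr_deriv ?_
    have e1 : (1 + t * Complex.I : ℂ) ^ (1 - 2 * s) =
        (1 + t * Complex.I : ℂ) * (1 + t * Complex.I : ℂ) ^ (-(2 * s)) := by
      rw [sub_eq_add_neg, Complex.cpow_add _ _ (one_add_mul_I_ne_zero t), Complex.cpow_one]
    have e2 : -(2 * s + 1) = -(2 * s) - 1 := by ring
    rw [e1, e2]
    simp
    ring
  have hlim : Tendsto (fun t : ℝ => Complex.exp ((1 + t * Complex.I) ^ 2) *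
      (1 + t * Complex.I : ℂ) ^ (-(2 * s))) (cocompact ℝ) (𝓝 0) := by
    have hb : (-(2 * s)).re ≤ 1 := by simp; linarith
    have h1 := (tendsto_exp_neg_sq one_pos 1 0)
    have h2 := (tendsto_exp_neg_sq one_pos 0 1)
    have h3 := (h1.add h2).const_mul (Real.exp 1 * Real.exp (Real.pi * |(-(2 * s)).im|))
    rw [add_zero, mul_zero] at h3
    refine squeeze_zero_norm (fun t => (norm_gaussian_mul_cpow_le hb t).trans (le_of_eq ?_)) h3
    simp
    ring
  have h := integral_of_hasDerivAt_of_tendsto hd ((i1.sub (i2.const_mul s)).const_mul _)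
    (hlim.mono_left atBot_le_cocompact) (hlim.mono_left atTop_le_cocompact)
  rw [integral_const_mul, integral_sub i1 (i2.const_mul s), integral_const_mul, sub_zero] at h
  have h2 : (2 : ℂ) * Complex.I ≠ 0 := by simp
  exact sub_eq_zero.mp ((mul_eq_zero.mp h).resolve_left h2)

/-- The limit of the integrand for a separated solution. -/
def modeLimit (s : ℂ) (e t : ℝ) : ℂ :=
  -2 * (Real.sqrt (Real.pi / 2) : ℝ) * Complex.exp (-(s * Real.log 2)) *
    Complex.exp (2 * e * t * Complex.I + 1 - t ^ 2) *
    ((1 + t * Complex.I) ^ (-(2 * s)) *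
      (1 + e * t * Complex.I + s * (1 + t * Complex.I)⁻¹))

lemma modeLimit_one (s : ℂ) (t : ℝ) : modeLimit s 1 t =
    -2 * (Real.sqrt (Real.pi / 2) : ℝ) * Complex.exp (-(s * Real.log 2)) *
      (Complex.exp ((1 + t * Complex.I) ^ 2) * (1 + t * Complex.I : ℂ) ^ (1 - 2 * s) +
      s * (Complex.exp ((1 + t * Complex.I) ^ 2) * (1 + t * Complex.I : ℂ) ^ (-(2 * s + 1)))) := by
  have h0 := one_add_mul_I_ne_zero t
  have e1 : (1 + t * Complex.I : ℂ) ^ (1 - 2 * s) =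
      (1 + t * Complex.I : ℂ) * (1 + t * Complex.I : ℂ) ^ (-(2 * s)) := by
    rw [sub_eq_add_neg, Complex.cpow_add _ _ h0, Complex.cpow_one]
  have e2 : (1 + t * Complex.I : ℂ) ^ (-(2 * s + 1)) =
      (1 + t * Complex.I : ℂ) ^ (-(2 * s)) * (1 + t * Complex.I : ℂ)⁻¹ := by
    rw [neg_add, Complex.cpow_add _ _ h0, Complex.cpow_neg_one]
  have e3 : (2 * ((1 : ℝ) : ℂ) * t * Complex.I + 1 - t ^ 2 : ℂ) = (1 + t * Complex.I) ^ 2 := by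
    push_cast
    linear_combination (-(t : ℂ) ^ 2) * Complex.I_sq
  rw [modeLimit, e1, e2, e3]
  push_cast
  ring

/-- By parts the two terms of `modeLimit_one` have equal integrals, so they add up instead of
cancelling, and each is s times a Gaussian integral already known to be nonzero. -/
lemma integral_modeLimit_one_ne_zero {s : ℂ} (hs : 0 < s.re) : ∫ t, modeLimit s 1 t ≠ 0 := by
  have i1 := integrable_gaussian_mul_cpow (b := 1 - 2 * s) (by simp; linarith)
  have i2 := integrable_gaussian_mul_cpow (b := -(2 * s + 1)) (by simp; linarith)
  have h0 := integral_gaussian_mul_cpow_ne_zero (a := 2 * s + 1) (by simp; linarith)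
  have hs0 : s ≠ 0 := fun h => by simp [h] at hs
  simp_rw [modeLimit_one]
  rw [integral_const_mul, integral_add i1 (i2.const_mul s), integral_const_mul,
    integral_gaussian_by_parts hs.le, ← two_mul]
  have h3 : ((Real.sqrt (Real.pi / 2) : ℝ) : ℂ) ≠ 0 := by
    exact_mod_cast (Real.sqrt_pos.mpr (by positivity)).ne'
  have h4 := Complex.exp_ne_zero (-(s * Real.log 2))
  simp only [ne_eq, mul_eq_zero, not_or]
  exact ⟨⟨⟨by norm_num, h3⟩, h4⟩, by norm_num, hs0, h0⟩

section

variable {ν s : ℂ} {e : ℝ}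

lemma mode_of_abs_eq_one (he : |e| = 1) (z : ℂ) :
    mode ν e z = charX e z * besselW ν z.im := by
  simp [mode, modeG, he]

lemma mode'_of_abs_eq_one (he : |e| = 1) (z h : ℂ) :
    mode' ν e z h = charX e z * (Complex.I * e * besselW ν z.im * h.re + besselW' ν z.im * h.im) := by
  simp [mode', sepDeriv, modeG, modeG', he]
  ring

lemma tendsto_exp_mul_of_shift {g : ℝ → ℂ} {L : ℂ}
    (h : Tendsto (fun t : ℝ => (Real.exp t : ℂ) * g t) atTop (𝓝 L)) (c : ℝ) :
    Tendsto (fun Y : ℝ => (Real.exp Y : ℂ) * g (Y + c)) atTop (𝓝 (Complex.exp (-c) * L)) := by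
  have h1 := (h.comp (tendsto_atTop_add_const_right atTop c tendsto_id)).const_mul
    (Complex.exp (-c))
  refine h1.congr fun Y => ?_
  simp only [Function.comp_apply, id]
  rw [← mul_assoc, ← Complex.ofReal_neg, ← Complex.ofReal_exp, ← Complex.ofReal_mul,
    ← Real.exp_add]
  congr 3
  ring

/-- For ζ = iY and z = ζ + γ one has y ~ Y and i(z̄ - ζ) ~ 2Y. The growth cancels and (2iγ)^(-s),
with the indicated branch, remains. -/
lemma tendsto_kernelV_vertical (s : ℂ) {γ : ℂ} :
    Tendsto (fun Y : ℝ => kernelV s (Y * Complex.I) (Y * Complex.I + γ)) atTop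
      (𝓝 (Complex.exp (s * (-Real.log 2 - Complex.log (Complex.I * γ))))) := by
  have hinv : Tendsto (fun Y : ℝ => ((Y⁻¹ : ℝ) : ℂ)) atTop (𝓝 0) := by
    have := (Complex.continuous_ofReal.tendsto 0).comp tendsto_inv_atTop_zero
    simpa [Function.comp_def] using! this
  have hlog : Tendsto (fun Y : ℝ => Complex.log (1 + γ.im * ((Y⁻¹ : ℝ) : ℂ)) -
      Complex.log (2 + Complex.I * (starRingEnd ℂ) γ * ((Y⁻¹ : ℝ) : ℂ))) atTop
      (𝓝 (-Real.log 2)) := by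
    have h1 : Tendsto (fun Y : ℝ => 1 + (γ.im : ℂ) * ((Y⁻¹ : ℝ) : ℂ)) atTop (𝓝 1) := by
      simpa using (hinv.const_mul (γ.im : ℂ)).const_add 1
    have h2 : Tendsto (fun Y : ℝ => 2 + Complex.I * (starRingEnd ℂ) γ * ((Y⁻¹ : ℝ) : ℂ)) atTop
        (𝓝 2) := by
      simpa using (hinv.const_mul (Complex.I * (starRingEnd ℂ) γ)).const_add 2
    have h3 := (h1.clog (by simp)).sub (h2.clog (by left; simp))
    convert! h3 using 1
    rw [Complex.log_one, zero_sub, ← Complex.ofReal_ofNat, Complex.ofReal_log (by norm_num)]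
  refine (((hlog.sub_const (Complex.log (Complex.I * γ))).const_mul s).cexp).congr' ?_
  filter_upwards [eventually_gt_atTop 0, eventually_gt_atTop (-γ.im)] with Y hY hY'
  rw [kernelV]
  have hYC : (Y : ℂ) ≠ 0 := by exact_mod_cast hY.ne'
  have e1 : (((Y : ℂ) * Complex.I + γ).im) = Y * (1 + γ.im * Y⁻¹) := by
    simp
    field_simp
  have hpos : 0 < 1 + γ.im * Y⁻¹ := by
    have : 0 < Y * (1 + γ.im * Y⁻¹) := by
      rw [mul_add, mul_one, mul_comm γ.im, ← mul_assoc, mul_inv_cancel₀ hY.ne', one_mul]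
      linarith
    exact (mul_pos_iff_of_pos_left hY).mp this
  have e2 : Complex.I * ((starRingEnd ℂ) ((Y : ℂ) * Complex.I + γ) - Y * Complex.I) =
      (Y : ℂ) * (2 + Complex.I * (starRingEnd ℂ) γ * ((Y⁻¹ : ℝ) : ℂ)) := by
    simp
    field_simp
    linear_combination (-2 * (Y : ℂ)) * Complex.I_sq
  have hne : 2 + Complex.I * (starRingEnd ℂ) γ * ((Y⁻¹ : ℝ) : ℂ) ≠ 0 := by
    intro h0
    have := congrArg Complex.re h0
    simp at this
    have h1 : 0 < 1 + γ.im * Y⁻¹ := hpos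
    nlinarith
  rw [e1, add_sub_cancel_left, e2, Real.log_mul hY.ne' hpos.ne', Complex.log_ofReal_mul hY hne]
  congr 2
  have e3 : (1 + (γ.im : ℂ) * ((Y⁻¹ : ℝ) : ℂ)) = ((1 + γ.im * Y⁻¹ : ℝ) : ℂ) := by push_cast; ring
  rw [e3, ← Complex.ofReal_log hpos.le]
  push_cast
  ring

lemma tendsto_kernelD_vertical {γ : ℂ} (h : ℂ) :
    Tendsto (fun Y : ℝ => kernelD (Y * Complex.I) (Y * Complex.I + γ) h) atTop (𝓝 (-h / γ)) := by
  have h1 : Tendsto (fun Y : ℝ => (h.im : ℂ) / ((Y + γ.im : ℝ) : ℂ)) atTop (𝓝 0) := by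
    have h0 : Tendsto (fun Y : ℝ => (Y + γ.im)⁻¹) atTop (𝓝 0) :=
      tendsto_inv_atTop_zero.comp (tendsto_atTop_add_const_right _ _ tendsto_id)
    have := ((Complex.continuous_ofReal.tendsto 0).comp h0).const_mul (h.im : ℂ)
    simpa [Function.comp_def, div_eq_mul_inv] using! this
  have h2 : Tendsto (fun Y : ℝ => (starRingEnd ℂ) h /
      ((starRingEnd ℂ) ((Y : ℂ) * Complex.I + γ) - Y * Complex.I)) atTop (𝓝 0) := by
    rw [tendsto_zero_iff_norm_tendsto_zero]
    have h0 : Tendsto (fun Y : ℝ => ‖h‖ * (2 * Y + γ.im)⁻¹) atTop (𝓝 0) := by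
      have : Tendsto (fun Y : ℝ => (2 * Y + γ.im)⁻¹) atTop (𝓝 0) :=
        tendsto_inv_atTop_zero.comp (tendsto_atTop_add_const_right _ _
          (tendsto_id.const_mul_atTop two_pos))
      simpa using this.const_mul ‖h‖
    refine squeeze_zero' (Eventually.of_forall fun _ => norm_nonneg _) ?_ h0
    filter_upwards [eventually_gt_atTop (-γ.im / 2)] with Y hY
    rw [norm_div, RCLike.norm_conj, div_eq_mul_inv]
    have hpos : 0 < 2 * Y + γ.im := by linarith
    gcongr
    refine le_trans ?_ (Complex.abs_im_le_norm _)
    refine le_trans (le_of_eq ?_) (neg_le_abs _)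
    simp
    ring
  have h3 := (h1.sub (tendsto_const_nhds (x := h / γ))).sub h2
  rw [zero_sub, sub_zero, ← neg_div] at h3
  refine h3.congr fun Y => ?_
  rw [kernelD_apply, add_sub_cancel_left]
  simp

/-- On parabolas of fixed size r = 1 the difference γ = z - ζ = -i(1+it)² does not depend on Y, and
iγ is a perfect square. The limit of the integrand is therefore explicit. -/
lemma tendsto_lewisForm_mode (he : |e| = 1) (t : ℝ) :
    Tendsto (fun Y : ℝ => (Real.exp Y : ℂ) * lewisForm s (mode ν e) (mode' ν e) (Y * Complex.I)
      (parabola (Y * Complex.I) 1 t) (parabola' 1 t)) atTop (𝓝 (modeLimit s e t)) := by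
  set p : ℂ := 1 + t * Complex.I with hp
  have hp0 : p ≠ 0 := one_add_mul_I_ne_zero t
  set γ : ℂ := -(Complex.I * p ^ 2) with hγ
  have hpar : ∀ Y : ℝ, parabola (Y * Complex.I) 1 t = Y * Complex.I + γ := fun Y => by
    rw [parabola, hγ, hp]
    push_cast
    ring
  have him : ∀ Y : ℝ, (parabola (Y * Complex.I) 1 t).im = Y + (t ^ 2 - 1) := fun Y => by
    rw [parabola_im]
    simp
  have hre : ∀ Y : ℝ, charX e (parabola (Y * Complex.I) 1 t) =
      Complex.exp (2 * e * t * Complex.I) := fun Y => by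
    rw [charX, parabola_re]
    simp
    ring_nf
  have h1 := tendsto_exp_mul_of_shift (tendsto_besselW ν) (t ^ 2 - 1)
  have h2 := tendsto_exp_mul_of_shift (tendsto_besselW' ν) (t ^ 2 - 1)
  have h3 := tendsto_kernelV_vertical s (γ := γ)
  have h4 := tendsto_kernelD_vertical (γ := γ) (Complex.I * parabola' 1 t)
  set w := Complex.I * parabola' 1 t with hw
  set c := Complex.exp (2 * e * t * Complex.I) with hc
  have h5 := ((((h1.const_mul (Complex.I * e)).mul_const (w.re : ℂ)).add
    (h2.mul_const (w.im : ℂ))).const_mul c).mul h3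
  have h6 := ((h1.const_mul c).mul ((h3.const_mul s).mul h4))
  have h7 := h5.sub h6
  have hwre : w.re = -2 * t := by
    rw [hw, parabola']
    simp
  have hwim : w.im = 2 := by
    rw [hw, parabola']
    simp
  have hIγ : Complex.I * γ = p ^ 2 := by
    rw [hγ]
    linear_combination (-p ^ 2) * Complex.I_sq
  -- Since Re p = 1, the argument of p lies within π/2 and the principal logarithm doubles without
  -- correction.
  have hlog : Complex.log (p ^ 2) = 2 * Complex.log p := by
    have harg : |Complex.arg p| < Real.pi / 2 := by
      rw [Complex.abs_arg_lt_pi_div_two_iff]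
      left
      simp [hp]
    have := abs_lt.mp harg
    rw [pow_two, Complex.log_mul hp0 hp0 ⟨by linarith, by linarith⟩, two_mul]
  have hwγ : -w / γ = 2 / p := by
    rw [hw, hγ, parabola']
    rw [← hp]
    have := Complex.I_ne_zero
    push_cast
    field_simp
  convert! h7 using 1
  · funext Y
    rw [lewisForm, greenForm_apply, mode_of_abs_eq_one he, mode'_of_abs_eq_one he, hre, him,
      kernelV', smul_apply, smul_eq_mul, hpar]
    ring
  · rw [modeLimit, hwre, hwim, hIγ, hlog, hwγ, ← hp]
    have e1 : Complex.exp (s * (-Real.log 2 - 2 * Complex.log p)) =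
        Complex.exp (-(s * Real.log 2)) * p ^ (-(2 * s)) := by
      rw [Complex.cpow_def_of_ne_zero hp0, ← Complex.exp_add]
      congr 1
      ring
    have e2 : Complex.exp (2 * e * t * Complex.I + 1 - t ^ 2) =
        c * Complex.exp (-((t ^ 2 - 1 : ℝ) : ℂ)) := by
      rw [hc, ← Complex.exp_add]
      congr 1
      push_cast
      ring
    rw [e1, e2]
    push_cast
    ring_nf

/-- Dominated convergence: the factor e^Y cancels against the decay e^{-(Y+t²-1)} of the mode, which
leaves a Gaussian in t. -/
lemma tendsto_lewisF_mode (hνs : s = ν + 1 / 2) (hs : 0 ≤ s.re) (he : |e| = 1) :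
    Tendsto (fun Y : ℝ => (Real.exp Y : ℂ) * lewisF s (mode ν e) (mode' ν e) (Y * Complex.I)) atTop
      (𝓝 (∫ t, modeLimit s e t)) := by
  have he0 : e ≠ 0 := fun h => by simp [h] at he
  obtain ⟨C, hC, hb⟩ := exists_norm_mode_le ν one_pos one_pos
  have hmem : ∀ Y : ℝ, 2 ≤ Y → ∀ t, parabola (Y * Complex.I) 1 t ∈ slitHalf (Y * Complex.I) :=
    fun Y hY => parabola_mem_slitHalf one_pos (by simp; linarith) (by simp)
  have hlim : Tendsto (fun Y : ℝ => ∫ t, (Real.exp Y : ℂ) * lewisForm s (mode ν e) (mode' ν e)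
      (Y * Complex.I) (parabola (Y * Complex.I) 1 t) (parabola' 1 t)) atTop
      (𝓝 (∫ t, modeLimit s e t)) := by
    refine tendsto_integral_filter_of_dominated_convergence
      (fun t => kernelBound s 1 1 * (C * 2) * Real.exp 1 * 2 *
        ((1 + |t|) * Real.exp (-1 * t ^ 2))) ?_ ?_
      ((integrable_abs_mul_exp_neg_sq one_pos).const_mul _)
      (ae_of_all _ fun t => tendsto_lewisForm_mode he t)
    · filter_upwards [eventually_ge_atTop 2] with Y hY
      exact (continuous_const.mul (continuous_lewisForm_parabola hνs (isEig_mode ν he0)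
        (by simp; linarith) (hmem Y hY))).aestronglyMeasurable
    · filter_upwards [eventually_ge_atTop 2] with Y hY
      refine ae_of_all _ fun t => ?_
      have him : (parabola (Y * Complex.I) 1 t).im = Y + (t ^ 2 - 1) := by
        rw [parabola_im]
        simp
      have him1 : 1 ≤ (parabola (Y * Complex.I) 1 t).im := by
        rw [him]
        nlinarith [sq_nonneg t]
      have h1 := norm_lewisForm_le (s := s) (ζ := Y * Complex.I) (u := mode ν e)
        (u₁ := mode' ν e) hs (by simp; linarith) one_pos him1 one_pos
        (norm_parabola_sub (Y * Complex.I) one_pos t)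
      have h2 := hb e he.ge _ him1
      rw [he, one_mul, him] at h2
      have h3 := norm_parabola'_le zero_le_one t
      have h4 := kernelBound_nonneg s one_pos one_pos
      rw [norm_mul, Complex.norm_real, Real.norm_eq_abs, Real.abs_exp]
      calc _ ≤ Real.exp Y * ((kernelBound s 1 1 * (C * (1 + 1) *
            Real.exp (-(Y + (t ^ 2 - 1))))) * (2 * 1 * (1 + |t|))) := by
            refine mul_le_mul_of_nonneg_left ?_ (Real.exp_pos _).le
            refine (ContinuousLinearMap.le_opNorm _ _).trans ?_
            refine mul_le_mul (h1.trans ?_) h3 (norm_nonneg _) (by positivity)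
            exact mul_le_mul_of_nonneg_left h2 h4
        _ = _ := by
          rw [show -(Y + (t ^ 2 - 1)) = -Y + (1 + -1 * t ^ 2) by ring, Real.exp_add, Real.exp_add,
            Real.exp_neg]
          field_simp
          ring
  refine hlim.congr' ?_
  filter_upwards [eventually_ge_atTop 2] with Y hY
  rw [integral_const_mul, lewisF_eq hνs hs (isEig_mode ν he0) (rapidDecay_mode ν he0)
    (p := Y * Complex.I) one_pos (by simp; linarith) (by simp)]
  rfl

/-- The constant relating the transform and the coefficients. -/
def lewisConst (s : ℂ) : ℂ := ∫ t, modeLimit s 1 t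

lemma lewisConst_ne_zero {s : ℂ} (hs : 0 < s.re) : lewisConst s ≠ 0 :=
  integral_modeLimit_one_ne_zero hs

lemma lewisF_mode_one (hνs : s = ν + 1 / 2) (hs : 0 ≤ s.re) {ζ : ℂ} (hζ : 0 < ζ.im) :
    lewisF s (mode ν 1) (mode' ν 1) ζ = lewisConst s * Complex.exp (Complex.I * ζ) := by
  obtain ⟨c, hc⟩ := exists_lewisF_mode_eq hνs hs one_ne_zero
  have h := tendsto_lewisF_mode (ν := ν) hνs hs abs_one
  have h2 : Tendsto (fun Y : ℝ => (Real.exp Y : ℂ) * lewisF s (mode ν 1) (mode' ν 1)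
      (Y * Complex.I)) atTop (𝓝 c) := by
    refine tendsto_const_nhds.congr' ?_
    filter_upwards [eventually_gt_atTop 0] with Y hY
    rw [hc _ (by simpa using hY), mul_left_comm, Complex.ofReal_exp, ← Complex.exp_add]
    have : (Y : ℂ) + Complex.I * ((1 : ℝ) : ℂ) * (Y * Complex.I) = 0 := by
      push_cast
      linear_combination (Y : ℂ) * Complex.I_sq
    rw [this, Complex.exp_zero, mul_one]
  rw [hc ζ hζ, tendsto_nhds_unique h2 h, lewisConst]
  simp

/-- At ζ = iY the transform equals c e^Y, whereas the limit just computed shows that it is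
O(e^{-Y}). Hence c = 0. -/
lemma lewisF_mode_neg_one (hνs : s = ν + 1 / 2) (hs : 0 ≤ s.re) {ζ : ℂ} (hζ : 0 < ζ.im) :
    lewisF s (mode ν (-1)) (mode' ν (-1)) ζ = 0 := by
  obtain ⟨c, hc⟩ := exists_lewisF_mode_eq (ν := ν) hνs hs (neg_ne_zero.mpr one_ne_zero)
  have h := tendsto_lewisF_mode (ν := ν) hνs hs (e := -1) (by simp)
  have h3 : Tendsto (fun Y : ℝ => ((Real.exp (-(2 * Y)) : ℝ) : ℂ)) atTop (𝓝 0) := by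
    have h4 : Tendsto (fun Y : ℝ => Real.exp (-(2 * Y))) atTop (𝓝 0) :=
      Real.tendsto_exp_neg_atTop_nhds_zero.comp (tendsto_id.const_mul_atTop two_pos)
    have := (Complex.continuous_ofReal.tendsto 0).comp h4
    simpa [Function.comp_def] using! this
  have h2 : Tendsto (fun Y : ℝ => ((Real.exp (-(2 * Y)) : ℝ) : ℂ) * ((Real.exp Y : ℂ) *
      lewisF s (mode ν (-1)) (mode' ν (-1)) (Y * Complex.I))) atTop (𝓝 c) := by
    refine tendsto_const_nhds.congr' ?_
    filter_upwards [eventually_gt_atTop 0] with Y hY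
    rw [hc _ (by simpa using hY), mul_left_comm _ c, mul_left_comm _ c, Complex.ofReal_exp,
      Complex.ofReal_exp, ← Complex.exp_add, ← Complex.exp_add]
    have : ((-(2 * Y) : ℝ) : ℂ) + ((Y : ℂ) + Complex.I * ((-1 : ℝ) : ℂ) * (Y * Complex.I)) = 0 := by
      push_cast
      linear_combination (-(Y : ℂ)) * Complex.I_sq
    rw [this, Complex.exp_zero, mul_one]
  have h5 := h3.mul h
  rw [zero_mul] at h5
  rw [hc ζ hζ, tendsto_nhds_unique h2 h5, zero_mul]

lemma lewisF_mode_of_pos (hνs : s = ν + 1 / 2) (hs : 0 ≤ s.re) {a : ℝ} (ha : 0 < a) {ζ : ℂ}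
    (hζ : 0 < ζ.im) : lewisF s (mode ν a) (mode' ν a) ζ =
      lewisConst s * (a : ℂ) ^ ν * Complex.exp (Complex.I * a * ζ) := by
  have h := lewisF_mode_scale hνs ha abs_one hζ
  rw [mul_one] at h
  rw [h, lewisF_mode_one hνs hs (by simpa using mul_pos ha hζ), ← mul_assoc Complex.I]
  ring

lemma lewisF_mode_of_neg (hνs : s = ν + 1 / 2) (hs : 0 ≤ s.re) {a : ℝ} (ha : a < 0) {ζ : ℂ}
    (hζ : 0 < ζ.im) : lewisF s (mode ν a) (mode' ν a) ζ = 0 := by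
  have h := lewisF_mode_scale (ν := ν) hνs (neg_pos.mpr ha) (e := -1) (by simp) hζ
  rw [neg_mul_neg, mul_one] at h
  rw [h, lewisF_mode_neg_one hνs hs (by simpa using mul_pos (neg_pos.mpr ha) hζ), mul_zero]

end

end

end HigherOrderLewis

namespace HigherOrderLewis

noncomputable section

/-! ### Fourier-Bessel series -/

lemma isEig_of_contDiffOn {ν : ℂ} {u : ℂ → ℂ} (hc : ContDiffOn ℝ 2 u {z : ℂ | 0 < z.im})
    (hl : ∀ z : ℂ, 0 < z.im →
      -((z.im : ℂ) ^ 2) * (Laplacian.laplacian u : ℂ → ℂ) z = (1 / 4 - ν ^ 2) * u z) :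
    IsEig ν {z : ℂ | 0 < z.im} u (fderiv ℝ u) := by
  intro z hz
  have hz' : {z : ℂ | 0 < z.im} ∈ 𝓝 z := isOpen_im_pos.mem_nhds hz
  have h1 : ContDiffOn ℝ 1 (fderiv ℝ u) {z : ℂ | 0 < z.im} :=
    hc.fderiv_of_isOpen isOpen_im_pos (by norm_num)
  refine ⟨((hc.contDiffAt hz').differentiableAt (by norm_num)).hasFDerivAt,
    fderiv ℝ (fderiv ℝ u) z, ((h1.contDiffAt hz').differentiableAt (by norm_num)).hasFDerivAt, ?_⟩
  have h2 := hl z hz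
  rw [InnerProductSpace.laplacian_eq_iteratedFDeriv_complexPlane] at h2
  simp only [iteratedFDeriv_two_apply, Matrix.cons_val_zero, Matrix.cons_val_one] at h2
  have hy : (z.im : ℂ) ≠ 0 := by exact_mod_cast (ne_of_gt (show 0 < z.im from hz))
  rw [div_mul_eq_mul_div, eq_div_iff (pow_ne_zero 2 hy)]
  linear_combination -h2

/-- Growth less than any exponential. -/
def SubExp {E : Type*} [NormedAddCommGroup E] (a : ℤ → E) : Prop :=
  ∀ δ > 0, ∃ C, 0 ≤ C ∧ ∀ k : ℤ, ‖a k‖ ≤ C * Real.exp (δ * |(k : ℝ)|)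

/-- The expansion of a function on the upper half plane in separated solutions. -/
def IsExpansion (ν : ℂ) (κ : ℝ) (a : ℤ → ℂ) (u : ℂ → ℂ) : Prop :=
  a 0 = 0 ∧ ∀ z : ℂ, 0 < z.im → HasSum (fun k : ℤ => a k * mode ν (κ * k) z) (u z)

lemma summable_exp_neg_mul_abs {c : ℝ} (hc : 0 < c) :
    Summable fun k : ℤ => Real.exp (-(c * |(k : ℝ)|)) := by
  have h : Summable fun n : ℕ => Real.exp (-(c * |(n : ℝ)|)) := by
    refine (Real.summable_exp_nat_mul_iff.mpr (neg_neg_of_pos hc)).congr fun n => ?_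
    rw [Nat.abs_cast]
    congr 1
    ring
  exact Summable.of_nat_of_neg (by simpa using h) (by simpa using h)

lemma one_add_mul_le_exp {κ c x : ℝ} (hκ : 0 < κ) (hc : 0 < c) (hx : 0 ≤ x) :
    1 + κ * x ≤ (1 + κ / c) * Real.exp (c * x) := by
  have h1 := Real.add_one_le_exp (c * x)
  have h2 : 1 ≤ Real.exp (c * x) := Real.one_le_exp (by positivity)
  have h3 : κ * x ≤ κ / c * Real.exp (c * x) := by
    calc κ * x = κ / c * (c * x) := by field_simp
      _ ≤ _ := by gcongr; linarith
  linarith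

/-- At the height y = δ/(2κ) the terms of the convergent series tend to 0, while the mode is at
least a constant times e^{-δ|k|/2}/√(κ|k|). So the coefficients are O(√|k| e^{δ|k|/2}). -/
lemma IsExpansion.subExp {ν : ℂ} {κ : ℝ} (hκ : 0 < κ) {a : ℤ → ℂ} {u : ℂ → ℂ}
    (h : IsExpansion ν κ a u) : SubExp a := by
  intro δ hδ
  obtain ⟨t₁, ht₁, c, hc, hb⟩ := exists_le_norm_besselW ν
  set y : ℝ := δ / (2 * κ) with hy
  have hy0 : 0 < y := by positivity
  have hκy : κ * y = δ / 2 := by rw [hy]; field_simp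
  have hz : 0 < ((y : ℂ) * Complex.I).im := by simpa using hy0
  have h1 := (h.2 _ hz).summable.tendsto_cofinite_zero.norm
  rw [norm_zero] at h1
  have h2 : Tendsto (fun k : ℤ => δ / 2 * |(k : ℝ)|) cofinite atTop :=
    ((tendsto_norm_cocompact_atTop (E := ℝ)).comp Int.tendsto_coe_cofinite).const_mul_atTop
      (by positivity)
  have hO : a =O[cofinite] fun k : ℤ => Real.exp (δ * |(k : ℝ)|) := by
    refine Asymptotics.IsBigO.of_bound (c⁻¹ * (1 + κ / (δ / 2))) ?_
    filter_upwards [h1.eventually_le_const one_pos, h2.eventually_ge_atTop t₁,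
      h2.eventually_gt_atTop 0] with k hk1 hk2 hk3
    have hk : 0 < |(k : ℝ)| := (mul_pos_iff_of_pos_left (by positivity)).mp hk3
    have habs : |κ * k| = κ * |(k : ℝ)| := by rw [abs_mul, abs_of_pos hκ]
    have harg : |κ * k| * y = δ / 2 * |(k : ℝ)| := by rw [habs, ← hκy]; ring
    have hq : 0 < κ * |(k : ℝ)| := by positivity
    have hsq : 0 < Real.sqrt (κ * |(k : ℝ)|) := Real.sqrt_pos.mpr hq
    rw [norm_mul, mode, norm_mul, norm_charX, one_mul, modeG, norm_mul, Complex.norm_real,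
      Complex.mul_I_im, Complex.ofReal_re, harg, habs, Real.norm_of_nonneg (by positivity)] at hk1
    have h3 := hb _ hk2
    have h4 : ‖a k‖ * (Real.sqrt (κ * |(k : ℝ)|))⁻¹ * (c * Real.exp (-(δ / 2 * |(k : ℝ)|))) ≤ 1 := by
      refine le_trans ?_ hk1
      rw [mul_assoc]
      gcongr
    have h5 : ‖a k‖ ≤ Real.sqrt (κ * |(k : ℝ)|) * c⁻¹ * Real.exp (δ / 2 * |(k : ℝ)|) := by
      rw [Real.exp_neg] at h4
      have h6 := mul_le_mul_of_nonneg_right h4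
        (by positivity : 0 ≤ Real.sqrt (κ * |(k : ℝ)|) * c⁻¹ * Real.exp (δ / 2 * |(k : ℝ)|))
      rw [one_mul] at h6
      refine le_trans (le_of_eq ?_) h6
      have := (Real.exp_pos (δ / 2 * |(k : ℝ)|)).ne'
      field_simp
    have h7 : Real.sqrt (κ * |(k : ℝ)|) ≤ 1 + κ * |(k : ℝ)| := by
      rw [Real.sqrt_le_left (by positivity)]
      nlinarith
    have h8 := h7.trans (one_add_mul_le_exp hκ (half_pos hδ) hk.le)
    rw [Real.norm_of_nonneg (Real.exp_pos _).le]
    calc ‖a k‖ ≤ ((1 + κ / (δ / 2)) * Real.exp (δ / 2 * |(k : ℝ)|)) * c⁻¹ *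
          Real.exp (δ / 2 * |(k : ℝ)|) := h5.trans (by gcongr)
      _ = c⁻¹ * (1 + κ / (δ / 2)) *
          (Real.exp (δ / 2 * |(k : ℝ)|) * Real.exp (δ / 2 * |(k : ℝ)|)) := by ring
      _ = _ := by
        rw [← Real.exp_add]
        ring_nf
  obtain ⟨C, hC⟩ := (Asymptotics.isBigO_cofinite_iff fun k hk =>
    absurd hk (Real.exp_pos _).ne').mp hO
  refine ⟨|C|, abs_nonneg _, fun k => (hC k).trans ?_⟩
  rw [Real.norm_of_nonneg (Real.exp_pos _).le]
  gcongr
  exact le_abs_self C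

/-- Half of the exponent κ|k|y is kept as κy/2. The other half is at least 4c|k| with c = κy₀/8: it
pays 2c|k| for the coefficient and c|k| for the factor 1 + |a|, and still leaves the summable
e^{-c|k|}. -/
lemma SubExp.exists_bound {ν : ℂ} {κ : ℝ} (hκ : 0 < κ) {a : ℤ → ℂ} (ha : SubExp a) (ha0 : a 0 = 0)
    {y₀ : ℝ} (hy₀ : 0 < y₀) : ∃ b : ℤ → ℝ, Summable b ∧ (∀ k, 0 ≤ b k) ∧
      ∀ (k : ℤ) (z : ℂ), y₀ ≤ z.im →
        ‖a k * mode ν (κ * k) z‖ + ‖a k • mode' ν (κ * k) z‖ ≤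
          b k * Real.exp (-(κ / 2) * z.im) := by
  obtain ⟨C, hC, hb⟩ := exists_norm_mode_le ν hκ hy₀
  set c : ℝ := κ * y₀ / 8 with hc
  have hc0 : 0 < c := by positivity
  obtain ⟨D, hD, hD'⟩ := ha (2 * c) (by positivity)
  refine ⟨fun k => D * C * (1 + κ / c) * Real.exp (-(c * |(k : ℝ)|)),
    (summable_exp_neg_mul_abs hc0).mul_left _, fun k => by positivity, fun k z hz => ?_⟩
  rcases eq_or_ne k 0 with rfl | hk
  · rw [ha0, zero_mul, zero_smul ℂ (mode' ν (κ * (0 : ℤ)) z), norm_zero, norm_zero, add_zero]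
    positivity
  have hk1 : 1 ≤ |(k : ℝ)| := by exact_mod_cast Int.one_le_abs hk
  have habs : |κ * k| = κ * |(k : ℝ)| := by rw [abs_mul, abs_of_pos hκ]
  have h1 := hb (κ * k) (by rw [habs]; nlinarith) z hz
  rw [habs] at h1
  have h2 := one_add_mul_le_exp hκ hc0 (abs_nonneg (k : ℝ))
  have hz0 : 0 < z.im := hy₀.trans_le hz
  rw [norm_mul, norm_smul, ← mul_add]
  calc _ ≤ D * Real.exp (2 * c * |(k : ℝ)|) *
        (C * ((1 + κ / c) * Real.exp (c * |(k : ℝ)|)) * Real.exp (-(κ * |(k : ℝ)| * z.im))) := by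
        refine mul_le_mul (hD' k) (h1.trans ?_) (by positivity) (by positivity)
        gcongr
    _ = D * C * (1 + κ / c) * (Real.exp (2 * c * |(k : ℝ)|) * Real.exp (c * |(k : ℝ)|) *
          Real.exp (-(κ * |(k : ℝ)| * z.im))) := by ring
    _ ≤ D * C * (1 + κ / c) * (Real.exp (-(c * |(k : ℝ)|)) * Real.exp (-(κ / 2) * z.im)) := by
        refine mul_le_mul_of_nonneg_left ?_ (by positivity)
        rw [← Real.exp_add, ← Real.exp_add, ← Real.exp_add]
        refine Real.exp_le_exp.mpr ?_
        have h3 : κ / 2 * |(k : ℝ)| * y₀ ≤ κ / 2 * |(k : ℝ)| * z.im := by gcongr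
        have h4 : κ / 2 * 1 * z.im ≤ κ / 2 * |(k : ℝ)| * z.im := by gcongr
        have h5 : c * |(k : ℝ)| = κ * y₀ * |(k : ℝ)| / 8 := by rw [hc]; ring
        nlinarith
    _ = _ := by ring

section

variable {ν s : ℂ} {κ : ℝ} {a : ℤ → ℂ} {u : ℂ → ℂ}

lemma hasFDerivAt_term (hκ : 0 < κ) (ha0 : a 0 = 0) (k : ℤ) {z : ℂ} (hz : 0 < z.im) :
    HasFDerivAt (fun z => a k * mode ν (κ * k) z) (a k • mode' ν (κ * k) z) z := by
  rcases eq_or_ne k 0 with rfl | hk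
  · rw [ha0, zero_smul ℂ (mode' ν (κ * (0 : ℤ)) z)]
    simp only [zero_mul]
    exact hasFDerivAt_const _ _
  · have hk' : κ * k ≠ 0 := mul_ne_zero hκ.ne' (by exact_mod_cast hk)
    exact ((isEig_mode ν hk').hasFDerivAt hz).const_mul (a k)

lemma IsExpansion.hasSum_fderiv (hκ : 0 < κ) (h : IsExpansion ν κ a u) {z : ℂ} (hz : 0 < z.im) :
    HasSum (fun k : ℤ => a k • mode' ν (κ * k) z) (fderiv ℝ u z) := by
  obtain ⟨b, hb, hb0, hle⟩ := (h.subExp hκ).exists_bound (ν := ν) hκ h.1 (half_pos hz)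
  have hexp : ∀ z : ℂ, z.im > 0 → Real.exp (-(κ / 2) * z.im) ≤ 1 := fun z hz => by
    rw [Real.exp_le_one_iff]
    nlinarith
  have hbd : ∀ (k : ℤ) (w : ℂ), z.im / 2 < w.im → ‖a k • mode' ν (κ * k) w‖ ≤ b k := by
    intro k w hw
    have h1 := hle k w hw.le
    have h2 := norm_nonneg (a k * mode ν (κ * k) w)
    have h3 := mul_le_mul_of_nonneg_left (hexp w (by linarith)) (hb0 k)
    linarith
  have hs : Summable fun k : ℤ => a k • mode' ν (κ * k) z :=
    hb.of_norm_bounded fun k => hbd k z (by linarith)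
  have hmain : HasFDerivAt (fun w => ∑' k : ℤ, a k * mode ν (κ * k) w)
      (∑' k : ℤ, a k • mode' ν (κ * k) z) z :=
    hasFDerivAt_tsum_of_isPreconnected (s := {w : ℂ | z.im / 2 < w.im}) (x₀ := z) hb
      (isOpen_lt continuous_const Complex.continuous_im)
      (convex_halfSpace_im_gt (z.im / 2)).isPreconnected
      (fun k w (hw : z.im / 2 < w.im) => hasFDerivAt_term hκ h.1 k (by linarith))
      (fun k w hw => hbd k w hw) (by change z.im / 2 < z.im; linarith) (h.2 z hz).summable
      (by change z.im / 2 < z.im; linarith)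
  have hu : HasFDerivAt u (∑' k : ℤ, a k • mode' ν (κ * k) z) z := by
    refine hmain.congr_of_eventuallyEq ?_
    filter_upwards [isOpen_im_pos.mem_nhds hz] with w hw using (h.2 w hw).tsum_eq.symm
  rw [hu.fderiv]
  exact hs.hasSum

lemma IsExpansion.rapidDecay (hκ : 0 < κ) (h : IsExpansion ν κ a u) :
    RapidDecay u (fderiv ℝ u) := by
  intro y₀ hy₀
  obtain ⟨b, hb, hb0, hle⟩ := (h.subExp hκ).exists_bound (ν := ν) hκ h.1 hy₀
  refine ⟨2 * ∑' k, b k, κ / 2, half_pos hκ, fun z hz => ?_⟩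
  have hz0 : 0 < z.im := hy₀.trans_le hz
  have hs := (hb.mul_right (Real.exp (-(κ / 2) * z.im))).hasSum
  have h1 : ‖u z‖ ≤ ∑' k, b k * Real.exp (-(κ / 2) * z.im) := by
    refine (h.2 z hz0).norm_le_of_bounded hs fun k => ?_
    have := norm_nonneg (a k • mode' ν (κ * k) z)
    linarith [hle k z hz]
  have h2 : ‖fderiv ℝ u z‖ ≤ ∑' k, b k * Real.exp (-(κ / 2) * z.im) := by
    refine (h.hasSum_fderiv hκ hz0).norm_le_of_bounded hs fun k => ?_
    have := norm_nonneg (a k * mode ν (κ * k) z)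
    linarith [hle k z hz]
  rw [tsum_mul_right] at h1 h2
  linarith

lemma lewisForm_smul (s c ζ z h : ℂ) (u : ℂ → ℂ) (u₁ : ℂ → ℂ →L[ℝ] ℂ) :
    lewisForm s (fun z => c * u z) (fun z => c • u₁ z) ζ z h = c * lewisForm s u u₁ ζ z h := by
  simp only [lewisForm, greenForm_apply, smul_apply, smul_eq_mul]
  ring

/-- Termwise integration. On the contour each term is bounded by a summable constant times one fixed
Gaussian, and the form is linear in the pair formed by u and its derivative. -/
lemma IsExpansion.hasSum_lewisF (hκ : 0 < κ) (hνs : s = ν + 1 / 2) (hs : 0 ≤ s.re)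
    (h : IsExpansion ν κ a u) {ζ : ℂ} (hζ : 0 < ζ.im) :
    HasSum (fun k : ℤ => a k * lewisF s (mode ν (κ * k)) (mode' ν (κ * k)) ζ)
      (lewisF s u (fderiv ℝ u) ζ) := by
  have hr : 0 < ζ.im / 2 := by linarith
  obtain ⟨b, hb, hb0, hle⟩ :=
    (h.subExp hκ).exists_bound (ν := ν) hκ h.1 (y₀ := ζ.im - ζ.im / 2) (by linarith)
  set F : ℤ → ℝ → ℂ := fun k t => a k * lewisForm s (mode ν (κ * k)) (mode' ν (κ * k)) ζ
    (parabola ζ (ζ.im / 2) t) (parabola' (ζ.im / 2) t) with hF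
  set K : ℝ := kernelBound s (ζ.im - ζ.im / 2) (ζ.im / 2 / 2) with hK
  set B : ℝ → ℝ := fun t => (1 + |t|) * Real.exp (-(κ / 2 * (ζ.im / 2)) * t ^ 2) with hB
  have hBi : Integrable B := integrable_abs_mul_exp_neg_sq (by positivity)
  set c : ℝ := K * Real.exp (-(κ / 2) * (ζ.im - ζ.im / 2)) * (2 * (ζ.im / 2)) with hc
  have hFb : ∀ k t, ‖F k t‖ ≤ b k * c * B t := by
    intro k t
    simp only [hF]
    rw [← lewisForm_smul]
    refine (norm_lewisForm_parabola_le hs hr (by linarith) (by simp; linarith)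
      (fun z hz => hle k z hz) t).trans (le_of_eq ?_)
    rw [hc, hB, hK]
    ring
  have hmem : ∀ t, parabola ζ (ζ.im / 2) t ∈ slitHalf ζ :=
    parabola_mem_slitHalf hr (by linarith) (by simp; linarith)
  have hFi : ∀ k, Integrable (F k) := by
    intro k
    refine (hBi.const_mul (b k * c)).mono' ?_ (ae_of_all _ (hFb k))
    rcases eq_or_ne k 0 with rfl | hk
    · simp only [hF, h.1, zero_mul]
      exact aestronglyMeasurable_const
    · have hk' : κ * k ≠ 0 := mul_ne_zero hκ.ne' (by exact_mod_cast hk)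
      exact (continuous_const.mul (continuous_lewisForm_parabola hνs (isEig_mode ν hk') hζ
        hmem)).aestronglyMeasurable
  have hsum : Summable fun k => ∫ t, ‖F k t‖ := by
    refine Summable.of_nonneg_of_le (fun k => integral_nonneg fun _ => norm_nonneg _) (fun k => ?_)
      (hb.mul_right (c * ∫ t, B t))
    rw [← mul_assoc, ← integral_const_mul]
    exact integral_mono (hFi k).norm (hBi.const_mul _) (hFb k)
  have hmain := hasSum_integral_of_summable_integral_norm hFi hsum
  have h1 : ∀ k, ∫ t, F k t = a k * lewisF s (mode ν (κ * k)) (mode' ν (κ * k)) ζ := fun k => by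
    rw [lewisF, contourF, ← integral_const_mul]
  have h2 : ∀ t, ∑' k, F k t = lewisForm s u (fderiv ℝ u) ζ (parabola ζ (ζ.im / 2) t)
      (parabola' (ζ.im / 2) t) := by
    intro t
    refine HasSum.tsum_eq ?_
    simp only [hF]
    have hz : 0 < (parabola ζ (ζ.im / 2) t).im := (hmem t).1
    generalize parabola ζ (ζ.im / 2) t = z at *
    generalize parabola' (ζ.im / 2) t = w at *
    have e1 := (h.2 z hz).mul_right (kernelV' s ζ z (Complex.I * w))
    have e2 := ((h.hasSum_fderiv hκ hz).mapL
      (ContinuousLinearMap.apply ℝ ℂ (Complex.I * w))).mul_left (kernelV s ζ z)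
    convert! e2.sub e1 using 1
    funext k
    simp only [lewisForm, greenForm_apply, ContinuousLinearMap.apply_apply, smul_apply,
      smul_eq_mul]
    ring
  simp_rw [h1, h2] at hmain
  exact hmain

/-- The holomorphic function on the upper half plane attached to the coefficients. -/
def upperSeries (ν : ℂ) (κ : ℝ) (a : ℤ → ℂ) (ζ : ℂ) : ℂ :=
  ∑' k : {k : ℤ // 0 < k}, ((k : ℤ) : ℂ) ^ ν * Complex.exp (Complex.I * (κ * (k : ℤ)) * ζ) * a k

/-- Negative frequencies contribute nothing, and each positive one contributes (κk)^ν e^{iκkζ}, from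
which κ^ν factors out. -/
lemma IsExpansion.lewisF_eq (hκ : 0 < κ) (hνs : s = ν + 1 / 2) (hs : 0 ≤ s.re)
    (h : IsExpansion ν κ a u) {ζ : ℂ} (hζ : 0 < ζ.im) :
    lewisF s u (fderiv ℝ u) ζ = lewisConst s * (κ : ℂ) ^ ν * upperSeries ν κ a ζ := by
  have h1 := h.hasSum_lewisF hκ hνs hs hζ
  have hsupp : Function.support (fun k : ℤ => a k * lewisF s (mode ν (κ * k)) (mode' ν (κ * k)) ζ) ⊆
      {k : ℤ | 0 < k} := by
    intro k hk
    by_contra hneg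
    refine hk ?_
    rcases (not_lt.mp (show ¬ 0 < k from hneg)).lt_or_eq with hlt | rfl
    · simp only
      rw [lewisF_mode_of_neg hνs hs _ hζ, mul_zero]
      exact mul_neg_of_pos_of_neg hκ (by exact_mod_cast hlt)
    · simp [h.1]
  have h2 := (hasSum_subtype_iff_of_support_subset hsupp).mpr h1
  rw [← h2.tsum_eq, upperSeries, ← tsum_mul_left]
  refine tsum_congr fun k => ?_
  have hk : (0 : ℝ) < ((k : ℤ) : ℝ) := by exact_mod_cast k.2
  simp only [Function.comp_apply]
  rw [lewisF_mode_of_pos hνs hs (mul_pos hκ hk) hζ]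
  push_cast
  rw [← Complex.ofReal_intCast, Complex.mul_cpow_ofReal_nonneg hκ.le hk.le]
  ring

/-- Holomorphy is inherited from the contour integral by dividing by a constant, whose nonvanishing
is needed here. -/
lemma IsExpansion.differentiableAt_upperSeries (hκ : 0 < κ) (hνs : s = ν + 1 / 2) (hs : 0 < s.re)
    (hu : IsEig ν {z : ℂ | 0 < z.im} u (fderiv ℝ u))
    (h : IsExpansion ν κ a u) {ζ : ℂ} (hζ : 0 < ζ.im) :
    DifferentiableAt ℂ (upperSeries ν κ a) ζ := by
  have hc : lewisConst s * (κ : ℂ) ^ ν ≠ 0 := mul_ne_zero (lewisConst_ne_zero hs) (by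
    rw [Ne, Complex.cpow_eq_zero_iff]
    simp [hκ.ne'])
  have h1 := (differentiableAt_lewisF hνs hs.le hu (h.rapidDecay hκ) hζ).const_mul
    (lewisConst s * (κ : ℂ) ^ ν)⁻¹
  refine h1.congr_of_eventuallyEq ?_
  filter_upwards [isOpen_im_pos.mem_nhds hζ] with w hw
  rw [h.lewisF_eq hκ hνs hs.le hw, ← mul_assoc, inv_mul_cancel₀ hc, one_mul]

end

end

end HigherOrderLewis

namespace HigherOrderLewis

noncomputable section

/-! ### Decay in sectors -/

/-- A pair of eigenfunctions with expansions that are exchanged by `z ↦ -1/z`. -/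
structure IsSwapPair (ν : ℂ) (κ : ℝ) (a a' : ℤ → ℂ) (u u' : ℂ → ℂ) : Prop where
  eig : IsEig ν {z : ℂ | 0 < z.im} u (fderiv ℝ u)
  eig' : IsEig ν {z : ℂ | 0 < z.im} u' (fderiv ℝ u')
  exp : IsExpansion ν κ a u
  exp' : IsExpansion ν κ a' u'
  swap : ∀ z : ℂ, 0 < z.im → u' z = u (-1 / z)

lemma im_neg_inv (z : ℂ) : (-1 / z).im = z.im / ‖z‖ ^ 2 := by
  rw [neg_div, one_div, Complex.neg_im, Complex.inv_im, Complex.normSq_eq_norm_sq]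
  ring

lemma im_neg_inv_pos {z : ℂ} (hz : 0 < z.im) : 0 < (-1 / z).im := by
  have h : z ≠ 0 := fun h => by simp [h] at hz
  rw [im_neg_inv]
  have := norm_pos_iff.mpr h
  positivity

lemma neg_inv_neg_inv (z : ℂ) : -1 / (-1 / z) = z := by
  rw [neg_div, neg_div, div_neg, neg_neg, one_div_one_div]

lemma IsSwapPair.symm {ν : ℂ} {κ : ℝ} {a a' : ℤ → ℂ} {u u' : ℂ → ℂ}
    (h : IsSwapPair ν κ a a' u u') : IsSwapPair ν κ a' a u' u :=
  ⟨h.eig', h.eig, h.exp', h.exp, fun z hz => by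
    rw [h.swap _ (im_neg_inv_pos hz), neg_inv_neg_inv]⟩

lemma IsSwapPair.fderiv_eq {ν : ℂ} {κ : ℝ} {a a' : ℤ → ℂ} {u u' : ℂ → ℂ}
    (h : IsSwapPair ν κ a a' u u') {z : ℂ} (hz : 0 < z.im) (w : ℂ) :
    fderiv ℝ u' z w = fderiv ℝ u (-1 / z) (w / z ^ 2) := by
  have h0 : z ≠ 0 := fun h => by simp [h] at hz
  have h1 : HasDerivAt (fun z : ℂ => -1 / z) (1 / z ^ 2) z := by
    have := (hasDerivAt_inv h0).neg
    convert! this using 1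
    · funext z; simp [div_eq_mul_inv]
    · field_simp
  have h2 := (h.eig.hasFDerivAt (im_neg_inv_pos hz)).comp z (h1.hasFDerivAt.restrictScalars ℝ)
  have h3 : HasFDerivAt u' _ z := h2.congr_of_eventuallyEq (by
    filter_upwards [isOpen_im_pos.mem_nhds hz] with w hw using h.swap w hw)
  rw [h3.fderiv]
  simp [div_eq_mul_inv]

/-- In the sector y ≥ c|z| exponential decay in y is exponential decay in |z| and beats every power.
One power more than m is taken to absorb the weight |z| on the derivative. -/
lemma RapidDecay.exists_bound {u : ℂ → ℂ} {u₁ : ℂ → ℂ →L[ℝ] ℂ} (h : RapidDecay u u₁) {c : ℝ}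
    (hc : 0 < c) (m : ℕ) : ∃ M, 0 ≤ M ∧ ∀ z : ℂ, 1 ≤ ‖z‖ → c * ‖z‖ ≤ z.im →
      ‖u z‖ + ‖z‖ * ‖u₁ z‖ ≤ M * (‖z‖ ^ m)⁻¹ := by
  obtain ⟨M, ε, hε, hb⟩ := h c hc
  refine ⟨|M| * ((m + 1).factorial / (ε * c) ^ (m + 1)), by positivity, fun z hz1 hz => ?_⟩
  have h0 : 0 < ‖z‖ := by linarith
  have h1 := hb z (by nlinarith)
  have h2 : ‖u z‖ + ‖z‖ * ‖u₁ z‖ ≤ ‖z‖ * (‖u z‖ + ‖u₁ z‖) := by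
    nlinarith [norm_nonneg (u z)]
  have h3 : M * Real.exp (-ε * z.im) ≤ |M| * Real.exp (-(ε * c * ‖z‖)) := by
    refine mul_le_mul (le_abs_self M) (Real.exp_le_exp.mpr ?_) (Real.exp_pos _).le (abs_nonneg _)
    nlinarith
  have h4 := Real.pow_div_factorial_le_exp (ε * c * ‖z‖) (by positivity) (m + 1)
  have h5 : Real.exp (-(ε * c * ‖z‖)) ≤
      (m + 1).factorial / (ε * c) ^ (m + 1) * (‖z‖ ^ (m + 1))⁻¹ := by
    rw [Real.exp_neg, inv_le_comm₀ (Real.exp_pos _) (by positivity)]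
    refine le_trans (le_of_eq ?_) h4
    rw [mul_pow, mul_inv, inv_inv, inv_div]
    ring
  calc _ ≤ ‖z‖ * (|M| * ((m + 1).factorial / (ε * c) ^ (m + 1) * (‖z‖ ^ (m + 1))⁻¹)) :=
        h2.trans (by gcongr; exact h1.trans (h3.trans (by gcongr)))
    _ = _ := by
      rw [pow_succ ‖z‖]
      field_simp

/-- For |z| ≥ 1 this is the decay of u at i∞. For |z| ≤ 1 it is that of u' at -1/z, since the
inversion preserves both the sector condition and the weighted norm |z| ‖du‖. The factor
e^{-m|log|z||} treats both cases symmetrically. -/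
lemma IsSwapPair.exists_bound {ν : ℂ} {κ : ℝ} (hκ : 0 < κ) {a a' : ℤ → ℂ} {u u' : ℂ → ℂ}
    (h : IsSwapPair ν κ a a' u u') {c : ℝ} (hc : 0 < c) (m : ℕ) :
    ∃ M, 0 ≤ M ∧ ∀ z : ℂ, 0 < z.im → c * ‖z‖ ≤ z.im →
      ‖u z‖ + ‖z‖ * ‖fderiv ℝ u z‖ ≤ M * Real.exp (-(m * |Real.log ‖z‖|)) := by
  obtain ⟨M, hM, hb⟩ := (h.exp.rapidDecay hκ).exists_bound hc m
  obtain ⟨M', hM', hb'⟩ := (h.exp'.rapidDecay hκ).exists_bound hc m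
  refine ⟨max M M', le_max_of_le_left hM, fun z hz hcz => ?_⟩
  have hz0 : z ≠ 0 := fun h => by simp [h] at hz
  have hr := norm_pos_iff.mpr hz0
  have hpow : ∀ r : ℝ, 0 < r → 0 ≤ Real.log r → Real.exp (-(m * |Real.log r|)) = (r ^ m)⁻¹ := by
    intro r hr hl
    rw [abs_of_nonneg hl, Real.exp_neg, mul_comm, Real.exp_mul, Real.exp_log hr, Real.rpow_natCast]
  rcases le_total 1 ‖z‖ with h1 | h1
  · rw [hpow _ hr (Real.log_nonneg h1)]
    refine (hb z h1 hcz).trans ?_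
    gcongr
    exact le_max_left _ _
  · have hn : ‖-1 / z‖ = ‖z‖⁻¹ := by rw [norm_div, norm_neg, norm_one, one_div]
    have h2 : 1 ≤ ‖-1 / z‖ := by rw [hn]; exact (one_le_inv₀ hr).mpr h1
    have h3 : c * ‖-1 / z‖ ≤ (-1 / z).im := by
      rw [hn, im_neg_inv, le_div_iff₀ (by positivity)]
      refine le_trans (le_of_eq ?_) hcz
      field_simp
    have h4 := hb' _ h2 h3
    have h5 : u z = u' (-1 / z) := h.symm.swap z hz
    have h6 : ‖z‖ * ‖fderiv ℝ u z‖ ≤ ‖-1 / z‖ * ‖fderiv ℝ u' (-1 / z)‖ := by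
      have : ‖fderiv ℝ u z‖ ≤ ‖fderiv ℝ u' (-1 / z)‖ / ‖z‖ ^ 2 := by
        refine ContinuousLinearMap.opNorm_le_bound _ (by positivity) fun w => ?_
        rw [h.symm.fderiv_eq hz]
        refine (ContinuousLinearMap.le_opNorm _ _).trans (le_of_eq ?_)
        rw [norm_div, norm_pow]
        ring
      rw [hn]
      calc _ ≤ ‖z‖ * (‖fderiv ℝ u' (-1 / z)‖ / ‖z‖ ^ 2) := by gcongr
        _ = _ := by field_simp
    have h7 : |Real.log ‖z‖| = |Real.log ‖-1 / z‖| := by rw [hn, Real.log_inv, abs_neg]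
    rw [h7, hpow _ (by linarith) (Real.log_nonneg h2), h5]
    refine (add_le_add le_rfl h6).trans (h4.trans ?_)
    gcongr
    exact le_max_right _ _

/-! ### Integrals along rays -/

/-- A branch of `(y / ((z - ζ) (z̄ - ζ)))^s` that is holomorphic in `ζ` off two rays. -/
def rayV (s ζ z : ℂ) : ℂ :=
  Complex.exp (s * (((Real.log z.im - 2 * Real.log ‖z‖ : ℝ) : ℂ) - Complex.log (1 - ζ / z) -
    Complex.log (1 - ζ / (starRingEnd ℂ) z)))

/-- The logarithmic derivative of the kernel in the direction `i z`. -/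
def rayD (ζ z : ℂ) : ℂ :=
  z.re / z.im - Complex.I * ((1 - ζ / z)⁻¹ - (1 - ζ / (starRingEnd ℂ) z)⁻¹)

/-- Green's form in the direction of the ray through `z`. -/
def rayForm (s : ℂ) (u : ℂ → ℂ) (ζ z : ℂ) : ℂ :=
  rayV s ζ z * (fderiv ℝ u z (Complex.I * z) - s * rayD ζ z * u z)

/-- The parametrized ray of argument `θ`. -/
def rayPt (θ τ : ℝ) : ℂ := Real.exp τ * Complex.exp (θ * Complex.I)

/-- The integral of Green's form along a ray. -/
def rayF (s : ℂ) (u : ℂ → ℂ) (θ : ℝ) (ζ : ℂ) : ℂ := ∫ τ, rayForm s u ζ (rayPt θ τ)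

lemma rayPt_re (θ τ : ℝ) : (rayPt θ τ).re = Real.exp τ * Real.cos θ := by
  rw [rayPt, Complex.re_ofReal_mul, Complex.exp_ofReal_mul_I_re]

lemma rayPt_im (θ τ : ℝ) : (rayPt θ τ).im = Real.exp τ * Real.sin θ := by
  rw [rayPt, Complex.im_ofReal_mul, Complex.exp_ofReal_mul_I_im]

lemma norm_rayPt (θ τ : ℝ) : ‖rayPt θ τ‖ = Real.exp τ := by
  rw [rayPt, norm_mul, Complex.norm_exp_ofReal_mul_I, mul_one, Complex.norm_real,
    Real.norm_of_nonneg (Real.exp_pos τ).le]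

lemma conj_rayPt (θ τ : ℝ) : (starRingEnd ℂ) (rayPt θ τ) = rayPt (-θ) τ := by
  apply Complex.ext
  · rw [Complex.conj_re, rayPt_re, rayPt_re, Real.cos_neg]
  · rw [Complex.conj_im, rayPt_im, rayPt_im, Real.sin_neg, mul_neg]

lemma continuous_rayPt (θ : ℝ) : Continuous (rayPt θ) := by
  unfold rayPt
  fun_prop

/-- A cone that avoids the rays of arguments `θ` and `-θ`. -/
def cone (θ c : ℝ) : Set ℂ :=
  {ζ | (ζ * Complex.exp (-(θ * Complex.I))).re < c * ‖ζ‖ ∧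
    (ζ * Complex.exp (θ * Complex.I)).re < c * ‖ζ‖}

lemma isOpen_cone (θ c : ℝ) : IsOpen (cone θ c) :=
  IsOpen.inter (s := {ζ : ℂ | (ζ * Complex.exp (-(θ * Complex.I))).re < c * ‖ζ‖})
    (t := {ζ : ℂ | (ζ * Complex.exp (θ * Complex.I)).re < c * ‖ζ‖})
    (isOpen_lt (by fun_prop) (by fun_prop)) (isOpen_lt (by fun_prop) (by fun_prop))

lemma div_rayPt (ζ : ℂ) (θ τ : ℝ) :
    ζ / rayPt θ τ = (Real.exp (-τ) : ℝ) * (ζ * Complex.exp (-(θ * Complex.I))) := by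
  rw [rayPt, Complex.exp_neg, Real.exp_neg]
  push_cast
  field_simp

lemma re_div_rayPt_lt {ζ : ℂ} {θ c : ℝ} (h : (ζ * Complex.exp (-(θ * Complex.I))).re < c * ‖ζ‖)
    (τ : ℝ) : (ζ / rayPt θ τ).re < c * ‖ζ / rayPt θ τ‖ := by
  have hn : ‖Complex.exp (-(θ * Complex.I))‖ = 1 := by rw [Complex.norm_exp]; simp
  rw [div_rayPt, Complex.re_ofReal_mul, norm_mul, norm_mul, Complex.norm_real,
    Real.norm_of_nonneg (Real.exp_pos _).le, hn, mul_one]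
  have := Real.exp_pos (-τ)
  have := mul_lt_mul_of_pos_left h this
  linarith

lemma mem_cone_bounds {ζ : ℂ} {θ c : ℝ} (h : ζ ∈ cone θ c) (τ : ℝ) :
    (ζ / rayPt θ τ).re < c * ‖ζ / rayPt θ τ‖ ∧
      (ζ / (starRingEnd ℂ) (rayPt θ τ)).re < c * ‖ζ / (starRingEnd ℂ) (rayPt θ τ)‖ := by
  refine ⟨re_div_rayPt_lt h.1 τ, ?_⟩
  rw [conj_rayPt]
  refine re_div_rayPt_lt ?_ τ
  have := h.2
  push_cast
  rwa [neg_mul, neg_neg]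

lemma one_sub_mem_slitPlane {w : ℂ} {c : ℝ} (hc : c < 1) (h : w.re < c * ‖w‖) :
    1 - w ∈ Complex.slitPlane := by
  rw [Complex.mem_slitPlane_iff]
  by_contra hcon
  push Not at hcon
  have him : w.im = 0 := by simpa using hcon.2
  have hre : 1 ≤ w.re := by simpa using hcon.1
  have hn : ‖w‖ = w.re := by
    have : w = (w.re : ℂ) := Complex.ext rfl (by simp [him])
    rw [this, Complex.norm_real, Complex.ofReal_re, Real.norm_of_nonneg (by linarith)]
  rw [hn] at h
  nlinarith

/-- |1-w|² = 1 - 2 Re w + |w|² is at least 1 - 2c|w| + |w|², and 2|w| ≤ 1 + |w|². -/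
lemma le_norm_one_sub_sq {w : ℂ} {c : ℝ} (hc : 0 ≤ c) (h : w.re < c * ‖w‖) :
    (1 - c) * (1 + ‖w‖ ^ 2) ≤ ‖1 - w‖ ^ 2 := by
  have h1 : ‖1 - w‖ ^ 2 = 1 - 2 * w.re + ‖w‖ ^ 2 := by
    rw [← Complex.normSq_eq_norm_sq, ← Complex.normSq_eq_norm_sq, Complex.normSq_apply,
      Complex.normSq_apply]
    simp
    ring
  rw [h1]
  nlinarith [sq_nonneg (1 - ‖w‖)]

/-- With ρ = |ζ|/|z|, each factor satisfies |1-w|² ≥ (1-c)(1+ρ²). Using 1+ρ² ≥ 1 gives the first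
entry of the minimum and 1+ρ² ≥ ρ² the second. Both cost e^{Re s |τ|}, which the decay of u will
absorb. -/
lemma norm_rayV_le {s ζ : ℂ} (hs : 0 ≤ s.re) {θ c : ℝ} (hθ : 0 < Real.sin θ) (hc : 0 ≤ c)
    (hc1 : c < 1) (h : ζ ∈ cone θ c) (τ : ℝ) :
    ‖rayV s ζ (rayPt θ τ)‖ ≤ Real.exp (2 * Real.pi * |s.im|) * (1 - c) ^ (-s.re) *
      Real.exp (s.re * |τ|) * min 1 (‖ζ‖ ^ (-(2 * s.re))) := by
  have hζ : 0 < ‖ζ‖ := by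
    rw [norm_pos_iff]
    rintro rfl
    simpa [cone] using h.1
  obtain ⟨h1, h2⟩ := mem_cone_bounds h τ
  set w₁ := ζ / rayPt θ τ with hw₁
  set w₂ := ζ / (starRingEnd ℂ) (rayPt θ τ) with hw₂
  have hn1 : ‖w₁‖ = ‖ζ‖ * Real.exp (-τ) := by
    rw [hw₁, norm_div, norm_rayPt, Real.exp_neg, div_eq_mul_inv]
  have hn2 : ‖w₂‖ = ‖ζ‖ * Real.exp (-τ) := by
    rw [hw₂, norm_div, RCLike.norm_conj, norm_rayPt, Real.exp_neg, div_eq_mul_inv]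
  set ρ := ‖ζ‖ * Real.exp (-τ) with hρ
  have hρ0 : 0 < ρ := by positivity
  have hc' : 0 < 1 - c := by linarith
  have key : ∀ w : ℂ, w.re < c * ‖w‖ → ‖w‖ = ρ →
      Real.log (1 - c) + Real.log (1 + ρ ^ 2) ≤ 2 * Real.log ‖1 - w‖ := by
    intro w hw hwn
    have h3 := le_norm_one_sub_sq hc hw
    rw [hwn] at h3
    rw [← Real.log_mul hc'.ne' (by positivity)]
    have := Real.log_le_log (by positivity) h3
    rwa [Real.log_pow] at this
  have k1 := key w₁ h1 hn1
  have k2 := key w₂ h2 hn2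
  have hy : Real.log (rayPt θ τ).im ≤ τ := by
    rw [rayPt_im, Real.log_mul (Real.exp_pos τ).ne' hθ.ne', Real.log_exp]
    linarith [Real.log_nonpos hθ.le (Real.sin_le_one θ)]
  have hl1 : 0 ≤ Real.log (1 + ρ ^ 2) := Real.log_nonneg (by nlinarith)
  have hl2 : 2 * (Real.log ‖ζ‖ - τ) ≤ Real.log (1 + ρ ^ 2) := by
    have h4 : Real.log ‖ζ‖ - τ = Real.log ρ := by
      rw [hρ, Real.log_mul hζ.ne' (Real.exp_pos _).ne', Real.log_exp]
      ring
    rw [h4, ← Real.log_rpow hρ0]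
    refine Real.log_le_log (by positivity) ?_
    have : ρ ^ (2 : ℝ) = ρ ^ 2 := by exact_mod_cast Real.rpow_natCast ρ 2
    rw [this]
    linarith
  refine norm_cexp_mul_sub_log_le.trans ?_
  rw [norm_rayPt, Real.log_exp, mul_assoc (Real.exp _), mul_assoc (Real.exp _)]
  refine mul_le_mul_of_nonneg_left ?_ (Real.exp_pos _).le
  set A := Real.log (rayPt θ τ).im - 2 * τ - Real.log ‖1 - w₁‖ - Real.log ‖1 - w₂‖ with hA
  have b1 : A ≤ -Real.log (1 - c) + |τ| := by
    have := neg_abs_le τ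
    linarith
  have b2 : A ≤ -Real.log (1 - c) + |τ| + -2 * Real.log ‖ζ‖ := by
    have := le_abs_self τ
    linarith
  rw [mul_assoc ((1 - c) ^ (-s.re)), mul_min_of_nonneg _ _ (Real.exp_pos _).le, mul_min_of_nonneg _ _ (Real.rpow_nonneg hc'.le _),
    mul_one, Real.rpow_def_of_pos hc', Real.rpow_def_of_pos hζ, ← Real.exp_add, ← Real.exp_add,
    ← Real.exp_add]
  refine le_min (Real.exp_le_exp.mpr ?_) (Real.exp_le_exp.mpr ?_)
  · nlinarith [mul_le_mul_of_nonneg_left b1 hs]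
  · nlinarith [mul_le_mul_of_nonneg_left b2 hs]

lemma norm_inv_one_sub_le {w : ℂ} {c : ℝ} (hc : 0 ≤ c) (hc1 : c < 1) (h : w.re < c * ‖w‖) :
    ‖(1 - w)⁻¹‖ ≤ (Real.sqrt (1 - c))⁻¹ := by
  have h1 := le_norm_one_sub_sq hc h
  have h2 : 0 < 1 - c := by linarith
  rw [norm_inv]
  refine inv_anti₀ (Real.sqrt_pos.mpr h2) ?_
  rw [Real.sqrt_le_left (norm_nonneg _)]
  nlinarith [sq_nonneg ‖w‖]

lemma norm_rayD_le {ζ : ℂ} {θ c : ℝ} (hc : 0 ≤ c)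
    (hc1 : c < 1) (h : ζ ∈ cone θ c) (τ : ℝ) :
    ‖rayD ζ (rayPt θ τ)‖ ≤ |Real.cos θ / Real.sin θ| + 2 * (Real.sqrt (1 - c))⁻¹ := by
  obtain ⟨h1, h2⟩ := mem_cone_bounds h τ
  have e : ((rayPt θ τ).re : ℂ) / (rayPt θ τ).im = ((Real.cos θ / Real.sin θ : ℝ) : ℂ) := by
    rw [rayPt_re, rayPt_im]
    push_cast
    rw [mul_div_mul_left]
    exact Complex.exp_ne_zero _
  rw [rayD, e]
  refine (norm_sub_le _ _).trans (add_le_add ?_ ?_)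
  · rw [Complex.norm_real, Real.norm_eq_abs]
  · rw [norm_mul, Complex.norm_I, one_mul]
    refine (norm_sub_le _ _).trans ?_
    linarith [norm_inv_one_sub_le hc hc1 h1, norm_inv_one_sub_le hc hc1 h2]

lemma integrable_exp_neg_abs : Integrable fun t : ℝ => Real.exp (-|t|) := by
  rw [← integrableOn_univ, ← Set.Iic_union_Ioi (a := (0 : ℝ))]
  refine IntegrableOn.union ?_ ?_
  · refine (integrableOn_exp_Iic 0).congr_fun (fun t ht => ?_) measurableSet_Iic
    simp only [abs_of_nonpos (Set.mem_Iic.mp ht), neg_neg]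
  · refine (exp_neg_integrableOn_Ioi 0 one_pos).congr_fun (fun t ht => ?_) measurableSet_Ioi
    simp only [abs_of_pos (Set.mem_Ioi.mp ht), neg_mul, one_mul]

section

variable {ν s : ℂ} {κ : ℝ} {a a' : ℤ → ℂ} {u u' : ℂ → ℂ}

lemma IsSwapPair.exists_bound_rayForm (hκ : 0 < κ) (h : IsSwapPair ν κ a a' u u')
    (hs : 0 ≤ s.re) {θ c : ℝ} (hθ : 0 < Real.sin θ) (hc : 0 ≤ c) (hc1 : c < 1) :
    ∃ K, 0 ≤ K ∧ ∀ ζ ∈ cone θ c, ∀ τ : ℝ, ‖rayForm s u ζ (rayPt θ τ)‖ ≤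
      K * min 1 (‖ζ‖ ^ (-(2 * s.re))) * Real.exp (-|τ|) := by
  -- With m ≥ Re s + 1 the decay e^{-m|τ|} of u beats the growth e^{Re s |τ|} of the kernel and
  -- leaves e^{-|τ|}.
  obtain ⟨m, hm⟩ := exists_nat_ge (s.re + 1)
  obtain ⟨M, hM, hb⟩ := h.exists_bound hκ hθ m
  set D := |Real.cos θ / Real.sin θ| + 2 * (Real.sqrt (1 - c))⁻¹ with hD
  have hD0 : 0 ≤ D := by positivity
  set A := Real.exp (2 * Real.pi * |s.im|) * (1 - c) ^ (-s.re) with hA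
  have hA0 : 0 ≤ A := mul_nonneg (Real.exp_pos _).le (Real.rpow_nonneg (by linarith) _)
  refine ⟨A * ((1 + ‖s‖ * D) * M), by positivity, fun ζ hζ τ => ?_⟩
  have h1 := norm_rayV_le hs hθ hc hc1 hζ τ
  have h2 := norm_rayD_le hc hc1 hζ τ
  have him : 0 < (rayPt θ τ).im := by
    rw [rayPt_im]
    have := Real.exp_pos τ
    positivity
  have h3 := hb (rayPt θ τ) him (by rw [norm_rayPt, rayPt_im, mul_comm])
  rw [norm_rayPt, Real.log_exp, ← norm_rayPt θ τ] at h3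
  set z := rayPt θ τ with hz
  have h4 : ‖fderiv ℝ u z (Complex.I * z) - s * rayD ζ z * u z‖ ≤
      (1 + ‖s‖ * D) * (‖u z‖ + ‖z‖ * ‖fderiv ℝ u z‖) := by
    refine (norm_sub_le _ _).trans ?_
    have e1 := (fderiv ℝ u z).le_opNorm (Complex.I * z)
    rw [norm_mul, Complex.norm_I, one_mul] at e1
    rw [norm_mul, norm_mul]
    have e2 : ‖s‖ * ‖rayD ζ z‖ * ‖u z‖ ≤ ‖s‖ * D * ‖u z‖ := by gcongr
    have e3 : 0 ≤ ‖s‖ * D * (‖z‖ * ‖fderiv ℝ u z‖) := by positivity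
    nlinarith [norm_nonneg (u z)]
  have hmin : 0 ≤ min 1 (‖ζ‖ ^ (-(2 * s.re))) :=
    le_min zero_le_one (Real.rpow_nonneg (norm_nonneg _) _)
  rw [rayForm, norm_mul]
  calc _ ≤ (A * Real.exp (s.re * |τ|) * min 1 (‖ζ‖ ^ (-(2 * s.re)))) *
        ((1 + ‖s‖ * D) * (M * Real.exp (-(m * |τ|)))) := by
        refine mul_le_mul h1 (h4.trans (by gcongr)) (norm_nonneg _) (by positivity)
    _ = A * ((1 + ‖s‖ * D) * M) * min 1 (‖ζ‖ ^ (-(2 * s.re))) *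
        (Real.exp (s.re * |τ|) * Real.exp (-(m * |τ|))) := by ring
    _ ≤ _ := by
        refine mul_le_mul_of_nonneg_left ?_ (by positivity)
        rw [← Real.exp_add]
        refine Real.exp_le_exp.mpr ?_
        nlinarith [abs_nonneg τ]

lemma IsSwapPair.aestronglyMeasurable_rayForm (h : IsSwapPair ν κ a a' u u') (ζ : ℂ) {θ : ℝ}
    (hθ : 0 < Real.sin θ) :
    AEStronglyMeasurable (fun τ => rayForm s u ζ (rayPt θ τ)) := by
  have hm : Measurable (rayPt θ) := (continuous_rayPt θ).measurable
  have him : ∀ τ, rayPt θ τ ∈ {z : ℂ | 0 < z.im} := fun τ => by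
    change 0 < (rayPt θ τ).im
    rw [rayPt_im]
    have := Real.exp_pos τ
    positivity
  have hu : Continuous fun τ => u (rayPt θ τ) :=
    h.eig.continuousOn.comp_continuous (continuous_rayPt θ) him
  have hu' : Continuous fun τ => fderiv ℝ u (rayPt θ τ) (Complex.I * rayPt θ τ) :=
    (h.eig.continuousOn_deriv.comp_continuous (continuous_rayPt θ) him).clm_apply
      (continuous_const.mul (continuous_rayPt θ))
  have hconj : Measurable fun τ => (starRingEnd ℂ) (rayPt θ τ) :=
    (Complex.continuous_conj.comp (continuous_rayPt θ)).measurable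
  have hV : Measurable fun τ => rayV s ζ (rayPt θ τ) := by
    unfold rayV
    fun_prop
  have hD : Measurable fun τ => rayD ζ (rayPt θ τ) := by
    unfold rayD
    fun_prop
  exact (hV.mul (hu'.measurable.sub ((hD.const_mul s).mul hu.measurable))).aestronglyMeasurable

lemma differentiableAt_rayForm (u : ℂ → ℂ) {ζ : ℂ} {θ c : ℝ} (hc1 : c < 1) (h : ζ ∈ cone θ c)
    (τ : ℝ) : DifferentiableAt ℂ (fun ζ => rayForm s u ζ (rayPt θ τ)) ζ := by
  obtain ⟨h1, h2⟩ := mem_cone_bounds h τ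
  have h3 := one_sub_mem_slitPlane hc1 h1
  have h4 := one_sub_mem_slitPlane hc1 h2
  have h5 := Complex.slitPlane_ne_zero h3
  have h6 := Complex.slitPlane_ne_zero h4
  unfold rayForm rayV rayD
  refine DifferentiableAt.mul (DifferentiableAt.cexp (DifferentiableAt.const_mul ?_ _)) ?_
  · refine DifferentiableAt.sub (DifferentiableAt.sub (by fun_prop) ?_) ?_
    · exact DifferentiableAt.clog (by fun_prop) h3
    · exact DifferentiableAt.clog (by fun_prop) h4
  · refine DifferentiableAt.sub (by fun_prop) (DifferentiableAt.mul_const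
      (DifferentiableAt.const_mul (DifferentiableAt.sub (by fun_prop)
        (DifferentiableAt.const_mul (DifferentiableAt.sub ?_ ?_) _)) _) _)
    · exact DifferentiableAt.inv (by fun_prop) h5
    · exact DifferentiableAt.inv (by fun_prop) h6

lemma IsSwapPair.integrable_rayForm (hκ : 0 < κ) (h : IsSwapPair ν κ a a' u u')
    (hs : 0 ≤ s.re) {θ c : ℝ} (hθ : 0 < Real.sin θ) (hc : 0 ≤ c) (hc1 : c < 1) {ζ : ℂ}
    (hζ : ζ ∈ cone θ c) : Integrable fun τ => rayForm s u ζ (rayPt θ τ) := by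
  obtain ⟨K, hK, hb⟩ := h.exists_bound_rayForm hκ hs hθ hc hc1
  exact (integrable_exp_neg_abs.const_mul _).mono' (h.aestronglyMeasurable_rayForm ζ hθ)
    (ae_of_all _ (hb ζ hζ))

lemma IsSwapPair.differentiableOn_rayF (hκ : 0 < κ) (h : IsSwapPair ν κ a a' u u')
    (hs : 0 ≤ s.re) {θ c : ℝ} (hθ : 0 < Real.sin θ) (hc : 0 ≤ c) (hc1 : c < 1) :
    DifferentiableOn ℂ (rayF s u θ) (cone θ c) := by
  obtain ⟨K, hK, hb⟩ := h.exists_bound_rayForm hκ hs hθ hc hc1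
  refine differentiableOn_integral_param (isOpen_cone θ c)
    (fun ζ _ => h.aestronglyMeasurable_rayForm ζ hθ)
    (ae_of_all _ fun τ ζ hζ => (differentiableAt_rayForm u hc1 hζ τ).differentiableWithinAt)
    (bound := fun τ => K * Real.exp (-|τ|)) (ae_of_all _ fun τ ζ hζ => (hb ζ hζ τ).trans ?_)
    (integrable_exp_neg_abs.const_mul _)
  gcongr
  exact mul_le_of_le_one_right hK (min_le_left _ _)

lemma IsSwapPair.exists_norm_rayF_le (hκ : 0 < κ) (h : IsSwapPair ν κ a a' u u')
    (hs : 0 ≤ s.re) {θ c : ℝ} (hθ : 0 < Real.sin θ) (hc : 0 ≤ c) (hc1 : c < 1) :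
    ∃ K, 0 ≤ K ∧ ∀ ζ ∈ cone θ c, ‖rayF s u θ ζ‖ ≤ K * min 1 (‖ζ‖ ^ (-(2 * s.re))) := by
  obtain ⟨K, hK, hb⟩ := h.exists_bound_rayForm hκ hs hθ hc hc1
  refine ⟨K * ∫ τ : ℝ, Real.exp (-|τ|), by positivity, fun ζ hζ => ?_⟩
  refine (norm_integral_le_of_norm_le (integrable_exp_neg_abs.const_mul _)
    (ae_of_all _ (hb ζ hζ))).trans (le_of_eq ?_)
  rw [integral_const_mul]
  ring

end

/-- A sector lies in a cone. -/
lemma exists_mem_cone {θ θ₀ : ℝ} (h0 : 0 ≤ θ₀) (h : θ₀ < θ) (hθ : θ < Real.pi) :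
    ∃ c, 0 ≤ c ∧ c < 1 ∧ ∀ ζ : ℂ, ζ ≠ 0 → |ζ.arg| ≤ θ₀ → ζ ∈ cone θ c := by
  have hlt : Real.cos (θ - θ₀) < 1 := by
    have := Real.cos_lt_cos_of_nonneg_of_le_pi le_rfl (by linarith : θ - θ₀ ≤ Real.pi)
      (by linarith)
    rwa [Real.cos_zero] at this
  -- The midpoint between cos(θ-θ₀) and 1 makes the cone inequality strict and keeps c below 1. The
  -- maximum with 0 only ensures c ≥ 0.
  refine ⟨max 0 ((1 + Real.cos (θ - θ₀)) / 2), le_max_left _ _, max_lt one_pos (by linarith),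
    fun ζ hζ harg => ?_⟩
  have hn := norm_pos_iff.mpr hζ
  have key : ∀ φ : ℝ, Real.cos (ζ.arg + φ) ≤ Real.cos (θ - θ₀) →
      (ζ * Complex.exp (φ * Complex.I)).re < max 0 ((1 + Real.cos (θ - θ₀)) / 2) * ‖ζ‖ := by
    intro φ hφ
    have e : ζ * Complex.exp (φ * Complex.I) =
        ‖ζ‖ * Complex.exp (((ζ.arg + φ : ℝ) : ℂ) * Complex.I) := by
      conv_lhs => rw [← Complex.norm_mul_exp_arg_mul_I ζ]
      rw [mul_assoc, ← Complex.exp_add]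
      push_cast
      ring_nf
    rw [e, Complex.re_ofReal_mul, Complex.exp_ofReal_mul_I_re, mul_comm]
    refine mul_lt_mul_of_pos_right (lt_of_lt_of_le ?_ (le_max_right _ _)) hn
    linarith
  -- The angles between ζ and the two rays stay at distance at least θ - θ₀ from the multiples of
  -- 2π.
  have hcos : ∀ x : ℝ, θ - θ₀ ≤ x → x ≤ 2 * Real.pi - (θ - θ₀) →
      Real.cos x ≤ Real.cos (θ - θ₀) := by
    intro x h1 h2
    rcases le_total x Real.pi with h3 | h3
    · exact Real.cos_le_cos_of_nonneg_of_le_pi (by linarith) h3 h1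
    · rw [← Real.cos_two_pi_sub x]
      exact Real.cos_le_cos_of_nonneg_of_le_pi (by linarith) (by linarith) (by linarith)
  have ha := abs_le.mp harg
  refine ⟨?_, key θ (hcos _ (by linarith) (by linarith))⟩
  have := key (-θ) (by
    rw [← Real.cos_neg]
    exact hcos _ (by linarith) (by linarith))
  push_cast at this
  rwa [neg_mul] at this

end

end HigherOrderLewis

namespace HigherOrderLewis

noncomputable section

/-! ### Comparison of the kernels on the imaginary axis -/

/-- The arguments have opposite signs, so their sum stays in the principal interval. -/
lemma log_mul_of_im_neg_of_im_pos {a b : ℂ} (ha : a.im < 0) (hb : 0 < b.im) :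
    Complex.log (a * b) = Complex.log a + Complex.log b := by
  have ha0 : a ≠ 0 := fun h => by simp [h] at ha
  have hb0 : b ≠ 0 := fun h => by simp [h] at hb
  have h1 := Complex.arg_neg_iff.mpr ha
  have h2 := Complex.arg_nonneg_iff.mpr hb.le
  exact Complex.log_mul ha0 hb0 ⟨by linarith [Complex.neg_pi_lt_arg a],
    by linarith [Complex.arg_le_pi b]⟩

/-- The mirror image of w in the imaginary axis has argument -π - arg w when w lies below the real
axis. This π, and its negative above the axis, is the source of the phases e^{±πis}. -/
lemma log_neg_conj_add_of_im_neg {w : ℂ} (hw : w.im < 0) :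
    Complex.log w + Complex.log (-(starRingEnd ℂ) w) =
      2 * Real.log ‖w‖ - Real.pi * Complex.I := by
  have h1 : (-(starRingEnd ℂ) w).arg = -w.arg - Real.pi := by
    rw [Complex.arg_neg_eq_arg_sub_pi_of_im_pos (by simpa using hw), Complex.arg_conj, if_neg]
    have := Complex.arg_neg_iff.mpr hw
    linarith [Real.pi_pos]
  rw [Complex.log, Complex.log, h1, norm_neg, RCLike.norm_conj]
  push_cast
  ring

lemma log_neg_conj_add_of_im_pos {w : ℂ} (hw : 0 < w.im) :
    Complex.log w + Complex.log (-(starRingEnd ℂ) w) =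
      2 * Real.log ‖w‖ + Real.pi * Complex.I := by
  have h := log_neg_conj_add_of_im_neg (w := (starRingEnd ℂ) w) (by simpa using hw)
  have h1 : (-(starRingEnd ℂ) w).arg = -w.arg + Real.pi := by
    rw [Complex.arg_neg_eq_arg_add_pi_of_im_neg (by simpa using hw), Complex.arg_conj, if_neg]
    intro h
    rw [Complex.arg_eq_pi_iff] at h
    linarith [h.2]
  rw [Complex.log, Complex.log, h1, norm_neg, RCLike.norm_conj]
  push_cast
  ring

lemma factor_left {z ζ : ℂ} (hz : z ≠ 0) :
    Complex.I * (z - ζ) = Complex.I * z * (1 - ζ / z) := by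
  field_simp

lemma im_one_sub_div (Y : ℝ) (z : ℂ) :
    (1 - Y * Complex.I / z).im = -(Y * z.re / ‖z‖ ^ 2) := by
  rw [div_eq_mul_inv, mul_assoc, Complex.sub_im, Complex.im_ofReal_mul, Complex.I_mul_im,
    Complex.inv_re, Complex.normSq_eq_norm_sq, Complex.one_im]
  ring

section

variable {Y : ℝ} {z : ℂ}

/-- For Re z < 0 and ζ = iY, the numbers iz and iz̄ lie in the lower half plane while 1 - ζ/z and 1
- ζ/z̄ lie in the upper one. All logarithms therefore split, and only log(iz) + log(iz̄) produces a
phase. -/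
lemma kernelV_eq_rayV_of_re_neg (s : ℂ) (hY : 0 < Y) (hre : z.re < 0) :
    kernelV s (Y * Complex.I) z = Complex.exp (Real.pi * Complex.I * s) *
      rayV s (Y * Complex.I) z := by
  have hz : z ≠ 0 := fun h => by simp [h] at hre
  have hz' : (starRingEnd ℂ) z ≠ 0 := (map_ne_zero _).mpr hz
  have hn := norm_pos_iff.mpr hz
  have hpos : 0 < -(Y * z.re / ‖z‖ ^ 2) := by
    rw [← neg_div, ← mul_neg]
    have : 0 < -z.re := by linarith
    positivity
  have h3 := log_neg_conj_add_of_im_neg (w := Complex.I * z) (by simpa using hre)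
  have e : -(starRingEnd ℂ) (Complex.I * z) = Complex.I * (starRingEnd ℂ) z := by simp
  rw [e, norm_mul, Complex.norm_I, one_mul] at h3
  have l1 := log_mul_of_im_neg_of_im_pos (a := Complex.I * z) (b := 1 - Y * Complex.I / z)
    (by simpa using hre) (by rw [im_one_sub_div]; exact hpos)
  have l2 := log_mul_of_im_neg_of_im_pos (a := Complex.I * (starRingEnd ℂ) z)
    (b := 1 - Y * Complex.I / (starRingEnd ℂ) z) (by simpa using hre)
    (by rw [im_one_sub_div, Complex.conj_re, RCLike.norm_conj]; exact hpos)
  rw [kernelV, rayV, factor_left hz, factor_left hz', l1, l2, ← Complex.exp_add]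
  congr 1
  push_cast
  linear_combination (-s) * h3

lemma kernelV_eq_rayV_of_re_pos (s : ℂ) (hY : 0 < Y) (hre : 0 < z.re) :
    kernelV s (Y * Complex.I) z = Complex.exp (-(Real.pi * Complex.I * s)) *
      rayV s (Y * Complex.I) z := by
  have hz : z ≠ 0 := fun h => by simp [h] at hre
  have hz' : (starRingEnd ℂ) z ≠ 0 := (map_ne_zero _).mpr hz
  have hn := norm_pos_iff.mpr hz
  have hneg : -(Y * z.re / ‖z‖ ^ 2) < 0 := by
    rw [neg_lt_zero]
    positivity
  have h3 := log_neg_conj_add_of_im_pos (w := Complex.I * z) (by simpa using hre)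
  have e : -(starRingEnd ℂ) (Complex.I * z) = Complex.I * (starRingEnd ℂ) z := by simp
  rw [e, norm_mul, Complex.norm_I, one_mul] at h3
  have l1 := log_mul_of_im_neg_of_im_pos (b := Complex.I * z) (a := 1 - Y * Complex.I / z)
    (by rw [im_one_sub_div]; exact hneg) (by simpa using hre)
  have l2 := log_mul_of_im_neg_of_im_pos (b := Complex.I * (starRingEnd ℂ) z)
    (a := 1 - Y * Complex.I / (starRingEnd ℂ) z)
    (by rw [im_one_sub_div, Complex.conj_re, RCLike.norm_conj]; exact hneg) (by simpa using hre)
  rw [kernelV, rayV, factor_left hz, factor_left hz', mul_comm (Complex.I * z), l1,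
    mul_comm (Complex.I * (starRingEnd ℂ) z), l2, ← Complex.exp_add]
  congr 1
  push_cast
  linear_combination (-s) * h3

/-- The double inversion turns ζ/z into z/ζ and ζ/z̄ into z̄/ζ up to the same convention, and i(w -
iY) = Y(1 - w/(iY)) for w = z and w = z̄ accounts for the factor Y^(2s). No phase arises here. -/
lemma rayV_swap (s : ℂ) (hY : 0 < Y) (hz : 0 < z.im) (hzY : z ≠ Y * Complex.I) :
    rayV s (-1 / (Y * Complex.I)) (-1 / z) =
      Complex.exp (2 * s * Real.log Y) * kernelV s (Y * Complex.I) z := by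
  have hz0 : z ≠ 0 := fun h => by simp [h] at hz
  have hY0 : (Y : ℂ) ≠ 0 := by exact_mod_cast hY.ne'
  have hI := Complex.I_ne_zero
  have hzc : (starRingEnd ℂ) z ≠ 0 := (map_ne_zero _).mpr hz0
  have e1 : -1 / (Y * Complex.I) / (-1 / z) = z / (Y * Complex.I) := by
    field_simp
  have e2 : -1 / (Y * Complex.I) / (starRingEnd ℂ) (-1 / z) =
      (starRingEnd ℂ) z / (Y * Complex.I) := by
    rw [map_div₀, map_neg, map_one]
    field_simp
  have f : ∀ w : ℂ, Complex.I * (w - Y * Complex.I) = Y * (1 - w / (Y * Complex.I)) := by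
    intro w
    field_simp
    linear_combination (w - Y * Complex.I) * Complex.I_sq
  have g1 : 1 - z / (Y * Complex.I) ≠ 0 := by
    intro h
    rw [sub_eq_zero, eq_comm, div_eq_one_iff_eq (mul_ne_zero hY0 hI)] at h
    exact hzY h
  have g2 : 1 - (starRingEnd ℂ) z / (Y * Complex.I) ≠ 0 := by
    intro h
    rw [sub_eq_zero, eq_comm, div_eq_one_iff_eq (mul_ne_zero hY0 hI)] at h
    have := congrArg Complex.im h
    simp at this
    linarith
  have hn := norm_pos_iff.mpr hz0
  rw [rayV, kernelV, f, f, Complex.log_ofReal_mul hY g1, Complex.log_ofReal_mul hY g2, e1, e2,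
    ← Complex.exp_add, im_neg_inv, norm_div, norm_neg, norm_one, one_div, Real.log_inv,
    Real.log_div hz.ne' (by positivity), Real.log_pow]
  congr 1
  push_cast
  ring

lemma rayD_eq_kernelD {ζ : ℂ} (hz : z ≠ 0) : rayD ζ z = kernelD ζ z (Complex.I * z) := by
  have hz' : (starRingEnd ℂ) z ≠ 0 := (map_ne_zero _).mpr hz
  have e : ∀ w : ℂ, w ≠ 0 → (1 - ζ / w)⁻¹ = w / (w - ζ) := by
    intro w hw
    have : 1 - ζ / w = (w - ζ) / w := by rw [sub_div, div_self hw]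
    rw [this, inv_div]
  rw [rayD, kernelD_apply, e z hz, e _ hz']
  simp
  ring

/-- Since (1 - w/ζ)⁻¹ = 1 - (1 - ζ/w)⁻¹, the difference of the two fractions changes sign, and so
does x/y under z ↦ -1/z. -/
lemma rayD_swap {ζ : ℂ} (hz : z ≠ 0) (hζ : ζ ≠ 0) (h1 : z ≠ ζ) (h2 : (starRingEnd ℂ) z ≠ ζ) :
    rayD (-1 / ζ) (-1 / z) = -rayD ζ z := by
  have hz' : (starRingEnd ℂ) z ≠ 0 := (map_ne_zero _).mpr hz
  have e0 : ∀ w : ℂ, w ≠ 0 → w ≠ ζ → (1 - w / ζ)⁻¹ = 1 - (1 - ζ / w)⁻¹ := by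
    intro w hw hwζ
    have a1 : w - ζ ≠ 0 := sub_ne_zero.mpr hwζ
    have a2 : ζ - w ≠ 0 := sub_ne_zero.mpr hwζ.symm
    have b1 : (1 - w / ζ)⁻¹ = ζ / (ζ - w) := by
      have : 1 - w / ζ = (ζ - w) / ζ := by rw [sub_div, div_self hζ]
      rw [this, inv_div]
    have b2 : (1 - ζ / w)⁻¹ = w / (w - ζ) := by
      have : 1 - ζ / w = (w - ζ) / w := by rw [sub_div, div_self hw]
      rw [this, inv_div]
    rw [b1, b2, ← neg_sub w ζ]
    field_simp
    ring
  have e1 : -1 / ζ / (-1 / z) = z / ζ := by field_simp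
  have e2 : -1 / ζ / (starRingEnd ℂ) (-1 / z) = (starRingEnd ℂ) z / ζ := by
    rw [map_div₀, map_neg, map_one]
    field_simp
  have hn : (‖z‖ : ℂ) ≠ 0 := by exact_mod_cast (norm_pos_iff.mpr hz).ne'
  have e3 : (-1 / z).re = -(z.re / ‖z‖ ^ 2) := by
    rw [neg_div, one_div, Complex.neg_re, Complex.inv_re, Complex.normSq_eq_norm_sq]
  have e4 : (((-1 / z).re : ℝ) : ℂ) / ((-1 / z).im : ℝ) = -(z.re / z.im) := by
    rw [e3, im_neg_inv]
    push_cast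
    rw [neg_div, div_div_div_cancel_right₀ (pow_ne_zero 2 hn)]
  rw [rayD, rayD, e1, e2, e0 z hz h1, e0 _ hz' h2, e4]
  ring

end

/-! ### Green's form along rays -/

section

variable {ν s : ℂ} {κ : ℝ} {a a' : ℤ → ℂ} {u u' : ℂ → ℂ}

lemma lewisForm_radial {ζ z : ℂ} (hz : z ≠ 0) :
    lewisForm s u (fderiv ℝ u) ζ z z =
      kernelV s ζ z * (fderiv ℝ u z (Complex.I * z) - s * rayD ζ z * u z) := by
  rw [lewisForm, greenForm_apply, kernelV', smul_apply, smul_eq_mul, rayD_eq_kernelD hz]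
  ring

lemma rayPt_ne_zero (θ τ : ℝ) : rayPt θ τ ≠ 0 := by
  rw [← norm_pos_iff, norm_rayPt]
  exact Real.exp_pos τ

lemma rayPt_im_pos {θ : ℝ} (hθ : 0 < Real.sin θ) (τ : ℝ) : 0 < (rayPt θ τ).im := by
  rw [rayPt_im]
  exact mul_pos (Real.exp_pos τ) hθ

lemma rayPt_re_neg {θ : ℝ} (hθ : Real.cos θ < 0) (τ : ℝ) : (rayPt θ τ).re < 0 := by
  rw [rayPt_re]
  exact mul_neg_of_pos_of_neg (Real.exp_pos τ) hθ

lemma rayPt_re_pos {θ : ℝ} (hθ : 0 < Real.cos θ) (τ : ℝ) : 0 < (rayPt θ τ).re := by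
  rw [rayPt_re]
  exact mul_pos (Real.exp_pos τ) hθ

/-- The integral of Green's form along a ray. -/
def rayL (s : ℂ) (u : ℂ → ℂ) (θ Y : ℝ) : ℂ :=
  ∫ τ, lewisForm s u (fderiv ℝ u) (Y * Complex.I) (rayPt θ τ) (rayPt θ τ)

lemma lewisForm_ray_of_cos_neg {Y : ℝ} (hY : 0 < Y) {θ : ℝ} (hθ : Real.cos θ < 0) (τ : ℝ) :
    lewisForm s u (fderiv ℝ u) (Y * Complex.I) (rayPt θ τ) (rayPt θ τ) =
      Complex.exp (Real.pi * Complex.I * s) * rayForm s u (Y * Complex.I) (rayPt θ τ) := by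
  rw [lewisForm_radial (rayPt_ne_zero θ τ), rayForm,
    kernelV_eq_rayV_of_re_neg s hY (rayPt_re_neg hθ τ)]
  ring

lemma lewisForm_ray_of_cos_pos {Y : ℝ} (hY : 0 < Y) {θ : ℝ} (hθ : 0 < Real.cos θ) (τ : ℝ) :
    lewisForm s u (fderiv ℝ u) (Y * Complex.I) (rayPt θ τ) (rayPt θ τ) =
      Complex.exp (-(Real.pi * Complex.I * s)) * rayForm s u (Y * Complex.I) (rayPt θ τ) := by
  rw [lewisForm_radial (rayPt_ne_zero θ τ), rayForm,
    kernelV_eq_rayV_of_re_pos s hY (rayPt_re_pos hθ τ)]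
  ring

lemma rayL_of_cos_neg (s : ℂ) (u : ℂ → ℂ) {Y : ℝ} (hY : 0 < Y) {θ : ℝ} (hθ : Real.cos θ < 0) :
    rayL s u θ Y = Complex.exp (Real.pi * Complex.I * s) * rayF s u θ (Y * Complex.I) := by
  rw [rayL, rayF, ← integral_const_mul]
  exact integral_congr_ae (ae_of_all _ (lewisForm_ray_of_cos_neg hY hθ))

lemma rayL_of_cos_pos (s : ℂ) (u : ℂ → ℂ) {Y : ℝ} (hY : 0 < Y) {θ : ℝ} (hθ : 0 < Real.cos θ) :
    rayL s u θ Y = Complex.exp (-(Real.pi * Complex.I * s)) * rayF s u θ (Y * Complex.I) := by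
  rw [rayL, rayF, ← integral_const_mul]
  exact integral_congr_ae (ae_of_all _ (lewisForm_ray_of_cos_pos hY hθ))

lemma rayPt_pi_sub (θ τ : ℝ) : rayPt (Real.pi - θ) τ = -1 / rayPt θ (-τ) := by
  rw [rayPt, rayPt, Real.exp_neg]
  push_cast
  rw [sub_mul, Complex.exp_sub, Complex.exp_pi_mul_I]
  have := Complex.exp_ne_zero (θ * Complex.I)
  have := Complex.exp_ne_zero τ
  field_simp

lemma IsSwapPair.rayForm_swap (h : IsSwapPair ν κ a a' u u') {Y : ℝ} (hY : 0 < Y) {z : ℂ}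
    (hz : 0 < z.im) (hre : z.re ≠ 0) :
    rayForm s u' (-1 / (Y * Complex.I)) (-1 / z) = -(Complex.exp (2 * s * Real.log Y) *
      lewisForm s u (fderiv ℝ u) (Y * Complex.I) z z) := by
  have hz0 : z ≠ 0 := fun h => by simp [h] at hz
  have hY0 : (Y : ℂ) ≠ 0 := by exact_mod_cast hY.ne'
  have hne : z ≠ Y * Complex.I := fun h => hre (by simp [h])
  have hne' : (starRingEnd ℂ) z ≠ Y * Complex.I := fun h => hre (by
    have := congrArg Complex.re h
    simpa using this)
  rw [rayForm, rayV_swap s hY hz hne, rayD_swap hz0 (mul_ne_zero hY0 Complex.I_ne_zero) hne hne',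
    h.swap _ (im_neg_inv_pos hz), neg_inv_neg_inv, h.fderiv_eq (im_neg_inv_pos hz),
    neg_inv_neg_inv, lewisForm_radial hz0]
  have e : Complex.I * (-1 / z) / (-1 / z) ^ 2 = -(Complex.I * z) := by field_simp
  rw [e, map_neg]
  ring

/-- The inversion carries the ray at θ to the ray at π - θ traversed backwards, whence the sign. The
factor Y^(2s) comes from the kernel. -/
lemma IsSwapPair.rayF_swap (h : IsSwapPair ν κ a a' u u') {Y : ℝ} (hY : 0 < Y) {θ : ℝ}
    (hθ : 0 < Real.sin θ) (hcos : Real.cos θ ≠ 0) :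
    rayF s u' (Real.pi - θ) (-1 / (Y * Complex.I)) =
      -(Complex.exp (2 * s * Real.log Y) * rayL s u θ Y) := by
  rw [rayF, rayL, ← integral_const_mul, ← integral_neg, ← integral_neg_eq_self]
  refine integral_congr_ae (ae_of_all _ fun τ => ?_)
  have hre : (rayPt θ τ).re ≠ 0 := by
    rw [rayPt_re]
    exact mul_ne_zero (Real.exp_pos τ).ne' hcos
  simp only
  rw [rayPt_pi_sub, neg_neg, h.rayForm_swap hY (rayPt_im_pos hθ τ) hre]

lemma I_mem_cone {Y : ℝ} (hY : 0 < Y) {θ : ℝ} (hθ : 0 < Real.sin θ) (hcos : Real.cos θ ≠ 0) :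
    ∃ c, 0 ≤ c ∧ c < 1 ∧ (Y : ℂ) * Complex.I ∈ cone θ c := by
  have h1 : Real.sin θ < 1 := by
    rcases (Real.sin_le_one θ).lt_or_eq with h | h
    · exact h
    · refine absurd ?_ hcos
      have := Real.sin_sq_add_cos_sq θ
      rw [h] at this
      nlinarith
  refine ⟨(1 + Real.sin θ) / 2, by linarith, by linarith, ?_⟩
  have hn : ‖(Y : ℂ) * Complex.I‖ = Y := by
    rw [norm_mul, Complex.norm_I, mul_one, Complex.norm_real, Real.norm_of_nonneg hY.le]
  have e : ∀ φ : ℝ, ((Y : ℂ) * Complex.I * Complex.exp (φ * Complex.I)).re = -(Y * Real.sin φ) := by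
    intro φ
    rw [mul_assoc, Complex.re_ofReal_mul, Complex.I_mul_re, Complex.exp_ofReal_mul_I_im]
    ring
  have e1 := e θ
  have e2 := e (-θ)
  push_cast at e2
  rw [neg_mul, Real.sin_neg] at e2
  refine ⟨?_, ?_⟩
  · rw [hn, e2]
    nlinarith
  · rw [hn, e1]
    nlinarith

lemma IsSwapPair.integrable_lewisForm_ray (hκ : 0 < κ) (h : IsSwapPair ν κ a a' u u')
    (hs : 0 ≤ s.re) {Y : ℝ} (hY : 0 < Y) {θ : ℝ} (hθ : 0 < Real.sin θ) (hcos : Real.cos θ ≠ 0) :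
    Integrable fun τ => lewisForm s u (fderiv ℝ u) (Y * Complex.I) (rayPt θ τ) (rayPt θ τ) := by
  obtain ⟨c, hc, hc1, hmem⟩ := I_mem_cone hY hθ hcos
  have hi := h.integrable_rayForm hκ hs hθ hc hc1 hmem
  rcases lt_or_gt_of_ne hcos with hneg | hpos
  · simp_rw [lewisForm_ray_of_cos_neg hY hneg]
    exact hi.const_mul _
  · simp_rw [lewisForm_ray_of_cos_pos hY hpos]
    exact hi.const_mul _

lemma hasDerivAt_rayPt (θ τ : ℝ) : HasDerivAt (rayPt θ) (rayPt θ τ) τ := by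
  have h := ((Real.hasDerivAt_exp τ).ofReal_comp).mul_const (Complex.exp (θ * Complex.I))
  exact h

lemma rayPt_mem_slitHalf {Y : ℝ} {θ : ℝ} (hθ : 0 < Real.sin θ) (hcos : Real.cos θ ≠ 0) (τ : ℝ) :
    rayPt θ τ ∈ slitHalf (Y * Complex.I) := by
  refine ⟨rayPt_im_pos hθ τ, fun h => ?_⟩
  rw [rayPt_re] at h
  simp at h
  exact absurd h hcos

lemma tendsto_rayPt_im {θ : ℝ} (hθ : 0 < Real.sin θ) :
    Tendsto (fun τ => (rayPt θ τ).im) atTop atTop := by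
  simp_rw [rayPt_im]
  exact Real.tendsto_exp_atTop.atTop_mul_const hθ

lemma tendsto_rayPt_re_mul {θ ε : ℝ} (hθ : 0 < Real.sin θ) (hε : 0 < ε) :
    Tendsto (fun τ => |(rayPt θ τ).re| * Real.exp (-ε * (rayPt θ τ).im)) atTop (𝓝 0) := by
  have h1 := (tendsto_rpow_mul_exp_neg_mul_atTop_nhds_zero 1 (ε * Real.sin θ) (by positivity)).comp
    Real.tendsto_exp_atTop
  have h2 := h1.const_mul |Real.cos θ|
  rw [mul_zero] at h2
  refine h2.congr fun τ => ?_
  simp only [Function.comp_apply]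
  rw [rayPt_re, rayPt_im, Real.rpow_one, abs_mul, abs_of_pos (Real.exp_pos τ),
    show -ε * (Real.exp τ * Real.sin θ) = -(ε * Real.sin θ) * Real.exp τ by ring]
  ring

/-- Within a sector the form stays bounded near 0, so its primitive varies by O(r) over the piece of
radius r. This makes the limits of the primitive at 0 along different rays agree. -/
lemma IsSwapPair.exists_norm_sub_le (hκ : 0 < κ) (h : IsSwapPair ν κ a a' u u') (hs : 0 ≤ s.re)
    {Y : ℝ} (hY : 0 < Y) {W : ℂ → ℂ} (hW : ∀ z ∈ slitHalf (Y * Complex.I),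
      HasFDerivAt W (lewisForm s u (fderiv ℝ u) (Y * Complex.I) z) z)
    {c : ℝ} (hc : 0 < c) : ∃ K, ∀ r, 0 < r → r ≤ 1 → r ≤ Y / 2 → ∀ z w : ℂ, ‖z‖ ≤ r → ‖w‖ ≤ r →
      c * r ≤ z.im → c * r ≤ w.im → ‖W z - W w‖ ≤ K * r := by
  -- Two powers are needed: |z| ‖du‖ = O(|z|²) gives du = O(r), which cancels the 1/r coming from
  -- the derivative of log y in the kernel.
  obtain ⟨M, hM, hb⟩ := h.exists_bound hκ hc 2
  set A := Real.exp (2 * Real.pi * |s.im|) * (Y / 2) ^ (-s.re) with hA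
  have hA0 : 0 ≤ A := mul_nonneg (Real.exp_pos _).le (Real.rpow_nonneg (by linarith) _)
  set B := 1 + ‖s‖ * (2 / c + 1 / (Y / 2)) with hB
  have hB0 : 0 ≤ B := by positivity
  refine ⟨A * B * (M * 2) * 2, fun r hr hr1 hrY z w hz hw hzi hwi => ?_⟩
  set S : Set ℂ := {z | c * r ≤ z.im} ∩ Metric.closedBall 0 r with hS
  have hSc : Convex ℝ S := (convex_halfSpace_im_ge (c * r)).inter (convex_closedBall 0 r)
  have hcr : 0 < c * r := by positivity
  have hbound : ∀ x ∈ S, ‖lewisForm s u (fderiv ℝ u) (Y * Complex.I) x‖ ≤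
      A * B * (M * 2) := by
    rintro x ⟨hx1, hx2⟩
    have hx1 : c * r ≤ x.im := hx1
    have hx2 : ‖x‖ ≤ r := by simpa using hx2
    have hxi : 0 < x.im := by linarith
    have hxn : c * r ≤ ‖x‖ := hx1.trans ((le_abs_self _).trans (Complex.abs_im_le_norm x))
    have hx0 : 0 < ‖x‖ := by linarith
    have hd : Y / 2 ≤ ‖x - Y * Complex.I‖ := by
      have h1 := norm_sub_norm_le (Y * Complex.I : ℂ) x
      rw [norm_sub_rev, norm_mul, Complex.norm_I, Complex.norm_real, Real.norm_of_nonneg hY.le]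
        at h1
      linarith
    have h1 := norm_lewisForm_le (u := u) (u₁ := fderiv ℝ u) hs
      (by simpa using hY.le : 0 ≤ (Y * Complex.I : ℂ).im) hcr hx1 (half_pos hY) hd
    have h2 := hb x hxi (by nlinarith)
    have h3 : Real.exp (-(((2 : ℕ) : ℝ) * |Real.log ‖x‖|)) = ‖x‖ ^ 2 := by
      rw [abs_of_nonpos (Real.log_nonpos hx0.le (by linarith)), mul_neg, neg_neg, mul_comm,
        Real.exp_mul, Real.exp_log hx0, Real.rpow_natCast]
    rw [h3] at h2
    have h4 : ‖u x‖ + ‖fderiv ℝ u x‖ ≤ M * 2 * r := by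
      have e1 : ‖u x‖ ≤ M * (r * 1) := by
        have : ‖x‖ ^ 2 ≤ r * 1 := by nlinarith
        have := mul_le_mul_of_nonneg_left this hM
        have : 0 ≤ ‖x‖ * ‖fderiv ℝ u x‖ := by positivity
        linarith
      have e2 : ‖fderiv ℝ u x‖ ≤ M * r := by
        have e3 : ‖x‖ * ‖fderiv ℝ u x‖ ≤ ‖x‖ * (M * ‖x‖) := by
          have := norm_nonneg (u x)
          nlinarith
        have := le_of_mul_le_mul_left e3 hx0
        exact this.trans (by gcongr)
      linarith
    have h5 : kernelBound s (c * r) (Y / 2) ≤ A * B / r := by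
      rw [kernelBound, ← hA, mul_div_assoc]
      refine mul_le_mul_of_nonneg_left ?_ hA0
      rw [le_div_iff₀ hr, hB]
      have e1 : (1 + ‖s‖ * (2 / (c * r) + 1 / (Y / 2))) * r =
          r + ‖s‖ * (2 / c + r * (1 / (Y / 2))) := by field_simp
      rw [e1]
      have e2 : r * (1 / (Y / 2)) ≤ 1 / (Y / 2) := mul_le_of_le_one_left (by positivity) hr1
      gcongr
    calc _ ≤ A * B / r * (M * 2 * r) := h1.trans (by gcongr)
      _ = _ := by field_simp
  have hmem : ∀ x ∈ S, HasFDerivWithinAt W (lewisForm s u (fderiv ℝ u) (Y * Complex.I) x) S x := by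
    rintro x ⟨hx1, hx2⟩
    have hx1 : c * r ≤ x.im := hx1
    have hx2 : ‖x‖ ≤ r := by simpa using hx2
    have h1 := (le_abs_self _).trans (Complex.abs_im_le_norm x)
    refine (hW x ⟨by linarith, fun _ => ?_⟩).hasFDerivWithinAt
    simp
    linarith
  have h1 := hSc.norm_image_sub_le_of_norm_hasFDerivWithin_le hmem hbound (x := w) (y := z)
    ⟨hwi, by simpa using hw⟩ ⟨hzi, by simpa using hz⟩
  have h2 : ‖z - w‖ ≤ 2 * r := (norm_sub_le z w).trans (by linarith)
  calc _ ≤ A * B * (M * 2) * (2 * r) := h1.trans (by gcongr)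
    _ = _ := by ring

/-- Contour deformation. The parabola and the broken line through 0 join the same two ends of the
primitive, and nothing is lost at 0 because the primitive has one common limit there along both
rays. -/
lemma IsSwapPair.lewisF_eq_rayL (hκ : 0 < κ) (h : IsSwapPair ν κ a a' u u') (hνs : s = ν + 1 / 2)
    (hs : 0 ≤ s.re) {Y : ℝ} (hY : 0 < Y) {θ : ℝ} (hθ : 0 < Real.sin θ) (hcos : Real.cos θ < 0) :
    lewisF s u (fderiv ℝ u) (Y * Complex.I) = rayL s u (Real.pi - θ) Y - rayL s u θ Y := by
  have hζ : 0 < (Y * Complex.I : ℂ).im := by simpa using hY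
  obtain ⟨W, wL, wR, ε, hε, hW, hL, hR, hc⟩ :=
    exists_ends_lewisForm hνs hs h.eig (h.exp.rapidDecay hκ) hζ
  have hF := hc (Y * Complex.I) ((Y * Complex.I : ℂ).im / 2) (by linarith)
    (parabola_mem_slitHalf (by linarith) (by linarith) (by simp; linarith))
  rw [lewisF, hF]
  have hθ' : 0 < Real.sin (Real.pi - θ) := by rwa [Real.sin_pi_sub]
  have hcos' : 0 < Real.cos (Real.pi - θ) := by rw [Real.cos_pi_sub]; linarith
  have hd : ∀ φ : ℝ, 0 < Real.sin φ → Real.cos φ ≠ 0 → ∀ τ, HasDerivAt (fun τ => W (rayPt φ τ))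
      (lewisForm s u (fderiv ℝ u) (Y * Complex.I) (rayPt φ τ) (rayPt φ τ)) τ := by
    intro φ h1 h2 τ
    exact (hW _ (rayPt_mem_slitHalf h1 h2 τ)).comp_hasDerivAt τ (hasDerivAt_rayPt φ τ)
  have i1 := h.integrable_lewisForm_ray hκ hs hY hθ hcos.ne
  have i2 := h.integrable_lewisForm_ray hκ hs hY hθ' hcos'.ne'
  have t1 : Tendsto (fun τ => W (rayPt θ τ)) atTop (𝓝 wL) := by
    refine hL atTop (rayPt θ) ?_ (tendsto_rayPt_im hθ) (tendsto_rayPt_re_mul hθ hε)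
    have := (Real.tendsto_exp_atTop.atTop_mul_const_of_neg hcos).eventually_le_atBot
      ((Y * Complex.I : ℂ).re - 1)
    filter_upwards [this] with τ hτ
    rwa [rayPt_re]
  have t2 : Tendsto (fun τ => W (rayPt (Real.pi - θ) τ)) atTop (𝓝 wR) := by
    refine hR atTop (rayPt (Real.pi - θ)) ?_ (tendsto_rayPt_im hθ') (tendsto_rayPt_re_mul hθ' hε)
    have := (Real.tendsto_exp_atTop.atTop_mul_const hcos').eventually_ge_atTop
      ((Y * Complex.I : ℂ).re + 1)
    filter_upwards [this] with τ hτ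
    rwa [rayPt_re]
  have b1 := tendsto_limUnder_of_hasDerivAt_of_integrableOn_Iic (a := 0)
    (fun τ _ => hd θ hθ hcos.ne τ) i1.integrableOn
  have b2 : Tendsto (fun τ => W (rayPt (Real.pi - θ) τ)) atBot
      (𝓝 (limUnder atBot fun τ => W (rayPt θ τ))) := by
    obtain ⟨K, hK⟩ := h.exists_norm_sub_le hκ hs hY hW hθ
    have h0 : Tendsto (fun τ : ℝ => W (rayPt (Real.pi - θ) τ) - W (rayPt θ τ)) atBot (𝓝 0) := by
      have h1 := Real.tendsto_exp_atBot.const_mul K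
      rw [mul_zero] at h1
      refine squeeze_zero_norm' ?_ h1
      have h2 := Real.tendsto_exp_atBot.eventually_le_const one_pos
      have h3 := Real.tendsto_exp_atBot.eventually_le_const (half_pos hY)
      filter_upwards [h2, h3] with τ hτ hτ'
      refine hK _ (Real.exp_pos τ) hτ hτ' _ _ (norm_rayPt _ _).le (norm_rayPt _ _).le ?_ ?_
      · rw [rayPt_im, Real.sin_pi_sub, mul_comm]
      · rw [rayPt_im, mul_comm]
    have := h0.add b1
    simpa using this
  rw [rayL, rayL, integral_of_hasDerivAt_of_tendsto (hd θ hθ hcos.ne) i1 b1 t1,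
    integral_of_hasDerivAt_of_tendsto (hd _ hθ' hcos'.ne') i2 b2 t2]
  ring

lemma I_cpow_neg {Y : ℝ} (hY : 0 < Y) (s : ℂ) : ((Y : ℂ) * Complex.I) ^ (-(2 * s)) =
    Complex.exp (-(2 * s * Real.log Y)) * Complex.exp (-(Real.pi * Complex.I * s)) := by
  have hY0 : (Y : ℂ) ≠ 0 := by exact_mod_cast hY.ne'
  rw [Complex.cpow_def_of_ne_zero (mul_ne_zero hY0 Complex.I_ne_zero),
    Complex.log_ofReal_mul hY Complex.I_ne_zero, Complex.log_I, ← Complex.exp_add]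
  congr 1
  ring

/-- Let L and R be the ray integrals at θ and π - θ, and E = e^{πis}. Then `lewisF` of u is E⁻¹R -
EL, that of u' at the inverted point is Y^(2s)(R - L), and (iY)^(-2s) = Y^(-2s)E⁻¹. Subtraction
removes R. With the extra factor E² it removes L instead, which is the version needed below the real
axis. -/
lemma IsSwapPair.lewisF_sub (hκ : 0 < κ) (h : IsSwapPair ν κ a a' u u') (hνs : s = ν + 1 / 2)
    (hs : 0 ≤ s.re) {Y : ℝ} (hY : 0 < Y) {θ : ℝ} (hθ : 0 < Real.sin θ) (hcos : Real.cos θ < 0) :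
    lewisF s u (fderiv ℝ u) (Y * Complex.I) - ((Y : ℂ) * Complex.I) ^ (-(2 * s)) *
        lewisF s u' (fderiv ℝ u') (-1 / (Y * Complex.I)) =
      (Complex.exp (-(Real.pi * Complex.I * s)) - Complex.exp (Real.pi * Complex.I * s)) *
        rayF s u θ (Y * Complex.I) ∧
    lewisF s u (fderiv ℝ u) (Y * Complex.I) - Complex.exp (2 * Real.pi * Complex.I * s) *
        ((Y : ℂ) * Complex.I) ^ (-(2 * s)) *
        lewisF s u' (fderiv ℝ u') (-1 / (Y * Complex.I)) =
      (Complex.exp (-(Real.pi * Complex.I * s)) - Complex.exp (Real.pi * Complex.I * s)) *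
        rayF s u (Real.pi - θ) (Y * Complex.I) := by
  have hθ' : 0 < Real.sin (Real.pi - θ) := by rwa [Real.sin_pi_sub]
  have hcos' : 0 < Real.cos (Real.pi - θ) := by rw [Real.cos_pi_sub]; linarith
  have hY' : 0 < Y⁻¹ := inv_pos.mpr hY
  have hY0 : (Y : ℂ) ≠ 0 := by exact_mod_cast hY.ne'
  have e0 : -1 / ((Y : ℂ) * Complex.I) = ((Y⁻¹ : ℝ) : ℂ) * Complex.I := by
    push_cast
    field_simp
    rw [Complex.I_sq]
  have h1 := h.lewisF_eq_rayL hκ hνs hs hY hθ hcos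
  have h2 := h.symm.lewisF_eq_rayL hκ hνs hs hY' hθ hcos
  have h3 := h.rayF_swap (s := s) hY hθ hcos.ne
  have h4 := h.rayF_swap (s := s) hY hθ' hcos'.ne'
  rw [sub_sub_cancel] at h4
  rw [rayL_of_cos_neg s u hY hcos] at h1 h3
  rw [rayL_of_cos_pos s u hY hcos'] at h1 h4
  rw [rayL_of_cos_neg s u' hY' hcos, rayL_of_cos_pos s u' hY' hcos', ← e0, h3, h4] at h2
  have hE : Complex.exp (Real.pi * Complex.I * s) * Complex.exp (-(Real.pi * Complex.I * s)) = 1 := by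
    rw [← Complex.exp_add, add_neg_cancel, Complex.exp_zero]
  have hL : Complex.exp (-(2 * s * Real.log Y)) * Complex.exp (2 * s * Real.log Y) = 1 := by
    rw [← Complex.exp_add, neg_add_cancel, Complex.exp_zero]
  have hE2 : Complex.exp (2 * Real.pi * Complex.I * s) =
      Complex.exp (Real.pi * Complex.I * s) * Complex.exp (Real.pi * Complex.I * s) := by
    rw [← Complex.exp_add]
    congr 1
    ring
  rw [e0] at h2 ⊢
  rw [h1, h2, I_cpow_neg hY, hE2]
  set E := Complex.exp (Real.pi * Complex.I * s)
  set E' := Complex.exp (-(Real.pi * Complex.I * s))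
  set G := Complex.exp (-(2 * s * Real.log Y))
  set G' := Complex.exp (2 * s * Real.log Y)
  set R := rayF s u (Real.pi - θ) (Y * Complex.I)
  set L := rayF s u θ (Y * Complex.I)
  constructor
  · linear_combination (E' * E' * E * L - E' * E * E' * R) * hL + (E' * L - E' * R) * hE
  · linear_combination (E * E * E' * E' * E * L - E * E * E' * E' * E * R) * hL +
      ((E * L - E * R) * (E * E' + 1)) * hE

end

end

end HigherOrderLewis

namespace HigherOrderLewis

noncomputable section

/-! ### Reflection in the imaginary axis -/

/-- The reflection `z ↦ -z̄` as a real linear map. -/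
def reflC : ℂ →L[ℝ] ℂ := -(Complex.conjCLE : ℂ →L[ℝ] ℂ)

@[simp] lemma reflC_apply (z : ℂ) : reflC z = -(starRingEnd ℂ) z := rfl

lemma reflC_im (z : ℂ) : (-(starRingEnd ℂ) z).im = z.im := by simp

section

variable {ν s : ℂ} {κ : ℝ} {a a' : ℤ → ℂ} {u u' : ℂ → ℂ}

lemma hasFDerivAt_refl {u₁ : ℂ →L[ℝ] ℂ} {z : ℂ} (h : HasFDerivAt u u₁ (-(starRingEnd ℂ) z)) :
    HasFDerivAt (fun z => u (-(starRingEnd ℂ) z)) (u₁.comp reflC) z :=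
  HasFDerivAt.comp (g := u) z h reflC.hasFDerivAt

lemma IsEig.refl (h : IsEig ν {z : ℂ | 0 < z.im} u (fderiv ℝ u)) :
    IsEig ν {z : ℂ | 0 < z.im} (fun z => u (-(starRingEnd ℂ) z))
      (fderiv ℝ fun z => u (-(starRingEnd ℂ) z)) := by
  have hd : ∀ z : ℂ, 0 < z.im → HasFDerivAt (fun z => u (-(starRingEnd ℂ) z))
      ((fderiv ℝ u (-(starRingEnd ℂ) z)).comp reflC) z := fun z hz =>
    hasFDerivAt_refl (h.hasFDerivAt (by simpa using hz))
  intro z hz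
  obtain ⟨u₂, h2, h3⟩ := (h (-(starRingEnd ℂ) z) (by simpa using hz)).2
  have h4 : HasFDerivAt (fun z : ℂ => fderiv ℝ u (-(starRingEnd ℂ) z)) (u₂.comp reflC) z :=
    HasFDerivAt.comp (g := fderiv ℝ u) z h2 reflC.hasFDerivAt
  have h5 := (((ContinuousLinearMap.compL ℝ ℂ ℂ ℂ).flip reflC).hasFDerivAt).comp z h4
  refine ⟨(hd z hz).differentiableAt.hasFDerivAt, _, h5.congr_of_eventuallyEq ?_, ?_⟩
  · filter_upwards [isOpen_im_pos.mem_nhds hz] with w hw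
    rw [(hd w hw).fderiv]
    rfl
  · simpa using h3

lemma IsExpansion.refl (h : IsExpansion ν κ a u) :
    IsExpansion ν κ (fun k => a (-k)) fun z => u (-(starRingEnd ℂ) z) := by
  refine ⟨by simpa using h.1, fun z hz => ?_⟩
  have h1 := (Equiv.neg ℤ).hasSum_iff.mpr (h.2 (-(starRingEnd ℂ) z) (by simpa using hz))
  convert! h1 using 1
  funext k
  simp [mode, charX, modeG]

lemma IsSwapPair.refl (h : IsSwapPair ν κ a a' u u') :
    IsSwapPair ν κ (fun k => a (-k)) (fun k => a' (-k)) (fun z => u (-(starRingEnd ℂ) z))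
      fun z => u' (-(starRingEnd ℂ) z) := by
  refine ⟨h.eig.refl, h.eig'.refl, h.exp.refl, h.exp'.refl, fun z hz => ?_⟩
  rw [h.swap _ (by simpa using hz), map_div₀, map_neg, map_one, neg_div_neg_eq, neg_div, neg_neg]

/-- Under z ↦ -z̄ the rays at θ and π - θ are exchanged, ζ becomes -ζ and the two kernel factors
trade places. The reversed angular direction gives the sign. -/
lemma IsSwapPair.rayF_refl (h : IsSwapPair ν κ a a' u u') {θ : ℝ} (hθ : 0 < Real.sin θ) (ζ : ℂ) :
    rayF s (fun z => u (-(starRingEnd ℂ) z)) (Real.pi - θ) ζ = -rayF s u θ (-ζ) := by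
  rw [rayF, rayF, ← integral_neg]
  refine integral_congr_ae (ae_of_all _ fun τ => ?_)
  have hz : rayPt (Real.pi - θ) τ = -(starRingEnd ℂ) (rayPt θ τ) := by
    apply Complex.ext <;> simp [rayPt_re, rayPt_im]
  have hd : fderiv ℝ (fun z => u (-(starRingEnd ℂ) z)) (-(starRingEnd ℂ) (rayPt θ τ)) =
      (fderiv ℝ u (rayPt θ τ)).comp reflC := by
    refine (hasFDerivAt_refl ?_).fderiv
    have := h.eig.hasFDerivAt (z := rayPt θ τ) (rayPt_im_pos hθ τ)
    simpa using this
  simp only [hz]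
  generalize rayPt θ τ = z at *
  have e1 : ζ / -(starRingEnd ℂ) z = -ζ / (starRingEnd ℂ) z := by rw [div_neg, neg_div]
  have e2 : ζ / -z = -ζ / z := by rw [div_neg, neg_div]
  have hV : rayV s ζ (-(starRingEnd ℂ) z) = rayV s (-ζ) z := by
    simp only [rayV, norm_neg, RCLike.norm_conj, reflC_im, map_neg, Complex.conj_conj, e1, e2]
    congr 1
    ring
  have hD : rayD ζ (-(starRingEnd ℂ) z) = -rayD (-ζ) z := by
    simp only [rayD, reflC_im, map_neg, Complex.conj_conj, e1, e2, Complex.neg_re, Complex.conj_re]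
    push_cast
    ring
  rw [rayForm, rayForm, hV, hD, hd]
  have e3 : reflC (Complex.I * -(starRingEnd ℂ) z) = -(Complex.I * z) := by simp
  simp only [ContinuousLinearMap.comp_apply, e3, map_neg, Complex.conj_conj, neg_neg]
  ring

/-! ### The holomorphic series -/

/-- The holomorphic function off the real line attached to the coefficients. -/
def lewisSeries (ν : ℂ) (κ : ℝ) (a : ℤ → ℂ) (z : ℂ) : ℂ :=
  if 0 < z.im then upperSeries ν κ a z else -upperSeries ν κ (fun k => a (-k)) (-z)

lemma lewisConst_mul_ne_zero (ν : ℂ) (hκ : 0 < κ) (hs : 0 < s.re) :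
    lewisConst s * (κ : ℂ) ^ ν ≠ 0 :=
  mul_ne_zero (lewisConst_ne_zero hs) (by
    rw [Ne, Complex.cpow_eq_zero_iff]
    simp [hκ.ne'])

/-- Convergence needs no new estimate: the terms are those of the convergent `lewisF` series,
divided by a nonzero constant. -/
lemma IsExpansion.hasSum_upperSeries (hκ : 0 < κ) (hν : -(1 / 2 : ℝ) < ν.re)
    (h : IsExpansion ν κ a u) {ζ : ℂ} (hζ : 0 < ζ.im) :
    HasSum (fun k : {k : ℤ // 0 < k} => ((k : ℤ) : ℂ) ^ ν *
      Complex.exp (Complex.I * (κ * (k : ℤ)) * ζ) * a k) (upperSeries ν κ a ζ) := by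
  have hs : 0 < (ν + 1 / 2).re := by
    simp only [Complex.add_re, Complex.div_ofNat_re, Complex.one_re]
    linarith
  have h1 := h.hasSum_lewisF hκ rfl hs.le hζ
  have h2 := (h1.summable.subtype {k : ℤ | 0 < k}).mul_left
    (lewisConst (ν + 1 / 2) * (κ : ℂ) ^ ν)⁻¹
  refine Summable.hasSum (h2.congr fun (k : {k : ℤ // 0 < k}) => ?_)
  have hk : (0 : ℝ) < ((k : ℤ) : ℝ) := by exact_mod_cast k.2
  simp only [Function.comp_apply]
  rw [lewisF_mode_of_pos rfl hs.le (mul_pos hκ hk) hζ]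
  have hne := lewisConst_mul_ne_zero ν hκ hs
  push_cast
  rw [← Complex.ofReal_intCast, Complex.mul_cpow_ofReal_nonneg hκ.le hk.le]
  generalize Complex.exp (Complex.I * (κ * ((k : ℤ) : ℝ)) * ζ) = E
  generalize (((k : ℤ) : ℝ) : ℂ) ^ ν = B
  rw [show a (k : ℤ) * (lewisConst (ν + 1 / 2) * ((κ : ℂ) ^ ν * B) * E) =
    (lewisConst (ν + 1 / 2) * (κ : ℂ) ^ ν) * (B * E * a k) by ring, inv_mul_cancel_left₀ hne]

/-- Compare term by term with ζ = i. As k ≥ 1, each term gains at least e^{-κ(Im ζ - 1)}. -/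
lemma IsExpansion.exists_norm_upperSeries_le (hκ : 0 < κ) (hν : -(1 / 2 : ℝ) < ν.re)
    (h : IsExpansion ν κ a u) : ∃ M, 0 ≤ M ∧ ∀ ζ : ℂ, 1 ≤ ζ.im →
      ‖upperSeries ν κ a ζ‖ ≤ M * Real.exp (-(κ * (ζ.im - 1))) := by
  have h0 := (h.hasSum_upperSeries hκ hν (ζ := Complex.I) (by simp)).summable.norm
  refine ⟨_, h0.hasSum.nonneg fun k => norm_nonneg _, fun ζ hζ => ?_⟩
  refine (h.hasSum_upperSeries hκ hν (by linarith)).norm_le_of_bounded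
    (h0.hasSum.mul_right (Real.exp (-(κ * (ζ.im - 1))))) fun k => ?_
  have hk : (1 : ℝ) ≤ ((k : ℤ) : ℝ) := by exact_mod_cast Int.add_one_le_iff.mpr k.2
  have e : ∀ w : ℂ, ‖Complex.exp (Complex.I * (κ * (k : ℤ)) * w)‖ =
      Real.exp (-(κ * ((k : ℤ) : ℝ) * w.im)) := by
    intro w
    rw [Complex.norm_exp]
    congr 1
    simp
  rw [norm_mul, norm_mul, norm_mul, norm_mul, e, e, Complex.I_im, mul_one]
  have h1 : Real.exp (-(κ * ((k : ℤ) : ℝ) * ζ.im)) ≤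
      Real.exp (-(κ * ((k : ℤ) : ℝ))) * Real.exp (-(κ * (ζ.im - 1))) := by
    rw [← Real.exp_add]
    refine Real.exp_le_exp.mpr ?_
    have : κ * 1 * (ζ.im - 1) ≤ κ * ((k : ℤ) : ℝ) * (ζ.im - 1) := by
      have : 0 ≤ ζ.im - 1 := by linarith
      gcongr
    nlinarith
  calc _ ≤ ‖((k : ℤ) : ℂ) ^ ν‖ * (Real.exp (-(κ * ((k : ℤ) : ℝ))) *
        Real.exp (-(κ * (ζ.im - 1)))) * ‖a k‖ := by gcongr
    _ = _ := by ring

/-! ### The analytic continuation -/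

/-- The linear form equals |z| sin(θ - arg z). It exhibits the sector as an intersection of half
planes, hence as a convex set on which the identity theorem can be applied. -/
lemma arg_lt_iff {z : ℂ} (hz : 0 < z.im) {θ : ℝ} (h0 : 0 < θ) (hθ : θ < Real.pi) :
    z.arg < θ ↔ 0 < Real.sin θ * z.re - Real.cos θ * z.im := by
  have hz0 : z ≠ 0 := fun h => by simp [h] at hz
  have hn := norm_pos_iff.mpr hz0
  have e : Real.sin θ * z.re - Real.cos θ * z.im = ‖z‖ * Real.sin (θ - z.arg) := by
    rw [Real.sin_sub, mul_sub, ← mul_assoc, mul_comm ‖z‖, mul_assoc, Complex.norm_mul_cos_arg,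
      mul_left_comm, Complex.norm_mul_sin_arg]
  have h1 := Complex.arg_nonneg_iff.mpr hz.le
  have h2 := Complex.arg_le_pi z
  rw [e, mul_pos_iff_of_pos_left hn]
  constructor
  · intro h
    exact Real.sin_pos_of_pos_of_lt_pi (by linarith) (by linarith)
  · intro h
    by_contra hc
    exact absurd h (not_lt.mpr (Real.sin_nonpos_of_nonpos_of_neg_pi_le (by linarith) (by linarith)))

lemma isOpen_upperSector (θ : ℝ) :
    IsOpen {z : ℂ | 0 < z.im ∧ 0 < Real.sin θ * z.re - Real.cos θ * z.im} :=
  isOpen_im_pos.inter (t := {z : ℂ | 0 < Real.sin θ * z.re - Real.cos θ * z.im})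
    (isOpen_lt (by fun_prop) (by fun_prop))

lemma isPreconnected_upperSector (θ : ℝ) :
    IsPreconnected {z : ℂ | 0 < z.im ∧ 0 < Real.sin θ * z.re - Real.cos θ * z.im} := by
  refine ((convex_halfSpace_im_gt 0).inter (t := {z : ℂ | 0 < Real.sin θ * z.re - Real.cos θ * z.im})
    ?_).isPreconnected
  exact convex_halfSpace_gt (f := fun z : ℂ => Real.sin θ * z.re - Real.cos θ * z.im)
    ⟨fun x y => by simp; ring, fun c x => by simp; ring⟩ 0

lemma isOpen_lowerSector (θ : ℝ) :
    IsOpen {z : ℂ | z.im < 0 ∧ 0 < Real.sin θ * z.re + Real.cos θ * z.im} :=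
  (isOpen_lt Complex.continuous_im continuous_const).inter
    (t := {z : ℂ | 0 < Real.sin θ * z.re + Real.cos θ * z.im})
    (isOpen_lt (by fun_prop) (by fun_prop))

lemma isPreconnected_lowerSector (θ : ℝ) :
    IsPreconnected {z : ℂ | z.im < 0 ∧ 0 < Real.sin θ * z.re + Real.cos θ * z.im} := by
  refine ((convex_halfSpace_im_lt 0).inter (t := {z : ℂ | 0 < Real.sin θ * z.re + Real.cos θ * z.im})
    ?_).isPreconnected
  exact convex_halfSpace_gt (f := fun z : ℂ => Real.sin θ * z.re + Real.cos θ * z.im)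
    ⟨fun x y => by simp; ring, fun c x => by simp; ring⟩ 0

lemma abs_arg_lt_of_mem_lowerSector {z : ℂ} (hz : z.im < 0) {θ : ℝ} (h0 : 0 < θ)
    (hθ : θ < Real.pi) : |z.arg| < θ ↔ 0 < Real.sin θ * z.re + Real.cos θ * z.im := by
  have hz' : 0 < ((starRingEnd ℂ) z).im := by simpa using hz
  have h1 := arg_lt_iff hz' h0 hθ
  have hne : z.arg ≠ Real.pi := by
    have := Complex.arg_neg_iff.mpr hz
    linarith [Real.pi_pos]
  rw [Complex.arg_conj, if_neg hne] at h1
  rw [abs_of_neg (Complex.arg_neg_iff.mpr hz), h1]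
  simp

lemma IsSwapPair.differentiableAt_rayF (hκ : 0 < κ) (h : IsSwapPair ν κ a a' u u')
    (hs : 0 ≤ s.re) {θ : ℝ} (hθ : θ < Real.pi) {z : ℂ} (hz : z ≠ 0) (harg : |z.arg| < θ) :
    DifferentiableAt ℂ (rayF s u θ) z := by
  have h0 := abs_nonneg z.arg
  obtain ⟨c, hc, hc1, hmem⟩ := exists_mem_cone h0 harg hθ
  exact (h.differentiableOn_rayF hκ hs (Real.sin_pos_of_pos_of_lt_pi (by linarith) hθ) hc
    hc1).differentiableAt ((isOpen_cone θ c).mem_nhds (hmem z hz le_rfl))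

/-- The constant in the integral formula for the period function. -/
def periodConst (ν : ℂ) (κ : ℝ) (s : ℂ) : ℂ :=
  (lewisConst s * (κ : ℂ) ^ ν)⁻¹ *
    (Complex.exp (-(Real.pi * Complex.I * s)) - Complex.exp (Real.pi * Complex.I * s))

lemma IsSwapPair.upperSeries_sub (hκ : 0 < κ) (h : IsSwapPair ν κ a a' u u')
    (hνs : s = ν + 1 / 2) (hs : 0 < s.re) {Y : ℝ} (hY : 0 < Y) {θ : ℝ} (hθ : Real.pi / 2 < θ)
    (hθ' : θ < Real.pi) :
    upperSeries ν κ a (Y * Complex.I) - ((Y : ℂ) * Complex.I) ^ (-(2 * s)) *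
        upperSeries ν κ a' (-1 / (Y * Complex.I)) =
      periodConst ν κ s * rayF s u θ (Y * Complex.I) ∧
    upperSeries ν κ a (Y * Complex.I) - Complex.exp (2 * Real.pi * Complex.I * s) *
        ((Y : ℂ) * Complex.I) ^ (-(2 * s)) * upperSeries ν κ a' (-1 / (Y * Complex.I)) =
      periodConst ν κ s * rayF s u (Real.pi - θ) (Y * Complex.I) := by
  have hsin : 0 < Real.sin θ := Real.sin_pos_of_pos_of_lt_pi (by linarith [Real.pi_pos]) hθ'
  have hcos : Real.cos θ < 0 := Real.cos_neg_of_pi_div_two_lt_of_lt hθ (by linarith [Real.pi_pos])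
  have hζ : 0 < ((Y : ℂ) * Complex.I).im := by simpa using hY
  obtain ⟨h1, h2⟩ := h.lewisF_sub hκ hνs hs.le hY hsin hcos
  rw [h.exp.lewisF_eq hκ hνs hs.le hζ, h.exp'.lewisF_eq hκ hνs hs.le (im_neg_inv_pos hζ)] at h1 h2
  have hne := lewisConst_mul_ne_zero ν hκ hs
  rw [periodConst]
  generalize lewisConst s * (κ : ℂ) ^ ν = K at *
  constructor
  · rw [mul_assoc _ _ (rayF s u θ _), ← h1]
    field_simp
  · rw [mul_assoc _ _ (rayF s u (Real.pi - θ) _), ← h2]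
    field_simp

/-- Both sides are holomorphic on the part of the sector in each half plane, and they agree on the
imaginary half axis there. For the lower half plane the reflected pair is used at -z, together with
the second of the two ray identities. -/
lemma IsSwapPair.lewisSeries_sub (hκ : 0 < κ) (h : IsSwapPair ν κ a a' u u')
    (hνs : s = ν + 1 / 2) (hs : 0 < s.re) {θ : ℝ} (hθ : Real.pi / 2 < θ) (hθ' : θ < Real.pi)
    {z : ℂ} (hz : z.im ≠ 0) (harg : |z.arg| < θ) :
    lewisSeries ν κ a z - z ^ (-(2 * s)) * lewisSeries ν κ a' (-1 / z) =
      periodConst ν κ s * rayF s u θ z := by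
  have hθ0 : 0 < θ := by linarith [Real.pi_pos]
  have hsin : 0 < Real.sin θ := Real.sin_pos_of_pos_of_lt_pi hθ0 hθ'
  have hcos : Real.cos θ < 0 := Real.cos_neg_of_pi_div_two_lt_of_lt hθ (by linarith [Real.pi_pos])
  have hν : IsEig ν _ _ _ := h.eig
  have hne0 : ∀ w : ℂ, w.im ≠ 0 → w ≠ 0 := fun w hw h0 => hw (by simp [h0])
  have hpow : ∀ w : ℂ, w.im ≠ 0 → DifferentiableAt ℂ (fun w : ℂ => w ^ (-(2 * s))) w := fun w hw =>
    DifferentiableAt.cpow_const differentiableAt_id (Complex.mem_slitPlane_iff.mpr (Or.inr hw))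
  rcases lt_or_gt_of_ne hz with hneg | hpos
  · have hr := h.refl
    set D := {z : ℂ | z.im < 0 ∧ 0 < Real.sin θ * z.re + Real.cos θ * z.im} with hD
    have hf : DifferentiableOn ℂ (fun z => -upperSeries ν κ (fun k => a (-k)) (-z) -
        z ^ (-(2 * s)) * -upperSeries ν κ (fun k => a' (-k)) (-(-1 / z))) D := by
      rintro w ⟨hw, -⟩
      have hw0 := hne0 w hw.ne
      have h1 : DifferentiableAt ℂ (fun w => upperSeries ν κ (fun k => a (-k)) (-w)) w := by
        refine DifferentiableAt.comp (g := upperSeries ν κ fun k => a (-k)) w ?_ (by fun_prop)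
        exact hr.exp.differentiableAt_upperSeries hκ hνs hs hr.eig (by simpa using hw)
      have h2 : DifferentiableAt ℂ (fun w => upperSeries ν κ (fun k => a' (-k)) (-(-1 / w))) w := by
        refine DifferentiableAt.comp (g := upperSeries ν κ fun k => a' (-k)) w ?_ ?_
        · refine hr.exp'.differentiableAt_upperSeries hκ hνs hs hr.eig' ?_
          have := im_neg_inv_pos (z := -w) (by simpa using hw)
          rwa [div_neg] at this
        · exact (DifferentiableAt.div (by fun_prop) (by fun_prop) hw0).neg
      exact (h1.neg.sub ((hpow w hw.ne).mul h2.neg)).differentiableWithinAt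
    have hg : DifferentiableOn ℂ (fun z => periodConst ν κ s * rayF s u θ z) D := by
      rintro w ⟨hw, hw2⟩
      exact ((h.differentiableAt_rayF hκ hs.le hθ' (hne0 w hw.ne)
        ((abs_arg_lt_of_mem_lowerSector hw hθ0 hθ').mpr hw2)).const_mul _).differentiableWithinAt
    have hEq := eqOn_of_eq_on_segment (isOpen_lowerSector θ) (isPreconnected_lowerSector θ) hf hg
      (z₀ := -Complex.I) (d := -Complex.I) ⟨by simp, by simpa using hcos⟩ (by simp) ?_
      ⟨hneg, (abs_arg_lt_of_mem_lowerSector hneg hθ0 hθ').mp harg⟩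
    · have hn1 : ¬ 0 < z.im := not_lt.mpr hneg.le
      have hn2 : ¬ 0 < (-1 / z).im := by
        have := im_neg_inv_pos (z := -z) (by simpa using hneg)
        rw [div_neg, Complex.neg_im] at this
        linarith
      rw [lewisSeries, lewisSeries, if_neg hn1, if_neg hn2]
      exact hEq
    · filter_upwards [self_mem_nhdsWithin] with t ht
      have ht0 : (0 : ℝ) < t := ht
      have hY : 0 < 1 + t := by linarith
      have e : -Complex.I + t * -Complex.I = -(((1 + t : ℝ) : ℂ) * Complex.I) := by
        push_cast
        ring
      have h1 := (hr.upperSeries_sub hκ hνs hs hY hθ hθ').2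
      rw [h.rayF_refl hsin] at h1
      have hYC : ((1 + t : ℝ) : ℂ) ≠ 0 := by exact_mod_cast hY.ne'
      -- The principal argument is -π/2 here instead of π/2, and the resulting factor e^{2πis} is
      -- exactly the one in the second identity.
      have e2 : (-(((1 + t : ℝ) : ℂ) * Complex.I)) ^ (-(2 * s)) =
          Complex.exp (2 * Real.pi * Complex.I * s) *
            (((1 + t : ℝ) : ℂ) * Complex.I) ^ (-(2 * s)) := by
        rw [← mul_neg, Complex.cpow_def_of_ne_zero (mul_ne_zero hYC (by simp)),
          Complex.cpow_def_of_ne_zero (mul_ne_zero hYC (by simp)),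
          Complex.log_ofReal_mul hY (by simp), Complex.log_ofReal_mul hY (by simp),
          Complex.log_neg_I, Complex.log_I, ← Complex.exp_add]
        congr 1
        ring
      simp only [e, e2, div_neg, neg_neg]
      linear_combination -h1
  · set D := {z : ℂ | 0 < z.im ∧ 0 < Real.sin θ * z.re - Real.cos θ * z.im} with hD
    have habs : ∀ w : ℂ, 0 < w.im → |w.arg| = w.arg := fun w hw =>
      abs_of_nonneg (Complex.arg_nonneg_iff.mpr hw.le)
    have hf : DifferentiableOn ℂ (fun z => upperSeries ν κ a z -
        z ^ (-(2 * s)) * upperSeries ν κ a' (-1 / z)) D := by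
      rintro w ⟨hw, -⟩
      have hw0 := hne0 w hw.ne'
      have h1 := h.exp.differentiableAt_upperSeries hκ hνs hs h.eig hw
      have h2 : DifferentiableAt ℂ (fun w => upperSeries ν κ a' (-1 / w)) w := by
        refine DifferentiableAt.comp (g := upperSeries ν κ a') w ?_ ?_
        · exact h.exp'.differentiableAt_upperSeries hκ hνs hs h.eig' (im_neg_inv_pos hw)
        · exact DifferentiableAt.div (by fun_prop) (by fun_prop) hw0
      exact (h1.sub ((hpow w hw.ne').mul h2)).differentiableWithinAt
    have hg : DifferentiableOn ℂ (fun z => periodConst ν κ s * rayF s u θ z) D := by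
      rintro w ⟨hw, hw2⟩
      refine ((h.differentiableAt_rayF hκ hs.le hθ' (hne0 w hw.ne') ?_).const_mul
        _).differentiableWithinAt
      rw [habs w hw]
      exact (arg_lt_iff hw hθ0 hθ').mpr hw2
    have hEq := eqOn_of_eq_on_segment (isOpen_upperSector θ) (isPreconnected_upperSector θ) hf hg
      (z₀ := Complex.I) (d := Complex.I) ⟨by simp, by simpa using hcos⟩ (by simp) ?_
      ⟨hpos, (arg_lt_iff hpos hθ0 hθ').mp (by rwa [habs z hpos] at harg)⟩
    · rw [lewisSeries, lewisSeries, if_pos hpos, if_pos (im_neg_inv_pos hpos)]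
      exact hEq
    · filter_upwards [self_mem_nhdsWithin] with t ht
      have ht0 : (0 : ℝ) < t := ht
      have hY : 0 < 1 + t := by linarith
      have e : Complex.I + t * Complex.I = ((1 + t : ℝ) : ℂ) * Complex.I := by
        push_cast
        ring
      simp only [e]
      exact (h.upperSeries_sub hκ hνs hs hY hθ hθ').1

lemma IsSwapPair.exists_norm_lewisSeries_sub_le (hκ : 0 < κ) (h : IsSwapPair ν κ a a' u u')
    (hνs : s = ν + 1 / 2) (hs : 0 < s.re) {δ : ℝ} (hδ : 0 < δ) :
    ∃ M, 0 ≤ M ∧ ∀ z : ℂ, z.im ≠ 0 → |z.arg| ≤ Real.pi - δ →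
      ‖lewisSeries ν κ a z - z ^ (-(2 * s)) * lewisSeries ν κ a' (-1 / z)‖ ≤
        M * min 1 (‖z‖ ^ (-(2 * s.re))) := by
  have hpi := Real.pi_pos
  -- Shrinking δ keeps the ray angle π - δ'/2 above π/2. It lies strictly between the edge of the
  -- sector and π.
  set δ' := min δ (Real.pi / 4) with hδ'
  have h1 : 0 < δ' := lt_min hδ (by linarith)
  have h2 : δ' ≤ Real.pi / 4 := min_le_right _ _
  have h3 : δ' ≤ δ := min_le_left _ _
  obtain ⟨c, hc, hc1, hmem⟩ := exists_mem_cone (θ := Real.pi - δ' / 2) (θ₀ := Real.pi - δ')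
    (by linarith) (by linarith) (by linarith)
  obtain ⟨K, hK, hb⟩ := h.exists_norm_rayF_le hκ hs.le
    (Real.sin_pos_of_pos_of_lt_pi (by linarith) (by linarith : Real.pi - δ' / 2 < Real.pi)) hc hc1
  refine ⟨‖periodConst ν κ s‖ * K, by positivity, fun z hz harg => ?_⟩
  have hz0 : z ≠ 0 := fun h0 => hz (by simp [h0])
  rw [h.lewisSeries_sub hκ hνs hs (θ := Real.pi - δ' / 2) (by linarith) (by linarith) hz
    (by linarith), norm_mul, mul_assoc]
  exact mul_le_mul_of_nonneg_left (hb z (hmem z hz0 (by linarith))) (norm_nonneg _)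

end

end

end HigherOrderLewis

namespace HigherOrderLewis

noncomputable section

/-! ### The Bessel equation with moderate growth -/

/-- The exponential decay is weakened to 1/y² in order to match the weight dy/y² of the
integrability hypothesis. -/
lemma exists_norm_modeG_le (ν : ℂ) {a : ℝ} (ha : a ≠ 0) :
    ∃ C, 0 ≤ C ∧ ∀ y : ℝ, 1 ≤ y → ‖modeG ν a y‖ ≤ C / y ^ 2 ∧ ‖modeG' ν a y‖ ≤ C / y ^ 2 := by
  have ha' : 0 < |a| := abs_pos.mpr ha
  obtain ⟨C, hC, h⟩ := exists_norm_besselW_le_exp ν ha'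
  have hs : 0 ≤ (Real.sqrt |a|)⁻¹ := by positivity
  refine ⟨(Real.sqrt |a|)⁻¹ * ((1 + |a|) * C * (2 / |a| ^ 2)), by positivity, fun y hy => ?_⟩
  have hy0 : 0 < y := by linarith
  have hexp : Real.exp (-(|a| * y)) ≤ 2 / |a| ^ 2 / y ^ 2 := by
    have h1 := Real.quadratic_le_exp_of_nonneg (x := |a| * y) (by positivity)
    have h2 : (|a| * y) ^ 2 / 2 ≤ Real.exp (|a| * y) := by nlinarith [mul_pos ha' hy0]
    rw [Real.exp_neg, inv_eq_one_div, div_div, div_le_div_iff₀ (Real.exp_pos _) (by positivity)]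
    nlinarith
  have hb := h (|a| * y) (by nlinarith)
  have e : (Real.sqrt |a|)⁻¹ * ((1 + |a|) * C * (2 / |a| ^ 2)) / y ^ 2 =
      (Real.sqrt |a|)⁻¹ * ((1 + |a|) * (C * (2 / |a| ^ 2 / y ^ 2))) := by ring
  have hCe : C * Real.exp (-(|a| * y)) ≤ C * (2 / |a| ^ 2 / y ^ 2) :=
    mul_le_mul_of_nonneg_left hexp hC
  have hp : 0 ≤ C * (2 / |a| ^ 2 / y ^ 2) := by positivity
  rw [e]
  constructor
  · rw [modeG, norm_mul, Complex.norm_real, Real.norm_of_nonneg hs]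
    refine mul_le_mul_of_nonneg_left ((hb.1.trans hCe).trans ?_) hs
    nlinarith
  · rw [modeG', norm_mul, Complex.norm_real, Real.norm_of_nonneg hs, norm_mul, Complex.norm_real,
      Real.norm_of_nonneg ha'.le]
    refine mul_le_mul_of_nonneg_left ?_ hs
    calc |a| * ‖besselW' ν (|a| * y)‖ ≤ |a| * (C * (2 / |a| ^ 2 / y ^ 2)) :=
          mul_le_mul_of_nonneg_left (hb.2.trans hCe) ha'.le
      _ ≤ _ := by nlinarith

lemma exists_modeG_ne_zero (ν : ℂ) {a : ℝ} (ha : a ≠ 0) : ∃ y : ℝ, 1 < y ∧ modeG ν a y ≠ 0 := by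
  obtain ⟨t₁, ht₁, c, hc, hb⟩ := exists_le_norm_besselW ν
  have ha' : 0 < |a| := abs_pos.mpr ha
  refine ⟨max 2 (t₁ / |a|), lt_of_lt_of_le (by norm_num) (le_max_left _ _), ?_⟩
  have h : t₁ ≤ |a| * max 2 (t₁ / |a|) := by
    calc t₁ = |a| * (t₁ / |a|) := by field_simp
      _ ≤ _ := mul_le_mul_of_nonneg_left (le_max_right _ _) ha'.le
  have h1 : besselW ν (|a| * max 2 (t₁ / |a|)) ≠ 0 := fun h0 => by
    have := hb _ h
    rw [h0, norm_zero] at this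
    have := mul_pos hc (Real.exp_pos (-(|a| * max 2 (t₁ / |a|))))
    linarith
  rw [modeG]
  refine mul_ne_zero ?_ h1
  exact_mod_cast (inv_pos.mpr (Real.sqrt_pos.mpr ha')).ne'

/-- Uniqueness for a linear second order equation with continuous coefficient. -/
lemma eq_zero_of_second_order {m f f' : ℝ → ℂ} (hm : ContinuousOn m (Set.Ioi 0))
    (h : ∀ y : ℝ, 0 < y → HasDerivAt f (f' y) y) (h' : ∀ y : ℝ, 0 < y → HasDerivAt f' (m y * f y) y)
    {y₁ : ℝ} (hy₁ : 0 < y₁) (h0 : f y₁ = 0) (h0' : f' y₁ = 0) {y : ℝ} (hy : 0 < y) : f y = 0 := by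
  set A := min y y₁ / 2
  set B := max y y₁ + 1
  have hA : 0 < A := by positivity
  have hAy : A < y := by have := min_le_left y y₁; simp only [A]; linarith [lt_min hy hy₁]
  have hAy₁ : A < y₁ := by have := min_le_right y y₁; simp only [A]; linarith [lt_min hy hy₁]
  have hBy : y < B := by have := le_max_left y y₁; simp only [B]; linarith
  have hBy₁ : y₁ < B := by have := le_max_right y y₁; simp only [B]; linarith
  obtain ⟨M, hM⟩ := isCompact_Icc.exists_bound_of_continuousOn
    (hm.mono fun t (ht : t ∈ Set.Icc A B) => hA.trans_le ht.1)
  set K : NNReal := ⟨max 1 |M|, by positivity⟩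
  let v : ℝ → ℂ × ℂ → ℂ × ℂ := fun t p => (p.2, m t * p.1)
  have hv : ∀ t ∈ Set.Ioo A B, LipschitzOnWith K (v t) Set.univ := by
    intro t ht
    refine LipschitzOnWith.of_dist_le_mul fun p _ r _ => ?_
    have hk : (K : ℝ) = max 1 |M| := rfl
    rw [hk, Prod.dist_eq, Prod.dist_eq]
    have hn : 0 ≤ max (dist p.1 r.1) (dist p.2 r.2) := le_max_of_le_left dist_nonneg
    refine max_le ?_ ?_
    · calc dist p.2 r.2 ≤ 1 * max (dist p.1 r.1) (dist p.2 r.2) := by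
            rw [one_mul]; exact le_max_right _ _
        _ ≤ _ := mul_le_mul_of_nonneg_right (le_max_left _ _) hn
    · have h1 : dist (m t * p.1) (m t * r.1) = ‖m t‖ * dist p.1 r.1 := by
        rw [dist_eq_norm, ← mul_sub, norm_mul, dist_eq_norm]
      change dist (m t * p.1) (m t * r.1) ≤ _
      rw [h1]
      refine mul_le_mul ?_ (le_max_left _ _) dist_nonneg (by positivity)
      exact ((hM t ⟨ht.1.le, ht.2.le⟩).trans (le_abs_self M)).trans (le_max_right _ _)
  have key := ODE_solution_unique_of_mem_Ioo (f := fun t => (f t, f' t)) (g := fun _ => (0, 0))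
    hv ⟨hAy₁, hBy₁⟩
    (fun t ht => ⟨(h t (hA.trans ht.1)).prodMk (h' t (hA.trans ht.1)), Set.mem_univ _⟩)
    (fun t _ => ⟨by simpa [v] using! hasDerivAt_const t ((0 : ℂ), (0 : ℂ)), Set.mem_univ _⟩)
    (by simp [h0, h0'])
  have := key ⟨hAy, hBy⟩
  simpa using congrArg Prod.fst this

/-- A solution of the Bessel equation that is integrable against `dy / y ^ 2` at infinity is a
multiple of `√y K_ν(|a| y)`. -/
lemma exists_eq_mul_modeG {ν : ℂ} {a : ℝ} (ha : a ≠ 0) {c c' : ℝ → ℂ}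
    (h : ∀ y : ℝ, 0 < y → HasDerivAt c (c' y) y)
    (h' : ∀ y : ℝ, 0 < y →
      HasDerivAt c' (((a : ℂ) ^ 2 + (ν ^ 2 - 1 / 4) / (y : ℂ) ^ 2) * c y) y)
    (hint : IntegrableOn (fun y : ℝ => c y / (y : ℂ) ^ 2) (Set.Ioi 1)) :
    ∃ b : ℂ, ∀ y : ℝ, 0 < y → c y = b * modeG ν a y := by
  set k := modeG ν a
  set k' := modeG' ν a
  have hk : ∀ y : ℝ, 0 < y → HasDerivAt k (k' y) y := fun y hy => hasDerivAt_modeG ν ha hy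
  have hk' : ∀ y : ℝ, 0 < y →
      HasDerivAt k' (((a : ℂ) ^ 2 + (ν ^ 2 - 1 / 4) / (y : ℂ) ^ 2) * k y) y :=
    fun y hy => hasDerivAt_modeG' ν ha hy
  have hcc : ContinuousOn c (Set.Ioi 0) := fun y hy => (h y hy).continuousAt.continuousWithinAt
  have hkc : ContinuousOn k (Set.Ioi 0) := fun y hy => (hk y hy).continuousAt.continuousWithinAt
  have hkc' : ContinuousOn k' (Set.Ioi 0) := fun y hy => (hk' y hy).continuousAt.continuousWithinAt
  have hsub : Set.Ioi (1 : ℝ) ⊆ Set.Ioi 0 := Set.Ioi_subset_Ioi zero_le_one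
  obtain ⟨C, hC, hb⟩ := exists_norm_modeG_le ν ha
  obtain ⟨y₁, hy₁, hne⟩ := exists_modeG_ne_zero ν ha
  replace hne : k y₁ ≠ 0 := hne
  have hy₁0 : 0 < y₁ := by linarith
  -- The Wronskian, constant because both functions solve the same equation without first order
  -- term.
  set W : ℝ → ℂ := fun y => c y * k' y - c' y * k y
  have hW : ∀ y : ℝ, 0 < y → W y = W y₁ := by
    have hd : ∀ y ∈ Set.Ioi (0 : ℝ), HasDerivAt W 0 y := fun y hy => by
      have := ((h y hy).mul (hk' y hy)).sub ((h' y hy).mul (hk y hy))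
      convert! this using 1
      ring
    intro y hy
    exact isOpen_Ioi.is_const_of_deriv_eq_zero (convex_Ioi (0 : ℝ)).isPreconnected
      (fun y hy => (hd y hy).differentiableAt.differentiableWithinAt)
      (fun y hy => (hd y hy).deriv) hy hy₁0
  have hint2 : ∀ g : ℝ → ℂ, ContinuousOn g (Set.Ioi 0) → (∀ y : ℝ, 1 ≤ y → ‖g y‖ ≤ C / y ^ 2) →
      IntegrableOn (fun y => c y * g y) (Set.Ioi 1) := by
    intro g hg hgb
    refine Integrable.mono' (hint.norm.const_mul C)
      (((hcc.mul hg).mono hsub).aestronglyMeasurable measurableSet_Ioi) ?_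
    refine (ae_restrict_iff' measurableSet_Ioi).mpr (Eventually.of_forall fun y hy => ?_)
    have hy1 : 1 ≤ y := le_of_lt hy
    have hy0 : 0 < y := by linarith
    rw [norm_mul, norm_div, norm_pow, Complex.norm_real, Real.norm_of_nonneg hy0.le]
    calc ‖c y‖ * ‖g y‖ ≤ ‖c y‖ * (C / y ^ 2) :=
          mul_le_mul_of_nonneg_left (hgb y hy1) (norm_nonneg _)
      _ = _ := by ring
  -- Suppose W ≠ 0. The derivative of ck + Wy is 2ck', which is integrable, so ck + Wy has a limit.
  -- Then |ck| grows linearly, contrary to the integrability of ck.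
  have hW0 : W y₁ = 0 := by
    by_contra hW0
    have hI := hint2 k hkc fun y hy => (hb y hy).1
    have hI' := (hint2 k' hkc' fun y hy => (hb y hy).2).const_mul 2
    have hlim := tendsto_limUnder_of_hasDerivAt_of_integrableOn_Ioi
      (f := fun y : ℝ => c y * k y + W y₁ * y) (f' := fun y => 2 * (c y * k' y)) (a := 1)
      (fun y hy => by
        have hy0 : (0 : ℝ) < y := hsub hy
        have h1 := ((h y hy0).mul (hk y hy0)).add
          ((Complex.ofRealCLM.hasDerivAt (x := y)).const_mul (W y₁))
        convert! h1 using 1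
        rw [← hW y hy0]
        simp only [W, Complex.ofRealCLM_apply, Complex.ofReal_one]
        ring) hI'
    obtain ⟨T, hT⟩ := eventually_atTop.mp (hlim.norm.eventually_le_const (lt_add_one _))
    set M := ‖limUnder atTop fun y : ℝ => c y * k y + W y₁ * y‖ + 1
    have hWn : 0 < ‖W y₁‖ := norm_pos_iff.mpr hW0
    set Y := max (max 1 T) ((M + 1) / ‖W y₁‖)
    have hY : IntegrableOn (fun _ : ℝ => (1 : ℝ)) (Set.Ioi Y) := by
      refine Integrable.mono' (hI.mono_set (Set.Ioi_subset_Ioi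
        ((le_max_left 1 T).trans (le_max_left _ _)))).norm aestronglyMeasurable_const ?_
      refine (ae_restrict_iff' measurableSet_Ioi).mpr (Eventually.of_forall fun y hy => ?_)
      have hy : Y < y := hy
      have hyT : T ≤ y := ((le_max_right 1 T).trans (le_max_left _ _)).trans hy.le
      have hy1 : 1 ≤ y := ((le_max_left 1 T).trans (le_max_left _ _)).trans hy.le
      have hyM : (M + 1) / ‖W y₁‖ ≤ y := (le_max_right _ _).trans hy.le
      rw [div_le_iff₀ hWn] at hyM
      have h1 := hT y hyT
      have h2 : ‖W y₁ * y‖ ≤ ‖c y * k y + W y₁ * y‖ + ‖c y * k y‖ := by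
        have := norm_sub_le (c y * k y + W y₁ * y) (c y * k y)
        rwa [add_sub_cancel_left] at this
      rw [norm_mul, Complex.norm_real, Real.norm_of_nonneg (by linarith : 0 ≤ y)] at h2
      rw [norm_one]
      linarith
    rw [integrableOn_const_iff] at hY
    simp at hY
  -- Since k(y₁) ≠ 0 and W = 0, the function c - (c(y₁)/k(y₁))k vanishes at y₁ together with its
  -- derivative.
  refine ⟨c y₁ / k y₁, fun y hy => ?_⟩
  have hm : ContinuousOn (fun y : ℝ => (a : ℂ) ^ 2 + (ν ^ 2 - 1 / 4) / (y : ℂ) ^ 2) (Set.Ioi 0) := by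
    refine continuousOn_const.add (continuousOn_const.div (by fun_prop) fun y hy => ?_)
    have : (y : ℂ) ≠ 0 := by exact_mod_cast (ne_of_gt (show (0 : ℝ) < y from hy))
    exact pow_ne_zero 2 this
  have := eq_zero_of_second_order hm (f := fun y => c y - c y₁ / k y₁ * k y)
    (f' := fun y => c' y - c y₁ / k y₁ * k' y) (fun y hy => (h y hy).sub ((hk y hy).const_mul _))
    (fun y hy => by
      convert! (h' y hy).sub ((hk' y hy).const_mul (c y₁ / k y₁)) using 1
      ring) hy₁0 (by field_simp; simp) (by
      simp only [W] at hW0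
      field_simp
      linear_combination -hW0) hy
  exact sub_eq_zero.mp this

end

end HigherOrderLewis

namespace HigherOrderLewis

noncomputable section

/-! ### Fourier coefficients on horizontal lines -/

lemma continuous_horizontal {E : Type*} [TopologicalSpace E] {F : ℂ → E}
    (hF : ContinuousOn F {z : ℂ | 0 < z.im}) {y : ℝ} (hy : 0 < y) :
    Continuous fun x : ℝ => F (x + y * Complex.I) :=
  hF.comp_continuous (by fun_prop) fun x => by simpa using hy

lemma intervalIntegrable_horizontal (L : ℝ) {F : ℂ → ℂ} (hF : ContinuousOn F {z : ℂ | 0 < z.im})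
    {χ : ℝ → ℂ} (hχ : Continuous χ) {y : ℝ} (hy : 0 < y) :
    IntervalIntegrable (fun x : ℝ => F (x + y * Complex.I) * χ x) volume 0 L :=
  ((continuous_horizontal hF hy).mul hχ).intervalIntegrable 0 L

lemma hasDerivAt_horizontal_integral (L : ℝ) {F : ℂ → ℂ} {F₁ : ℂ → ℂ →L[ℝ] ℂ}
    (hF : ∀ z : ℂ, 0 < z.im → HasFDerivAt F (F₁ z) z) (hc : ContinuousOn F₁ {z : ℂ | 0 < z.im})
    {χ : ℝ → ℂ} (hχ : Continuous χ) {y : ℝ} (hy : 0 < y) :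
    HasDerivAt (fun y : ℝ => ∫ x in (0 : ℝ)..L, F (x + y * Complex.I) * χ x)
      (∫ x in (0 : ℝ)..L, F₁ (x + y * Complex.I) Complex.I * χ x) y := by
  have hFc : ContinuousOn F {z : ℂ | 0 < z.im} := fun z hz =>
    (hF z hz).continuousAt.continuousWithinAt
  have hc1 : ContinuousOn (fun z => F₁ z Complex.I) {z : ℂ | 0 < z.im} :=
    hc.clm_apply continuousOn_const
  have hcont : ContinuousOn (fun p : ℝ × ℝ => F₁ (p.1 + p.2 * Complex.I) Complex.I * χ p.1)
      (Set.uIcc 0 L ×ˢ Set.Icc (y / 2) (y + 1)) := by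
    refine ContinuousOn.mul (hc1.comp (by fun_prop) fun p hp => ?_) (by fun_prop)
    have : 0 < p.2 := lt_of_lt_of_le (by positivity) hp.2.1
    simpa using this
  obtain ⟨M, hM⟩ := (isCompact_uIcc.prod isCompact_Icc).exists_bound_of_continuousOn hcont
  refine (intervalIntegral.hasDerivAt_integral_of_dominated_loc_of_deriv_le
    (F := fun (y x : ℝ) => F (x + y * Complex.I) * χ x)
    (F' := fun (y x : ℝ) => F₁ (x + y * Complex.I) Complex.I * χ x) (bound := fun _ => M)
    (s := Set.Ioo (y / 2) (y + 1)) (Ioo_mem_nhds (by linarith) (by linarith)) ?_ ?_ ?_ ?_ ?_ ?_).2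
  · filter_upwards [lt_mem_nhds hy] with t ht
    exact ((continuous_horizontal hFc ht).mul hχ).aestronglyMeasurable
  · exact ((continuous_horizontal hFc hy).mul hχ).intervalIntegrable _ _
  · exact ((continuous_horizontal hc1 hy).mul hχ).aestronglyMeasurable
  · exact Eventually.of_forall fun x hx t ht =>
      hM (x, t) ⟨Set.uIoc_subset_uIcc hx, Set.Ioo_subset_Icc_self ht⟩
  · exact intervalIntegrable_const
  · refine Eventually.of_forall fun x _ t ht => ?_
    have ht0 : 0 < t := lt_trans (by positivity) ht.1
    have h1 : HasDerivAt (fun t : ℝ => (x : ℂ) + t * Complex.I) Complex.I t := by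
      have := ((Complex.ofRealCLM.hasDerivAt (x := t)).mul_const Complex.I).const_add (x : ℂ)
      simpa using! this
    have h2 := (hF (x + t * Complex.I) (by simpa using ht0)).comp_hasDerivAt t h1
    simpa [Function.comp_def] using! h2.mul_const (χ x)

/-- Integration by parts over one period. The boundary terms cancel because F and the exponential
both take equal values at the two ends. -/
lemma integral_horizontal_deriv {L : ℝ} {F : ℂ → ℂ} {F₁ : ℂ → ℂ →L[ℝ] ℂ}
    (hF : ∀ z : ℂ, 0 < z.im → HasFDerivAt F (F₁ z) z) (hc : ContinuousOn F₁ {z : ℂ | 0 < z.im})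
    (hper : ∀ z : ℂ, 0 < z.im → F (z + L) = F z) {c : ℂ} (hL : Complex.exp (c * L) = 1)
    {y : ℝ} (hy : 0 < y) :
    ∫ x in (0 : ℝ)..L, F₁ (x + y * Complex.I) 1 * Complex.exp (c * x) =
      -c * ∫ x in (0 : ℝ)..L, F (x + y * Complex.I) * Complex.exp (c * x) := by
  have hFc : ContinuousOn F {z : ℂ | 0 < z.im} := fun z hz =>
    (hF z hz).continuousAt.continuousWithinAt
  have hc1 : ContinuousOn (fun z => F₁ z 1) {z : ℂ | 0 < z.im} := hc.clm_apply continuousOn_const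
  have he : Continuous fun x : ℝ => Complex.exp (c * x) := by fun_prop
  have hi1 := intervalIntegrable_horizontal L hc1 he hy
  have hi2 := intervalIntegrable_horizontal L hFc he hy
  have hd : ∀ x : ℝ, HasDerivAt (fun x : ℝ => F (x + y * Complex.I) * Complex.exp (c * x))
      (F₁ (x + y * Complex.I) 1 * Complex.exp (c * x) +
        c * (F (x + y * Complex.I) * Complex.exp (c * x))) x := by
    intro x
    have h1 : HasDerivAt (fun x : ℝ => (x : ℂ) + y * Complex.I) 1 x := by
      simpa using! (Complex.ofRealCLM.hasDerivAt (x := x)).add_const (y * Complex.I)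
    have h2 := (hF (x + y * Complex.I) (by simpa using hy)).comp_hasDerivAt x h1
    have h3 := ((Complex.ofRealCLM.hasDerivAt (x := x)).const_mul c).cexp
    convert! h2.mul h3 using 1
    simp
    ring
  have key := intervalIntegral.integral_eq_sub_of_hasDerivAt (a := 0) (b := L) (fun x _ => hd x)
    (hi1.add (hi2.const_mul c))
  rw [intervalIntegral.integral_add hi1 (hi2.const_mul c),
    intervalIntegral.integral_const_mul] at key
  have e : F ((L : ℂ) + y * Complex.I) = F (y * Complex.I) := by
    rw [add_comm]
    exact hper _ (by simpa using hy)
  rw [e, hL] at key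
  simp at key
  linear_combination key

/-- The (unnormalized) Fourier integral `∫_0^L w(x+iy) e^{-iax} dx`. -/
def fourierInt (L : ℝ) (w : ℂ → ℂ) (a y : ℝ) : ℂ :=
  ∫ x in (0 : ℝ)..L, w (x + y * Complex.I) * Complex.exp (-(Complex.I * a) * x)

section

variable {ν : ℂ} {L : ℝ} {w : ℂ → ℂ}

lemma contDiffOn_fderiv (hc : ContDiffOn ℝ 2 w {z : ℂ | 0 < z.im}) :
    ContDiffOn ℝ 1 (fderiv ℝ w) {z : ℂ | 0 < z.im} :=
  hc.fderiv_of_isOpen isOpen_im_pos (by norm_num)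

lemma fderiv_add_period (hper : ∀ z : ℂ, 0 < z.im → w (z + L) = w z) {z : ℂ} (hz : 0 < z.im) :
    fderiv ℝ w (z + L) = fderiv ℝ w z := by
  rw [← fderiv_comp_add_right]
  refine Filter.EventuallyEq.fderiv_eq ?_
  filter_upwards [isOpen_im_pos.mem_nhds hz] with t ht
  exact hper t ht

lemma hasFDerivAt_fderiv_apply (hc : ContDiffOn ℝ 2 w {z : ℂ | 0 < z.im}) (h : ℂ) {z : ℂ}
    (hz : 0 < z.im) : HasFDerivAt (fun z => fderiv ℝ w z h)
      ((ContinuousLinearMap.apply ℝ ℂ h).comp (fderiv ℝ (fderiv ℝ w) z)) z := by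
  have h1 := (((contDiffOn_fderiv hc).contDiffAt (isOpen_im_pos.mem_nhds hz)).differentiableAt
    (by norm_num)).hasFDerivAt
  exact (ContinuousLinearMap.apply ℝ ℂ h).hasFDerivAt.comp z h1

lemma continuousOn_fderiv_fderiv_apply (hc : ContDiffOn ℝ 2 w {z : ℂ | 0 < z.im}) (h : ℂ) :
    ContinuousOn (fun z => (ContinuousLinearMap.apply ℝ ℂ h).comp (fderiv ℝ (fderiv ℝ w) z))
      {z : ℂ | 0 < z.im} :=
  continuousOn_const.clm_comp
    ((contDiffOn_fderiv hc).continuousOn_fderiv_of_isOpen isOpen_im_pos (by norm_num))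

lemma hasFDerivAt_of_contDiffOn (hc : ContDiffOn ℝ 2 w {z : ℂ | 0 < z.im}) {z : ℂ}
    (hz : 0 < z.im) : HasFDerivAt w (fderiv ℝ w z) z :=
  ((hc.contDiffAt (isOpen_im_pos.mem_nhds hz)).differentiableAt (by norm_num)).hasFDerivAt

/-- Integrating by parts twice. -/
lemma integral_fderiv_fderiv (hc : ContDiffOn ℝ 2 w {z : ℂ | 0 < z.im})
    (hper : ∀ z : ℂ, 0 < z.im → w (z + L) = w z) {a : ℝ}
    (ha : Complex.exp (-(Complex.I * a) * L) = 1) {y : ℝ} (hy : 0 < y) :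
    ∫ x in (0 : ℝ)..L, fderiv ℝ (fderiv ℝ w) (x + y * Complex.I) 1 1 *
      Complex.exp (-(Complex.I * a) * x) = -(a : ℂ) ^ 2 * fourierInt L w a y := by
  have h1 := integral_horizontal_deriv (fun z hz => hasFDerivAt_fderiv_apply hc 1 hz)
    (continuousOn_fderiv_fderiv_apply hc 1)
    (fun z hz => by rw [fderiv_add_period hper hz]) ha hy
  have h2 := integral_horizontal_deriv (fun z hz => hasFDerivAt_of_contDiffOn hc hz)
    (contDiffOn_fderiv hc).continuousOn hper ha hy
  rw [h2] at h1
  refine h1.trans ?_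
  rw [fourierInt]
  linear_combination (a : ℂ) ^ 2 *
    (∫ x in (0 : ℝ)..L, w (x + y * Complex.I) * Complex.exp (-(Complex.I * a) * x)) * Complex.I_sq

/-- The derivative of the Fourier integral in the height. -/
def fourierInt' (L : ℝ) (w : ℂ → ℂ) (a y : ℝ) : ℂ :=
  ∫ x in (0 : ℝ)..L, fderiv ℝ w (x + y * Complex.I) Complex.I * Complex.exp (-(Complex.I * a) * x)

lemma hasDerivAt_fourierInt (hc : ContDiffOn ℝ 2 w {z : ℂ | 0 < z.im}) (a : ℝ) {y : ℝ}
    (hy : 0 < y) : HasDerivAt (fourierInt L w a) (fourierInt' L w a y) y :=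
  hasDerivAt_horizontal_integral L (fun z hz => hasFDerivAt_of_contDiffOn hc hz)
    (contDiffOn_fderiv hc).continuousOn (by fun_prop) hy

/-- The eigenvalue equation trades the second y-derivative for the second x-derivative, which two
integrations by parts replace by -a². -/
lemma hasDerivAt_fourierInt' (hc : ContDiffOn ℝ 2 w {z : ℂ | 0 < z.im})
    (hl : ∀ z : ℂ, 0 < z.im → fderiv ℝ (fderiv ℝ w) z 1 1 +
      fderiv ℝ (fderiv ℝ w) z Complex.I Complex.I = (ν ^ 2 - 1 / 4) / (z.im : ℂ) ^ 2 * w z)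
    (hper : ∀ z : ℂ, 0 < z.im → w (z + L) = w z) {a : ℝ}
    (ha : Complex.exp (-(Complex.I * a) * L) = 1) {y : ℝ} (hy : 0 < y) :
    HasDerivAt (fourierInt' L w a)
      (((a : ℂ) ^ 2 + (ν ^ 2 - 1 / 4) / (y : ℂ) ^ 2) * fourierInt L w a y) y := by
  have h1 := hasDerivAt_horizontal_integral L
    (fun z hz => hasFDerivAt_fderiv_apply hc Complex.I hz)
    (continuousOn_fderiv_fderiv_apply hc Complex.I)
    (χ := fun x : ℝ => Complex.exp (-(Complex.I * a) * x)) (by fun_prop) hy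
  convert! h1 using 1
  have he : Continuous fun x : ℝ => Complex.exp (-(Complex.I * a) * x) := by fun_prop
  have hi1 := intervalIntegrable_horizontal L hc.continuousOn he hy
  have hi2 := intervalIntegrable_horizontal L ((continuousOn_fderiv_fderiv_apply hc 1).clm_apply
    (continuousOn_const (c := (1 : ℂ)))) he hy
  have e : ∀ x : ℝ, ((ContinuousLinearMap.apply ℝ ℂ Complex.I).comp
      (fderiv ℝ (fderiv ℝ w) (x + y * Complex.I))) Complex.I * Complex.exp (-(Complex.I * a) * x) =
      (ν ^ 2 - 1 / 4) / (y : ℂ) ^ 2 *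
        (w (x + y * Complex.I) * Complex.exp (-(Complex.I * a) * x)) -
      ((ContinuousLinearMap.apply ℝ ℂ 1).comp (fderiv ℝ (fderiv ℝ w) (x + y * Complex.I))) 1 *
        Complex.exp (-(Complex.I * a) * x) := by
    intro x
    have := hl (x + y * Complex.I) (by simpa using hy)
    simp at this
    simp
    linear_combination Complex.exp (-(Complex.I * a * x)) * this
  simp_rw [e]
  rw [intervalIntegral.integral_sub (hi1.const_mul _) hi2, intervalIntegral.integral_const_mul]
  have h2 := integral_fderiv_fderiv hc hper ha hy
  change _ = _ * fourierInt L w a y - ∫ x in (0 : ℝ)..L,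
    fderiv ℝ (fderiv ℝ w) (x + y * Complex.I) 1 1 * Complex.exp (-(Complex.I * a) * x)
  rw [h2]
  ring

end

end

end HigherOrderLewis

namespace HigherOrderLewis

noncomputable section

/-! ### The Fourier-Bessel expansion of a cusp form -/

lemma hasSum_fourier_of_summable {L : ℝ} (hL : 0 < L) {g : ℝ → ℂ} (hg : Continuous g)
    (hper : ∀ x, g (x + L) = g x)
    (hs : Summable fun k : ℤ => ∫ x in (0 : ℝ)..L,
      g x * Complex.exp (-(Complex.I * ((2 * Real.pi / L * k : ℝ) : ℂ)) * x)) (x : ℝ) :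
    HasSum (fun k : ℤ => (L : ℂ)⁻¹ * (∫ x in (0 : ℝ)..L,
      g x * Complex.exp (-(Complex.I * ((2 * Real.pi / L * k : ℝ) : ℂ)) * x)) *
        Complex.exp (Complex.I * ((2 * Real.pi / L * k : ℝ) : ℂ) * x)) (g x) := by
  have : Fact (0 < L) := ⟨hL⟩
  have hp : Function.Periodic g L := hper
  let G : C(AddCircle L, ℂ) := ⟨hp.lift, by
    refine continuous_quot_lift _ hg⟩
  have hG : ∀ x : ℝ, G x = g x := fun x => hp.lift_coe x
  have hL0 : (L : ℂ) ≠ 0 := by exact_mod_cast hL.ne'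
  have hcoef : ∀ k : ℤ, fourierCoeff G k = (L : ℂ)⁻¹ * ∫ x in (0 : ℝ)..L,
      g x * Complex.exp (-(Complex.I * ((2 * Real.pi / L * k : ℝ) : ℂ)) * x) := by
    intro k
    rw [fourierCoeff_eq_intervalIntegral _ k 0, zero_add, Complex.real_smul]
    push_cast
    rw [one_div]
    congr 1
    refine intervalIntegral.integral_congr fun x _ => ?_
    change fourier (-k) (x : AddCircle L) • G x = _
    rw [fourier_coe_apply, hG, smul_eq_mul, mul_comm]
    congr 2
    push_cast
    field_simp
  have hs' : Summable (fourierCoeff G) := by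
    refine (hs.mul_left (L : ℂ)⁻¹).congr fun k => ?_
    rw [hcoef]
  have h := has_pointwise_sum_fourier_series_of_summable hs' x
  rw [hG] at h
  convert! h using 2 with k
  rw [hcoef, fourier_coe_apply, smul_eq_mul]
  congr 2
  push_cast
  field_simp

section

variable {ν : ℂ} {L : ℝ} {w : ℂ → ℂ}

lemma exp_period (hL : 0 < L) (k : ℤ) :
    Complex.exp (-(Complex.I * ((2 * Real.pi / L * k : ℝ) : ℂ)) * L) = 1 := by
  have hL0 : (L : ℂ) ≠ 0 := by exact_mod_cast hL.ne'
  rw [Complex.exp_eq_one_iff]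
  refine ⟨-k, ?_⟩
  push_cast
  field_simp

lemma norm_exp_neg_I_mul (a x : ℝ) : ‖Complex.exp (-(Complex.I * a) * x)‖ = 1 := by
  have : -(Complex.I * a) * x = ((-(a * x) : ℝ) : ℂ) * Complex.I := by push_cast; ring
  rw [this, Complex.norm_exp_ofReal_mul_I]

lemma integrableOn_fourierInt (hL : 0 < L)
    (hint : IntegrableOn (fun p : ℝ × ℝ => w (p.1 + p.2 * Complex.I) / (p.2 : ℂ) ^ 2)
      (Set.Ioc 0 L ×ˢ Set.Ioi 1)) (a : ℝ) :
    IntegrableOn (fun y : ℝ => fourierInt L w a y / (y : ℂ) ^ 2) (Set.Ioi 1) := by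
  have h1 : IntegrableOn (fun p : ℝ × ℝ => Complex.exp (-(Complex.I * a) * p.1) *
      (w (p.1 + p.2 * Complex.I) / (p.2 : ℂ) ^ 2)) (Set.Ioc 0 L ×ˢ Set.Ioi 1) := by
    refine Integrable.bdd_mul (c := 1) hint (by
      exact Continuous.aestronglyMeasurable (by fun_prop)) ?_
    exact Eventually.of_forall fun p => (norm_exp_neg_I_mul a p.1).le
  rw [IntegrableOn, Measure.volume_eq_prod, ← Measure.prod_restrict] at h1
  have h2 := h1.integral_prod_right
  refine h2.congr (Eventually.of_forall fun y => ?_)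
  simp only [fourierInt]
  rw [intervalIntegral.integral_of_le hL.le, ← integral_div]
  refine integral_congr_ae (Eventually.of_forall fun x => ?_)
  simp only
  ring

/-- Up to sign, a² times the Fourier integral of w is that of its second x-derivative, which is
bounded on the segment. The resulting O(1/k²) makes the Fourier series converge pointwise. -/
lemma exists_norm_fourierInt_le (hc : ContDiffOn ℝ 2 w {z : ℂ | 0 < z.im})
    (hper : ∀ z : ℂ, 0 < z.im → w (z + L) = w z) {y : ℝ} (hy : 0 < y) :
    ∃ M : ℝ, ∀ a : ℝ, Complex.exp (-(Complex.I * a) * L) = 1 → a ^ 2 * ‖fourierInt L w a y‖ ≤ M := by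
  have hc1 : ContinuousOn (fun z => fderiv ℝ (fderiv ℝ w) z 1 1) {z : ℂ | 0 < z.im} :=
    (continuousOn_fderiv_fderiv_apply hc 1).clm_apply (continuousOn_const (c := (1 : ℂ)))
  obtain ⟨M, hM⟩ := isCompact_uIcc.exists_bound_of_continuousOn
    (continuous_horizontal hc1 hy).continuousOn (s := Set.uIcc 0 L)
  refine ⟨M * |L - 0|, fun a ha => ?_⟩
  have h := integral_fderiv_fderiv hc hper ha hy
  have h2 := intervalIntegral.norm_integral_le_of_norm_le_const (a := 0) (b := L) (C := M)
    (f := fun x : ℝ => fderiv ℝ (fderiv ℝ w) (x + y * Complex.I) 1 1 *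
      Complex.exp (-(Complex.I * a) * x)) (fun x hx => by
      rw [norm_mul, norm_exp_neg_I_mul, mul_one]
      exact hM x (Set.uIoc_subset_uIcc hx))
  rw [h, norm_mul, norm_neg, norm_pow, Complex.norm_real, Real.norm_eq_abs, sq_abs] at h2
  exact h2

/-- The Fourier-Bessel expansion of a periodic eigenfunction of mean value zero. -/
theorem exists_isExpansion (hL : 0 < L) (hc : ContDiffOn ℝ 2 w {z : ℂ | 0 < z.im})
    (hl : ∀ z : ℂ, 0 < z.im →
      -((z.im : ℂ) ^ 2) * (Laplacian.laplacian w : ℂ → ℂ) z = (1 / 4 - ν ^ 2) * w z)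
    (hper : ∀ z : ℂ, 0 < z.im → w (z + L) = w z)
    (hzero : ∀ y : ℝ, 0 < y → ∫ x in (0 : ℝ)..L, w (x + y * Complex.I) = 0)
    (hint : IntegrableOn (fun p : ℝ × ℝ => w (p.1 + p.2 * Complex.I) / (p.2 : ℂ) ^ 2)
      (Set.Ioc 0 L ×ˢ Set.Ioi 1)) :
    ∃ a : ℤ → ℂ, IsExpansion ν (2 * Real.pi / L) a w := by
  have hκ : 0 < 2 * Real.pi / L := by positivity
  have hl' : ∀ z : ℂ, 0 < z.im → fderiv ℝ (fderiv ℝ w) z 1 1 +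
      fderiv ℝ (fderiv ℝ w) z Complex.I Complex.I = (ν ^ 2 - 1 / 4) / (z.im : ℂ) ^ 2 * w z := by
    intro z hz
    obtain ⟨-, u₂, h2, h3⟩ := isEig_of_contDiffOn hc hl z hz
    rwa [h2.fderiv]
  have hb : ∀ k : ℤ, ∃ b : ℂ, (k = 0 → b = 0) ∧ ∀ y : ℝ, 0 < y →
      fourierInt L w (2 * Real.pi / L * k) y = b * modeG ν (2 * Real.pi / L * k) y := by
    intro k
    rcases eq_or_ne k 0 with rfl | hk
    · refine ⟨0, fun _ => rfl, fun y hy => ?_⟩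
      simpa [fourierInt] using hzero y hy
    · have hk' : 2 * Real.pi / L * (k : ℝ) ≠ 0 := mul_ne_zero hκ.ne' (by exact_mod_cast hk)
      obtain ⟨b, hb⟩ := exists_eq_mul_modeG hk' (fun y hy => hasDerivAt_fourierInt hc _ hy)
        (fun y hy => hasDerivAt_fourierInt' hc hl' hper (exp_period hL k) hy)
        (integrableOn_fourierInt hL hint _)
      exact ⟨b, fun h => absurd h hk, hb⟩
  choose b hb0 hb using hb
  refine ⟨fun k => (L : ℂ)⁻¹ * b k, by simp [hb0 0 rfl], fun z hz => ?_⟩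
  obtain ⟨M, hM⟩ := exists_norm_fourierInt_le (L := L) hc hper hz
  have hs : Summable fun k : ℤ => fourierInt L w (2 * Real.pi / L * k) z.im := by
    refine Summable.of_norm_bounded_eventually (g := fun k : ℤ =>
      M / (2 * Real.pi / L) ^ 2 * (1 / (k : ℝ) ^ 2))
      ((Real.summable_one_div_int_pow.mpr one_lt_two).mul_left _) ?_
    filter_upwards [eventually_cofinite_ne (0 : ℤ)] with k hk
    have hk' : (0 : ℝ) < (k : ℝ) ^ 2 := by positivity
    have := hM _ (exp_period hL k)
    rw [mul_pow, ← le_div_iff₀' (by positivity)] at this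
    refine this.trans (le_of_eq ?_)
    field_simp
  have hper' : ∀ x : ℝ, w ((x + L : ℝ) + z.im * Complex.I) = w (x + z.im * Complex.I) := by
    intro x
    rw [← hper (x + z.im * Complex.I) (by simpa using hz)]
    congr 1
    push_cast
    ring
  have h := hasSum_fourier_of_summable hL (continuous_horizontal hc.continuousOn hz) hper' hs z.re
  rw [Complex.re_add_im] at h
  convert! h using 2 with k
  have e := hb k z.im hz
  rw [fourierInt] at e
  rw [e, mode, charX]
  ring

end

end

end HigherOrderLewis

namespace HigherOrderLewis

noncomputable section

/-! ### Uniqueness of the Fourier-Bessel coefficients -/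

section

variable {ν : ℂ} {L : ℝ} {w : ℂ → ℂ} {a a' : ℤ → ℂ}

lemma integral_exp_mul_exp (hL : 0 < L) (k m : ℤ) :
    ∫ x in (0 : ℝ)..L, Complex.exp (Complex.I * ((2 * Real.pi / L * k : ℝ) : ℂ) * x) *
      Complex.exp (-(Complex.I * ((2 * Real.pi / L * m : ℝ) : ℂ)) * x) =
      if k = m then (L : ℂ) else 0 := by
  have hL0 : (L : ℂ) ≠ 0 := by exact_mod_cast hL.ne'
  have e : ∀ x : ℝ, Complex.exp (Complex.I * ((2 * Real.pi / L * k : ℝ) : ℂ) * x) *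
      Complex.exp (-(Complex.I * ((2 * Real.pi / L * m : ℝ) : ℂ)) * x) =
      Complex.exp (-(Complex.I * ((2 * Real.pi / L * (m - k : ℤ) : ℝ) : ℂ)) * x) := by
    intro x
    rw [← Complex.exp_add]
    congr 1
    push_cast
    ring
  simp_rw [e]
  split_ifs with h
  · subst h
    simp
  · have hne : -(Complex.I * ((2 * Real.pi / L * (m - k : ℤ) : ℝ) : ℂ)) ≠ 0 := by
      refine neg_ne_zero.mpr (mul_ne_zero Complex.I_ne_zero ?_)
      have : ((m - k : ℤ) : ℝ) ≠ 0 := by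
        exact_mod_cast sub_ne_zero.mpr (Ne.symm h)
      have hp := Real.pi_pos
      exact_mod_cast mul_ne_zero (by positivity) this
    rw [integral_exp_mul_complex hne, exp_period hL]
    simp

/-- The series is dominated by a summable constant on a horizontal segment, so it is integrated
termwise and the characters are orthogonal. -/
lemma IsExpansion.fourierInt_eq (hL : 0 < L) (h : IsExpansion ν (2 * Real.pi / L) a w) (m : ℤ)
    {y : ℝ} (hy : 0 < y) : fourierInt L w (2 * Real.pi / L * m) y =
      L * (a m * modeG ν (2 * Real.pi / L * m) y) := by
  have hκ : 0 < 2 * Real.pi / L := by positivity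
  obtain ⟨b, hb, hb0, hle⟩ := (h.subExp hκ).exists_bound (ν := ν) hκ h.1 hy
  have hs : HasSum (fun k : ℤ => ∫ x in (0 : ℝ)..L,
      a k * mode ν (2 * Real.pi / L * k) (x + y * Complex.I) *
        Complex.exp (-(Complex.I * ((2 * Real.pi / L * m : ℝ) : ℂ)) * x))
      (fourierInt L w (2 * Real.pi / L * m) y) := by
    refine intervalIntegral.hasSum_integral_of_dominated_convergence
      (fun k _ => b k * Real.exp (-(2 * Real.pi / L / 2) * y)) (fun k => ?_) (fun k => ?_) ?_ ?_ ?_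
    · simp only [mode, charX]
      refine Continuous.aestronglyMeasurable ?_
      have e : ∀ x : ℝ, ((x : ℂ) + y * Complex.I).im = y := fun x => by simp
      simp only [e]
      fun_prop
    · refine Eventually.of_forall fun x _ => ?_
      have h1 := hle k (x + y * Complex.I) (by simp)
      have h2 := norm_nonneg (a k • mode' ν (2 * Real.pi / L * k) (x + y * Complex.I))
      have e : ((x : ℂ) + y * Complex.I).im = y := by simp
      rw [e] at h1
      rw [norm_mul, norm_exp_neg_I_mul, mul_one]
      linarith
    · exact Eventually.of_forall fun x _ => hb.mul_right _
    · exact intervalIntegrable_const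
    · exact Eventually.of_forall fun x _ => (h.2 _ (by simpa using hy)).mul_right _
  have e : ∀ k : ℤ, (∫ x in (0 : ℝ)..L,
      a k * mode ν (2 * Real.pi / L * k) (x + y * Complex.I) *
        Complex.exp (-(Complex.I * ((2 * Real.pi / L * m : ℝ) : ℂ)) * x)) =
      if k = m then L * (a k * modeG ν (2 * Real.pi / L * k) y) else 0 := by
    intro k
    have e1 : ∀ x : ℝ, a k * mode ν (2 * Real.pi / L * k) (x + y * Complex.I) *
        Complex.exp (-(Complex.I * ((2 * Real.pi / L * m : ℝ) : ℂ)) * x) =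
        a k * modeG ν (2 * Real.pi / L * k) y *
          (Complex.exp (Complex.I * ((2 * Real.pi / L * k : ℝ) : ℂ) * x) *
      Complex.exp (-(Complex.I * ((2 * Real.pi / L * m : ℝ) : ℂ)) * x)) := by
      intro x
      have e1 : ((x : ℂ) + y * Complex.I).im = y := by simp
      have e2 : ((x : ℂ) + y * Complex.I).re = x := by simp
      rw [mode, charX, e1, e2]
      ring
    simp_rw [e1]
    rw [intervalIntegral.integral_const_mul, integral_exp_mul_exp hL]
    split_ifs
    · ring
    · ring
  simp_rw [e] at hs
  refine hs.unique ?_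
  convert! hasSum_ite_eq m (L * (a m * modeG ν (2 * Real.pi / L * m) y)) using 2 with k
  split_ifs with hk
  · rw [hk]
  · rfl

/-- A single height at which the Bessel factor does not vanish determines the m-th coefficient. -/
lemma IsExpansion.unique (hL : 0 < L) (h : IsExpansion ν (2 * Real.pi / L) a w)
    (h' : IsExpansion ν (2 * Real.pi / L) a' w) : a = a' := by
  funext m
  rcases eq_or_ne m 0 with rfl | hm
  · rw [h.1, h'.1]
  have hκ : 0 < 2 * Real.pi / L := by positivity
  obtain ⟨y, hy, hne⟩ := exists_modeG_ne_zero ν (mul_ne_zero hκ.ne' (by exact_mod_cast hm) :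
    2 * Real.pi / L * (m : ℝ) ≠ 0)
  have hy0 : 0 < y := by linarith
  have h1 := h.fourierInt_eq hL m hy0
  rw [h'.fourierInt_eq hL m hy0] at h1
  have hL0 : (L : ℂ) ≠ 0 := by exact_mod_cast hL.ne'
  exact (mul_right_cancel₀ hne (mul_left_cancel₀ hL0 h1)).symm

end

/-! ### A compact strip of the Borel-Serre space -/

/-- The stabilizer of ∞ consists of upper triangular matrices whose diagonal entries are equal to a
common sign, and these act as integral translations. -/
lemma exists_translation_of_smul_infty {σ : SL(2, ℤ)}
    (h : OnePoint.infty = Matrix.SpecialLinearGroup.mapGL ℚ σ • (OnePoint.infty : OnePoint ℚ)) :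
    ∃ n : ℝ, (∀ z : ℍ, (σ⁻¹ • z).re = z.re - n ∧ (σ⁻¹ • z).im = z.im) ∧
      ∀ t : ℝ, Matrix.SpecialLinearGroup.mapGL ℝ σ • (t : OnePoint ℝ) = ((t + n : ℝ) : OnePoint ℝ) := by
  have h10 : σ 1 0 = 0 := by
    have := OnePoint.smul_infty_eq_self_iff.mp h.symm
    simpa using this
  have hdet := σ.det_coe
  rw [Matrix.det_fin_two, h10, mul_zero, sub_zero] at hdet
  have h2 : σ 0 0 = σ 1 1 ∧ σ 1 1 * σ 1 1 = 1 := by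
    rcases Int.mul_eq_one_iff_eq_one_or_neg_one.mp hdet with ⟨h1, h2⟩ | ⟨h1, h2⟩ <;>
      simp [h1, h2]
  refine ⟨(σ 0 1 * σ 1 1 : ℤ), fun z => ?_, fun t => ?_⟩
  · have h3 : ((σ⁻¹ • z : ℍ) : ℂ) = z - ((σ 0 1 * σ 1 1 : ℤ) : ℂ) := by
      have h4 : ((σ 1 1 : ℤ) : ℂ) * σ 1 1 = 1 := by exact_mod_cast h2.2
      have h5 : ((σ 1 1 : ℤ) : ℂ) ≠ 0 := fun h => by simp [h] at h4
      rw [UpperHalfPlane.coe_specialLinearGroup_apply]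
      simp [Matrix.SpecialLinearGroup.coe_inv, Matrix.adjugate_fin_two, h10, h2.1]
      field_simp
      linear_combination (σ 0 1 : ℂ) * h4
    constructor
    · rw [← UpperHalfPlane.coe_re, h3]; simp
    · rw [← UpperHalfPlane.coe_im, h3]; simp
  · have h4 : ((σ 1 1 : ℤ) : ℝ) * σ 1 1 = 1 := by exact_mod_cast h2.2
    have h5 : ((σ 1 1 : ℤ) : ℝ) ≠ 0 := fun h => by simp [h] at h4
    rw [OnePoint.smul_some_eq_ite]
    simp [h10, h5, h2.1]
    field_simp
    linear_combination (-(σ 0 1 : ℝ)) * h4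

/-- The coordinates `(x, t) ↦ x + i/t` near the cusp `∞` of the Borel-Serre space, where `t = 0`
is the boundary line. -/
def cuspChart (p : ℝ × ℝ) : BorelSerre :=
  if h : 0 < p.2 then .inner ⟨⟨p.1, p.2⁻¹⟩, by simpa using h⟩
  else .bdry OnePoint.infty (p.1 : OnePoint ℝ) (by simp)

lemma isOpen_cuspChart_inner {U : Set ℍ} (hU : IsOpen U) :
    IsOpen {p : ℝ × ℝ | ∃ h : 0 < p.2, (⟨⟨p.1, p.2⁻¹⟩, by simpa using h⟩ : ℍ) ∈ U} := by
  have h1 : {p : ℝ × ℝ | ∃ h : 0 < p.2, (⟨⟨p.1, p.2⁻¹⟩, by simpa using h⟩ : ℍ) ∈ U} =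
      {p : ℝ × ℝ | 0 < p.2} ∩ (fun p : ℝ × ℝ => (p.1 : ℂ) + (p.2⁻¹ : ℝ) * Complex.I) ⁻¹'
        (UpperHalfPlane.coe '' U) := by
    ext p
    constructor
    · rintro ⟨h, hp⟩
      refine ⟨h, _, hp, ?_⟩
      exact Complex.mk_eq_add_mul_I _ _
    · rintro ⟨h, z, hz, hp⟩
      refine ⟨h, ?_⟩
      have e : (⟨⟨p.1, p.2⁻¹⟩, by simpa using h⟩ : ℍ) = z := by
        apply UpperHalfPlane.ext
        rw [hp]
        exact Complex.mk_eq_add_mul_I _ _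
      rw [e]
      exact hz
  rw [h1]
  refine ContinuousOn.isOpen_inter_preimage ?_ (isOpen_lt continuous_const continuous_snd)
    (UpperHalfPlane.isOpenEmbedding_coe.isOpenMap _ hU)
  have : ContinuousOn (fun p : ℝ × ℝ => p.2⁻¹) {p : ℝ × ℝ | 0 < p.2} :=
    continuousOn_snd.inv₀ fun p hp => ne_of_gt hp
  exact (by fun_prop : Continuous fun p : ℝ × ℝ => (p.1 : ℂ)).continuousOn.add
    ((Complex.continuous_ofReal.comp_continuousOn this).mul continuousOn_const)

/-- Checked on the generating open sets. A half strip at ∞ pulls back to the set a < x - n < b, tY <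
1. A half strip at another cusp contains no point of the line at ∞, so only its open trace in the
half plane matters. -/
lemma continuous_cuspChart : Continuous cuspChart := by
  refine continuous_generateFrom_iff.mpr ?_
  rintro s (⟨U, hU, rfl⟩ | ⟨σ, a, b, Y, hY, rfl⟩)
  · convert! isOpen_cuspChart_inner hU using 1
    ext p
    simp only [Set.mem_preimage, Set.mem_image, cuspChart]
    by_cases h : 0 < p.2 <;> simp [h]
  · by_cases hσ : OnePoint.infty =
        Matrix.SpecialLinearGroup.mapGL ℚ σ • (OnePoint.infty : OnePoint ℚ)
    · obtain ⟨n, hn, hn'⟩ := exists_translation_of_smul_infty hσ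
      have e : cuspChart ⁻¹' stripNhd σ a b Y =
          {p : ℝ × ℝ | a < p.1 - n} ∩ {p | p.1 - n < b} ∩ {p | p.2 * Y < 1} := by
        ext p
        by_cases h : 0 < p.2
        · have e1 : Y < p.2⁻¹ ↔ p.2 * Y < 1 := by
            rw [lt_inv_comm₀ hY h, ← one_div, lt_div_iff₀ hY]
          have e2 := hn ⟨⟨p.1, p.2⁻¹⟩, by simpa using h⟩
          have e3 : p ∈ cuspChart ⁻¹' stripNhd σ a b Y ↔
              a < p.1 - n ∧ p.1 - n < b ∧ Y < p.2⁻¹ := by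
            simp only [Set.mem_preimage, cuspChart, h, dif_pos]
            change a < (σ⁻¹ • _ : ℍ).re ∧ (σ⁻¹ • _ : ℍ).re < b ∧ Y < (σ⁻¹ • _ : ℍ).im ↔ _
            rw [e2.1, e2.2]
            rfl
          rw [e3, e1]
          exact and_assoc.symm
        · have e1 : p.2 * Y < 1 := by nlinarith
          have e3 : p ∈ cuspChart ⁻¹' stripNhd σ a b Y ↔ a < p.1 - n ∧ p.1 - n < b := by
            simp only [Set.mem_preimage, cuspChart, h, dif_neg, not_false_eq_true]
            change (OnePoint.infty = _ ∧ ∃ t : ℝ, a < t ∧ t < b ∧ (p.1 : OnePoint ℝ) = _) ↔ _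
            constructor
            · rintro ⟨-, t, h1, h2, h3⟩
              rw [hn', OnePoint.coe_eq_coe] at h3
              rw [h3, add_sub_cancel_right]
              exact ⟨h1, h2⟩
            · rintro ⟨h1, h2⟩
              refine ⟨hσ, p.1 - n, h1, h2, ?_⟩
              rw [hn', sub_add_cancel]
          rw [e3]
          exact ⟨fun h => ⟨h, e1⟩, fun h => h.1⟩
      rw [e]
      exact ((isOpen_lt (by fun_prop) (by fun_prop)).inter (t := {p : ℝ × ℝ | p.1 - n < b})
        (isOpen_lt (by fun_prop) (by fun_prop))).inter (t := {p : ℝ × ℝ | p.2 * Y < 1})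
          (isOpen_lt (by fun_prop) (by fun_prop))
    · have hc : Continuous fun z : ℍ => σ⁻¹ • z :=
        continuous_const_smul (Matrix.SpecialLinearGroup.mapGL ℝ σ⁻¹)
      have hU : IsOpen {z : ℍ | a < (σ⁻¹ • z).re ∧ (σ⁻¹ • z).re < b ∧ Y < (σ⁻¹ • z).im} :=
        (isOpen_lt continuous_const (UpperHalfPlane.continuous_re.comp hc)).inter
          (t := {z : ℍ | (σ⁻¹ • z).re < b ∧ Y < (σ⁻¹ • z).im})
          ((isOpen_lt (UpperHalfPlane.continuous_re.comp hc) continuous_const).inter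
            (t := {z : ℍ | Y < (σ⁻¹ • z).im})
            (isOpen_lt continuous_const (UpperHalfPlane.continuous_im.comp hc)))
      convert! isOpen_cuspChart_inner hU using 1
      ext p
      by_cases h : 0 < p.2
      · simp only [Set.mem_preimage, cuspChart, h, dif_pos]
        exact ⟨fun h1 => ⟨h, h1⟩, fun ⟨_, h1⟩ => h1⟩
      · simp only [Set.mem_preimage, cuspChart, h, dif_neg, not_false_eq_true]
        exact ⟨fun h1 => absurd h1.1 hσ, fun ⟨h1, _⟩ => absurd h1 h⟩

/-- In the coordinate t = 1/y the strip together with its boundary segment is the image of [0,L] ×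
[0,1]. The attached line thus makes the whole end of the strip relatively compact, and local square
integrability controls the cusp. -/
lemma exists_isCompact_strip (L : ℝ) : ∃ K : Set BorelSerre, IsCompact K ∧
    UpperHalfPlane.coe ⁻¹' {z : ℂ | z.re ∈ Set.Ioc 0 L ∧ 1 < z.im} ⊆ BorelSerre.inner ⁻¹' K := by
  refine ⟨cuspChart '' (Set.Icc 0 L ×ˢ Set.Icc 0 1),
    (isCompact_Icc.prod isCompact_Icc).image continuous_cuspChart, ?_⟩
  rintro z ⟨h1, h2⟩
  have h2 : 1 < z.im := h2
  have hi : 0 < (z.im)⁻¹ := inv_pos.mpr z.im_pos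
  refine ⟨(z.re, (z.im)⁻¹), ⟨⟨h1.1.le, h1.2⟩, hi.le, inv_le_one_of_one_le₀ h2.le⟩, ?_⟩
  simp only [cuspChart, hi, dif_pos]
  congr 1
  apply UpperHalfPlane.ext
  apply Complex.ext <;> simp

end

end HigherOrderLewis

namespace HigherOrderLewis

noncomputable section

/-! ### Integrability over the strip -/

lemma IsLocL2.integrableOn_sq {u : ℍ → ℂ} (h : IsLocL2 u) (L : ℝ) :
    IntegrableOn (fun z : ℂ => ‖(u ∘ ofComplex) z‖ ^ 2 / z.im ^ 2)
      {z : ℂ | z.re ∈ Set.Ioc 0 L ∧ 1 < z.im} := by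
  set S : Set ℂ := {z : ℂ | z.re ∈ Set.Ioc 0 L ∧ 1 < z.im}
  have hS : MeasurableSet S :=
    (measurableSet_Ioc.preimage Complex.measurable_re).inter
      (measurableSet_lt measurable_const Complex.measurable_im)
  obtain ⟨K, hK, hSK⟩ := exists_isCompact_strip L
  have h1 : MemLp u 2 ((volume : Measure ℍ).restrict (UpperHalfPlane.coe ⁻¹' S)) :=
    (h.2 K hK).mono_measure (Measure.restrict_mono hSK le_rfl)
  have h2 : Integrable (fun z => ‖u z‖ ^ 2)
      ((volume : Measure ℍ).restrict (UpperHalfPlane.coe ⁻¹' S)) := h1.integrable_norm_pow (by simp)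
  have hm : MeasurableSet (UpperHalfPlane.coe ⁻¹' S) := measurable_coe hS
  rw [volume_def, restrict_withDensity hm, integrable_withDensity_iff_integrable_smul] at h2
  · have e : (fun z : ℍ => ((1 / NNReal.mk z.im z.im_pos.le) ^ 2 : NNReal) • ‖u z‖ ^ 2) =
        (fun z : ℂ => ‖(u ∘ ofComplex) z‖ ^ 2 / z.im ^ 2) ∘ UpperHalfPlane.coe := by
      funext z
      simp [NNReal.smul_def, ofComplex_apply, div_eq_inv_mul]
    have h3 : IntegrableOn ((fun z : ℂ => ‖(u ∘ ofComplex) z‖ ^ 2 / z.im ^ 2) ∘ UpperHalfPlane.coe)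
        (UpperHalfPlane.coe ⁻¹' S) ((volume : Measure ℂ).comap UpperHalfPlane.coe) := by
      rw [← e]
      exact h2
    rw [← measurableEmbedding_coe.integrableOn_map_iff, measurableEmbedding_coe.map_comap,
      IntegrableOn, Measure.restrict_restrict hS] at h3
    have e2 : S ∩ Set.range UpperHalfPlane.coe = S := by
      refine Set.inter_eq_left.mpr fun z hz => ?_
      exact ⟨⟨z, lt_trans one_pos hz.2⟩, rfl⟩
    rwa [e2] at h3
  · have : Measurable fun z : ℍ => NNReal.mk z.im z.im_pos.le :=
      (UpperHalfPlane.continuous_im.measurable).subtype_mk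
    fun_prop

/-- Use |u| ≤ |u|² + 1 and the finiteness of the hyperbolic area of the strip. -/
lemma IsLocL2.integrableOn {u : ℍ → ℂ} (h : IsLocL2 u) (hu : Continuous u) (L : ℝ) :
    IntegrableOn (fun p : ℝ × ℝ => (u ∘ ofComplex) (p.1 + p.2 * Complex.I) / (p.2 : ℂ) ^ 2)
      (Set.Ioc 0 L ×ˢ Set.Ioi 1) := by
  have h1 := h.integrableOn_sq L
  rw [← (Complex.volume_preserving_equiv_real_prod.symm
    Complex.measurableEquivRealProd).integrableOn_comp_preimage
      Complex.measurableEquivRealProd.symm.measurableEmbedding] at h1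
  have e1 : Complex.measurableEquivRealProd.symm ⁻¹' {z : ℂ | z.re ∈ Set.Ioc 0 L ∧ 1 < z.im} =
      Set.Ioc 0 L ×ˢ Set.Ioi 1 := by
    ext p
    simp [Complex.measurableEquivRealProd]
  rw [e1] at h1
  have h2 : IntegrableOn (fun p : ℝ × ℝ => (1 : ℝ) * p.2 ^ (-2 : ℝ))
      (Set.Ioc 0 L ×ˢ Set.Ioi 1) := by
    rw [IntegrableOn, Measure.volume_eq_prod, ← Measure.prod_restrict]
    refine Integrable.mul_prod (f := fun _ : ℝ => (1 : ℝ)) (g := fun y : ℝ => y ^ (-2 : ℝ)) ?_ ?_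
    · exact integrable_const _
    · exact integrableOn_Ioi_rpow_of_lt (by norm_num) one_pos
  have hc : ContinuousOn (u ∘ ofComplex) {z : ℂ | 0 < z.im} := by
    rw [continuousOn_iff_continuous_domRestrict]
    have : Set.domRestrict {z : ℂ | 0 < z.im} (u ∘ ofComplex) =
        fun z => u ⟨z.1, z.2⟩ := by
      funext z
      simp only [Set.domRestrict_apply, Function.comp_apply]
      rw [ofComplex_apply_of_im_pos z.2]
    rw [this]
    refine hu.comp ?_
    rw [UpperHalfPlane.isEmbedding_coe.continuous_iff]
    exact continuous_subtype_val
  refine Integrable.mono' (h1.add h2) ?_ ?_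
  · refine ContinuousOn.aestronglyMeasurable ?_ (measurableSet_Ioc.prod measurableSet_Ioi)
    refine ContinuousOn.div (hc.comp (by fun_prop) fun p hp => ?_) (by fun_prop) fun p hp => ?_
    · have : (1 : ℝ) < p.2 := hp.2
      simp
      linarith
    · have : (1 : ℝ) < p.2 := hp.2
      exact pow_ne_zero 2 (by exact_mod_cast (by linarith : p.2 ≠ 0))
  · refine (ae_restrict_iff' (measurableSet_Ioc.prod measurableSet_Ioi)).mpr
      (Eventually.of_forall fun p hp => ?_)
    have hp2 : (1 : ℝ) < p.2 := hp.2
    have hp0 : 0 < p.2 := by linarith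
    have e2 : Complex.measurableEquivRealProd.symm p = p.1 + p.2 * Complex.I :=
      Complex.mk_eq_add_mul_I _ _
    simp only [Pi.add_apply, Function.comp_apply, e2]
    rw [norm_div, norm_pow, Complex.norm_real, Real.norm_of_nonneg hp0.le, Real.rpow_neg hp0.le,
      Real.rpow_two, one_mul, ← one_div]
    have e3 : ((p.1 : ℂ) + p.2 * Complex.I).im = p.2 := by simp
    rw [e3, ← add_div]
    refine div_le_div_of_nonneg_right ?_ (by positivity)
    nlinarith [sq_nonneg (‖u (ofComplex (p.1 + p.2 * Complex.I))‖ - 1)]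

/-! ### The cusp width -/

section

variable (Γ : Subgroup PSL(2, ℤ))

lemma cuspWidth_spec [Γ.FiniteIndex] : 0 < cuspWidth Γ ∧ genT ^ cuspWidth Γ ∈ Γ := by
  have h : {n : ℕ | 0 < n ∧ genT ^ n ∈ Γ}.Nonempty := by
    obtain ⟨n, hn, -, h⟩ := Subgroup.exists_pow_mem_of_index_ne_zero
      (Subgroup.FiniteIndex.index_ne_zero (H := Γ)) genT
    exact ⟨n, hn, h⟩
  exact Nat.sInf_mem h

lemma genT_pow_mem_parabolicSubgroup [Γ.FiniteIndex] :
    (⟨genT ^ cuspWidth Γ, (cuspWidth_spec Γ).2⟩ : Γ) ∈ parabolicSubgroup Γ := by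
  refine Subgroup.subset_closure ⟨ModularGroup.T ^ cuspWidth Γ, by rw [map_pow], ?_⟩
  have hT : ((ModularGroup.T ^ cuspWidth Γ : SL(2, ℤ)) : Matrix (Fin 2) (Fin 2) ℤ) =
      !![1, (cuspWidth Γ : ℤ); 0, 1] := by
    have := ModularGroup.coe_T_zpow (cuspWidth Γ : ℤ)
    rwa [zpow_natCast] at this
  rw [hT]
  constructor
  · rintro ⟨r, hr⟩
    have h1 := congrFun (congrFun hr 0) 1
    have h0 := (cuspWidth_spec Γ).1
    rw [Matrix.scalar_apply, Matrix.diagonal_apply_ne _ (by decide)] at h1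
    have h2 : (cuspWidth Γ : ℤ) = 0 := h1.symm
    omega
  · simp [Matrix.discr_fin_two, Matrix.trace_fin_two, Matrix.det_fin_two]

end

lemma moebius_genT_coe (z : ℍ) : ((moebius genT z : ℍ) : ℂ) = z + 1 := by
  rw [moebius_toPSL]
  have := ModularGroup.coe_T_zpow_smul_eq z (n := 1)
  simpa using this

lemma moebius_genS_coe (z : ℍ) : ((moebius genS z : ℍ) : ℂ) = -1 / z := by
  rw [moebius_toPSL, UpperHalfPlane.modular_S_smul]
  change (-(z : ℂ))⁻¹ = -1 / z
  rw [neg_div, one_div, inv_neg]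

/-- The relation `T S = (S T⁻¹)²` in `PSL(2, ℤ)`. -/
lemma genT_mul_genS : genT * genS = (genS * genT⁻¹) * (genS * genT⁻¹) := by
  rw [← map_inv, ← map_mul, ← map_mul, ← map_mul, QuotientGroup.mk'_eq_mk']
  -- In SL(2, ℤ) the two sides differ by the central element -1.
  refine ⟨-1, ?_, ?_⟩
  · rw [Matrix.SpecialLinearGroup.mem_center_iff]
    refine ⟨-1, by simp, ?_⟩
    ext i j
    fin_cases i <;> fin_cases j <;> simp
  · ext i j
    fin_cases i <;> fin_cases j <;> rfl

lemma genS_mul_genS : genS * genS = 1 := by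
  rw [← map_mul, ← map_one toPSL, QuotientGroup.mk'_eq_mk']
  refine ⟨-1, ?_, ?_⟩
  · rw [Matrix.SpecialLinearGroup.mem_center_iff]
    refine ⟨-1, by simp, ?_⟩
    ext i j
    fin_cases i <;> fin_cases j <;> simp
  · ext i j
    fin_cases i <;> fin_cases j <;> rfl

end

end HigherOrderLewis

namespace HigherOrderLewis

noncomputable section

section FiniteDimensional

variable {V : Type*} [NormedAddCommGroup V] [NormedSpace ℂ V] [FiniteDimensional ℂ V]

/-! ### Testing against linear functionals -/

lemma sum_coord_smul (v : V) :
    ∑ i, (Module.finBasis ℂ V).coord i v • Module.finBasis ℂ V i = v :=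
  (Module.finBasis ℂ V).sum_repr v

lemma apply_eq_sum_coord (l : Module.Dual ℂ V) (v : V) :
    l v = ∑ i, (Module.finBasis ℂ V).coord i v * l (Module.finBasis ℂ V i) := by
  conv_lhs => rw [← sum_coord_smul v, map_sum]
  simp only [map_smul, smul_eq_mul]

lemma eq_of_forall_dual {v w : V} (h : ∀ l : Module.Dual ℂ V, l v = l w) : v = w := by
  rw [← sum_coord_smul v, ← sum_coord_smul w]
  simp_rw [h]

lemma tendsto_iff_dual {α : Type*} {F : Filter α} {f : α → V} {v : V} :
    Tendsto f F (𝓝 v) ↔ ∀ l : Module.Dual ℂ V, Tendsto (fun x => l (f x)) F (𝓝 (l v)) := by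
  refine ⟨fun h l => (l.continuous_of_finiteDimensional.tendsto v).comp h, fun h => ?_⟩
  have h1 := tendsto_finsetSum Finset.univ fun i (_ : i ∈ Finset.univ) =>
    (h ((Module.finBasis ℂ V).coord i)).smul_const (Module.finBasis ℂ V i)
  simp_rw [sum_coord_smul] at h1
  exact h1

lemma hasSum_iff_dual {ι : Type*} {f : ι → V} {v : V} :
    HasSum f v ↔ ∀ l : Module.Dual ℂ V, HasSum (fun i => l (f i)) (l v) := by
  simp only [HasSum, ← map_sum]
  exact tendsto_iff_dual

lemma differentiableAt_of_dual {f : ℂ → V} {z : ℂ}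
    (h : ∀ l : Module.Dual ℂ V, DifferentiableAt ℂ (fun z => l (f z)) z) :
    DifferentiableAt ℂ f z := by
  have h1 := DifferentiableAt.fun_sum (u := Finset.univ) fun i (_ : i ∈ Finset.univ) =>
    (h ((Module.finBasis ℂ V).coord i)).smul_const (Module.finBasis ℂ V i)
  simp_rw [sum_coord_smul] at h1
  exact h1

lemma exists_norm_le_of_dual {α : Type*} {S : Set α} {f : α → V} {g : α → ℝ}
    (h : ∀ l : Module.Dual ℂ V, ∃ M : ℝ, ∀ z ∈ S, ‖l (f z)‖ ≤ M * g z) :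
    ∃ M : ℝ, ∀ z ∈ S, ‖f z‖ ≤ M * g z := by
  choose M hM using h
  refine ⟨∑ i, M ((Module.finBasis ℂ V).coord i) * ‖Module.finBasis ℂ V i‖, fun z hz => ?_⟩
  rw [← sum_coord_smul (f z), Finset.sum_mul]
  refine (norm_sum_le _ _).trans (Finset.sum_le_sum fun i _ => ?_)
  rw [norm_smul, mul_right_comm]
  exact mul_le_mul_of_nonneg_right (hM _ z hz) (norm_nonneg _)

/-! ### Vector valued expansions -/

/-- The coordinate of `u : ℍ → V` along the functional `l`, as a function on `ℂ`. -/
def coordFun (l : Module.Dual ℂ V) (u : ℍ → V) : ℂ → ℂ := (fun z => l (u z)) ∘ ofComplex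

omit [FiniteDimensional ℂ V] in
lemma coordFun_coe (l : Module.Dual ℂ V) (u : ℍ → V) (z : ℍ) : coordFun l u z = l (u z) := by
  simp [coordFun, ofComplex_apply]

variable {ν : ℂ} {N : ℕ} {u : ℍ → V} {v : ℤ → V}

lemma fourierBessel_term (hN : 0 < N) {k : ℤ} (hk : k ≠ 0) (z : ℍ) :
    Complex.exp (2 * Real.pi * Complex.I * (k : ℂ) * (z.re : ℂ) / (N : ℂ)) *
        (Real.sqrt z.im : ℂ) * besselK ν (2 * Real.pi * |(k : ℝ)| * z.im / (N : ℝ)) =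
      mode ν (2 * Real.pi / (N : ℝ) * k) z := by
  have hN' : (0 : ℝ) < N := by exact_mod_cast hN
  have hκ : 0 < 2 * Real.pi / (N : ℝ) := by positivity
  have hk' : 2 * Real.pi / (N : ℝ) * (k : ℝ) ≠ 0 := mul_ne_zero hκ.ne' (by exact_mod_cast hk)
  rw [mode, charX, modeG_eq ν hk', abs_mul, abs_of_pos hκ, UpperHalfPlane.coe_re,
    UpperHalfPlane.coe_im, mul_assoc]
  congr 2
  · push_cast
    ring
  · congr 1
    ring

/-- Reduces the vector valued expansion to scalar ones. The convention that the zeroth coefficient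
vanishes reconciles sums over nonzero integers with sums over all integers. -/
lemma isFourierBessel_iff (hN : 0 < N) : IsFourierBessel ν N u v ↔
    ∀ l : Module.Dual ℂ V, IsExpansion ν (2 * Real.pi / (N : ℝ)) (fun k => l (v k))
      (coordFun l u) := by
  have key : ∀ (z : ℍ) (l : Module.Dual ℂ V), l (v 0) = 0 →
      (HasSum (fun k : {k : ℤ // k ≠ 0} => l
        ((Complex.exp (2 * Real.pi * Complex.I * ((k : ℤ) : ℂ) * (z.re : ℂ) / (N : ℂ)) *
        (Real.sqrt z.im : ℂ) * besselK ν (2 * Real.pi * |((k : ℤ) : ℝ)| * z.im / (N : ℝ))) •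
          v k)) (l (u z)) ↔
      HasSum (fun k : ℤ => l (v k) * mode ν (2 * Real.pi / (N : ℝ) * k) z) (coordFun l u z)) := by
    intro z l h0
    rw [coordFun_coe, ← hasSum_subtype_iff_of_support_subset (s := {k : ℤ | k ≠ 0})]
    · refine iff_of_eq (congrArg (fun f => HasSum f (l (u z))) (funext fun k => ?_))
      rw [fourierBessel_term hN k.2, map_smul, smul_eq_mul, mul_comm]
      rfl
    · intro k hk h
      rw [Function.mem_support] at hk
      rw [h, h0, zero_mul] at hk
      exact hk rfl
  constructor
  · rintro ⟨h0, h⟩ l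
    have hl : l (v 0) = 0 := by rw [h0, map_zero]
    refine ⟨hl, fun z hz => ?_⟩
    exact (key ⟨z, hz⟩ l hl).mp (hasSum_iff_dual.mp (h ⟨z, hz⟩) l)
  · intro h
    have h0 : v 0 = 0 := eq_of_forall_dual fun l => by rw [map_zero]; exact (h l).1
    refine ⟨h0, fun z => hasSum_iff_dual.mpr fun l => ?_⟩
    exact (key z l (h l).1).mpr ((h l).2 z z.im_pos)

/-- Only the expansions along a basis of coordinates are chosen. Those for other functionals follow
by linear combination. -/
lemma exists_vector_expansion {κ : ℝ}
    (h : ∀ l : Module.Dual ℂ V, ∃ a : ℤ → ℂ, IsExpansion ν κ a (coordFun l u)) :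
    ∃ v : ℤ → V, ∀ l : Module.Dual ℂ V, IsExpansion ν κ (fun k => l (v k)) (coordFun l u) := by
  choose a ha using h
  refine ⟨fun k => ∑ i, a ((Module.finBasis ℂ V).coord i) k • Module.finBasis ℂ V i, fun l => ?_⟩
  have e : ∀ k : ℤ, l (∑ i, a ((Module.finBasis ℂ V).coord i) k • Module.finBasis ℂ V i) =
      ∑ i, a ((Module.finBasis ℂ V).coord i) k * l (Module.finBasis ℂ V i) := fun k => by simp
  simp only [e]
  refine ⟨Finset.sum_eq_zero fun i _ => by rw [(ha _).1, zero_mul], fun z hz => ?_⟩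
  have h1 := hasSum_sum (s := Finset.univ) fun i (_ : i ∈ Finset.univ) =>
    ((ha ((Module.finBasis ℂ V).coord i)).2 z hz).mul_right (l (Module.finBasis ℂ V i))
  convert! h1 using 1
  · funext k
    rw [Finset.sum_mul]
    exact Finset.sum_congr rfl fun i _ => by ring
  · exact apply_eq_sum_coord l _

/-! ### The vector valued holomorphic function -/

lemma IsExpansion.hasSum_lewisSeries {κ : ℝ} {a : ℤ → ℂ} {w : ℂ → ℂ} (hκ : 0 < κ)
    (hν : -(1 / 2 : ℝ) < ν.re) (h : IsExpansion ν κ a w) {z : ℂ} (hz : 0 < z.im) :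
    HasSum (fun k : {k : ℤ // 0 < k} => ((k : ℤ) : ℂ) ^ ν *
      Complex.exp (Complex.I * (κ * (k : ℤ)) * z) * a k) (lewisSeries ν κ a z) := by
  rw [lewisSeries, if_pos hz]
  exact h.hasSum_upperSeries hκ hν hz

lemma IsExpansion.hasSum_lewisSeries_neg {κ : ℝ} {a : ℤ → ℂ} {w : ℂ → ℂ} (hκ : 0 < κ)
    (hν : -(1 / 2 : ℝ) < ν.re) (h : IsExpansion ν κ a w) {z : ℂ} (hz : z.im < 0) :
    HasSum (fun k : {k : ℤ // k < 0} => -(((|((k : ℤ) : ℝ)| : ℝ) : ℂ) ^ ν *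
      Complex.exp (Complex.I * (κ * (k : ℤ)) * z)) * a k) (lewisSeries ν κ a z) := by
  rw [lewisSeries, if_neg hz.le.not_gt]
  have h1 := (h.refl.hasSum_upperSeries hκ hν (ζ := -z) (by simpa using hz)).neg
  let e : {k : ℤ // k < 0} ≃ {k : ℤ // 0 < k} :=
    ⟨fun k => ⟨-k.1, by have := k.2; omega⟩, fun k => ⟨-k.1, by have := k.2; omega⟩,
      fun k => by simp, fun k => by simp⟩
  refine (e.hasSum_iff.mpr h1).congr_fun fun k => ?_
  have hk : ((k : ℤ) : ℝ) < 0 := by exact_mod_cast k.2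
  simp only [Function.comp_apply, e, Equiv.coe_fn_mk, abs_of_neg hk]
  push_cast
  rw [neg_neg]
  ring_nf

end FiniteDimensional

end

end HigherOrderLewis

namespace HigherOrderLewis

noncomputable section

/-! ### The holomorphic series: behaviour at the ends, translation, vector valued form. -/

section Scalar

variable {ν : ℂ} {κ : ℝ} {a a' : ℤ → ℂ} {w : ℂ → ℂ}

lemma IsExpansion.tendsto_lewisSeries (hκ : 0 < κ) (hν : -(1 / 2 : ℝ) < ν.re)
    (h : IsExpansion ν κ a w) :
    Tendsto (lewisSeries ν κ a) (comap (fun z : ℂ => |z.im|) atTop) (𝓝 0) := by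
  obtain ⟨M, hM, hb⟩ := h.exists_norm_upperSeries_le hκ hν
  obtain ⟨M', hM', hb'⟩ := h.refl.exists_norm_upperSeries_le hκ hν
  have h1 : Tendsto (fun y : ℝ => (M + M') * Real.exp (-(κ * (y - 1)))) atTop (𝓝 0) := by
    have h2 : Tendsto (fun y : ℝ => κ * (y - 1)) atTop atTop :=
      (tendsto_atTop_add_const_right atTop (-1 : ℝ) tendsto_id).const_mul_atTop hκ
    simpa using (Real.tendsto_exp_neg_atTop_nhds_zero.comp h2).const_mul (M + M')
  refine squeeze_zero_norm' ?_ (h1.comp tendsto_comap)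
  have h3 : ∀ᶠ z : ℂ in comap (fun z : ℂ => |z.im|) atTop, 1 ≤ |z.im| :=
    tendsto_comap.eventually (eventually_ge_atTop 1)
  filter_upwards [h3] with z hz
  simp only [Function.comp_apply]
  have he : 0 ≤ Real.exp (-(κ * (|z.im| - 1))) := (Real.exp_pos _).le
  rw [lewisSeries]
  split_ifs with hz0
  · rw [abs_of_pos hz0] at hz he ⊢
    refine (hb z hz).trans ?_
    nlinarith
  · have hz1 : |z.im| = (-z).im := by rw [abs_of_nonpos (not_lt.mp hz0), Complex.neg_im]
    rw [hz1] at hz he ⊢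
    rw [norm_neg]
    refine (hb' (-z) hz).trans ?_
    nlinarith

lemma IsExpansion.differentiableAt_lewisSeries (hκ : 0 < κ) (hν : -(1 / 2 : ℝ) < ν.re)
    (hw : IsEig ν {z : ℂ | 0 < z.im} w (fderiv ℝ w)) (h : IsExpansion ν κ a w) {z : ℂ}
    (hz : z.im ≠ 0) : DifferentiableAt ℂ (lewisSeries ν κ a) z := by
  have hs : 0 < (ν + 1 / 2).re := by
    simp only [Complex.add_re, Complex.div_ofNat_re, Complex.one_re]
    linarith
  rcases lt_or_gt_of_ne hz with hz | hz
  · have h1 := h.refl.differentiableAt_upperSeries hκ rfl hs hw.refl (ζ := -z) (by simpa using hz)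
    have h2 : DifferentiableAt ℂ (fun z => -upperSeries ν κ (fun k => a (-k)) (-z)) z :=
      (h1.comp z differentiableAt_id.neg).neg
    refine h2.congr_of_eventuallyEq ?_
    filter_upwards [(isOpen_lt Complex.continuous_im continuous_const).mem_nhds hz] with t ht
    rw [lewisSeries, if_neg (not_lt.mpr (le_of_lt ht))]
  · refine (h.differentiableAt_upperSeries hκ rfl hs hw hz).congr_of_eventuallyEq ?_
    filter_upwards [isOpen_im_pos.mem_nhds hz] with t ht
    rw [lewisSeries, if_pos ht]

lemma lewisSeries_add_one (h : ∀ k : ℤ, a' k = Complex.exp (Complex.I * (κ * k)) * a k) (z : ℂ) :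
    lewisSeries ν κ a (z + 1) = lewisSeries ν κ a' z := by
  have e : (z + 1).im = z.im := by simp
  rw [lewisSeries, lewisSeries, e]
  simp only [upperSeries, h]
  split_ifs
  · refine tsum_congr fun k => ?_
    rw [mul_add, Complex.exp_add]
    ring_nf
  · congr 1
    refine tsum_congr fun k => ?_
    rw [neg_add, mul_add, Complex.exp_add]
    push_cast
    ring_nf

end Scalar

section Vector

variable {V : Type*} [NormedAddCommGroup V] [NormedSpace ℂ V] [FiniteDimensional ℂ V]
variable {ν : ℂ} {u : ℍ → V} {v : ℤ → V}

/-- The vector valued function with coordinates `lewisSeries`, extended by zero to the real line. -/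
def lewisVec (ν : ℂ) (κ : ℝ) (v : ℤ → V) (z : ℂ) : V :=
  if z.im = 0 then 0 else
    ∑ i, lewisSeries ν κ (fun k => (Module.finBasis ℂ V).coord i (v k)) z • Module.finBasis ℂ V i

/-- The definition uses basis coordinates only. Since all series involved converge, uniqueness of
sums extends the formula to every functional. -/
lemma apply_lewisVec {κ : ℝ} (hκ : 0 < κ) (hν : -(1 / 2 : ℝ) < ν.re)
    (h : ∀ l : Module.Dual ℂ V, IsExpansion ν κ (fun k => l (v k)) (coordFun l u))
    (l : Module.Dual ℂ V) {z : ℂ} (hz : z.im ≠ 0) :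
    l (lewisVec ν κ v z) = lewisSeries ν κ (fun k => l (v k)) z := by
  rw [lewisVec, if_neg hz, map_sum]
  simp only [map_smul, smul_eq_mul]
  rcases lt_or_gt_of_ne hz with hz | hz
  · refine HasSum.unique ?_ ((h l).hasSum_lewisSeries_neg hκ hν hz)
    have h1 := hasSum_sum (s := Finset.univ) fun i (_ : i ∈ Finset.univ) =>
      ((h ((Module.finBasis ℂ V).coord i)).hasSum_lewisSeries_neg hκ hν hz).mul_right
        (l (Module.finBasis ℂ V i))
    convert! h1 using 1
    funext k
    rw [apply_eq_sum_coord l (v k), Finset.mul_sum]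
    exact Finset.sum_congr rfl fun i _ => (mul_assoc _ _ _).symm
  · refine HasSum.unique ?_ ((h l).hasSum_lewisSeries hκ hν hz)
    have h1 := hasSum_sum (s := Finset.univ) fun i (_ : i ∈ Finset.univ) =>
      ((h ((Module.finBasis ℂ V).coord i)).hasSum_lewisSeries hκ hν hz).mul_right
        (l (Module.finBasis ℂ V i))
    convert! h1 using 1
    funext k
    rw [apply_eq_sum_coord l (v k), Finset.mul_sum]
    exact Finset.sum_congr rfl fun i _ => (mul_assoc _ _ _).symm

lemma isLewisSeries_lewisVec {N : ℕ} (hN : 0 < N) (hν : -(1 / 2 : ℝ) < ν.re)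
    (h : ∀ l : Module.Dual ℂ V, IsExpansion ν (2 * Real.pi / (N : ℝ)) (fun k => l (v k))
      (coordFun l u)) : IsLewisSeries ν N v (lewisVec ν (2 * Real.pi / (N : ℝ)) v) := by
  have hN' : (0 : ℝ) < N := by exact_mod_cast hN
  have hκ : 0 < 2 * Real.pi / (N : ℝ) := by positivity
  have e : ∀ (k : ℤ) (z : ℂ), Complex.exp (2 * Real.pi * Complex.I * (k : ℂ) * z / (N : ℂ)) =
      Complex.exp (Complex.I * (((2 * Real.pi / (N : ℝ) : ℝ) : ℂ) * k) * z) := by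
    intro k z
    congr 1
    push_cast
    ring
  constructor
  · intro z hz
    refine hasSum_iff_dual.mpr fun l => ?_
    rw [apply_lewisVec hκ hν h l hz.ne']
    simp only [map_smul, smul_eq_mul, e]
    exact (h l).hasSum_lewisSeries hκ hν hz
  · intro z hz
    refine hasSum_iff_dual.mpr fun l => ?_
    rw [apply_lewisVec hκ hν h l hz.ne]
    simp only [map_smul, smul_eq_mul, e]
    exact (h l).hasSum_lewisSeries_neg hκ hν hz

omit [FiniteDimensional ℂ V] in
lemma IsLewisSeries.unique {N : ℕ} {f g : ℂ → V} (hf : IsLewisSeries ν N v f)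
    (hg : IsLewisSeries ν N v g) {z : ℂ} (hz : z.im ≠ 0) : f z = g z := by
  rcases lt_or_gt_of_ne hz with hz | hz
  · exact (hf.2 z hz).unique (hg.2 z hz)
  · exact (hf.1 z hz).unique (hg.1 z hz)

lemma tendsto_lewisVec {κ : ℝ} (hκ : 0 < κ) (hν : -(1 / 2 : ℝ) < ν.re)
    (h : ∀ l : Module.Dual ℂ V, IsExpansion ν κ (fun k => l (v k)) (coordFun l u)) :
    Tendsto (lewisVec ν κ v) (comap (fun z : ℂ => |z.im|) atTop) (𝓝 0) := by
  refine tendsto_iff_dual.mpr fun l => ?_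
  rw [map_zero]
  refine ((h l).tendsto_lewisSeries hκ hν).congr' ?_
  have h3 : ∀ᶠ z : ℂ in comap (fun z : ℂ => |z.im|) atTop, 0 < |z.im| :=
    tendsto_comap.eventually (eventually_gt_atTop 0)
  filter_upwards [h3] with z hz
  exact (apply_lewisVec hκ hν h l (abs_pos.mp hz)).symm

lemma comap_im_atTop_le : comap Complex.im atTop ≤ comap (fun z : ℂ => |z.im|) atTop := by
  rw [← tendsto_iff_comap]
  exact tendsto_abs_atTop_atTop.comp tendsto_comap

lemma comap_im_atBot_le : comap Complex.im atBot ≤ comap (fun z : ℂ => |z.im|) atTop := by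
  rw [← tendsto_iff_comap]
  exact tendsto_abs_atBot_atTop.comp tendsto_comap

/-! ### The expansion of a twisted cusp form -/

variable {Γ : Subgroup PSL(2, ℤ)} {q : ℕ} {η : Representation ℂ PSL(2, ℤ) V}

omit [FiniteDimensional ℂ V] in
lemma coordFun_isEigenfunction (hu : u ∈ twistedCuspForms Γ ν q η) (l : Module.Dual ℂ V) :
    IsEigenfunction ν fun z => l (u z) := (hu.1 l).1.1

omit [FiniteDimensional ℂ V] in
lemma laplacian_coordFun (hu : u ∈ twistedCuspForms Γ ν q η) (l : Module.Dual ℂ V) (z : ℂ)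
    (hz : 0 < z.im) : -((z.im : ℂ) ^ 2) * (Laplacian.laplacian (coordFun l u) : ℂ → ℂ) z =
      (1 / 4 - ν ^ 2) * coordFun l u z := by
  have h1 := (coordFun_isEigenfunction hu l).2 ⟨z, hz⟩
  have h2 := coordFun_coe l u ⟨z, hz⟩
  change coordFun l u z = _ at h2
  rw [h2]
  exact h1

omit [FiniteDimensional ℂ V] in
lemma isEig_coordFun (hu : u ∈ twistedCuspForms Γ ν q η) (l : Module.Dual ℂ V) :
    IsEig ν {z : ℂ | 0 < z.im} (coordFun l u) (fderiv ℝ (coordFun l u)) :=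
  isEig_of_contDiffOn (coordFun_isEigenfunction hu l).1 (laplacian_coordFun hu l)

omit [FiniteDimensional ℂ V] in
-- Equivariance moves the group action from the variable to the functional. This is why the
-- expansions are required for all functionals simultaneously.
lemma coordFun_moebius (hu : u ∈ twistedCuspForms Γ ν q η) (l : Module.Dual ℂ V)
    (γ : PSL(2, ℤ)) (z : ℍ) : coordFun l u (moebius γ z) = coordFun (l.comp (η γ)) u z := by
  rw [coordFun_coe, coordFun_coe, hu.2]
  rfl

lemma moebius_genT_pow_coe (n : ℕ) (z : ℍ) : ((moebius (genT ^ n) z : ℍ) : ℂ) = z + n := by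
  induction n with
  | zero => simp
  | succ n ih =>
    rw [pow_succ', map_mul, Equiv.Perm.mul_apply, moebius_genT_coe, ih]
    push_cast
    ring

omit [FiniteDimensional ℂ V] in
-- T^N belongs to the parabolic subgroup, on which η is trivial.
lemma coordFun_add_width [Γ.FiniteIndex]
    (hpar : ∀ γ ∈ parabolicSubgroup Γ, η (γ : PSL(2, ℤ)) = 1)
    (hu : u ∈ twistedCuspForms Γ ν q η) (l : Module.Dual ℂ V) {z : ℂ} (hz : 0 < z.im) :
    coordFun l u (z + (cuspWidth Γ : ℝ)) = coordFun l u z := by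
  have h1 := coordFun_moebius hu l (genT ^ cuspWidth Γ) ⟨z, hz⟩
  rw [moebius_genT_pow_coe, hpar _ (genT_pow_mem_parabolicSubgroup Γ)] at h1
  push_cast
  exact h1

lemma exists_expansion [Γ.FiniteIndex]
    (hpar : ∀ γ ∈ parabolicSubgroup Γ, η (γ : PSL(2, ℤ)) = 1)
    (hu : u ∈ twistedCuspForms Γ ν q η) :
    ∃ v : ℤ → V, ∀ l : Module.Dual ℂ V,
      IsExpansion ν (2 * Real.pi / (cuspWidth Γ : ℝ)) (fun k => l (v k)) (coordFun l u) := by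
  have hN : (0 : ℝ) < cuspWidth Γ := by exact_mod_cast (cuspWidth_spec Γ).1
  refine exists_vector_expansion fun l => ?_
  have hl := coordFun_isEigenfunction hu l
  refine exists_isExpansion hN hl.1 (laplacian_coordFun hu l)
    (fun z hz => coordFun_add_width hpar hu l hz) (fun y hy => ?_)
    ((hu.1 l).1.2.1.integrableOn hl.continuous _)
  simpa [coordFun] using (hu.1 l).2 1 y hy

omit [FiniteDimensional ℂ V] in
-- Both sides are the coefficients of z ↦ l(u(z+1)), so they agree by uniqueness of expansions.
lemma expansion_genT {κ : ℝ} (hκ : κ = 2 * Real.pi / (cuspWidth Γ : ℝ)) [Γ.FiniteIndex]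
    (hu : u ∈ twistedCuspForms Γ ν q η)
    (h : ∀ l : Module.Dual ℂ V, IsExpansion ν κ (fun k => l (v k)) (coordFun l u))
    (l : Module.Dual ℂ V) (k : ℤ) :
    l (η genT (v k)) = Complex.exp (Complex.I * (κ * k)) * l (v k) := by
  have hN : (0 : ℝ) < cuspWidth Γ := by exact_mod_cast (cuspWidth_spec Γ).1
  have h1 : IsExpansion ν κ (fun k => Complex.exp (Complex.I * (κ * k)) * l (v k))
      (coordFun (l.comp (η genT)) u) := by
    refine ⟨by simp [(h l).1], fun z hz => ?_⟩
    have h2 := (h l).2 (z + 1) (by simpa using hz)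
    have h3 := coordFun_moebius hu l genT ⟨z, hz⟩
    rw [moebius_genT_coe] at h3
    change coordFun l u (z + 1) = coordFun (l.comp (η genT)) u z at h3
    rw [h3] at h2
    convert! h2 using 1
    funext k
    have h4 := mode_add ν (κ * k) 1 z
    rw [Complex.ofReal_one] at h4
    rw [h4]
    push_cast
    ring_nf
  subst hκ
  exact congrFun ((h (l.comp (η genT))).unique hN h1) k

lemma lewisVec_add_one {κ : ℝ} (hκ : κ = 2 * Real.pi / (cuspWidth Γ : ℝ)) [Γ.FiniteIndex]
    (hν : -(1 / 2 : ℝ) < ν.re) (hu : u ∈ twistedCuspForms Γ ν q η)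
    (h : ∀ l : Module.Dual ℂ V, IsExpansion ν κ (fun k => l (v k)) (coordFun l u))
    {z : ℂ} (hz : z.im ≠ 0) : lewisVec ν κ v (z + 1) = η genT (lewisVec ν κ v z) := by
  have hN : (0 : ℝ) < cuspWidth Γ := by exact_mod_cast (cuspWidth_spec Γ).1
  have hκ0 : 0 < κ := by rw [hκ]; positivity
  refine eq_of_forall_dual fun l => ?_
  rw [apply_lewisVec hκ0 hν h l (by simpa using hz)]
  have h1 := apply_lewisVec hκ0 hν h (l.comp (η genT)) hz
  rw [LinearMap.comp_apply] at h1
  rw [h1]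
  exact lewisSeries_add_one (expansion_genT hκ hu h l) z

lemma lewisVec_mem_spaceF {κ : ℝ} (hκ : κ = 2 * Real.pi / (cuspWidth Γ : ℝ)) [Γ.FiniteIndex]
    (hν : -(1 / 2 : ℝ) < ν.re) (hu : u ∈ twistedCuspForms Γ ν q η)
    (h : ∀ l : Module.Dual ℂ V, IsExpansion ν κ (fun k => l (v k)) (coordFun l u)) :
    lewisVec ν κ v ∈ spaceF η := by
  have hN : (0 : ℝ) < cuspWidth Γ := by exact_mod_cast (cuspWidth_spec Γ).1
  have hκ0 : 0 < κ := by rw [hκ]; positivity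
  have hlim := tendsto_lewisVec hκ0 hν h
  refine ⟨fun z hz => ?_, fun z hz => if_pos hz, fun z hz => lewisVec_add_one hκ hν hu h hz,
    hlim.isBigO_one ℝ, 0, hlim.mono_left comap_im_atTop_le, ?_⟩
  · refine (differentiableAt_of_dual fun l => ?_).differentiableWithinAt
    refine ((h l).differentiableAt_lewisSeries hκ0 hν (isEig_coordFun hu l)
      hz).congr_of_eventuallyEq ?_
    filter_upwards [(isOpen_ne_fun Complex.continuous_im continuous_const).mem_nhds hz] with t ht
    exact apply_lewisVec hκ0 hν h l ht
  · rw [neg_zero]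
    exact hlim.mono_left comap_im_atBot_le

end Vector

end

end HigherOrderLewis

namespace HigherOrderLewis

noncomputable section

/-! ### Complex powers -/

lemma arg_mem_of_im_pos {z : ℂ} (hz : 0 < z.im) : 0 < z.arg ∧ z.arg < Real.pi := by
  refine ⟨lt_of_le_of_ne (Complex.arg_nonneg_iff.mpr hz.le) fun h => ?_,
    Complex.arg_lt_pi_iff.mpr (Or.inr hz.ne')⟩
  exact hz.ne' (Complex.arg_eq_zero_iff.mp h.symm).2

lemma arg_mem_of_im_neg {z : ℂ} (hz : z.im < 0) : -Real.pi < z.arg ∧ z.arg < 0 :=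
  ⟨Complex.neg_pi_lt_arg z, Complex.arg_neg_iff.mpr hz⟩

/-- The logarithms add up to a multiple 2πin. All three arguments lie in (0,π), or all in (-π,0),
which forces n = 0. -/
lemma mul_cpow_of_same_side {x y : ℂ} (h : (0 < x.im ∧ 0 < y.im ∧ 0 < (x * y).im) ∨
    (x.im < 0 ∧ y.im < 0 ∧ (x * y).im < 0)) (c : ℂ) : (x * y) ^ c = x ^ c * y ^ c := by
  have hx : x ≠ 0 := by rintro rfl; simp at h
  have hy : y ≠ 0 := by rintro rfl; simp at h
  have hlog : Complex.log (x * y) = Complex.log x + Complex.log y := by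
    rw [Complex.log_mul_eq_add_log_iff hx hy]
    have h1 : Complex.exp (Complex.log x + Complex.log y) = Complex.exp (Complex.log (x * y)) := by
      rw [Complex.exp_add, Complex.exp_log hx, Complex.exp_log hy,
        Complex.exp_log (mul_ne_zero hx hy)]
    obtain ⟨n, hn⟩ := Complex.exp_eq_exp_iff_exists_int.mp h1
    have h2 := congrArg Complex.im hn
    simp [Complex.log_im] at h2
    have hpi := Real.pi_pos
    rcases h with ⟨h3, h4, h5⟩ | ⟨h3, h4, h5⟩
    · obtain ⟨a1, a2⟩ := arg_mem_of_im_pos h3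
      obtain ⟨b1, b2⟩ := arg_mem_of_im_pos h4
      obtain ⟨c1, c2⟩ := arg_mem_of_im_pos h5
      have h6 : (n : ℝ) < 1 := by
        by_contra! h
        nlinarith
      have h7 : (-1 : ℝ) < n := by
        by_contra! h
        nlinarith
      have h8 : n = 0 := by
        have h6' : n < 1 := by exact_mod_cast h6
        have h7' : -1 < n := by exact_mod_cast h7
        omega
      rw [h8] at h2
      simp at h2
      exact ⟨by linarith, by linarith⟩
    · obtain ⟨a1, a2⟩ := arg_mem_of_im_neg h3
      obtain ⟨b1, b2⟩ := arg_mem_of_im_neg h4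
      obtain ⟨c1, c2⟩ := arg_mem_of_im_neg h5
      have h6 : (n : ℝ) < 1 := by
        by_contra! h
        nlinarith
      have h7 : (-1 : ℝ) < n := by
        by_contra! h
        nlinarith
      have h8 : n = 0 := by
        have h6' : n < 1 := by exact_mod_cast h6
        have h7' : -1 < n := by exact_mod_cast h7
        omega
      rw [h8] at h2
      simp at h2
      exact ⟨by linarith, by linarith⟩
  rw [Complex.cpow_def_of_ne_zero (mul_ne_zero hx hy), Complex.cpow_def_of_ne_zero hx,
    Complex.cpow_def_of_ne_zero hy, hlog, add_mul, Complex.exp_add]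

/-- The moduli of z and -1/z are reciprocal, so only the arguments contribute, by at most 2π
altogether. -/
lemma norm_cpow_mul_neg_inv_cpow_le {z : ℂ} (hz : z ≠ 0) (c : ℂ) :
    ‖z ^ c * (-1 / z) ^ c‖ ≤ Real.exp (2 * Real.pi * ‖c‖) := by
  have hz' : -1 / z ≠ 0 := div_ne_zero (by simp) hz
  rw [Complex.cpow_def_of_ne_zero hz, Complex.cpow_def_of_ne_zero hz', ← Complex.exp_add,
    ← add_mul, Complex.norm_exp]
  refine Real.exp_le_exp.mpr ((Complex.re_le_norm _).trans ?_)
  rw [norm_mul]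
  refine mul_le_mul_of_nonneg_right ?_ (norm_nonneg c)
  have h1 : (Complex.log z + Complex.log (-1 / z)).re = 0 := by
    rw [Complex.add_re, Complex.log_re, Complex.log_re, norm_div, norm_neg, norm_one, one_div,
      Real.log_inv, add_neg_cancel]
  have h2 := Complex.norm_le_abs_re_add_abs_im (Complex.log z + Complex.log (-1 / z))
  rw [h1, abs_zero, zero_add, Complex.add_im, Complex.log_im, Complex.log_im] at h2
  refine h2.trans ((abs_add_le _ _).trans ?_)
  linarith [Complex.abs_arg_le_pi z, Complex.abs_arg_le_pi (-1 / z)]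

/-! ### Extension by continuity to the positive reals -/

lemma dense_im_ne_zero : Dense {z : ℂ | z.im ≠ 0} :=
  (dense_compl_singleton (0 : ℝ)).preimage Complex.isOpenMap_im

lemma eqOn_slitPlane_of_continuousOn {E : Type*} [TopologicalSpace E] [T2Space E] {f g : ℂ → E}
    (hf : ContinuousOn f Complex.slitPlane) (hg : ContinuousOn g Complex.slitPlane)
    (h : ∀ z : ℂ, z.im ≠ 0 → f z = g z) : Set.EqOn f g Complex.slitPlane := by
  refine Set.EqOn.of_subset_closure (s := {z : ℂ | z.im ≠ 0}) h hf hg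
    (fun z hz => Complex.mem_slitPlane_iff.mpr (Or.inr hz)) ?_
  rw [dense_im_ne_zero.closure_eq]
  exact Set.subset_univ _

lemma im_div_add_one (z : ℂ) : (z / (z + 1)).im = z.im / ‖z + 1‖ ^ 2 := by
  rw [Complex.div_im, Complex.normSq_eq_norm_sq]
  simp
  ring

lemma add_one_mem_slitPlane {z : ℂ} (hz : z ∈ Complex.slitPlane) : z + 1 ∈ Complex.slitPlane := by
  rw [Complex.mem_slitPlane_iff] at hz ⊢
  rcases hz with h | h
  · left; simp; linarith
  · right; simpa using h

lemma div_add_one_mem_slitPlane {z : ℂ} (hz : z ∈ Complex.slitPlane) :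
    z / (z + 1) ∈ Complex.slitPlane := by
  have h0 := Complex.slitPlane_ne_zero (add_one_mem_slitPlane hz)
  have h1 : 0 < ‖z + 1‖ ^ 2 := by positivity
  rw [Complex.mem_slitPlane_iff, im_div_add_one]
  by_cases h : z.im = 0
  · left
    rw [Complex.mem_slitPlane_iff] at hz
    have h2 := hz.resolve_right (not_not.mpr h)
    rw [Complex.div_re, Complex.normSq_eq_norm_sq, h]
    simp
    positivity
  · right
    exact div_ne_zero h h1.ne'

section

variable {V : Type*} [NormedAddCommGroup V] [NormedSpace ℂ V] [FiniteDimensional ℂ V]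
variable {ν : ℂ} {κ : ℝ} {u : ℍ → V} {v : ℤ → V}
variable {Γ : Subgroup PSL(2, ℤ)} {q : ℕ} {η : Representation ℂ PSL(2, ℤ) V}

/-! ### The period function -/

/-- The function `f(z) - z^{-2ν-1} η(S) f(-1/z)` off the real line. -/
def periodDiff (ν : ℂ) (η : Representation ℂ PSL(2, ℤ) V) (f : ℂ → V) (z : ℂ) : V :=
  f z - z ^ (-2 * ν - 1) • η genS (f (-1 / z))

/-- The integral formula for the period function on the sector `|arg z| < 3π/4`. -/
def rayVec (ν : ℂ) (κ : ℝ) (u : ℍ → V) (z : ℂ) : V :=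
  ∑ i, (periodConst ν κ (ν + 1 / 2) * rayF (ν + 1 / 2)
    (coordFun ((Module.finBasis ℂ V).coord i) u) (3 * Real.pi / 4) z) • Module.finBasis ℂ V i

open Classical in
/-- The period function on the slit plane. -/
def periodVec (ν : ℂ) (κ : ℝ) (η : Representation ℂ PSL(2, ℤ) V) (u : ℍ → V) (v : ℤ → V)
    (z : ℂ) : V :=
  if z ∈ Complex.slitPlane then
    if z.im = 0 then rayVec ν κ u z else periodDiff ν η (lewisVec ν κ v) z
  else 0

lemma periodVec_of_im_ne_zero {z : ℂ} (hz : z.im ≠ 0) :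
    periodVec ν κ η u v z = periodDiff ν η (lewisVec ν κ v) z := by
  rw [periodVec, if_pos (Complex.mem_slitPlane_iff.mpr (Or.inr hz)), if_neg hz]

lemma im_neg_inv_ne_zero {z : ℂ} (hz : z.im ≠ 0) : (-1 / z).im ≠ 0 := by
  have h0 : z ≠ 0 := fun h => by simp [h] at hz
  rw [im_neg_inv]
  exact div_ne_zero hz (by positivity)

omit [FiniteDimensional ℂ V] in
-- Invariance under S enters here: replacing z by -1/z replaces l by l ∘ η(S).
lemma isSwapPair_coordFun (hu : u ∈ twistedCuspForms Γ ν q η)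
    (h : ∀ l : Module.Dual ℂ V, IsExpansion ν κ (fun k => l (v k)) (coordFun l u))
    (l : Module.Dual ℂ V) : IsSwapPair ν κ (fun k => l (v k)) (fun k => l (η genS (v k)))
      (coordFun l u) (coordFun (l.comp (η genS)) u) := by
  refine ⟨isEig_coordFun hu l, isEig_coordFun hu _, h l, h (l.comp (η genS)), fun z hz => ?_⟩
  have h1 := coordFun_moebius hu l genS ⟨z, hz⟩
  rw [moebius_genS_coe] at h1
  exact h1.symm

lemma apply_periodDiff (hκ : 0 < κ) (hν : -(1 / 2 : ℝ) < ν.re)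
    (h : ∀ l : Module.Dual ℂ V, IsExpansion ν κ (fun k => l (v k)) (coordFun l u))
    (l : Module.Dual ℂ V) {z : ℂ} (hz : z.im ≠ 0) :
    l (periodDiff ν η (lewisVec ν κ v) z) = lewisSeries ν κ (fun k => l (v k)) z -
      z ^ (-(2 * (ν + 1 / 2))) * lewisSeries ν κ (fun k => l (η genS (v k))) (-1 / z) := by
  have h1 := apply_lewisVec hκ hν h (l.comp (η genS)) (im_neg_inv_ne_zero hz)
  rw [LinearMap.comp_apply] at h1
  rw [periodDiff, map_sub, map_smul, smul_eq_mul, apply_lewisVec hκ hν h l hz, h1]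
  congr 3
  ring

lemma re_half_pos (hν : -(1 / 2 : ℝ) < ν.re) : 0 < (ν + 1 / 2).re := by
  simp only [Complex.add_re, Complex.div_ofNat_re, Complex.one_re]
  linarith

/-- The two formulas in the definition of `periodVec` agree on the sector. The angle 3π/4 is merely
a convenient one between π/2 and π. -/
lemma periodVec_eq_rayVec (hκ : 0 < κ) (hν : -(1 / 2 : ℝ) < ν.re)
    (hu : u ∈ twistedCuspForms Γ ν q η)
    (h : ∀ l : Module.Dual ℂ V, IsExpansion ν κ (fun k => l (v k)) (coordFun l u)) {z : ℂ}
    (hz : z ∈ Complex.slitPlane) (harg : |z.arg| < 3 * Real.pi / 4) :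
    periodVec ν κ η u v z = rayVec ν κ u z := by
  by_cases hz0 : z.im = 0
  · rw [periodVec, if_pos hz, if_pos hz0]
  rw [periodVec_of_im_ne_zero hz0, ← sum_coord_smul (periodDiff ν η (lewisVec ν κ v) z), rayVec]
  refine Finset.sum_congr rfl fun i _ => ?_
  rw [apply_periodDiff hκ hν h _ hz0, (isSwapPair_coordFun hu h _).lewisSeries_sub hκ rfl
    (re_half_pos hν) (by linarith [Real.pi_pos]) (by linarith [Real.pi_pos]) hz0 harg]

lemma differentiableAt_lewisVec (hκ : 0 < κ) (hν : -(1 / 2 : ℝ) < ν.re)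
    (hu : u ∈ twistedCuspForms Γ ν q η)
    (h : ∀ l : Module.Dual ℂ V, IsExpansion ν κ (fun k => l (v k)) (coordFun l u)) {z : ℂ}
    (hz : z.im ≠ 0) : DifferentiableAt ℂ (lewisVec ν κ v) z := by
  refine differentiableAt_of_dual fun l => ?_
  refine ((h l).differentiableAt_lewisSeries hκ hν (isEig_coordFun hu l)
    hz).congr_of_eventuallyEq ?_
  filter_upwards [(isOpen_ne_fun Complex.continuous_im continuous_const).mem_nhds hz] with t ht
  exact apply_lewisVec hκ hν h l ht

/-- Off the real line the function is built from holomorphic series. Near a positive real point it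
coincides with the ray integral, which is holomorphic there. -/
lemma differentiableOn_periodVec (hκ : 0 < κ) (hν : -(1 / 2 : ℝ) < ν.re)
    (hu : u ∈ twistedCuspForms Γ ν q η)
    (h : ∀ l : Module.Dual ℂ V, IsExpansion ν κ (fun k => l (v k)) (coordFun l u)) :
    DifferentiableOn ℂ (periodVec ν κ η u v) Complex.slitPlane := by
  intro z hz
  refine DifferentiableAt.differentiableWithinAt ?_
  have hz0 : z ≠ 0 := Complex.slitPlane_ne_zero hz
  by_cases him : z.im = 0
  · have hre : 0 < z.re := (Complex.mem_slitPlane_iff.mp hz).resolve_right (not_not.mpr him)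
    have harg : z.arg = 0 := Complex.arg_eq_zero_iff.mpr ⟨hre.le, him⟩
    have hpi := Real.pi_pos
    have h1 : DifferentiableAt ℂ (rayVec ν κ u) z := by
      refine DifferentiableAt.fun_sum fun i _ => ?_
      exact (((isSwapPair_coordFun hu h _).differentiableAt_rayF hκ (re_half_pos hν).le
        (by linarith) hz0 (by rw [harg, abs_zero]; linarith)).const_mul _).smul_const _
    refine h1.congr_of_eventuallyEq ?_
    have h2 : ∀ᶠ t in 𝓝 z, |t.arg| < 3 * Real.pi / 4 :=
      (Complex.continuousAt_arg hz).abs.eventually_lt_const (by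
        change |z.arg| < _
        rw [harg, abs_zero]; linarith)
    filter_upwards [h2, Complex.isOpen_slitPlane.mem_nhds hz] with t ht ht'
    exact periodVec_eq_rayVec hκ hν hu h ht' ht
  · have h1 : DifferentiableAt ℂ (fun z : ℂ => -1 / z) z :=
      (differentiableAt_const _).div differentiableAt_id hz0
    have h2 : DifferentiableAt ℂ (fun z : ℂ => lewisVec ν κ v (-1 / z)) z :=
      (differentiableAt_lewisVec hκ hν hu h (im_neg_inv_ne_zero him)).comp z h1
    have h3 : DifferentiableAt ℂ (fun z : ℂ => η genS (lewisVec ν κ v (-1 / z))) z :=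
      (LinearMap.toContinuousLinearMap (η genS)).differentiableAt.comp z h2
    have h4 : DifferentiableAt ℂ (periodDiff ν η (lewisVec ν κ v)) z :=
      (differentiableAt_lewisVec hκ hν hu h him).sub
        ((differentiableAt_id.cpow_const hz).smul h3)
    refine h4.congr_of_eventuallyEq ?_
    filter_upwards [(isOpen_ne_fun Complex.continuous_im continuous_const).mem_nhds him] with t ht
    exact periodVec_of_im_ne_zero ht

omit [FiniteDimensional ℂ V] in
-- By periodicity f(z/(z+1)) = η(T) f(-1/(z+1)) and f(-(z+1)/z) = η(T)⁻¹ f(-1/z). The terms with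
-- f(-1/(z+1)) cancel, and those with f(-1/z) match because TS = (ST⁻¹)².
lemma periodDiff_lewis {f : ℂ → V} (hf : ∀ z : ℂ, z.im ≠ 0 → f (z + 1) = η genT (f z)) {z : ℂ}
    (hz : z.im ≠ 0) : η genT (periodDiff ν η f z) = periodDiff ν η f (z + 1) +
      (z + 1) ^ (-2 * ν - 1) • η (genS * genT⁻¹) (periodDiff ν η f (z / (z + 1))) := by
  have hz0 : z ≠ 0 := fun h => by simp [h] at hz
  have hz1 : (z + 1).im ≠ 0 := by simpa using hz
  have hz10 : z + 1 ≠ 0 := fun h => by simp [h] at hz1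
  have hn : 0 < ‖z + 1‖ ^ 2 := by positivity
  have hinv : ∀ x : V, η genT⁻¹ (η genT x) = x := fun x => by
    rw [← Module.End.mul_apply, ← map_mul, inv_mul_cancel, map_one, Module.End.one_apply]
  have h1 : f (z / (z + 1)) = η genT (f (-1 / (z + 1))) := by
    rw [← hf _ (im_neg_inv_ne_zero hz1)]
    congr 1
    field_simp
    ring
  have h2 : f (-1 / (z / (z + 1))) = η genT⁻¹ (f (-1 / z)) := by
    have h3 : (-1 / (z / (z + 1))).im ≠ 0 := im_neg_inv_ne_zero (by
      rw [im_div_add_one]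
      exact div_ne_zero hz hn.ne')
    have h4 : f (-1 / z) = η genT (f (-1 / (z / (z + 1)))) := by
      rw [← hf _ h3]
      congr 1
      field_simp
      ring
    rw [h4, hinv]
  -- The points z, z + 1 and z/(z+1) lie on the same side of the real line, so the principal power
  -- is multiplicative.
  have h3 : z ^ (-2 * ν - 1) =
      (z + 1) ^ (-2 * ν - 1) * (z / (z + 1)) ^ (-2 * ν - 1) := by
    have e : (z + 1) * (z / (z + 1)) = z := by field_simp
    rw [← mul_cpow_of_same_side, e]
    rw [e, im_div_add_one, Complex.add_im, Complex.one_im, add_zero]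
    rcases lt_or_gt_of_ne hz with h | h
    · exact Or.inr ⟨h, div_neg_of_neg_of_pos h hn, h⟩
    · exact Or.inl ⟨h, div_pos h hn, h⟩
  have h4 : η genT (η genS (f (-1 / z))) =
      η (genS * genT⁻¹) (η genS (η genT⁻¹ (f (-1 / z)))) := by
    have := congrArg (fun g => η g (f (-1 / z))) genT_mul_genS
    simpa only [map_mul, Module.End.mul_apply] using this
  have h5 : η (genS * genT⁻¹) (η genT (f (-1 / (z + 1)))) = η genS (f (-1 / (z + 1))) := by
    rw [map_mul, Module.End.mul_apply, hinv]
  simp only [periodDiff]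
  rw [hf z hz, h1, h2, map_sub, map_sub, map_smul, map_smul, h4, h5, h3, smul_sub, smul_smul]
  abel

omit [FiniteDimensional ℂ V] in
-- As S² = 1, the terms with f(-1/z) cancel, leaving f(z) with a bounded factor. Since f tends to 0,
-- so does the whole expression.
lemma periodDiff_add_slash (f : ℂ → V) (z : ℂ) :
    periodDiff ν η f z + z ^ (-2 * ν - 1) • η genS (periodDiff ν η f (-1 / z)) =
      f z - (z ^ (-2 * ν - 1) * (-1 / z) ^ (-2 * ν - 1)) • f z := by
  have h1 : -1 / (-1 / z) = z := neg_inv_neg_inv z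
  have h2 : η genS (η genS (f z)) = f z := by
    rw [← Module.End.mul_apply, ← map_mul, genS_mul_genS, map_one, Module.End.one_apply]
  simp only [periodDiff]
  rw [h1, map_sub, map_smul, h2, smul_sub, smul_smul]
  abel

/-- The algebraic identity holds off the real line and extends to the positive reals by continuity.
-/
lemma periodVec_lewis (hκ : 0 < κ) (hν : -(1 / 2 : ℝ) < ν.re)
    (hu : u ∈ twistedCuspForms Γ ν q η)
    (h : ∀ l : Module.Dual ℂ V, IsExpansion ν κ (fun k => l (v k)) (coordFun l u))
    (hf : ∀ z : ℂ, z.im ≠ 0 → lewisVec ν κ v (z + 1) = η genT (lewisVec ν κ v z)) :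
    ∀ z ∈ Complex.slitPlane, η genT (periodVec ν κ η u v z) = periodVec ν κ η u v (z + 1) +
      (z + 1) ^ (-2 * ν - 1) • η (genS * genT⁻¹) (periodVec ν κ η u v (z / (z + 1))) := by
  have hc := (differentiableOn_periodVec hκ hν hu h).continuousOn
  have hlin : ∀ γ : PSL(2, ℤ), Continuous (η γ) := fun γ =>
    (η γ).continuous_of_finiteDimensional
  refine eqOn_slitPlane_of_continuousOn ((hlin _).comp_continuousOn hc) ?_ fun z hz => ?_
  · refine (hc.comp (by fun_prop) fun z hz => add_one_mem_slitPlane hz).add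
      (ContinuousOn.smul ?_ ((hlin _).comp_continuousOn (hc.comp ?_
        fun z hz => div_add_one_mem_slitPlane hz)))
    · exact ContinuousOn.cpow_const (by fun_prop) fun z hz => add_one_mem_slitPlane hz
    · exact continuousOn_id.div (by fun_prop) fun z hz =>
        Complex.slitPlane_ne_zero (add_one_mem_slitPlane hz)
  · have hz1 : (z + 1).im ≠ 0 := by simpa using hz
    have hz10 : z + 1 ≠ 0 := fun h => by simp [h] at hz1
    have hz2 : (z / (z + 1)).im ≠ 0 := by
      rw [im_div_add_one]
      exact div_ne_zero hz (by positivity)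
    rw [periodVec_of_im_ne_zero hz, periodVec_of_im_ne_zero hz1, periodVec_of_im_ne_zero hz2]
    exact periodDiff_lewis hf hz

lemma tendsto_periodVec_add_slash (hκ : 0 < κ) (hν : -(1 / 2 : ℝ) < ν.re)
    (h : ∀ l : Module.Dual ℂ V, IsExpansion ν κ (fun k => l (v k)) (coordFun l u)) :
    Tendsto (fun z : ℂ => periodVec ν κ η u v z +
      z ^ (-2 * ν - 1) • η genS (periodVec ν κ η u v (-1 / z)))
      (comap (fun z : ℂ => |z.im|) atTop) (𝓝 0) := by
  have h1 := (tendsto_lewisVec hκ hν h).norm.const_mul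
    (1 + Real.exp (2 * Real.pi * ‖-2 * ν - 1‖))
  rw [norm_zero, mul_zero] at h1
  refine squeeze_zero_norm' ?_ h1
  have h3 : ∀ᶠ z : ℂ in comap (fun z : ℂ => |z.im|) atTop, 0 < |z.im| :=
    tendsto_comap.eventually (eventually_gt_atTop 0)
  filter_upwards [h3] with z hz
  have hz : z.im ≠ 0 := abs_pos.mp hz
  have hz0 : z ≠ 0 := fun h => by simp [h] at hz
  rw [periodVec_of_im_ne_zero hz, periodVec_of_im_ne_zero (im_neg_inv_ne_zero hz),
    periodDiff_add_slash]
  refine (norm_sub_le _ _).trans ?_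
  rw [norm_smul, add_mul, one_mul]
  gcongr
  exact norm_cpow_mul_neg_inv_cpow_le hz0 _

lemma hasDecay_periodVec (hκ : 0 < κ) (hν : -(1 / 2 : ℝ) < ν.re)
    (hu : u ∈ twistedCuspForms Γ ν q η)
    (h : ∀ l : Module.Dual ℂ V, IsExpansion ν κ (fun k => l (v k)) (coordFun l u)) :
    HasDecay (2 * (ν + 1 / 2).re) (periodVec ν κ η u v) := by
  intro δ hδ
  -- Even for large δ the sector |arg z| < π - δ' must contain the positive reals in its interior.
  set δ' := min δ 1
  have hδ' : 0 < δ' := lt_min hδ one_pos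
  have hpi := Real.pi_gt_three
  obtain ⟨M, hM⟩ := exists_norm_le_of_dual (S := {z : ℂ | z.im ≠ 0 ∧ |z.arg| ≤ Real.pi - δ'})
    (f := periodVec ν κ η u v) (g := fun z => min 1 (‖z‖ ^ (-(2 * (ν + 1 / 2).re))))
    fun l => by
      obtain ⟨M, -, hM⟩ := (isSwapPair_coordFun hu h l).exists_norm_lewisSeries_sub_le hκ rfl
        (re_half_pos hν) hδ'
      refine ⟨M, fun z hz => ?_⟩
      rw [periodVec_of_im_ne_zero hz.1, apply_periodDiff hκ hν h l hz.1]
      exact hM z hz.1 hz.2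
  refine ⟨M, fun z hz harg => ?_⟩
  by_cases him : z.im = 0
  · have hre : 0 < z.re := (Complex.mem_slitPlane_iff.mp hz).resolve_right (not_not.mpr him)
    have hz0 : z ≠ 0 := Complex.slitPlane_ne_zero hz
    have harg0 : z.arg = 0 := Complex.arg_eq_zero_iff.mpr ⟨hre.le, him⟩
    have h1 : ∀ᶠ t in 𝓝 z, |t.arg| < Real.pi - δ' :=
      (Complex.continuousAt_arg hz).abs.eventually_lt_const (by
        change |z.arg| < _
        rw [harg0, abs_zero]
        have : δ' ≤ 1 := min_le_right _ _
        linarith)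
    -- The bound is known only off the real line. A positive real point is a limit of nonreal points
    -- of the sector, and both sides are continuous there.
    have h2 : ∃ᶠ t : ℂ in 𝓝 z, t.im ≠ 0 :=
      mem_closure_iff_frequently.mp (dense_im_ne_zero z)
    have h3 : ContinuousAt (periodVec ν κ η u v) z :=
      (differentiableOn_periodVec hκ hν hu h).continuousOn.continuousAt
        (Complex.isOpen_slitPlane.mem_nhds hz)
    have h4 : ContinuousAt (fun z : ℂ => M * min 1 (‖z‖ ^ (-(2 * (ν + 1 / 2).re)))) z :=
      continuousAt_const.mul (continuousAt_const.min
        (continuous_norm.continuousAt.rpow_const (Or.inl (norm_ne_zero_iff.mpr hz0))))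
    exact le_of_tendsto_of_tendsto_of_frequently h3.norm h4
      ((h2.and_eventually h1).mono fun t ht => hM t ⟨ht.1, ht.2.le⟩)
  · refine hM z ⟨him, harg.trans ?_⟩
    have : δ' ≤ δ := min_le_left _ _
    linarith

end

end

end HigherOrderLewis

/-! ### Uniqueness and linearity of the transform. -/

namespace HigherOrderLewis

noncomputable section

variable {V : Type*} [NormedAddCommGroup V] [NormedSpace ℂ V] [FiniteDimensional ℂ V]
variable {ν : ℂ} {N : ℕ} {u u' : ℍ → V} {v v' : ℤ → V} {f f' ψ ψ' : ℂ → V}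
variable {Γ : Subgroup PSL(2, ℤ)} {q : ℕ} {η : Representation ℂ PSL(2, ℤ) V}

omit [FiniteDimensional ℂ V] in
lemma IsFourierBessel.add (h : IsFourierBessel ν N u v) (h' : IsFourierBessel ν N u' v') :
    IsFourierBessel ν N (u + u') (v + v') :=
  ⟨by rw [Pi.add_apply, h.1, h'.1, add_zero], fun z => by
    simpa only [Pi.add_apply, smul_add] using (h.2 z).add (h'.2 z)⟩

omit [FiniteDimensional ℂ V] in
lemma IsFourierBessel.smul (c : ℂ) (h : IsFourierBessel ν N u v) :
    IsFourierBessel ν N (c • u) (c • v) :=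
  ⟨by rw [Pi.smul_apply, h.1, smul_zero], fun z => by
    simpa only [Pi.smul_apply, smul_comm _ c] using (h.2 z).const_smul c⟩

omit [FiniteDimensional ℂ V] in
lemma IsLewisSeries.add (h : IsLewisSeries ν N v f) (h' : IsLewisSeries ν N v' f') :
    IsLewisSeries ν N (v + v') (f + f') :=
  ⟨fun z hz => by simpa only [Pi.add_apply, smul_add] using (h.1 z hz).add (h'.1 z hz),
    fun z hz => by simpa only [Pi.add_apply, smul_add] using (h.2 z hz).add (h'.2 z hz)⟩

omit [FiniteDimensional ℂ V] in
lemma IsLewisSeries.smul (c : ℂ) (h : IsLewisSeries ν N v f) :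
    IsLewisSeries ν N (c • v) (c • f) :=
  ⟨fun z hz => by simpa only [Pi.smul_apply, smul_comm _ c] using (h.1 z hz).const_smul c,
    fun z hz => by simpa only [Pi.smul_apply, smul_comm _ c] using (h.2 z hz).const_smul c⟩

/-- Existence and uniqueness of the Fourier-Bessel coefficients of a twisted cusp form. -/
lemma existsUnique_isFourierBessel [Γ.FiniteIndex]
    (hpar : ∀ γ ∈ parabolicSubgroup Γ, η (γ : PSL(2, ℤ)) = 1)
    (hu : u ∈ twistedCuspForms Γ ν q η) :
    ∃! v : ℤ → V, IsFourierBessel ν (cuspWidth Γ) u v := by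
  have hN := (cuspWidth_spec Γ).1
  obtain ⟨v, hv⟩ := exists_expansion hpar hu
  refine ⟨v, (isFourierBessel_iff hN).mpr hv, fun v' hv' => ?_⟩
  replace hv' := (isFourierBessel_iff hN).mp hv'
  funext k
  exact eq_of_forall_dual fun l =>
    congrFun ((hv' l).unique (by exact_mod_cast hN) (hv l)) k

/-- The functions `f_u` and `ψ_u` attached to `u`. -/
structure IsLewisTransform (Γ : Subgroup PSL(2, ℤ)) (ν : ℂ) (hν : -(1 / 2 : ℝ) < ν.re)
    (η : Representation ℂ PSL(2, ℤ) V) (u : ℍ → V) (f ψ : ℂ → V) : Prop where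
  series : ∀ v : ℤ → V, IsFourierBessel ν (cuspWidth Γ) u v → IsLewisSeries ν (cuspWidth Γ) v f
  mem_spaceFnu : f ∈ spaceFnu ν η
  mem_periodFunctions : ψ ∈ periodFunctions ν hν η
  eq_sub : ∀ z : ℂ, z.im ≠ 0 → ψ z = f z - z ^ (-2 * ν - 1) • η genS (f (-1 / z))

lemma exists_isLewisTransform (hν : -(1 / 2 : ℝ) < ν.re) [Γ.FiniteIndex]
    (hpar : ∀ γ ∈ parabolicSubgroup Γ, η (γ : PSL(2, ℤ)) = 1)
    (hu : u ∈ twistedCuspForms Γ ν q η) :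
    ∃ f ψ : ℂ → V, IsLewisTransform Γ ν hν η u f ψ := by
  have hN : (0 : ℝ) < cuspWidth Γ := by exact_mod_cast (cuspWidth_spec Γ).1
  obtain ⟨v, hv⟩ := exists_expansion hpar hu
  set κ := 2 * Real.pi / (cuspWidth Γ : ℝ) with hκ
  have hκ0 : 0 < κ := by positivity
  have hd := differentiableOn_periodVec (η := η) hκ0 hν hu hv
  have hlim := tendsto_periodVec_add_slash (η := η) hκ0 hν hv
  refine ⟨lewisVec ν κ v, periodVec ν κ η u v, fun v' hv' => ?_,
    ⟨lewisVec_mem_spaceF hκ hν hu hv, _, hd, fun z hz => periodVec_of_im_ne_zero hz⟩,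
    ⟨⟨hd, fun z hz => if_neg hz,
      periodVec_lewis hκ0 hν hu hv fun z hz => lewisVec_add_one hκ hν hu hv hz, 0, 0,
      hlim.mono_left comap_im_atTop_le, hlim.mono_left comap_im_atBot_le, by simp⟩,
      -- The decay proved has the full exponent 2 Re ν + 1, which the strict inequality on C
      -- excludes. Half of it is taken, which only weakens the bound.
      (ν + 1 / 2).re, re_half_pos hν, ?_, fun δ hδ => ?_⟩,
    fun z hz => periodVec_of_im_ne_zero hz⟩
  · rw [(existsUnique_isFourierBessel hpar hu).unique hv'
      ((isFourierBessel_iff (cuspWidth_spec Γ).1).mpr hv)]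
    exact isLewisSeries_lewisVec (cuspWidth_spec Γ).1 hν hv
  · simp only [Complex.add_re, Complex.div_ofNat_re, Complex.one_re]
    linarith
  · obtain ⟨M, hM⟩ := hasDecay_periodVec (η := η) hκ0 hν hu hv δ hδ
    have hs := re_half_pos hν
    refine ⟨|M|, fun z hz harg => (hM z hz harg).trans ?_⟩
    have hz0 : 0 < ‖z‖ := norm_pos_iff.mpr (Complex.slitPlane_ne_zero hz)
    have h1 : 0 ≤ min 1 (‖z‖ ^ (-(2 * (ν + 1 / 2).re))) :=
      le_min zero_le_one (Real.rpow_nonneg hz0.le _)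
    exact (mul_le_mul_of_nonneg_right (le_abs_self M) h1).trans
      (mul_le_mul_of_nonneg_left (min_rpow_le hz0 hs.le (by linarith)) (abs_nonneg M))

/-- The series fixes f off the real line, f then fixes ψ there, and continuity fixes ψ on the
positive reals. Extension by zero settles the remaining points. -/
lemma IsLewisTransform.unique {hν : -(1 / 2 : ℝ) < ν.re} [Γ.FiniteIndex]
    (hpar : ∀ γ ∈ parabolicSubgroup Γ, η (γ : PSL(2, ℤ)) = 1)
    (hu : u ∈ twistedCuspForms Γ ν q η) (h : IsLewisTransform Γ ν hν η u f ψ)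
    (h' : IsLewisTransform Γ ν hν η u f' ψ') : f = f' ∧ ψ = ψ' := by
  obtain ⟨v, hv, -⟩ := existsUnique_isFourierBessel hpar hu
  have hf : f = f' := by
    funext z
    by_cases hz : z.im = 0
    · rw [h.mem_spaceFnu.1.2.1 z hz, h'.mem_spaceFnu.1.2.1 z hz]
    · exact (h.series v hv).unique (h'.series v hv) hz
  refine ⟨hf, funext fun z => ?_⟩
  by_cases hz : z ∈ Complex.slitPlane
  · refine eqOn_slitPlane_of_continuousOn h.mem_periodFunctions.1.1.continuousOn
      h'.mem_periodFunctions.1.1.continuousOn (fun z hz => ?_) hz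
    rw [h.eq_sub z hz, h'.eq_sub z hz, hf]
  · rw [h.mem_periodFunctions.1.2.1 z hz, h'.mem_periodFunctions.1.2.1 z hz]

lemma IsLewisTransform.add {hν : -(1 / 2 : ℝ) < ν.re} [Γ.FiniteIndex]
    (hpar : ∀ γ ∈ parabolicSubgroup Γ, η (γ : PSL(2, ℤ)) = 1)
    (hu : u ∈ twistedCuspForms Γ ν q η) (hu' : u' ∈ twistedCuspForms Γ ν q η)
    (h : IsLewisTransform Γ ν hν η u f ψ) (h' : IsLewisTransform Γ ν hν η u' f' ψ') :
    IsLewisTransform Γ ν hν η (u + u') (f + f') (ψ + ψ') := by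
  refine ⟨fun w hw => ?_, Submodule.add_mem _ h.mem_spaceFnu h'.mem_spaceFnu,
    Submodule.add_mem _ h.mem_periodFunctions h'.mem_periodFunctions, fun z hz => ?_⟩
  · obtain ⟨v, hv, -⟩ := existsUnique_isFourierBessel hpar hu
    obtain ⟨v', hv', -⟩ := existsUnique_isFourierBessel hpar hu'
    rw [(existsUnique_isFourierBessel hpar (Submodule.add_mem _ hu hu')).unique hw (hv.add hv')]
    exact (h.series v hv).add (h'.series v' hv')
  · simp only [Pi.add_apply, h.eq_sub z hz, h'.eq_sub z hz, map_add, smul_add]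
    abel

lemma IsLewisTransform.smul {hν : -(1 / 2 : ℝ) < ν.re} [Γ.FiniteIndex]
    (hpar : ∀ γ ∈ parabolicSubgroup Γ, η (γ : PSL(2, ℤ)) = 1)
    (hu : u ∈ twistedCuspForms Γ ν q η) (c : ℂ) (h : IsLewisTransform Γ ν hν η u f ψ) :
    IsLewisTransform Γ ν hν η (c • u) (c • f) (c • ψ) := by
  refine ⟨fun w hw => ?_, Submodule.smul_mem _ c h.mem_spaceFnu,
    Submodule.smul_mem _ c h.mem_periodFunctions, fun z hz => ?_⟩
  · obtain ⟨v, hv, -⟩ := existsUnique_isFourierBessel hpar hu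
    rw [(existsUnique_isFourierBessel hpar (Submodule.smul_mem _ c hu)).unique hw (hv.smul c)]
    exact (h.series v hv).smul c
  · simp only [Pi.smul_apply, h.eq_sub z hz, map_smul, smul_sub]
    rw [smul_comm]

/-- The maps `u ↦ f_u` and `u ↦ ψ_u` are linear. -/
lemma exists_lewisTransform (hν : -(1 / 2 : ℝ) < ν.re) [Γ.FiniteIndex]
    (hpar : ∀ γ ∈ parabolicSubgroup Γ, η (γ : PSL(2, ℤ)) = 1) :
    ∃ (F : twistedCuspForms Γ ν q η →ₗ[ℂ] spaceFnu ν η)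
      (Ψ : twistedCuspForms Γ ν q η →ₗ[ℂ] periodFunctions ν hν η),
      ∀ u : twistedCuspForms Γ ν q η, IsLewisTransform Γ ν hν η (u : ℍ → V) (F u) (Ψ u) := by
  -- The choice is made separately for each u. Additivity and homogeneity follow from uniqueness
  -- applied to sums and scalar multiples.
  choose F Ψ h using fun u : twistedCuspForms Γ ν q η => exists_isLewisTransform hν hpar u.2
  have hadd : ∀ u u' : twistedCuspForms Γ ν q η, F (u + u') = F u + F u' ∧ Ψ (u + u') = Ψ u + Ψ u' :=
    fun u u' => (h (u + u')).unique hpar (u + u').2 ((h u).add hpar u.2 u'.2 (h u'))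
  have hsmul : ∀ (c : ℂ) (u : twistedCuspForms Γ ν q η), F (c • u) = c • F u ∧ Ψ (c • u) = c • Ψ u :=
    fun c u => (h (c • u)).unique hpar (c • u).2 ((h u).smul hpar u.2 c)
  exact ⟨⟨⟨fun u => ⟨F u, (h u).mem_spaceFnu⟩, fun u u' => Subtype.ext (hadd u u').1⟩,
      fun c u => Subtype.ext (hsmul c u).1⟩,
    ⟨⟨fun u => ⟨Ψ u, (h u).mem_periodFunctions⟩, fun u u' => Subtype.ext (hadd u u').2⟩,
      fun c u => Subtype.ext (hsmul c u).2⟩, h⟩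

end

end HigherOrderLewis

theorem mainTheorem5 {V : Type*} [NormedAddCommGroup V] [NormedSpace ℂ V] [FiniteDimensional ℂ V]
    (Γ : Subgroup PSL(2, ℤ)) [Γ.Normal] [Γ.FiniteIndex]
    (hΓ : ∀ γ ∈ Γ, IsOfFinOrder γ → γ = 1)
    (q : ℕ) (η : Representation ℂ PSL(2, ℤ) V)
    (hpar : ∀ γ ∈ HigherOrderLewis.parabolicSubgroup Γ, η (γ : PSL(2, ℤ)) = 1)
    (hη : HigherOrderLewis.IsUnipotentOfLength (η.comp Γ.subtype) q)
    (ν : ℂ) (hν : -(1 / 2 : ℝ) < ν.re) :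
    (∀ u ∈ HigherOrderLewis.twistedCuspForms Γ ν q η,
      ∃! v : ℤ → V, HigherOrderLewis.IsFourierBessel ν (HigherOrderLewis.cuspWidth Γ) u v) ∧
    ∃ (f : HigherOrderLewis.twistedCuspForms Γ ν q η →ₗ[ℂ] HigherOrderLewis.spaceFnu ν η)
      (ψ : HigherOrderLewis.twistedCuspForms Γ ν q η →ₗ[ℂ]
        HigherOrderLewis.periodFunctions ν hν η),
      (∀ (u : HigherOrderLewis.twistedCuspForms Γ ν q η) (v : ℤ → V),
        HigherOrderLewis.IsFourierBessel ν (HigherOrderLewis.cuspWidth Γ) (u : ℍ → V) v →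
          HigherOrderLewis.IsLewisSeries ν (HigherOrderLewis.cuspWidth Γ) v (f u : ℂ → V)) ∧
      ∀ (u : HigherOrderLewis.twistedCuspForms Γ ν q η) (z : ℂ), z.im ≠ 0 →
        (ψ u : ℂ → V) z = (f u : ℂ → V) z -
          z ^ (-2 * ν - 1) • η HigherOrderLewis.genS ((f u : ℂ → V) (-1 / z)) := by
  obtain ⟨F, Ψ, h⟩ := HigherOrderLewis.exists_lewisTransform (Γ := Γ) (q := q) hν hpar
  exact ⟨fun u hu => HigherOrderLewis.existsUnique_isFourierBessel hpar hu, F, Ψ,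
    fun u v hv => (h u).series v hv, fun u z hz => (h u).eq_sub z hz⟩
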